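/- Let $\mathcal C$ be a (small) ringed site with a final object $X$ and structure sheaf $\mathcal O_X$. Let $f:M\to N$ be a homomorphism of $\mathcal O_X$-modules, and write $H^0=\ker f$, $B=\operatorname{Im} f$, $H^1=\operatorname{coker} f$, $\mathrm{pr}:M\to B$ and $i:B\to N$ for the canonical maps. Assume that $H^1$ is locally free of finite rank and that $\mathrm{pr}$ locally admits sections. Put $\mathcal A=\underline{\operatorname{Hom}}_{\mathcal O_X}(H^1,H^0)$, the sheaf $U\mapsto \operatorname{Hom}(H^1|_U,H^0|_U)$. Let $\operatorname{cl}(f)\in\operatorname{Ext}^2(H^1,H^0)$ be the Yoneda class of the exact sequence $0\to H^0\to M\to N\to H^1\to 0$, i.e. the Yoneda product of the classes of $0\to B\to N\to H^1\to0$ and $0\to H^0\to M\to B\to 0$. *Diagram completions.* A diagram completion over $U$ is an $\mathcal O_U$-module $E$ with homomorphisms $h:M|_U\to E$ and $g:E\to N|_U$ such that the square formed by $\mathrm{pr},h,i,g$ (so $g h=i\,\mathrm{pr}$) is cartesian and cocartesian; a morphism $(E,g,h)\to(E',g',h')$ is a homomorphism $\varphi:E\to E'$ with $\varphi h=h'$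 and $g'\varphi=g$. These form a category fibered in groupoids $\mathscr Cp$ over $\mathcal C$. For $\xi:H^1|_U\to H^0|_U$ let $\xi_E$ be the composition $E\xrightarrow{g}N|_U\to H^1|_U\xrightarrow{\xi}H^0|_U\to M|_U\xrightarrow{h}E$. *Splittings.* Let $\mathscr Sc^{\circ}$ be the fibered category whose objects over $U$ are the splittings $s:H^1|_U\to N|_U$ of $N|_U\to H^1|_U$, whose morphisms $s\to s'$ are the homomorphisms $\xi:H^1|_U\to M|_U$ with $s=s'+f\circ\xi$, and whose composition is addition. The gerbe of splittings $\mathscr Sc$ is the stack associated with $\mathscr Sc^{\circ}$. *Classes.* If $\mathscr G$ is a gerbe banded by an abelian sheaf $\mathcal A$, its class in $H^2(X,\mathcal A)$ is the following. For exact sequences $0\to \mathcal A\to I^0\to Q\to 0$ and $0\to Q\to I^1\to Z\to 0$ of abelian sheaves and $z\in\Gamma(X,Z)$, let $d:I^0\to Q\to I^1$, and consider the fibered category whose objects over $U$ are the $t\in I^1(U)$ lifting $z|_U$ and whose morphisms $t\to t'$ are the $\xi\in I^0(U)$ with $t=t'+d\xi$. If there is a morphism from it to $\mathscr G$ that is compatible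 with the actions of $\mathcal A$ on automorphisms, then the class of $\mathscr G$ is the image of $z$ under the connecting maps $H^0(X,Z)\to H^1(X,Q)\to H^2(X,\mathcal A)$. **Theorem.** 1. There are isomorphisms $\operatorname{Ext}^n(H^1,F)\simeq H^n(X,\underline{\operatorname{Hom}}_{\mathcal O_X}(H^1,F))$, $n\ge0$, natural in the $\mathcal O_X$-module $F$, compatible with the connecting homomorphisms, and equal to the evident identification for $n=0$. In particular $\operatorname{Ext}^2(H^1,H^0)=H^2(X,\mathcal A)$. 2. $\mathscr Cp$ is a gerbe, banded by $\mathcal A$ through $\xi\mapsto \mathrm{id}_E+\xi_E$. The associated stack $\mathscr Sc$ exists and is a gerbe, banded by $\mathcal A$ in such a way that $\xi:H^1|_U\to H^0|_U$ acts on each splitting $s$ over $U$ as the automorphism $H^1|_U\xrightarrow{\xi}H^0|_U\subset M|_U$ of $s$. 3. With these bands, each of the two gerbes has a well-defined class in $H^2(X,\mathcal A)$, and the two classes are equal. 4. Each of $\mathscr Cp$ and $\mathscr Sc$ has an object over $X$ if and only if $\operatorname{cl}(f)=0$. -/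

import Mathlib

open CategoryTheory Limits Opposite CategoryTheory.Bicategory

universe u

namespace SheafOfModules

section Exactness

variable {D : Type u} [SmallCategory D] {K : GrothendieckTopology D} (S : Sheaf K RingCat.{u})

instance toSheaf_preservesFiniteColimits : PreservesFiniteColimits (toSheaf.{u} S) where
  preservesFiniteColimits I _ _ := ⟨fun {F} ↦ by
    let a := PresheafOfModules.sheafification.{u} (𝟙 S.obj)
    let G : SheafOfModules.{u} S ⥤ PresheafOfModules.{u} S.obj :=
      forget S ⋙ PresheafOfModules.restrictScalars (𝟙 S.obj)
    let adj : a ⊣ G := PresheafOfModules.sheafificationAdjunction (𝟙 S.obj)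
    have : PreservesColimitsOfShape I (a ⋙ toSheaf S) :=
      inferInstanceAs (PreservesColimitsOfShape I
        (PresheafOfModules.toPresheaf _ ⋙ presheafToSheaf K AddCommGrpCat))
    have : a.IsLeftAdjoint := adj.isLeftAdjoint
    have : PreservesColimit ((F ⋙ G) ⋙ a) (toSheaf S) :=
      preservesColimit_of_preserves_colimit_cocone
        (isColimitOfPreserves a (colimit.isColimit (F ⋙ G)))
        (isColimitOfPreserves (a ⋙ toSheaf S) (colimit.isColimit (F ⋙ G)))
    exact preservesColimit_of_iso_diagram (K₁ := (F ⋙ G) ⋙ a) _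
      (Functor.isoWhiskerLeft F (asIso adj.counit))⟩

instance toSheaf_reflectsFiniteColimits : ReflectsFiniteColimits (toSheaf.{u} S) where
  reflects _ _ _ := inferInstance

end Exactness

variable {C : Type u} [SmallCategory C] {J : GrothendieckTopology C} (R : Sheaf J RingCat.{u})

section Restriction

variable {U V W : C}

instance overMap_preservesFiniteLimits (k : V ⟶ U) :
    PreservesFiniteLimits (overMap.{u} R k) := by
  have : PreservesFiniteLimits (overMap.{u} R k ⋙ toSheaf _) :=
    inferInstanceAs (PreservesFiniteLimits (toSheaf _ ⋙ J.overMapPullback AddCommGrpCat.{u} k))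
  exact preservesFiniteLimits_of_reflects_of_preserves _ (toSheaf _)

instance overMap_preservesFiniteColimits (k : V ⟶ U) :
    PreservesFiniteColimits (overMap.{u} R k) := by
  have : (J.overMapPullback AddCommGrpCat.{u} k).IsLeftAdjoint :=
    ((Over.map k).sheafAdjunctionCocontinuous AddCommGrpCat.{u} (J.over V) (J.over U)).isLeftAdjoint
  have : PreservesFiniteColimits (overMap.{u} R k ⋙ toSheaf _) :=
    inferInstanceAs (PreservesFiniteColimits (toSheaf _ ⋙ J.overMapPullback AddCommGrpCat.{u} k))
  exact preservesFiniteColimits_of_reflects_of_preserves _ (toSheaf _)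

instance overMap_additive (k : V ⟶ U) : (overMap.{u} R k).Additive where

instance overFunctor_additive (U : C) : (overFunctor.{u} R U).Additive where

/-- The structure sheaf on `Over U`, compared with its restriction along `𝟭 (Over U)`. -/
noncomputable def overIdHom (U : C) : R.over U ⟶
    ((𝟭 (Over U)).sheafPushforwardContinuous RingCat (J.over U) (J.over U)).obj (R.over U) :=
  𝟙 (R.over U)

lemma overIdHom_comp (U : C) :
    overIdHom R U ≫ (Functor.sheafPushforwardContinuousNatTrans (Over.mapId U).hom
      RingCat (J.over U) (J.over U)).app (R.over U) = (Sheaf.pushforwardOverMapIso R (𝟙 U)).inv := by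
  ext T : 3
  change 𝟙 _ ≫ R.obj.map _ = 𝟙 _
  erw [Category.id_comp]
  exact R.obj.map_id _

lemma overMapComp_aux (f : W ⟶ V) (g : V ⟶ U) :
    haveI : Functor.IsContinuous (Over.map f ⋙ Over.map g) (J.over W) (J.over U) :=
      Functor.isContinuous_comp _ _ _ (J.over V) _
    (show R.over W ⟶ ((Over.map f ⋙ Over.map g).sheafPushforwardContinuous
        RingCat (J.over W) (J.over U)).obj (R.over U) from
      (Sheaf.pushforwardOverMapIso R f).inv ≫
        ((Over.map f).sheafPushforwardContinuous RingCat (J.over W) (J.over V)).map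
          (Sheaf.pushforwardOverMapIso R g).inv) ≫
      (Functor.sheafPushforwardContinuousNatTrans (Over.mapComp f g).hom
        RingCat (J.over W) (J.over U)).app (R.over U) =
      (Sheaf.pushforwardOverMapIso R (f ≫ g)).inv := by
  ext T : 3
  change (𝟙 _ ≫ 𝟙 _) ≫ R.obj.map (𝟙 _) = 𝟙 _
  simp

/-- Restriction of sheaves of modules along an identity is the identity. -/
noncomputable def overMapId (U : C) : overMap.{u} R (𝟙 U) ≅ 𝟭 _ :=
  (pushforwardCongr₂ (φ := overIdHom R U) (ψ := (Sheaf.pushforwardOverMapIso R (𝟙 U)).inv)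
    (F := Over.map (𝟙 U)) (G := 𝟭 _) (Over.mapId U) (overIdHom_comp R U)).symm ≪≫ pushforwardId _

/-- Restriction of sheaves of modules is transitive. -/
noncomputable def overMapComp (f : W ⟶ V) (g : V ⟶ U) :
    overMap.{u} R (f ≫ g) ≅ overMap.{u} R g ⋙ overMap.{u} R f :=
  haveI : Functor.IsContinuous (Over.map f ⋙ Over.map g) (J.over W) (J.over U) :=
    Functor.isContinuous_comp _ _ _ (J.over V) _
  (pushforwardComp (Sheaf.pushforwardOverMapIso R f).inv (Sheaf.pushforwardOverMapIso R g).inv ≪≫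
    pushforwardCongr₂ (F := Over.map (f ≫ g)) (ψ := (Sheaf.pushforwardOverMapIso R (f ≫ g)).inv)
      _ (Over.mapComp f g) (overMapComp_aux R f g)).symm

variable {R}

lemma overMapId_hom_apply (U : C) (E : SheafOfModules.{u} (R.over U)) (T : Over U)
    (x : E.val.obj (op ((Over.map (𝟙 U)).obj T))) :
    ((overMapId R U).hom.app E).val.app (op T) x =
      E.val.map ((Over.mapId U).inv.app T).op x := rfl

lemma overMapComp_hom_apply (f : W ⟶ V) (g : V ⟶ U) (E : SheafOfModules.{u} (R.over U))
    (T : Over W) (x : E.val.obj (op ((Over.map (f ≫ g)).obj T))) :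
    ((overMapComp R f g).hom.app E).val.app (op T) x =
      E.val.map ((Over.mapComp f g).inv.app T).op x := rfl

lemma overMapComp_inv_apply (f : W ⟶ V) (g : V ⟶ U) (E : SheafOfModules.{u} (R.over U))
    (T : Over W) (x : E.val.obj (op ((Over.map g).obj ((Over.map f).obj T)))) :
    ((overMapComp R f g).inv.app E).val.app (op T) x =
      E.val.map ((Over.mapComp f g).hom.app T).op x := rfl

lemma map_self_apply {D : Type u} [SmallCategory D] {K : GrothendieckTopology D}
    {S : Sheaf K RingCat.{u}} (E : SheafOfModules.{u} S) {X : D} (a : X ⟶ X) (ha : a = 𝟙 X)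
    (x : E.val.obj (op X)) : E.val.map a.op x = x := by
  subst ha
  exact CategoryTheory.congr_fun (E.val.presheaf.map_id _) x


end Restriction

end SheafOfModules

namespace SheafOfModules
variable {C : Type u} [SmallCategory C] {J : GrothendieckTopology C} {R : Sheaf J RingCat.{u}}
  {M N : SheafOfModules.{u} R}

section Coherence
variable {U V W T : C}

lemma overFunctorMap_id (M : SheafOfModules.{u} R) (U : C) :
    (overFunctorMap R (𝟙 U)).inv.app M ≫ (overMapId R U).hom.app (M.over U) = 𝟙 (M.over U) := by
  ext ⟨T⟩ x
  exact map_self_apply M _ rfl x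

lemma overFunctorMap_comp (M : SheafOfModules.{u} R) (k : W ⟶ V) (l : V ⟶ U) :
    (overFunctorMap R (k ≫ l)).inv.app M ≫ (overMapComp R k l).hom.app (M.over U) =
      (overFunctorMap R k).inv.app M ≫ (overMap R k).map ((overFunctorMap R l).inv.app M) := by
  ext ⟨T⟩ x
  exact map_self_apply M _ rfl x

/-- A morphism of sheaves of modules, on sections over `X`. -/
noncomputable def sectionMap {D : Type u} [SmallCategory D] {K : GrothendieckTopology D}
    {S : Sheaf K RingCat.{u}} {E E' : SheafOfModules.{u} S} (a : E ⟶ E') (X : Dᵒᵖ) :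
    E.val.presheaf.obj X ⟶ E'.val.presheaf.obj X :=
  ((PresheafOfModules.toPresheaf S.obj).map a.val).app X

lemma sectionMap_comp {D : Type u} [SmallCategory D] {K : GrothendieckTopology D}
    {S : Sheaf K RingCat.{u}} {E E' E'' : SheafOfModules.{u} S} (a : E ⟶ E') (b : E' ⟶ E'')
    (X : Dᵒᵖ) : sectionMap (a ≫ b) X = sectionMap a X ≫ sectionMap b X := rfl

lemma sectionMap_ext {D : Type u} [SmallCategory D] {K : GrothendieckTopology D}
    {S : Sheaf K RingCat.{u}} {E E' : SheafOfModules.{u} S} {a b : E ⟶ E'}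
    (h : ∀ X, sectionMap a X = sectionMap b X) : a = b := by
  apply (toSheaf S).map_injective
  ext X : 3
  exact h X

lemma sectionMap_eqToHom {f f' : V ⟶ U} (hf : f = f') (E : SheafOfModules.{u} (R.over U))
    (e : (overMap R f).obj E ⟶ (overMap R f').obj E) (he : e = eqToHom (by rw [hf]))
    (T : Over V) (a : (Over.map f').obj T ⟶ (Over.map f).obj T) (ha : a.left = 𝟙 _) :
    sectionMap e (op T) = E.val.presheaf.map a.op := by
  subst hf he
  obtain rfl : a = 𝟙 _ := by ext; exact ha
  exact (E.val.presheaf.map_id _).symm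

lemma overMapComp_assoc {T : C} (m : T ⟶ W) (k : W ⟶ V) (l : V ⟶ U)
    (E : SheafOfModules.{u} (R.over U))
    (e : (overMap R (m ≫ k ≫ l)).obj E ⟶ (overMap R ((m ≫ k) ≫ l)).obj E)
    (he : e = eqToHom (by simp)) :
    (overMapComp R m (k ≫ l)).hom.app E ≫ (overMap R m).map ((overMapComp R k l).hom.app E) ≫
      (overMapComp R m k).inv.app ((overMap R l).obj E) ≫
        (overMapComp R (m ≫ k) l).inv.app E = e := by
  refine sectionMap_ext fun ⟨S⟩ ↦ ?_
  rw [sectionMap_eqToHom (by simp) E e he S (Over.homMk (𝟙 _)) rfl]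
  change E.val.presheaf.map _ ≫ E.val.presheaf.map _ ≫ E.val.presheaf.map _ ≫
    E.val.presheaf.map _ = E.val.presheaf.map _
  rw [← Functor.map_comp, ← Functor.map_comp, ← Functor.map_comp]
  congr 1
  apply Quiver.Hom.unop_inj
  ext
  simp [Over.mapComp]

lemma overMapComp_id_left (k : V ⟶ U) (E : SheafOfModules.{u} (R.over U))
    (e : (overMap R (𝟙 V ≫ k)).obj E ⟶ (overMap R k).obj E) (he : e = eqToHom (by simp)) :
    (overMapComp R (𝟙 V) k).hom.app E ≫ (overMapId R V).hom.app ((overMap R k).obj E) = e := by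
  refine sectionMap_ext fun ⟨S⟩ ↦ ?_
  rw [sectionMap_eqToHom (by simp) E e he S (Over.homMk (𝟙 _)) rfl]
  change E.val.presheaf.map _ ≫ E.val.presheaf.map _ = E.val.presheaf.map _
  rw [← Functor.map_comp]
  congr 1
  apply Quiver.Hom.unop_inj
  ext
  simp [Over.mapComp, Over.mapId]

lemma overMapComp_id_right (k : V ⟶ U) (E : SheafOfModules.{u} (R.over U))
    (e : (overMap R (k ≫ 𝟙 U)).obj E ⟶ (overMap R k).obj E) (he : e = eqToHom (by simp)) :
    (overMapComp R k (𝟙 U)).hom.app E ≫ (overMap R k).map ((overMapId R U).hom.app E) = e := by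
  refine sectionMap_ext fun ⟨S⟩ ↦ ?_
  rw [sectionMap_eqToHom (by simp) E e he S (Over.homMk (𝟙 _)) rfl]
  change E.val.presheaf.map _ ≫ E.val.presheaf.map _ = E.val.presheaf.map _
  rw [← Functor.map_comp]
  congr 1
  apply Quiver.Hom.unop_inj
  ext
  simp [Over.mapComp, Over.mapId]

end Coherence

end SheafOfModules

namespace SheafOfModules


variable {C : Type u} [SmallCategory C] {J : GrothendieckTopology C} {R : Sheaf J RingCat.{u}}
  {M N : SheafOfModules.{u} R}

/-- A diagram completion of `f|U : M|U ⟶ N|U`: a module `E` over `U` with morphisms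
`h : M|U ⟶ E` and `g : E ⟶ N|U` such that the square formed by `h`, `g`, the projection
`M|U ⟶ B|U` and the inclusion `B|U ⟶ N|U` is cartesian and cocartesian, `B` being the image
of `f`. -/
structure DiagramCompletion (f : M ⟶ N) (U : C) where
  E : SheafOfModules.{u} (R.over U)
  h : M.over U ⟶ E
  g : E ⟶ N.over U
  bicartesian : BicartesianSq ((overFunctor R U).map (Abelian.factorThruImage f)) h
    ((overFunctor R U).map (Abelian.image.ι f)) g

namespace DiagramCompletion

variable {f : M ⟶ N} {U V W : C}

@[ext]
structure Hom (X Y : DiagramCompletion f U) where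
  φ : X.E ⟶ Y.E
  h_comp : X.h ≫ φ = Y.h
  comp_g : φ ≫ Y.g = X.g

instance : Category (DiagramCompletion f U) where
  Hom := Hom
  id X := { φ := 𝟙 _, h_comp := Category.comp_id _, comp_g := Category.id_comp _ }
  comp a b :=
    { φ := a.φ ≫ b.φ
      h_comp := by rw [← Category.assoc, a.h_comp, b.h_comp]
      comp_g := by rw [Category.assoc, b.comp_g, a.comp_g] }
  id_comp _ := Hom.ext (Category.id_comp _)
  comp_id _ := Hom.ext (Category.comp_id _)
  assoc _ _ _ := Hom.ext (Category.assoc _ _ _)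

lemma hom_ext {X Y : DiagramCompletion f U} {a b : X ⟶ Y} (h : a.φ = b.φ) : a = b := Hom.ext h

def isoMk {X Y : DiagramCompletion f U} (e : X.E ≅ Y.E) (h₁ : X.h ≫ e.hom = Y.h)
    (h₂ : e.hom ≫ Y.g = X.g) : X ≅ Y where
  hom := { φ := e.hom, h_comp := h₁, comp_g := h₂ }
  inv :=
    { φ := e.inv
      h_comp := by rw [← h₁, Category.assoc, e.hom_inv_id, Category.comp_id]
      comp_g := by rw [← h₂, ← Category.assoc, e.inv_hom_id, Category.id_comp] }
  hom_inv_id := Hom.ext e.hom_inv_id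
  inv_hom_id := Hom.ext e.inv_hom_id

lemma eqToHom_φ {X Y : DiagramCompletion f U} (h : X = Y) :
    (eqToHom h).φ = eqToHom (by rw [h]) := by
  subst h
  rfl

lemma eqToHom_toNatTrans_app_φ {A : Cat.{u, u + 1}} {F G : A ⟶ Cat.of (DiagramCompletion f U)}
    (h : F = G) (X : A) :
    ((eqToHom h).toNatTrans.app X).φ = eqToHom (by rw [h]) := by
  subst h
  rfl

lemma bicartesian_restrict (X : DiagramCompletion f U) (k : V ⟶ U) :
    BicartesianSq ((overFunctor R V).map (Abelian.factorThruImage f))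
      ((overFunctorMap R k).inv.app M ≫ (overMap R k).map X.h)
      ((overFunctor R V).map (Abelian.image.ι f))
      ((overMap R k).map X.g ≫ (overFunctorMap R k).hom.app N) := by
  have hp := X.bicartesian.toIsPullback.map (overMap R k)
  have hq := X.bicartesian.toIsPushout.map (overMap R k)
  have n₁ := (overFunctorMap R k).hom.naturality (Abelian.factorThruImage f)
  have n₂ := (overFunctorMap R k).hom.naturality (Abelian.image.ι f)
  refine BicartesianSq.of_isPullback_isPushout
    (hp.of_iso ((overFunctorMap R k).app M) ((overFunctorMap R k).app _) (Iso.refl _)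
      ((overFunctorMap R k).app N) n₁ ?_ n₂ ?_)
    (hq.of_iso ((overFunctorMap R k).app M) ((overFunctorMap R k).app _) (Iso.refl _)
      ((overFunctorMap R k).app N) n₁ ?_ n₂ ?_)
  all_goals simp

/-- Restriction of diagram completions along `k : V ⟶ U`. -/
noncomputable def restrict (k : V ⟶ U) : DiagramCompletion f U ⥤ DiagramCompletion f V where
  obj X :=
    { E := (overMap R k).obj X.E
      h := (overFunctorMap R k).inv.app M ≫ (overMap R k).map X.h
      g := (overMap R k).map X.g ≫ (overFunctorMap R k).hom.app N
      bicartesian := X.bicartesian_restrict k }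
  map a :=
    { φ := (overMap R k).map a.φ
      h_comp := by rw [Category.assoc, ← Functor.map_comp, a.h_comp]
      comp_g := by rw [← Category.assoc, ← Functor.map_comp, a.comp_g] }
  map_id _ := Hom.ext ((overMap R k).map_id _)
  map_comp _ _ := Hom.ext ((overMap R k).map_comp _ _)

noncomputable def restrictId (U : C) : restrict (f := f) (𝟙 U) ≅ 𝟭 _ :=
  NatIso.ofComponents (fun X ↦ isoMk ((overMapId R U).app X.E)
    (by
      have h₁ := (overMapId R U).hom.naturality X.h
      have h₂ := overFunctorMap_id M U
      dsimp [restrict] at h₁ ⊢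
      rw [Category.assoc, h₁, reassoc_of% h₂])
    (by
      have h₁ := (overMapId R U).hom.naturality X.g
      have h₂ := overFunctorMap_id N U
      dsimp [restrict] at h₁ ⊢
      have h₃ := (Iso.inv_comp_eq ((overFunctorMap R (𝟙 U)).app N)).1 h₂
      rw [Category.comp_id] at h₃
      rw [← h₁, h₃]
      rfl))
    (fun a ↦ Hom.ext ((overMapId R U).hom.naturality a.φ))

noncomputable def restrictComp (k : W ⟶ V) (l : V ⟶ U) :
    restrict (f := f) (k ≫ l) ≅ restrict l ⋙ restrict k :=
  NatIso.ofComponents (fun X ↦ isoMk ((overMapComp R k l).app X.E)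
    (by
      have h₁ := (overMapComp R k l).hom.naturality X.h
      have h₂ := overFunctorMap_comp M k l
      dsimp [restrict] at h₁ ⊢
      rw [Category.assoc, h₁, reassoc_of% h₂, Functor.map_comp])
    (by
      have h₁ := (overMapComp R k l).hom.naturality X.g
      have h₂ := (Iso.inv_comp_eq ((overFunctorMap R (k ≫ l)).app N)).1 (overFunctorMap_comp N k l)
      have h₃ : (overMap R k).map ((overFunctorMap R l).inv.app N) ≫
          (overMap R k).map ((overFunctorMap R l).hom.app N) = 𝟙 _ := by
        rw [← Functor.map_comp, Iso.inv_hom_id_app, CategoryTheory.Functor.map_id]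
      dsimp [restrict] at h₁ h₂ ⊢
      rw [Functor.map_comp, Category.assoc, ← reassoc_of% h₁, h₂]
      simp only [Category.assoc]
      rw [reassoc_of% h₃, Iso.inv_hom_id_app, Category.comp_id]))
    (fun a ↦ Hom.ext ((overMapComp R k l).hom.naturality a.φ))

end DiagramCompletion

/-- The category fibered in groupoids of diagram completions of `f : M ⟶ N`, as a pseudofunctor. -/
noncomputable def completions (f : M ⟶ N) : LocallyDiscrete Cᵒᵖ ⥤ᵖ Cat.{u, u + 1} :=
  LocallyDiscrete.mkPseudofunctor
    (fun U ↦ Cat.of (DiagramCompletion f U.unop))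
    (fun k ↦ (DiagramCompletion.restrict k.unop).toCatHom)
    (fun U ↦ Cat.Hom.isoMk (DiagramCompletion.restrictId U.unop))
    (fun k l ↦ Cat.Hom.isoMk (DiagramCompletion.restrictComp l.unop k.unop))
    (fun k l m ↦ by
      ext X
      apply DiagramCompletion.hom_ext
      exact overMapComp_assoc m.unop l.unop k.unop X.E _
        (DiagramCompletion.eqToHom_toNatTrans_app_φ _ X))
    (fun k ↦ by
      ext X
      apply DiagramCompletion.hom_ext
      exact overMapComp_id_right k.unop X.E _ (DiagramCompletion.eqToHom_toNatTrans_app_φ _ X))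
    (fun k ↦ by
      ext X
      apply DiagramCompletion.hom_ext
      exact overMapComp_id_left k.unop X.E _ (DiagramCompletion.eqToHom_toNatTrans_app_φ _ X))

end SheafOfModules

namespace SheafOfModules

variable {C : Type u} [SmallCategory C] {J : GrothendieckTopology C} {R : Sheaf J RingCat.{u}}

section HomSheaf

variable (H F : SheafOfModules.{u} R)

lemma overFunctorMap_hom_id (U : C) :
    (overFunctorMap R (𝟙 U)).hom.app F = (overMapId R U).hom.app (F.over U) := by
  have h := (Iso.inv_comp_eq ((overFunctorMap R (𝟙 U)).app F)).1 (overFunctorMap_id F U)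
  rw [Category.comp_id] at h
  exact h.symm

lemma overFunctorMap_hom_comp {U V W : C} (k : W ⟶ V) (l : V ⟶ U) :
    (overFunctorMap R (k ≫ l)).hom.app F = (overMapComp R k l).hom.app (F.over U) ≫
      (overMap R k).map ((overFunctorMap R l).hom.app F) ≫ (overFunctorMap R k).hom.app F := by
  have h := (Iso.inv_comp_eq ((overFunctorMap R (k ≫ l)).app F)).1 (overFunctorMap_comp F k l)
  have h₃ : (overMap R k).map ((overFunctorMap R l).inv.app F) ≫
      (overMap R k).map ((overFunctorMap R l).hom.app F) = 𝟙 _ := by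
    rw [← Functor.map_comp, Iso.inv_hom_id_app, CategoryTheory.Functor.map_id]
  dsimp at h
  rw [h]
  simp only [Category.assoc]
  rw [reassoc_of% h₃, Iso.inv_hom_id_app, Category.comp_id]

variable {H F} in
/-- Restriction along `k : V ⟶ U` of a morphism `H|U ⟶ F|U`. -/
noncomputable def restrictHom {U V : C} (k : V ⟶ U) :
    (H.over U ⟶ F.over U) →+ (H.over V ⟶ F.over V) where
  toFun φ := (overFunctorMap R k).inv.app H ≫ (overMap R k).map φ ≫ (overFunctorMap R k).hom.app F
  map_zero' := by simp
  map_add' φ ψ := by simp [Functor.map_add]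

lemma restrictHom_id {U : C} (φ : H.over U ⟶ F.over U) : restrictHom (𝟙 U) φ = φ := by
  dsimp [restrictHom]
  have h := (overMapId R U).hom.naturality φ
  have h' := overFunctorMap_id H U
  dsimp at h
  rw [overFunctorMap_hom_id, h, reassoc_of% h']

lemma restrictHom_comp {U V W : C} (k : W ⟶ V) (l : V ⟶ U) (φ : H.over U ⟶ F.over U) :
    restrictHom (k ≫ l) φ = restrictHom k (restrictHom l φ) := by
  dsimp [restrictHom]
  have h := (overMapComp R k l).hom.naturality φ
  have h' := overFunctorMap_comp H k l
  dsimp at h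
  rw [overFunctorMap_hom_comp, reassoc_of% h, reassoc_of% h', Functor.map_comp, Functor.map_comp]
  simp only [Category.assoc]

lemma restrictHom_over {U V : C} (k : V ⟶ U) (φ : H ⟶ F) :
    restrictHom k ((overFunctor R U).map φ) = (overFunctor R V).map φ := by
  have h := (overFunctorMap R k).hom.naturality φ
  dsimp [restrictHom] at h ⊢
  rw [h, Iso.inv_hom_id_app_assoc]

lemma restrictHom_comp_comp {G : SheafOfModules.{u} R} {U V : C} (k : V ⟶ U)
    (φ : H.over U ⟶ F.over U) (ψ : F.over U ⟶ G.over U) :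
    restrictHom k (φ ≫ ψ) = restrictHom k φ ≫ restrictHom k ψ := by
  simp [restrictHom]

/-- The presheaf `U ↦ Hom(H|U, F|U)`. -/
noncomputable def homPresheaf : Cᵒᵖ ⥤ AddCommGrpCat.{u} where
  obj U := AddCommGrpCat.of (H.over U.unop ⟶ F.over U.unop)
  map k := AddCommGrpCat.ofHom (restrictHom k.unop)
  map_id U := AddCommGrpCat.hom_ext (AddMonoidHom.ext fun (φ : H.over U.unop ⟶ F.over U.unop) ↦
    restrictHom_id H F φ)
  map_comp {U _ _} k l := AddCommGrpCat.hom_ext (AddMonoidHom.ext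
    fun (φ : H.over U.unop ⟶ F.over U.unop) ↦ restrictHom_comp H F l.unop k.unop φ)

/-- The inclusion of the presheaf of linear morphisms into that of additive morphisms. -/
noncomputable def homPresheafι : homPresheaf H F ⋙ CategoryTheory.forget AddCommGrpCat ⟶
    presheafHom H.val.presheaf F.val.presheaf where
  app U := ↾fun (φ : H.over U.unop ⟶ F.over U.unop) ↦
    (PresheafOfModules.toPresheaf (R.over U.unop).obj).map φ.val
  naturality _ _ _ := rfl

lemma homPresheafι_injective (U : Cᵒᵖ) : Function.Injective ((homPresheafι H F).app U) := by
  intro φ ψ h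
  exact (toSheaf (R.over U.unop)).map_injective (by ext1; exact h)

lemma isSheaf_homPresheaf : Presheaf.IsSheaf J (homPresheaf H F) := by
  rw [Presheaf.isSheaf_iff_isSheaf_forget _ _ (CategoryTheory.forget AddCommGrpCat.{u})]
  have hmono : Mono (homPresheafι H F) := by
    have : ∀ U, Mono ((homPresheafι H F).app U) := fun U ↦
      (mono_iff_injective _).2 (homPresheafι_injective H F U)
    exact NatTrans.mono_of_mono_app _
  have hsheaf : Presieve.IsSheaf J (presheafHom H.val.presheaf F.val.presheaf) :=
    (isSheaf_iff_isSheaf_of_type _ _).1 (Presheaf.IsSheaf.hom _ _ F.isSheaf)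
  rw [isSheaf_iff_isSheaf_of_type]
  refine Presieve.isSheaf_iso J (asIso (Subfunctor.toRange (homPresheafι H F))).symm ?_
  rw [Subfunctor.isSheaf_iff _ hsheaf]
  intro U s hs
  have hlin : ∀ (T : (Over U.unop)ᵒᵖ) (r : (R.over U.unop).obj.obj T)
      (m : (H.over U.unop).val.obj T), 
      s.app T (r • m : (H.over U.unop).val.obj T) =
        r • (show (F.over U.unop).val.obj T from s.app T m) := by
    intro T r m
    have hS := J.pullback_stable T.unop.hom hs
    have hF : Presieve.IsSeparated J (F.val.presheaf ⋙ CategoryTheory.forget AddCommGrpCat.{u}) :=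
      ((isSheaf_iff_isSheaf_of_type _ _).1 ((Presheaf.isSheaf_iff_isSheaf_forget _ _
        (CategoryTheory.forget AddCommGrpCat.{u})).1 F.isSheaf)).isSeparated
    refine (hF _ hS).ext ?_
    intro V k hk
    obtain ⟨φ, hφ⟩ := hk
    let k' : Over.mk (k ≫ T.unop.hom) ⟶ T.unop := Over.homMk k
    obtain ⟨g, hg, hs⟩ : ∃ g : H.val.obj (op V) → F.val.obj (op V),
        (∀ (a : R.obj.obj (op V)) x, g (a • x) = a • g x) ∧
        ∀ x : H.val.obj (op T.unop.left), F.val.map k.op (s.app T x) = g (H.val.map k.op x) := by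
      refine ⟨fun x ↦ φ.val.app (op (Over.mk (𝟙 V))) x,
        fun a x ↦ (φ.val.app (op (Over.mk (𝟙 V)))).hom.map_smul a x, fun x ↦ ?_⟩
      have h₁ := CategoryTheory.congr_fun (s.naturality k'.op) x
      have h₂ := presheafHom_map_app_op_mk_id (k ≫ T.unop.hom) s
      refine h₁.symm.trans (((CategoryTheory.congr_fun h₂ _).symm.trans ?_))
      exact CategoryTheory.congr_fun (congr_app hφ (op (Over.mk (𝟙 V)))).symm _
    refine (hs (r • m)).trans ?_
    refine Eq.trans ?_ (PresheafOfModules.map_smul F.val k.op r _).symm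
    exact ((congr_arg g (PresheafOfModules.map_smul H.val k.op r m)).trans (hg _ _)).trans
      (congr_arg (fun z ↦ R.obj.map k.op r • z) (hs m).symm)
  exact ⟨⟨PresheafOfModules.homMk s hlin⟩, by rfl⟩

/-- The abelian sheaf `Hom(H, F)` of `R`-linear morphisms. -/
noncomputable def homSheaf : Sheaf J AddCommGrpCat.{u} := ⟨homPresheaf H F, isSheaf_homPresheaf H F⟩

variable {F} in
/-- Composition with `a : F ⟶ G`, as a morphism `Hom(H, F) ⟶ Hom(H, G)`. -/
noncomputable def homSheafMap {G : SheafOfModules.{u} R} (a : F ⟶ G) :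
    homSheaf H F ⟶ homSheaf H G := ⟨{
  app U := AddCommGrpCat.ofHom (AddMonoidHom.mk'
    (fun (φ : H.over U.unop ⟶ F.over U.unop) ↦ φ ≫ (overFunctor R U.unop).map a)
    (fun _ _ ↦ Preadditive.add_comp _ _ _ _ _ _))
  naturality U V k := AddCommGrpCat.hom_ext (AddMonoidHom.ext
    fun (φ : H.over U.unop ⟶ F.over U.unop) ↦ by
      change restrictHom k.unop φ ≫ (overFunctor R V.unop).map a =
        restrictHom k.unop (φ ≫ (overFunctor R U.unop).map a)
      rw [restrictHom_comp_comp, restrictHom_over]) }⟩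

variable {H} in
lemma homSheaf_hom_ext {F G : SheafOfModules.{u} R} {a b : homSheaf H F ⟶ homSheaf H G}
    (h : ∀ (U : C) (φ : H.over U ⟶ F.over U), a.hom.app (op U) φ = b.hom.app (op U) φ) : a = b :=
  Sheaf.hom_ext (NatTrans.ext (funext fun U ↦ AddCommGrpCat.hom_ext (AddMonoidHom.ext (h U.unop))))

/-- The functor `F ↦ Hom(H, F)` from modules to abelian sheaves. -/
noncomputable def homSheafFunctor : SheafOfModules.{u} R ⥤ Sheaf J AddCommGrpCat.{u} where
  obj F := homSheaf H F
  map a := homSheafMap H a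
  map_id F := homSheaf_hom_ext fun U φ ↦ by
    change φ ≫ (overFunctor R U).map (𝟙 F) = φ
    simp
  map_comp a b := homSheaf_hom_ext fun U φ ↦ by
    change φ ≫ (overFunctor R U).map (a ≫ b) =
      (φ ≫ (overFunctor R U).map a) ≫ (overFunctor R U).map b
    simp

instance : (homSheafFunctor H).Additive where
  map_add {F G a b} := homSheaf_hom_ext fun U φ ↦ by
    change φ ≫ (overFunctor R U).map (a + b) =
      φ ≫ (overFunctor R U).map a + φ ≫ (overFunctor R U).map b
    rw [Functor.map_add, Preadditive.comp_add]

end HomSheaf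

end SheafOfModules

namespace CategoryTheory


variable {C : Type u} [SmallCategory C]

section Translation

/-- An object over `U` of the fibered category of translations attached to `d : A ⟶ B` and to a
subfunctor `P` of `B`: a section of `P` over `U`. (The universe is only raised in order to match
that of the categories of modules.) -/
structure TranslationObj {A B : Cᵒᵖ ⥤ AddCommGrpCat.{u}} (d : A ⟶ B)
    (P : Subfunctor (B ⋙ forget AddCommGrpCat.{u})) (U : C) : Type (u + 1) where
  val : B.obj (op U)
  mem : val ∈ P.obj (op U)

namespace TranslationObj

variable {A B : Cᵒᵖ ⥤ AddCommGrpCat.{u}} {d : A ⟶ B}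
  {P : Subfunctor (B ⋙ forget AddCommGrpCat.{u})} {U V W : C}

lemma ext {t t' : TranslationObj d P U} (h : t.val = t'.val) : t = t' := by
  cases t
  cases t'
  subst h
  rfl

/-- A morphism `t ⟶ t'` is a section `ξ` of `A` such that `t = t' + d ξ`. -/
@[ext]
structure Hom (t t' : TranslationObj d P U) where
  ξ : A.obj (op U)
  eq : t.val = t'.val + d.app (op U) ξ

/-- Composition of morphisms is the addition of sections of `A`. -/
instance : Category (TranslationObj d P U) where
  Hom := Hom
  id t := { ξ := 0, eq := by simp }
  comp a b := { ξ := a.ξ + b.ξ, eq := by rw [a.eq, b.eq, map_add]; abel }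
  id_comp _ := Hom.ext (zero_add _)
  comp_id _ := Hom.ext (add_zero _)
  assoc _ _ _ := Hom.ext (add_assoc _ _ _)

lemma hom_ext {t t' : TranslationObj d P U} {a b : t ⟶ t'} (h : a.ξ = b.ξ) : a = b := Hom.ext h

@[simp] lemma id_ξ (t : TranslationObj d P U) : Hom.ξ (𝟙 t) = 0 := rfl

@[simp] lemma comp_ξ {t t' t'' : TranslationObj d P U} (a : t ⟶ t') (b : t' ⟶ t'') :
    (a ≫ b).ξ = a.ξ + b.ξ := rfl

lemma eqToHom_ξ {t t' : TranslationObj d P U} (h : t = t') : (eqToHom h).ξ = 0 := by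
  subst h
  rfl

lemma eqToHom_toNatTrans_app_ξ {D : Cat.{u, u + 1}} {F G : D ⟶ Cat.of (TranslationObj d P U)}
    (h : F = G) (t : D) : ((eqToHom h).toNatTrans.app t).ξ = 0 := by
  subst h
  rfl

/-- Two equal objects are isomorphic through the zero section. -/
def isoOfEq {t t' : TranslationObj d P U} (h : t.val = t'.val) : t ≅ t' where
  hom := { ξ := 0, eq := by simp [h] }
  inv := { ξ := 0, eq := by simp [h] }
  hom_inv_id := hom_ext (add_zero _)
  inv_hom_id := hom_ext (add_zero _)

/-- The automorphism of `t` defined by a section `ξ` of `A` which is killed by `d`. -/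
def autOfKer (t : TranslationObj d P U) (ξ : A.obj (op U)) (h : d.app (op U) ξ = 0) : t ⟶ t where
  ξ := ξ
  eq := by rw [h, add_zero]

/-- Restriction along `k : V ⟶ U`. -/
def restrict (k : V ⟶ U) : TranslationObj d P U ⥤ TranslationObj d P V where
  obj t := { val := B.map k.op t.val, mem := P.map k.op t.mem }
  map a :=
    { ξ := A.map k.op a.ξ
      eq := by
        refine (congr_arg (B.map k.op) a.eq).trans ?_
        rw [map_add]
        exact congr_arg _ (CategoryTheory.congr_fun (d.naturality k.op) a.ξ).symm }
  map_id _ := hom_ext (map_zero _)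
  map_comp _ _ := hom_ext (map_add _ _ _)

def restrictId (U : C) : restrict (d := d) (P := P) (𝟙 U) ≅ 𝟭 _ :=
  NatIso.ofComponents
    (fun t ↦ isoOfEq (CategoryTheory.congr_fun (B.map_id (op U)) t.val))
    (fun a ↦ hom_ext (by
      refine (add_zero _).trans (Eq.trans ?_ (zero_add _).symm)
      exact CategoryTheory.congr_fun (A.map_id (op U)) a.ξ))

def restrictComp (k : W ⟶ V) (l : V ⟶ U) :
    restrict (d := d) (P := P) (k ≫ l) ≅ restrict l ⋙ restrict k :=
  NatIso.ofComponents
    (fun t ↦ isoOfEq (CategoryTheory.congr_fun (B.map_comp l.op k.op) t.val))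
    (fun a ↦ hom_ext (by
      refine (add_zero _).trans (Eq.trans ?_ (zero_add _).symm)
      exact CategoryTheory.congr_fun (A.map_comp l.op k.op) a.ξ))

end TranslationObj

/-- The category fibered in groupoids of translations attached to `d : A ⟶ B` and to `P ⊆ B`: the
objects over `U` are the sections `t` of `P` over `U`, and the morphisms `t ⟶ t'` are the
sections `ξ` of `A` over `U` such that `t = t' + d ξ`. -/
def translations {A B : Cᵒᵖ ⥤ AddCommGrpCat.{u}} (d : A ⟶ B)
    (P : Subfunctor (B ⋙ forget AddCommGrpCat.{u})) : LocallyDiscrete Cᵒᵖ ⥤ᵖ Cat.{u, u + 1} :=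
  LocallyDiscrete.mkPseudofunctor
    (fun U ↦ Cat.of (TranslationObj d P U.unop))
    (fun k ↦ (TranslationObj.restrict k.unop).toCatHom)
    (fun U ↦ Cat.Hom.isoMk (TranslationObj.restrictId U.unop))
    (fun k l ↦ Cat.Hom.isoMk (TranslationObj.restrictComp l.unop k.unop))
    (fun k l m ↦ by
      ext t
      apply TranslationObj.hom_ext
      refine Eq.trans ?_ (TranslationObj.eqToHom_toNatTrans_app_ξ _ t).symm
      change (0 : A.obj _) + (A.map m 0 + (0 + (0 + 0))) = 0
      simp)
    (fun k ↦ by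
      ext t
      apply TranslationObj.hom_ext
      refine Eq.trans ?_ (TranslationObj.eqToHom_toNatTrans_app_ξ _ t).symm
      change (0 : A.obj _) + (A.map k 0 + 0) = 0
      simp)
    (fun k ↦ by
      ext t
      apply TranslationObj.hom_ext
      refine Eq.trans ?_ (TranslationObj.eqToHom_toNatTrans_app_ξ _ t).symm
      change (0 : A.obj _) + (0 + 0) = 0
      simp)

end Translation

end CategoryTheory

namespace CategoryTheory

variable {C : Type u} [SmallCategory C]

section Gerbes

/-- A banding of `F` by the abelian presheaf `A`: for all objects `x` over `U`, an identification of
the sections of `A` over `U` with the automorphisms of `x`, compatible with the morphisms `x ⟶ y`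
and with restriction. -/
structure Banding (F : LocallyDiscrete Cᵒᵖ ⥤ᵖ Cat.{u, u + 1}) (A : Cᵒᵖ ⥤ AddCommGrpCat.{u}) where
  aut {U : C} (x : F.obj ⟨op U⟩) : Multiplicative (A.obj (op U)) ≃* Aut x
  naturality {U : C} {x y : F.obj ⟨op U⟩} (φ : x ⟶ y) (a : A.obj (op U)) :
    (aut x (.ofAdd a)).hom ≫ φ = φ ≫ (aut y (.ofAdd a)).hom
  restrict {U V : C} (k : V ⟶ U) (x : F.obj ⟨op U⟩) (a : A.obj (op U)) :
    (F.map k.op.toLoc).toFunctor.map (aut x (.ofAdd a)).hom =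
      (aut ((F.map k.op.toLoc).toFunctor.obj x) (.ofAdd (A.map k.op a))).hom

/-- The automorphism of `x` given by the section `a` of the band. -/
def Banding.act {F : LocallyDiscrete Cᵒᵖ ⥤ᵖ Cat.{u, u + 1}} {A : Cᵒᵖ ⥤ AddCommGrpCat.{u}}
    (b : Banding F A) {U : C} (x : F.obj ⟨op U⟩) (a : A.obj (op U)) : x ⟶ x :=
  (b.aut x (.ofAdd a)).hom

variable (J : GrothendieckTopology C)

/-- A gerbe: a stack in groupoids which locally has objects, any two of which are locally
isomorphic. -/
structure IsGerbe (F : LocallyDiscrete Cᵒᵖ ⥤ᵖ Cat.{u, u + 1}) : Prop where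
  isStack : F.IsStack J
  isIso {U : C} {x y : F.obj ⟨op U⟩} (φ : x ⟶ y) : IsIso φ
  locally_nonempty (U : C) : ∃ S ∈ J U, ∀ ⦃V : C⦄ (k : V ⟶ U), S k → Nonempty (F.obj ⟨op V⟩)
  locally_iso {U : C} (x y : F.obj ⟨op U⟩) : ∃ S ∈ J U, ∀ ⦃V : C⦄ (k : V ⟶ U), S k →
    Nonempty ((F.map k.op.toLoc).toFunctor.obj x ≅ (F.map k.op.toLoc).toFunctor.obj y)

/-- `η : F ⟶ S` exhibits `S` as the stack associated with `F`: `S` is a stack, and `η` is fully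
faithful and locally essentially surjective. (This is used for `F` whose presheaves of morphisms
are sheaves.) -/
structure IsAssociatedStack {F S : LocallyDiscrete Cᵒᵖ ⥤ᵖ Cat.{u, u + 1}}
    (η : Pseudofunctor.StrongTrans F S) : Prop where
  isStack : S.IsStack J
  full (U : C) : (η.app ⟨op U⟩).toFunctor.Full
  faithful (U : C) : (η.app ⟨op U⟩).toFunctor.Faithful
  locally_essSurj {U : C} (y : S.obj ⟨op U⟩) : ∃ T ∈ J U, ∀ ⦃V : C⦄ (k : V ⟶ U), T k →
    ∃ x : F.obj ⟨op V⟩, Nonempty ((η.app ⟨op V⟩).toFunctor.obj x ≅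
      (S.map k.op.toLoc).toFunctor.obj y)

variable {J}

/-- The sections of `I` which are mapped by `q : I ⟶ Z` to the restrictions of the
global section `z` of `Z`. -/
def fiberSubfunctor {X : C} (hX : IsTerminal X) {I Z : Cᵒᵖ ⥤ AddCommGrpCat.{u}} (q : I ⟶ Z)
    (z : Z.obj (op X)) : Subfunctor (I ⋙ forget AddCommGrpCat.{u}) where
  obj U := {t : I.obj U | q.app U t = Z.map (hX.from U.unop).op z}
  map {U V} k := fun (t : I.obj U) (ht : q.app U t = Z.map (hX.from U.unop).op z) ↦ by
    change q.app V (I.map k t) = Z.map (hX.from V.unop).op z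
    have h₁ := CategoryTheory.congr_fun (q.naturality k) t
    have h₂ : (hX.from V.unop).op = (hX.from U.unop).op ≫ k :=
      Quiver.Hom.unop_inj (hX.hom_ext _ _)
    refine h₁.trans ((congr_arg (Z.map k) ht).trans ?_)
    rw [h₂]
    exact (CategoryTheory.congr_fun (Z.map_comp _ _) z).symm

/-- A two-step right resolution `0 ⟶ A ⟶ I⁰ ⟶ I¹ ⟶ Z ⟶ 0` of an abelian sheaf `A`, spliced from
the short exact sequences `0 ⟶ A ⟶ I⁰ ⟶ Q ⟶ 0` and `0 ⟶ Q ⟶ I¹ ⟶ Z ⟶ 0`. -/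
structure TwoStepResolution (A : Sheaf J AddCommGrpCat.{u}) where
  {I₀ Q I₁ Z : Sheaf J AddCommGrpCat.{u}}
  ι : A ⟶ I₀
  p : I₀ ⟶ Q
  j : Q ⟶ I₁
  q : I₁ ⟶ Z
  ι_p : ι ≫ p = 0
  j_q : j ≫ q = 0
  shortExact₀ : (ShortComplex.mk ι p ι_p).ShortExact
  shortExact₁ : (ShortComplex.mk j q j_q).ShortExact

namespace TwoStepResolution

variable {A : Sheaf J AddCommGrpCat.{u}} (K : TwoStepResolution A) {X : C} (hX : IsTerminal X)
  (z : K.Z.obj.obj (op X))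

/-- The fibered category of liftings of the global section `z` of `Z`: the objects over `U` are the
`t ∈ I¹(U)` which lift `z|U`, and the morphisms `t ⟶ t'` are the `ξ ∈ I⁰(U)` such that
`t = t' + d ξ`, where `d` is the composition `I⁰ ⟶ Q ⟶ I¹`. -/
def liftings : LocallyDiscrete Cᵒᵖ ⥤ᵖ Cat.{u, u + 1} :=
  translations (K.p ≫ K.j).hom (fiberSubfunctor hX K.q.hom z)

lemma d_ι {U : C} (a : A.obj.obj (op U)) :
    (K.p ≫ K.j).hom.app (op U) (K.ι.hom.app (op U) a) = 0 := by
  have h : K.ι ≫ K.p ≫ K.j = 0 := by rw [← Category.assoc, K.ι_p, zero_comp]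
  have h' := congr_arg (fun φ : A ⟶ K.I₁ ↦ φ.hom.app (op U)) h
  exact CategoryTheory.congr_fun h' a

/-- The image of `z` under the two connecting homomorphisms `H⁰(X, Z) ⟶ H¹(X, Q) ⟶ H²(X, A)`. -/
noncomputable def δδ : Sheaf.H A 2 :=
  (((Sheaf.H.equiv₀ K.Z hX).symm z).comp K.shortExact₁.extClass (zero_add 1)).comp
    K.shortExact₀.extClass rfl

end TwoStepResolution

/-- `c` is the cohomology class of the gerbe `F` banded by `A`: for some two-step resolution
`0 ⟶ A ⟶ I⁰ ⟶ I¹ ⟶ Z ⟶ 0` and some global section `z` of `Z`, the gerbe is a target of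
a morphism from the liftings of `z` which is compatible with the action of `A` on automorphisms, and
`c` is the image of `z` in `H²(X, A)`. -/
def Banding.HasClass {X : C} (hX : IsTerminal X) {F : LocallyDiscrete Cᵒᵖ ⥤ᵖ Cat.{u, u + 1}}
    {A : Sheaf J AddCommGrpCat.{u}} (b : Banding F A.obj) (c : Sheaf.H A 2) : Prop :=
  ∃ (K : TwoStepResolution A) (z : K.Z.obj.obj (op X))
    (θ : Pseudofunctor.StrongTrans (K.liftings hX z) F),
    (∀ (U : C) (t : TranslationObj (K.p ≫ K.j).hom (fiberSubfunctor hX K.q.hom z) U)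
      (a : A.obj.obj (op U)),
      (θ.app ⟨op U⟩).toFunctor.map (t.autOfKer (K.ι.hom.app (op U) a) (K.d_ι a)) =
        b.act ((θ.app ⟨op U⟩).toFunctor.obj t) a) ∧
    c = K.δδ hX z

end Gerbes

end CategoryTheory

namespace SheafOfModules

variable {C : Type u} [SmallCategory C] {J : GrothendieckTopology C} {R : Sheaf J RingCat.{u}}
  {M N : SheafOfModules.{u} R}

instance hasExt : HasExt.{u + 1} (SheafOfModules.{u} R) := HasExt.standard _

/-- `H` is locally free of finite rank. -/
def IsLocallyFreeOfFiniteRank (H : SheafOfModules.{u} R) : Prop :=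
  ∃ q : LocalGeneratorsData.{u} H, q.IsLocallyFreeData ∧ q.IsFiniteType

/-- `p : M ⟶ B` locally admits sections. -/
def LocallySplit {B : SheafOfModules.{u} R} (p : M ⟶ B) : Prop :=
  ∀ U : C, ∃ T ∈ J U, ∀ ⦃V : C⦄ (k : V ⟶ U), T k →
    ∃ σ : B.over V ⟶ M.over V, σ ≫ (overFunctor R V).map p = 𝟙 (B.over V)

section Yoneda

variable (f : M ⟶ N)

/-- The short exact sequence `0 ⟶ ker f ⟶ M ⟶ im f ⟶ 0`. -/
lemma kernel_image_shortExact : (ShortComplex.mk (kernel.ι f) (Abelian.factorThruImage f)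
    (by rw [← cancel_mono (Abelian.image.ι f)]; simp)).ShortExact where
  exact := by
    let φ : ShortComplex.mk (kernel.ι f) (Abelian.factorThruImage f)
        (by rw [← cancel_mono (Abelian.image.ι f)]; simp) ⟶
        ShortComplex.mk (kernel.ι f) f (kernel.condition f) :=
      { τ₁ := 𝟙 _, τ₂ := 𝟙 _, τ₃ := Abelian.image.ι f }
    have : Epi φ.τ₁ := inferInstanceAs (Epi (𝟙 _))
    have : IsIso φ.τ₂ := inferInstanceAs (IsIso (𝟙 _))
    have : Mono φ.τ₃ := inferInstanceAs (Mono (Abelian.image.ι f))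
    exact (ShortComplex.exact_iff_of_epi_of_isIso_of_mono φ).2
      (ShortComplex.exact_of_f_is_kernel _ (kernelIsKernel f))
  mono_f := inferInstanceAs (Mono (kernel.ι f))
  epi_g := inferInstanceAs (Epi (Abelian.factorThruImage f))

/-- The short exact sequence `0 ⟶ im f ⟶ N ⟶ coker f ⟶ 0`. -/
lemma image_cokernel_shortExact : (ShortComplex.mk (Abelian.image.ι f) (cokernel.π f)
    (kernel.condition _)).ShortExact where
  exact := ShortComplex.exact_of_f_is_kernel _ (kernelIsKernel (cokernel.π f))
  mono_f := inferInstanceAs (Mono (kernel.ι (cokernel.π f)))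
  epi_g := inferInstanceAs (Epi (cokernel.π f))

/-- The Yoneda class in `Ext²(coker f, ker f)` of `0 ⟶ ker f ⟶ M ⟶ N ⟶ coker f ⟶ 0`. -/
noncomputable def yonedaClass : Abelian.Ext (cokernel f) (kernel f) 2 :=
  (image_cokernel_shortExact f).extClass.comp (kernel_image_shortExact f).extClass rfl

end Yoneda

section Splittings

variable (f : M ⟶ N)

/-- The splittings of `N|U ⟶ coker f|U`. -/
noncomputable def splittingSubfunctor :
    Subfunctor ((homSheaf (cokernel f) N).obj ⋙ CategoryTheory.forget AddCommGrpCat.{u}) where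
  obj U := {s : (cokernel f).over U.unop ⟶ N.over U.unop |
    s ≫ (overFunctor R U.unop).map (cokernel.π f) = 𝟙 ((cokernel f).over U.unop)}
  map {U V} k := fun (s : (cokernel f).over U.unop ⟶ N.over U.unop)
      (hs : s ≫ (overFunctor R U.unop).map (cokernel.π f) = 𝟙 ((cokernel f).over U.unop)) ↦ by
    change restrictHom k.unop s ≫ (overFunctor R V.unop).map (cokernel.π f) = 𝟙 _
    rw [← restrictHom_over _ _ k.unop (cokernel.π f), ← restrictHom_comp_comp, hs]
    exact (congr_arg _ ((overFunctor R U.unop).map_id _).symm).trans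
      ((restrictHom_over _ _ k.unop (𝟙 _)).trans ((overFunctor R V.unop).map_id _))

/-- The category fibered in groupoids of splittings: the objects over `U` are the splittings
`s` of `N|U ⟶ H¹|U`, with `H¹ = coker f`, and the morphisms `s ⟶ s'` are
the `ξ : H¹|U ⟶ M|U` such that `s = s' + ξ ≫ f|U`. -/
noncomputable def splittings : LocallyDiscrete Cᵒᵖ ⥤ᵖ Cat.{u, u + 1} :=
  translations (homSheafMap (cokernel f) f).hom (splittingSubfunctor f)

variable {f}

/-- A morphism `H¹|U ⟶ H⁰|U`, as an automorphism of a splitting. -/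
noncomputable def splittingAut {U : C}
    (s : TranslationObj (homSheafMap (cokernel f) f).hom (splittingSubfunctor f) U)
    (ξ : (cokernel f).over U ⟶ (kernel f).over U) : s ⟶ s :=
  s.autOfKer (ξ ≫ (overFunctor R U).map (kernel.ι f)) (by
    change (ξ ≫ (overFunctor R U).map (kernel.ι f)) ≫ (overFunctor R U).map f = 0
    rw [Category.assoc, ← Functor.map_comp, kernel.condition, Functor.map_zero, comp_zero])

/-- For `ξ : H¹|U ⟶ H⁰|U`, the endomorphism
`E ⟶ N|U ⟶ H¹|U ⟶ H⁰|U ⟶ M|U ⟶ E` of a diagram completion. -/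
noncomputable def DiagramCompletion.endo {U : C} (E : DiagramCompletion f U)
    (ξ : (cokernel f).over U ⟶ (kernel f).over U) : E.E ⟶ E.E :=
  E.g ≫ (overFunctor R U).map (cokernel.π f) ≫ ξ ≫ (overFunctor R U).map (kernel.ι f) ≫ E.h

end Splittings

/-- The banding of the diagram completions in which `ξ` acts as `𝟙 + ξ_E`. -/
def IsCompletionBanding {f : M ⟶ N}
    (b : Banding (completions f) (homSheaf (cokernel f) (kernel f)).obj) : Prop :=
  ∀ (U : C) (E : DiagramCompletion f U) (ξ : (cokernel f).over U ⟶ (kernel f).over U),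
    DiagramCompletion.Hom.φ (b.act (F := completions f) (U := U) E ξ) = 𝟙 E.E + E.endo ξ

/-- The banding of the stack of splittings in which `ξ` acts tautologically on the splittings. -/
def IsSplittingBanding {f : M ⟶ N} {S : LocallyDiscrete Cᵒᵖ ⥤ᵖ Cat.{u, u + 1}}
    (η : Pseudofunctor.StrongTrans (splittings f) S)
    (b : Banding S (homSheaf (cokernel f) (kernel f)).obj) : Prop :=
  ∀ (U : C) (s : TranslationObj (homSheafMap (cokernel f) f).hom (splittingSubfunctor f) U)
    (ξ : (cokernel f).over U ⟶ (kernel f).over U),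
    b.act ((η.app ⟨op U⟩).toFunctor.obj s) ξ = (η.app ⟨op U⟩).toFunctor.map (splittingAut s ξ)

section Identification

/-- A system of isomorphisms `Extⁿ(H, F) ≃ Hⁿ(X, Hom(H, F))` which identifies the two
sides as universal `∂`-functors in `F`: they are natural in `F`, they are
compatible with the connecting homomorphisms (in particular `Hom(H, -)` is exact), and in degree
zero they are the evident identification. -/
structure ExtIdentification {X : C} (hX : IsTerminal X) (H : SheafOfModules.{u} R) where
  e (n : ℕ) (F : SheafOfModules.{u} R) : Abelian.Ext H F n ≃+ Sheaf.H (homSheaf H F) n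
  naturality (n : ℕ) {F G : SheafOfModules.{u} R} (a : F ⟶ G) (x : Abelian.Ext H F n) :
    e n G (x.comp (Abelian.Ext.mk₀ a) (add_zero n)) = Sheaf.H.map (homSheafMap H a) n (e n F x)
  shortExact {S : ShortComplex (SheafOfModules.{u} R)} (hS : S.ShortExact) :
    (S.map (homSheafFunctor H)).ShortExact
  connecting {S : ShortComplex (SheafOfModules.{u} R)} (hS : S.ShortExact) (n : ℕ)
    (x : Abelian.Ext H S.X₃ n) :
    e (n + 1) S.X₁ (x.comp hS.extClass rfl) =
      Abelian.Ext.comp (e n S.X₃ x) (shortExact hS).extClass rfl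
  zero {F : SheafOfModules.{u} R} (φ : H ⟶ F) :
    Sheaf.H.equiv₀ (homSheaf H F) hX (e 0 F (Abelian.Ext.mk₀ φ)) = (overFunctor R X).map φ

end Identification

end SheafOfModules

/-! Write H¹ = coker f, H⁰ = ker f, B = im f. The whole theorem is read off from the resolution 0 →
Hom(H¹, H⁰) → Hom(H¹, M) → Hom(H¹, N) → Hom(H¹, H¹) → 0, spliced through Hom(H¹, B)
(`homResolution`). It is exact because morphisms out of a locally free module of finite rank lift
locally along epimorphisms (`exists_local_lift`). A splitting of N → H¹ is a lifting of the identity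
section of Hom(H¹, H¹), so the fibered category of splittings is the category of liftings attached
to this resolution (`splittingSubfunctor_eq`).

Ext and cohomology: the exact functor Hom(H, -) acts on Ext groups, and composition with the class
of the identity gives maps from Extⁿ(H, F) to Hⁿ(X, Hom(H, F)). Dimension shifting reduces
bijectivity to the vanishing of the higher cohomology of Hom(H, I) for I injective. This sheaf need
not be injective among abelian sheaves, as H need not be flat over ℤ. But Hom(K, Hom(H, I)) consists
of the linear morphisms from H ⊗_ℤ K to I, and tensoring over ℤ preserves monomorphisms with
torsion-free cokernel. Hence Hom(H, I) has no higher Ext from torsion-free sheaves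
(`ext_homSheaf_eq_zero`), in particular from the constant sheaf ℤ.

Completions and splittings: a splitting s yields the completion M ⊕ H¹ with g = (f, s); morphisms of
splittings become unipotent matrices, which makes this fully faithful. Every completion is an
extension of H¹ by M, hence locally split, hence locally of this form. Since modules and their
morphisms glue, the completions are a stack, and therefore a stack associated with the splittings
(`isAssociatedStack`). Both gerbes are thus instances of one general statement.

General statement (`TwoStepResolution.exists_banding`): let a stack be associated with the liftings
of a global section z. It is a gerbe, because two liftings differ by a section of Q, which comes
locally from I⁰. The band is obtained by transporting the action of A on liftings to all objects by
descent. The class is well defined because two compatible morphisms to the same gerbe, from liftings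
of z and of z', can be compared on the presheaf of isomorphisms between their images. There the
differences form a cocycle with values in the cokernel of the diagonal A → I⁰ ⊕ I'⁰, and this
cocycle maps to those defining both classes (`δδ_eq_δδ`). A global object exists if and only if the
image of z in H¹(Q) comes from H¹(I⁰), that is, dies in H²(A). Finally, compatibility with
connecting homomorphisms matches the image of the identity with the Yoneda class
(`yonedaClass_eq_zero_iff`). -/

namespace SheafOfModules

variable {C : Type u} [SmallCategory C] {J : GrothendieckTopology C} {R : Sheaf J RingCat.{u}}

/-! ### Exactness of restriction, local bases, and local lifting out of locally free modules -/

section Restriction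

instance overFunctor_preservesFiniteLimits (U : C) :
    PreservesFiniteLimits (overFunctor.{u} R U) := by
  have : PreservesFiniteLimits (J.overPullback AddCommGrpCat.{u} U) := inferInstance
  have : PreservesFiniteLimits (overFunctor.{u} R U ⋙ toSheaf _) :=
    inferInstanceAs (PreservesFiniteLimits (toSheaf _ ⋙ J.overPullback AddCommGrpCat.{u} U))
  exact preservesFiniteLimits_of_reflects_of_preserves _ (toSheaf _)

/-- On abelian sheaves, restriction has a right adjoint because the forgetful functor of the slice
is cocontinuous. The passage to the underlying abelian sheaf is exact and reflects finite colimits,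
so the property descends to modules. -/
instance overFunctor_preservesFiniteColimits (U : C) :
    PreservesFiniteColimits (overFunctor.{u} R U) := by
  have : (J.overPullback AddCommGrpCat.{u} U).IsLeftAdjoint :=
    ((Over.forget U).sheafAdjunctionCocontinuous AddCommGrpCat.{u} (J.over U) J).isLeftAdjoint
  have : PreservesFiniteColimits (overFunctor.{u} R U ⋙ toSheaf _) :=
    inferInstanceAs (PreservesFiniteColimits (toSheaf _ ⋙ J.overPullback AddCommGrpCat.{u} U))
  exact preservesFiniteColimits_of_reflects_of_preserves _ (toSheaf _)

end Restriction

section Sections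

variable {D : Type u} [SmallCategory D] {K : GrothendieckTopology D} {S : Sheaf K RingCat.{u}}

lemma sectionMap_naturality {E F : SheafOfModules.{u} S} (φ : E ⟶ F) {X Y : D} (k : X ⟶ Y)
    (x : E.val.presheaf.obj (op Y)) :
    sectionMap φ (op X) (E.val.presheaf.map k.op x) =
      F.val.presheaf.map k.op (sectionMap φ (op Y) x) :=
  CategoryTheory.congr_fun (((PresheafOfModules.toPresheaf S.obj).map φ.val).naturality k.op) x

lemma presheaf_map_map (E : SheafOfModules.{u} S) {X Y Z : D} (k : X ⟶ Y) (l : Y ⟶ Z)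
    (x : E.val.presheaf.obj (op Z)) :
    E.val.presheaf.map k.op (E.val.presheaf.map l.op x) = E.val.presheaf.map (k ≫ l).op x :=
  (CategoryTheory.congr_fun (E.val.presheaf.map_comp l.op k.op) x).symm

lemma presheaf_map_id (E : SheafOfModules.{u} S) {X : D} (x : E.val.presheaf.obj (op X)) :
    E.val.presheaf.map (𝟙 X).op x = x :=
  CategoryTheory.congr_fun (E.val.presheaf.map_id _) x

lemma bijective_sections_terminal (F : SheafOfModules.{u} S) {X : D} (hX : IsTerminal X) :
    Function.Bijective (fun s : F.sections ↦ s.val (op X)) := by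
  refine ⟨fun s t h ↦ ?_, fun x ↦ ?_⟩
  · apply Subtype.ext
    funext ⟨Y⟩
    rw [← s.property (hX.from Y).op, ← t.property (hX.from Y).op]
    exact congr_arg _ h
  · refine ⟨⟨fun Y ↦ F.val.presheaf.map (hX.from Y.unop).op x, fun {Y Z} k ↦ ?_⟩, ?_⟩
    · refine (presheaf_map_map F k.unop _ x).trans ?_
      rw [hX.hom_ext (k.unop ≫ hX.from Y.unop) (hX.from Z.unop)]
    · change F.val.presheaf.map (hX.from X).op x = x
      rw [hX.hom_ext (hX.from X) (𝟙 X)]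
      exact presheaf_map_id F x

end Sections

/-- The sections `b i` of `H` over `V` are a basis of `H.over V`, in the strong sense that
they remain so after restriction. -/
def IsBasis (H : SheafOfModules.{u} R) {V : C} {I : Type u}
    (b : I → H.val.presheaf.obj (op V)) : Prop :=
  ∀ ⦃W : C⦄ (k : W ⟶ V) (F : SheafOfModules.{u} (R.over W)),
    Function.Bijective (fun (φ : H.over W ⟶ F) i ↦
      sectionMap φ (op (Over.mk (𝟙 W))) (H.val.presheaf.map k.op (b i)))

/-- Restriction commutes with finite direct sums and carries the structure sheaf to the structure
sheaf, so a free presentation of finite rank stays one over every smaller object. Morphisms out of a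
free module are families of global sections, and over a slice these are the sections at the terminal
object. -/
lemma isBasis_of_isIso {H : SheafOfModules.{u} R} {X V : C} (σ : (H.over X).GeneratingSections)
    [IsIso σ.π] [Finite σ.I] (m : V ⟶ X) :
    IsBasis H (V := V) (fun i ↦ H.val.presheaf.map m.op ((σ.s i).val (op (Over.mk (𝟙 X))))) := by
  intro W k F
  have : PreservesColimitsOfShape (Discrete σ.I) (overMap.{u} R (k ≫ m)) := inferInstance
  let η : unit (R.over W) ≅ (overMap R (k ≫ m)).obj (unit (R.over X)) :=
    (overMapUnitIso (k ≫ m)).symm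
  let e : free σ.I ≅ H.over W := mapFreeIso (overMap R (k ≫ m)) σ.I η ≪≫
    (overMap R (k ≫ m)).mapIso (asIso σ.π) ≪≫ (overFunctorMap R (k ≫ m)).app H
  have hbij : Function.Bijective (fun (φ : H.over W ⟶ F) i ↦
      (F.freeHomEquiv (e.hom ≫ φ) i).val (op (Over.mk (𝟙 W)))) :=
    (Function.Bijective.comp (Function.Bijective.piMap
      fun i ↦ bijective_sections_terminal F Over.mkIdTerminal)
        (F.freeHomEquiv.bijective.comp (Iso.homFromEquiv e.symm (Z := F)).bijective) :)
  convert hbij using 3 with φ i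
  have h₁ : ιFree i ≫ e.hom = η.hom ≫ (overMap R (k ≫ m)).map (ιFree i ≫ σ.π) ≫
      (overFunctorMap R (k ≫ m)).hom.app H := by
    have h₀ : ιFree i ≫ (mapFreeIso (overMap R (k ≫ m)) σ.I η).hom =
        η.hom ≫ (overMap R (k ≫ m)).map (ιFree i) := ιFree_mapFreeIso_hom _ _ _ _
    simp only [e, Iso.trans_hom, Functor.mapIso_hom, asIso_hom, Iso.app_hom, Functor.map_comp,
      Category.assoc, reassoc_of% h₀]
  have h₂ : ιFree i ≫ σ.π = (H.over X).unitHomEquiv.symm (σ.s i) := by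
    rw [← unitHomEquiv_symm_freeHomEquiv_apply, Equiv.apply_symm_apply]
  have h₃ : (F.freeHomEquiv (e.hom ≫ φ) i).val (op (Over.mk (𝟙 W))) =
      sectionMap φ (op (Over.mk (𝟙 W))) (((H.over X).unitHomEquiv ((H.over X).unitHomEquiv.symm
        (σ.s i))).val (op ((Over.map (k ≫ m)).obj (Over.mk (𝟙 W))))) := by
    rw [← h₂]
    have h₄ : F.freeHomEquiv (e.hom ≫ φ) i = F.unitHomEquiv ((ιFree i ≫ e.hom) ≫ φ) := by
      rw [Category.assoc]
      rfl
    rw [h₄, h₁]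
    rfl
  rw [Equiv.apply_symm_apply] at h₃
  refine Eq.trans (congr_arg (sectionMap φ _) ?_) h₃.symm
  refine (presheaf_map_map H _ _ _).trans (Eq.trans ?_ ((σ.s i).property
    (Over.homMk (𝟙 W ≫ k ≫ m) : (Over.map (k ≫ m)).obj (Over.mk (𝟙 W)) ⟶ Over.mk (𝟙 X)).op))
  exact congr_arg (fun l : W ⟶ X ↦ H.val.presheaf.map l.op ((σ.s i).val (op (Over.mk (𝟙 X)))))
    (Category.id_comp (k ≫ m)).symm

lemma exists_isBasis {H : SheafOfModules.{u} R} (hH : ∃ q : LocalGeneratorsData.{u} H,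
    q.IsLocallyFreeData ∧ q.IsFiniteType) (U : C) :
    ∃ T ∈ J U, ∀ ⦃V : C⦄ (k : V ⟶ U), T k →
      ∃ (I : Type u) (_ : Finite I) (b : I → H.val.presheaf.obj (op V)), IsBasis H b := by
  obtain ⟨q, hq, hq'⟩ := hH
  refine ⟨_, q.coversTop U, fun V k ⟨i, ⟨m⟩⟩ ↦ ?_⟩
  have := hq.isIso i
  have : Finite (q.generators i).I := (hq'.isFiniteType i).finite
  exact ⟨_, this, _, isBasis_of_isIso (q.generators i) m⟩

/-- The restriction of a morphism out of `H.over V` along `k`. -/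
noncomputable def overRestrict {H : SheafOfModules.{u} R} {V W : C} (k : W ⟶ V)
    {F : SheafOfModules.{u} (R.over V)} (φ : H.over V ⟶ F) : H.over W ⟶ (overMap R k).obj F :=
  (overFunctorMap R k).inv.app H ≫ (overMap R k).map φ

/-- This is one of the places where finiteness of the rank matters: the basis elements are lifted on
separate covering sieves, which must have a common refinement. -/
lemma exists_le_of_finite {V : C} {I : Type*} [Finite I] (T : I → Sieve V) (hT : ∀ i, T i ∈ J V) :
    ∃ S ∈ J V, ∀ i, S ≤ T i := by
  have := Fintype.ofFinite I
  classical
  suffices ∀ s : Finset I, ∃ S ∈ J V, ∀ i ∈ s, S ≤ T i by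
    obtain ⟨S, hS, h⟩ := this Finset.univ
    exact ⟨S, hS, fun i ↦ h i (Finset.mem_univ i)⟩
  intro s
  induction s using Finset.induction_on with
  | empty => exact ⟨⊤, J.top_mem _, by simp⟩
  | insert i s _ ih =>
    obtain ⟨S, hS, h⟩ := ih
    refine ⟨T i ⊓ S, J.intersection_covering (hT i) hS, fun j hj ↦ ?_⟩
    obtain rfl | hj := Finset.mem_insert.1 hj
    · exact inf_le_left
    · exact inf_le_right.trans (h j hj)

/-- The images of the finitely many basis elements lift on a common covering sieve, and a morphism
is freely determined by its values on a basis. -/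
lemma exists_lift_of_isBasis {H : SheafOfModules.{u} R} {V : C} {I : Type u} [Finite I]
    {b : I → H.val.presheaf.obj (op V)} (hb : IsBasis H b) {E G : SheafOfModules.{u} (R.over V)}
    (g : E ⟶ G) [Epi g] (φ : H.over V ⟶ G) :
    ∃ T ∈ J V, ∀ ⦃W : C⦄ (k : W ⟶ V), T k → ∃ ψ : H.over W ⟶ (overMap R k).obj E,
      ψ ≫ (overMap R k).map g = overRestrict k φ := by
  have hg : Sheaf.IsLocallySurjective ((toSheaf _).map g) :=
    (Sheaf.isLocallySurjective_iff_epi' _ _).2 inferInstance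
  have hg' : Presheaf.IsLocallySurjective (J.over V) ((toSheaf _).map g).hom := hg
  let y (i : I) : G.val.presheaf.obj (op (Over.mk (𝟙 V))) := sectionMap φ (op (Over.mk (𝟙 V))) (b i)
  obtain ⟨T, hT, hT'⟩ := exists_le_of_finite
    (fun i ↦ Sieve.overEquiv _ (Presheaf.imageSieve ((toSheaf _).map g).hom (y i)))
    (fun i ↦ (J.mem_over_iff _).1 (hg'.imageSieve_mem (y i)))
  refine ⟨T, hT, fun W k hk ↦ ?_⟩
  have h (i : I) : ∃ e : E.val.presheaf.obj (op ((Over.map k).obj (Over.mk (𝟙 W)))),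
      sectionMap g _ e = G.val.presheaf.map
        (Over.homMk k : (Over.map k).obj (Over.mk (𝟙 W)) ⟶ Over.mk (𝟙 V)).op (y i) := by
    obtain ⟨e, he⟩ := (Sieve.overEquiv_iff _ _).1 (hT' i _ hk)
    -- The local lift lives over the structure map `k ≫ 𝟙 V`, while the target has structure map `𝟙
    -- W ≫ k`. Restriction along the identity of `W` passes from one to the other.
    refine ⟨E.val.presheaf.map (Over.homMk (𝟙 W) : (Over.map k).obj (Over.mk (𝟙 W)) ⟶
      Over.mk (k ≫ 𝟙 V)).op e, ?_⟩
    refine (sectionMap_naturality g _ _).trans ((congr_arg _ he).trans ?_)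
    refine (presheaf_map_map G _ _ _).trans ?_
    have : (Over.homMk (𝟙 W) : (Over.map k).obj (Over.mk (𝟙 W)) ⟶ Over.mk (k ≫ 𝟙 V)) ≫
        (Over.homMk k : Over.mk (k ≫ 𝟙 V) ⟶ Over.mk (𝟙 V)) = Over.homMk k := by
      ext
      simp
    exact congr_arg (fun l ↦ G.val.presheaf.map (Quiver.Hom.op l) (y i)) this
  choose e he using h
  obtain ⟨ψ, hψ⟩ := (hb k ((overMap R k).obj E)).2 e
  -- Surjectivity in the basis property has produced `ψ`; injectivity reduces the required equality
  -- to the basis elements.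
  refine ⟨ψ, (hb k _).1 (funext fun i ↦ ?_)⟩
  refine (congr_arg (sectionMap g _) (congr_fun hψ i)).trans ((he i).trans ?_)
  exact (sectionMap_naturality φ (Over.homMk k : (Over.map k).obj (Over.mk (𝟙 W)) ⟶
    Over.mk (𝟙 V)) (b i)).symm

lemma overRestrict_comp {H : SheafOfModules.{u} R} {U V W : C} (k : W ⟶ V) (l : V ⟶ U)
    {F : SheafOfModules.{u} (R.over U)} (φ : H.over U ⟶ F) :
    overRestrict (k ≫ l) φ ≫ (overMapComp R k l).hom.app F = overRestrict k (overRestrict l φ) := by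
  have h := (overMapComp R k l).hom.naturality φ
  have h' := overFunctorMap_comp H k l
  dsimp at h
  simp only [overRestrict, Category.assoc, h, reassoc_of% h', Functor.map_comp]

/-- Morphisms out of a locally free module of finite rank lift locally along epimorphisms. -/
lemma exists_local_lift {H : SheafOfModules.{u} R} (hH : IsLocallyFreeOfFiniteRank H) {U : C}
    {E G : SheafOfModules.{u} (R.over U)} (g : E ⟶ G) [Epi g] (φ : H.over U ⟶ G) :
    ∃ T ∈ J U, ∀ ⦃W : C⦄ (k : W ⟶ U), T k → ∃ ψ : H.over W ⟶ (overMap R k).obj E,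
      ψ ≫ (overMap R k).map g = overRestrict k φ := by
  obtain ⟨T, hT, hT'⟩ := exists_isBasis hH U
  have (V : C) (k : V ⟶ U) (hk : T k) : ∃ T' ∈ J V, ∀ ⦃W : C⦄ (l : W ⟶ V), T' l →
      ∃ ψ : H.over W ⟶ (overMap R l).obj ((overMap R k).obj E),
        ψ ≫ (overMap R l).map ((overMap R k).map g) = overRestrict l (overRestrict k φ) := by
    obtain ⟨I, _, b, hb⟩ := hT' k hk
    exact exists_lift_of_isBasis hb ((overMap R k).map g) (overRestrict k φ)
  choose T' hT'₁ hT'₂ using this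
  -- Two successive localizations: one to have a basis, one to lift its images.
  refine ⟨Sieve.bind T T', J.bind_covering hT fun V k hk ↦ hT'₁ V k hk, ?_⟩
  rintro W _ ⟨V, k, l, hl, hk, rfl⟩
  obtain ⟨ψ, hψ⟩ := hT'₂ V l hl k hk
  refine ⟨ψ ≫ (overMapComp R k l).inv.app E, ?_⟩
  have h := (overMapComp R k l).inv.naturality g
  dsimp at h
  rw [Category.assoc, ← h, reassoc_of% hψ, ← overRestrict_comp, Category.assoc,
    Iso.hom_inv_id_app, Category.comp_id]

/-! ### Exactness of the functor Hom(H, -) -/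

section Exactness

variable (H : SheafOfModules.{u} R)

lemma overRestrict_over {F : SheafOfModules.{u} R} {U V : C} (k : V ⟶ U)
    (φ : H.over U ⟶ F.over U) :
    overRestrict k φ ≫ (overFunctorMap R k).hom.app F = restrictHom k φ := by
  simp [overRestrict, restrictHom]

variable {H}

/-- Epimorphisms of abelian sheaves are the locally surjective morphisms, and local surjectivity is
here the local lifting property of `H`. This is where exactness of Hom(H, -) uses local freeness. -/
lemma epi_homSheafMap (hH : IsLocallyFreeOfFiniteRank H) {F G : SheafOfModules.{u} R} (g : F ⟶ G)
    [Epi g] : Epi (homSheafMap H g) := by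
  rw [← Sheaf.isLocallySurjective_iff_epi']
  refine ⟨fun {U} (φ : H.over U ⟶ G.over U) ↦ ?_⟩
  obtain ⟨T, hT, h⟩ := exists_local_lift hH ((overFunctor R U).map g) φ
  refine J.superset_covering (fun V k hk ↦ ?_) hT
  obtain ⟨ψ, hψ⟩ := h k hk
  refine ⟨ψ ≫ (overFunctorMap R k).hom.app F, ?_⟩
  change (ψ ≫ (overFunctorMap R k).hom.app F) ≫ (overFunctor R V).map g = restrictHom k φ
  have h' := (overFunctorMap R k).hom.naturality g
  dsimp at h'
  rw [Category.assoc, ← h', reassoc_of% hψ, overRestrict_over]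

lemma sheaf_hom_ext_apply {A : Sheaf J AddCommGrpCat.{u}} {B : Sheaf J AddCommGrpCat.{u}}
    {a b : A ⟶ B} (h : ∀ (U : C) (x : A.obj.obj (op U)), a.hom.app (op U) x = b.hom.app (op U) x) :
    a = b :=
  Sheaf.hom_ext (NatTrans.ext (funext fun U ↦ AddCommGrpCat.hom_ext (AddMonoidHom.ext (h U.unop))))

lemma mono_homSheafMap {F G : SheafOfModules.{u} R} (g : F ⟶ G) [Mono g] :
    Mono (homSheafMap H g) where
  right_cancellation a b h := sheaf_hom_ext_apply fun U x ↦ by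
    have h' := CategoryTheory.congr_fun (congr_arg (fun φ ↦ φ.hom.app (op U)) h) x
    exact (cancel_mono ((overFunctor R U).map g)).1 h'

section Kernel

variable {S : ShortComplex (SheafOfModules.{u} R)} (hS : S.Exact) [Mono S.f]
  {A : Sheaf J AddCommGrpCat.{u}} (k : A ⟶ homSheaf H S.X₂) (hk : k ≫ homSheafMap H S.g = 0)

include hS hk in
-- Restriction to `U` is exact, so the restriction of `S.f` is still a kernel of the restriction of
-- `S.g`. Uniqueness, which is not recorded here, is the fact that this restriction is a
-- monomorphism.
lemma exists_unique_homSheaf_lift {U : C} (x : A.obj.obj (op U)) :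
    ∃ φ : H.over U ⟶ S.X₁.over U, φ ≫ (overFunctor R U).map S.f = k.hom.app (op U) x := by
  have : Mono (S.map (overFunctor R U)).f := inferInstanceAs (Mono ((overFunctor R U).map S.f))
  have h : (show H.over U ⟶ S.X₂.over U from k.hom.app (op U) x) ≫ (overFunctor R U).map S.g = 0 :=
    CategoryTheory.congr_fun (congr_arg (fun φ ↦ φ.hom.app (op U)) hk) x
  exact ⟨(hS.map (overFunctor R U)).lift _ h, (hS.map (overFunctor R U)).lift_f _ h⟩

include hS hk in
-- The sectionwise factorizations are unique, hence automatically additive and compatible with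
-- restriction.
lemma exists_homSheaf_lift : ∃ l : A ⟶ homSheaf H S.X₁, l ≫ homSheafMap H S.f = k := by
  choose l hl using fun (U : C) (x : A.obj.obj (op U)) ↦ exists_unique_homSheaf_lift hS k hk x
  have (U : C) {φ ψ : H.over U ⟶ S.X₁.over U}
      (h : φ ≫ (overFunctor R U).map S.f = ψ ≫ (overFunctor R U).map S.f) : φ = ψ :=
    (cancel_mono ((overFunctor R U).map S.f)).1 h
  refine ⟨⟨{ app U := AddCommGrpCat.ofHom (AddMonoidHom.mk' (l U.unop) fun x y ↦ this _ ?_),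
             naturality U V m := AddCommGrpCat.hom_ext (AddMonoidHom.ext fun x ↦ this _ ?_) }⟩,
    sheaf_hom_ext_apply fun U x ↦ hl U x⟩
  · rw [Preadditive.add_comp, hl, hl, hl, map_add]
    rfl
  · change l V.unop (A.obj.map m x) ≫ _ = restrictHom m.unop (l U.unop x) ≫ _
    rw [hl, ← restrictHom_over _ _ m.unop S.f, ← restrictHom_comp_comp, hl]
    exact CategoryTheory.congr_fun (k.hom.naturality m) x

end Kernel

lemma shortExact_map_homSheafFunctor (hH : IsLocallyFreeOfFiniteRank H)
    {S : ShortComplex (SheafOfModules.{u} R)} (hS : S.ShortExact) :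
    (S.map (homSheafFunctor H)).ShortExact := by
  have := hS.mono_f
  have := hS.epi_g
  have hm : Mono (homSheafMap H S.f) := mono_homSheafMap _
  have : Mono (S.map (homSheafFunctor H)).f := hm
  have : Epi (S.map (homSheafFunctor H)).g := epi_homSheafMap hH S.g
  exact ⟨ShortComplex.exact_of_f_is_kernel _ (KernelFork.IsLimit.ofι' _ _ fun k hk ↦
    ⟨(exists_homSheaf_lift hS.exact k hk).choose, (exists_homSheaf_lift hS.exact k hk).choose_spec⟩)⟩

/-- An additive functor preserving short exact sequences is exact in this sense; this is the form
needed to let Hom(H, -) act on Ext groups. -/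
lemma preservesFiniteLimits_homSheafFunctor (hH : IsLocallyFreeOfFiniteRank H) :
    PreservesFiniteLimits (homSheafFunctor H) :=
  have h : _ ∧ _ := ((homSheafFunctor H).exact_tfae.out 0 3).1
    fun _ hS ↦ shortExact_map_homSheafFunctor hH hS
  h.1

lemma preservesFiniteColimits_homSheafFunctor (hH : IsLocallyFreeOfFiniteRank H) :
    PreservesFiniteColimits (homSheafFunctor H) :=
  have h : _ ∧ _ := ((homSheafFunctor H).exact_tfae.out 0 3).1
    fun _ hS ↦ shortExact_map_homSheafFunctor hH hS
  h.2

end Exactness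

end SheafOfModules

/-! ### Sheaves of modules as a Grothendieck abelian category -/

namespace PresheafOfModules

variable {C : Type u} [SmallCategory C] (R : Cᵒᵖ ⥤ RingCat.{u})

instance ab5 : AB5OfSize.{u, u} (PresheafOfModules.{u} R) where
  ofShape K _ _ := HasExactColimitsOfShape.domain_of_functor K (toPresheaf R)

end PresheafOfModules

namespace SheafOfModules

variable {C : Type u} [SmallCategory C] {J : GrothendieckTopology C} (R : Sheaf J RingCat.{u})

instance ab5 : AB5OfSize.{u, u} (SheafOfModules.{u} R) where
  ofShape K _ _ :=
    (PresheafOfModules.sheafificationAdjunction (𝟙 R.obj)).hasExactColimitsOfShape K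

/-- The free presheaves of modules on representables separate presheaves of modules, and the
sheafification adjunction carries this to sheaves. -/
lemma isSeparating_free_yoneda : ObjectProperty.IsSeparating (ObjectProperty.ofObj fun X : C ↦
    (PresheafOfModules.sheafification (𝟙 R.obj)).obj
      ((PresheafOfModules.free R.obj).obj (yoneda.obj X))) := by
  intro M N f g h
  let adj := PresheafOfModules.sheafificationAdjunction (𝟙 R.obj)
  let G := SheafOfModules.forget R ⋙ PresheafOfModules.restrictScalars (𝟙 R.obj)
  apply G.map_injective
  apply PresheafOfModules.freeYoneda.isSeparating
  rintro _ ⟨X⟩ a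
  have := h _ ⟨X⟩ ((adj.homEquiv _ _).symm a)
  apply (adj.homEquiv _ _).symm.injective
  rwa [adj.homEquiv_naturality_right_symm, adj.homEquiv_naturality_right_symm]

/-- Its purpose is the existence of enough injective modules, on which the dimension shifting for
Ext(H, -) rests. -/
instance isGrothendieckAbelian : IsGrothendieckAbelian.{u} (SheafOfModules.{u} R) where
  hasSeparator := ⟨_, isSeparator_sigma _ |>.2 (isSeparating_free_yoneda R)⟩

end SheafOfModules

/-! ### The tensor product over ℤ of a presheaf of modules with an abelian presheaf -/

section
open scoped TensorProduct

lemma TensorProduct.addHom_ext_int {A B G : Type*} [AddCommGroup A] [AddCommGroup B] [AddCommGroup G]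
    {a b : A ⊗[ℤ] B →+ G} (h : ∀ x y, a (x ⊗ₜ y) = b (x ⊗ₜ y)) : a = b := by
  ext m
  induction m with
  | zero => simp
  | tmul x y => exact h x y
  | add x y hx hy => rw [map_add, map_add, hx, hy]

namespace PresheafOfModules

variable {C : Type u} [SmallCategory C] {R : Cᵒᵖ ⥤ RingCat.{u}} (H : PresheafOfModules.{u} R)

/-- The presheaf of abelian groups `U ↦ H(U) ⊗_ℤ K(U)`. -/
noncomputable def tensorAbPresheaf (K : Cᵒᵖ ⥤ AddCommGrpCat.{u}) : Cᵒᵖ ⥤ AddCommGrpCat.{u} where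
  obj U := AddCommGrpCat.of (H.presheaf.obj U ⊗[ℤ] K.obj U)
  map k := AddCommGrpCat.ofHom (TensorProduct.map (H.presheaf.map k).hom.toIntLinearMap
    (K.map k).hom.toIntLinearMap).toAddMonoidHom
  map_id U := AddCommGrpCat.hom_ext (TensorProduct.addHom_ext_int fun x y ↦ congr_arg₂ (· ⊗ₜ[ℤ] ·)
    (CategoryTheory.congr_fun (H.presheaf.map_id U) x) (CategoryTheory.congr_fun (K.map_id U) y))
  map_comp k l := AddCommGrpCat.hom_ext (TensorProduct.addHom_ext_int fun x y ↦ congr_arg₂ (· ⊗ₜ[ℤ] ·)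
    (CategoryTheory.congr_fun (H.presheaf.map_comp k l) x)
    (CategoryTheory.congr_fun (K.map_comp k l) y))

noncomputable instance (K : Cᵒᵖ ⥤ AddCommGrpCat.{u}) (U : Cᵒᵖ) :
    Module (R.obj U) ((H.tensorAbPresheaf K).obj U) :=
  inferInstanceAs (Module (R.obj U) (H.obj U ⊗[ℤ] K.obj U))

lemma tensorAbPresheaf_map_smul {K : Cᵒᵖ ⥤ AddCommGrpCat.{u}} ⦃U V : Cᵒᵖ⦄ (k : U ⟶ V) (r : R.obj U)
    (m : (H.tensorAbPresheaf K).obj U) : (H.tensorAbPresheaf K).map k (r • m) =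
      R.map k r • (H.tensorAbPresheaf K).map k m := by
  induction (show H.obj U ⊗[ℤ] K.obj U from m) with
  | zero => 
    refine (congr_arg ((H.tensorAbPresheaf K).map k) (smul_zero r)).trans ((map_zero _).trans ?_)
    exact (congr_arg _ (map_zero ((H.tensorAbPresheaf K).map k).hom)).trans (smul_zero _) |>.symm
  | tmul x y => exact congr_arg (fun z ↦ z ⊗ₜ[ℤ] (K.map k) y) (H.map_smul k r x)
  | add x y hx hy =>
    refine (congr_arg ((H.tensorAbPresheaf K).map k) (smul_add r x y)).trans
      ((map_add ((H.tensorAbPresheaf K).map k).hom _ _).trans ?_)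
    refine (congr_arg₂ _ hx hy).trans ?_
    exact (smul_add _ _ _).symm.trans
      (congr_arg _ (map_add ((H.tensorAbPresheaf K).map k).hom _ _).symm)

/-- The presheaf of modules `U ↦ H(U) ⊗_ℤ K(U)`. -/
noncomputable def tensorAb (K : Cᵒᵖ ⥤ AddCommGrpCat.{u}) : PresheafOfModules.{u} R :=
  ofPresheaf (H.tensorAbPresheaf K) H.tensorAbPresheaf_map_smul

variable {H}

/-- The morphism out of `U ↦ H(U) ⊗_ℤ K(U)` defined by natural bilinear maps. -/
noncomputable def tensorAbLift {K : Cᵒᵖ ⥤ AddCommGrpCat.{u}} {G : PresheafOfModules.{u} R}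
    (β : ∀ U : Cᵒᵖ, K.obj U →+ (H.obj U →ₗ[R.obj U] G.obj U))
    (hβ : ∀ {U V : Cᵒᵖ} (k : U ⟶ V) (x : H.obj U) (y : K.obj U),
      β V (K.map k y) (H.map k x) = G.map k (β U y x)) : H.tensorAb K ⟶ G :=
  homMk
    { app U := AddCommGrpCat.ofHom
        (Y := G.obj U) (TensorProduct.lift (R := ℤ) (AddMonoidHom.toIntLinearMap
          { toFun x := AddMonoidHom.toIntLinearMap
              { toFun y := β U y x
                map_zero' := by simp
                map_add' := by simp }
            map_zero' := by ext; simp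
            map_add' _ _ := by ext; simp })).toAddMonoidHom
      naturality U V k := AddCommGrpCat.hom_ext (AddMonoidHom.ext fun m ↦ by
        change H.obj U ⊗[ℤ] K.obj U at m
        induction m with
        | zero => exact (map_zero _).trans (map_zero _).symm
        | tmul x y => exact hβ k x y
        | add x y hx hy =>
          exact (map_add _ _ _).trans ((congr_arg₂ _ hx hy).trans (map_add _ _ _).symm)) }
    (fun U r m ↦ by
      change H.obj U ⊗[ℤ] K.obj U at m
      induction m with
      | zero =>
        refine (congr_arg _ (smul_zero (A := H.obj U ⊗[ℤ] K.obj U) r)).trans ?_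
        refine (map_zero _).trans (Eq.symm ?_)
        exact (congr_arg _ (map_zero _)).trans (smul_zero _)
      | tmul x y => exact (β U y).map_smul r x
      | add x y hx hy =>
        refine (congr_arg _ (smul_add (A := H.obj U ⊗[ℤ] K.obj U) r x y)).trans ?_
        refine (map_add _ _ _).trans ((congr_arg₂ _ hx hy).trans ?_)
        exact (smul_add _ _ _).symm.trans (congr_arg _ (map_add _ _ _).symm))

variable (H) in
noncomputable def tensorAbMap {K L : Cᵒᵖ ⥤ AddCommGrpCat.{u}} (a : K ⟶ L) :
    H.tensorAb K ⟶ H.tensorAb L :=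
  tensorAbLift (G := H.tensorAb L) (fun U : Cᵒᵖ ↦
    { toFun y :=
        { toFun x := (x ⊗ₜ[ℤ] a.app U y : H.obj U ⊗[ℤ] L.obj U)
          map_add' _ _ := TensorProduct.add_tmul _ _ _
          map_smul' _ _ := rfl }
      map_zero' := by
        ext x
        exact (congr_arg _ (map_zero _)).trans (TensorProduct.tmul_zero _ _)
      map_add' _ _ := by
        ext x
        exact (congr_arg _ (map_add _ _ _)).trans (TensorProduct.tmul_add _ _ _) })
    (fun {U V} k x y ↦ congr_arg (fun z ↦ (H.map k x ⊗ₜ[ℤ] z : H.obj V ⊗[ℤ] L.obj V))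
      (CategoryTheory.congr_fun (a.naturality k) y))

lemma mono_tensorAbMap {K L : Cᵒᵖ ⥤ AddCommGrpCat.{u}} (a : K ⟶ L)
    (ha : ∀ U, Function.Injective ((a.app U).hom.toIntLinearMap.lTensor (H.obj U))) :
    Mono (tensorAbMap H a) := by
  have : Mono ((toPresheaf R).map (tensorAbMap H a)) := by
    have (U : Cᵒᵖ) : Mono (((toPresheaf R).map (tensorAbMap H a)).app U) := by
      refine (AddCommGrpCat.mono_iff_injective _).2 ?_
      have h : (((toPresheaf R).map (tensorAbMap H a)).app U).hom =
          ((a.app U).hom.toIntLinearMap.lTensor (H.obj U)).toAddMonoidHom :=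
        TensorProduct.addHom_ext_int fun x y ↦ rfl
      exact fun x y hxy ↦ ha U ((DFunLike.congr_fun h x).symm.trans
        (hxy.trans (DFunLike.congr_fun h y)))
    exact NatTrans.mono_of_mono_app _
  exact (toPresheaf R).mono_of_mono_map this

end PresheafOfModules

end

/-! ### Torsion-free abelian sheaves, and extension of morphisms to Hom(H, I) -/

section
open scoped TensorProduct

namespace CategoryTheory.Sheaf

variable {C : Type u} [SmallCategory C] {J : GrothendieckTopology C}

/-- An abelian sheaf is torsion-free if its sections have no torsion. -/
def IsTorsionFree (A : Sheaf J AddCommGrpCat.{u}) : Prop :=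
  ∀ U : Cᵒᵖ, Module.IsTorsionFree ℤ (A.obj.obj U)

lemma injective_app_of_mono {A B : Sheaf J AddCommGrpCat.{u}} (a : A ⟶ B) [Mono a] (U : Cᵒᵖ) :
    Function.Injective (a.hom.app U) := by
  have : Mono ((sheafToPresheaf J _).map a) := inferInstance
  exact (AddCommGrpCat.mono_iff_injective _).1
    (inferInstanceAs (Mono (((sheafToPresheaf J _).map a).app U)))

lemma IsTorsionFree.of_mono {A B : Sheaf J AddCommGrpCat.{u}} (hB : B.IsTorsionFree) (a : A ⟶ B)
    [Mono a] : A.IsTorsionFree := fun U ↦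
  have := hB U
  Function.Injective.moduleIsTorsionFree (a.hom.app U) (injective_app_of_mono a U)
    (fun n x ↦ map_zsmul (a.hom.app U).hom n x)

/-- Absence of torsion means that multiplication by each nonzero integer is a monomorphism.
Sheafification is additive and exact, so it preserves this. -/
lemma isTorsionFree_sheafify (G : Cᵒᵖ ⥤ AddCommGrpCat.{u})
    (hG : ∀ U, Module.IsTorsionFree ℤ (G.obj U)) :
    ((presheafToSheaf J AddCommGrpCat.{u}).obj G).IsTorsionFree := by
  intro U
  rw [Module.isTorsionFree_iff_smul_eq_zero]
  intro n x hx
  by_contra! hn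
  have : Mono (n • 𝟙 G) := by
    have (U : Cᵒᵖ) : Mono ((n • 𝟙 G).app U) := by
      rw [AddCommGrpCat.mono_iff_injective]
      intro x y hxy
      have := hG U
      exact smul_right_injective _ hn.1 hxy
    exact NatTrans.mono_of_mono_app _
  have h : Mono ((presheafToSheaf J AddCommGrpCat.{u}).map (n • 𝟙 G)) := inferInstance
  rw [Functor.map_zsmul, CategoryTheory.Functor.map_id] at h
  refine hn.2 (injective_app_of_mono (n • 𝟙 ((presheafToSheaf J AddCommGrpCat.{u}).obj G)) U (Eq.trans ?_ (map_zero _).symm))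
  exact hx

lemma isTorsionFree_constantSheaf : ((constantSheaf J AddCommGrpCat.{u}).obj
    (AddCommGrpCat.of (ULift.{u} ℤ))).IsTorsionFree :=
  isTorsionFree_sheafify _ fun _ ↦ inferInstanceAs (Module.IsTorsionFree ℤ (ULift.{u} ℤ))

/-- The cover is the sheafification of the presheaf of free abelian groups on the sections of `A`.
-/
lemma exists_epi_of_isTorsionFree (A : Sheaf J AddCommGrpCat.{u}) :
    ∃ (P : Sheaf J AddCommGrpCat.{u}) (p : P ⟶ A), P.IsTorsionFree ∧ Epi p := by
  let G : Cᵒᵖ ⥤ AddCommGrpCat.{u} := (A.obj ⋙ forget _) ⋙ AddCommGrpCat.free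
  let g : G ⟶ A.obj := Functor.whiskerLeft A.obj AddCommGrpCat.adj.counit
  have (U : Cᵒᵖ) : Epi (g.app U) := inferInstanceAs (Epi (AddCommGrpCat.adj.counit.app (A.obj.obj U)))
  have : Epi g := NatTrans.epi_of_epi_app _
  refine ⟨(presheafToSheaf J _).obj G, (presheafToSheaf J _).map g ≫
    (sheafificationAdjunction J AddCommGrpCat).counit.app A, isTorsionFree_sheafify _ fun U ↦ ?_, ?_⟩
  swap
  · have : IsIso (sheafificationAdjunction J AddCommGrpCat.{u}).counit := inferInstance
    have : Epi ((presheafToSheaf J AddCommGrpCat.{u}).map g) := inferInstance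
    exact epi_comp _ _
  change Module.IsTorsionFree ℤ (FreeAbelianGroup (A.obj.obj U))
  infer_instance

end CategoryTheory.Sheaf

namespace SheafOfModules

variable {C : Type u} [SmallCategory C] {J : GrothendieckTopology C} {R : Sheaf J RingCat.{u}}
  {H I : SheafOfModules.{u} R} {K : Sheaf J AddCommGrpCat.{u}}

/-- A morphism `H|U ⟶ I|U`, on sections over `U`. -/
noncomputable def evalSection (U : C) : (H.over U ⟶ I.over U) →+
    (H.val.obj (op U) →ₗ[R.obj.obj (op U)] I.val.obj (op U)) where
  toFun φ := (φ.val.app (op (Over.mk (𝟙 U)))).hom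
  map_zero' := rfl
  map_add' _ _ := rfl

lemma evalSection_restrictHom {U V : C} (l : V ⟶ U) (φ : H.over U ⟶ I.over U)
    (x : H.val.obj (op U)) :
    evalSection V (restrictHom l φ) (H.val.map l.op x) = I.val.map l.op (evalSection U φ x) :=
  sectionMap_naturality φ (Over.homMk l : (Over.map l).obj (Over.mk (𝟙 V)) ⟶ Over.mk (𝟙 U)) x

/-- A morphism over `U` is therefore recovered from the values at the terminal objects of all its
restrictions, which makes it possible to describe morphisms into Hom(H, I) by bilinear maps. -/
lemma evalSection_restrictHom_hom {U : C} (φ : H.over U ⟶ I.over U) (T : Over U)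
    (x : H.val.obj (op T.left)) :
    evalSection T.left (restrictHom T.hom φ) x = sectionMap φ (op T) x := by
  let a : T ⟶ (Over.map T.hom).obj (Over.mk (𝟙 T.left)) := Over.homMk (𝟙 _)
  have h := sectionMap_naturality φ a x
  have h₁ : (H.over U).val.presheaf.map a.op x = x := presheaf_map_id H x
  have h₂ : (I.over U).val.presheaf.map a.op (evalSection T.left (restrictHom T.hom φ) x) =
    evalSection T.left (restrictHom T.hom φ) x := presheaf_map_id I _
  rw [h₁] at h
  exact h₂.symm.trans h.symm

/-- The morphism `H ⊗_ℤ K ⟶ I` attached to `K ⟶ Hom(H, I)`. -/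
noncomputable def tensorAbHom (k : K ⟶ homSheaf H I) : H.val.tensorAb K.obj ⟶
    (PresheafOfModules.restrictScalars (𝟙 R.obj)).obj ((forget R).obj I) :=
  PresheafOfModules.tensorAbLift
    (G := (PresheafOfModules.restrictScalars (𝟙 R.obj)).obj ((forget R).obj I))
    (fun U ↦ (evalSection U.unop).comp (k.hom.app U).hom)
    (fun {U V} l x y ↦ by
      have h : k.hom.app V (K.obj.map l y) = (restrictHom l.unop
        (show H.over U.unop ⟶ I.over U.unop from k.hom.app U y)) :=
        CategoryTheory.congr_fun (k.hom.naturality l) y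
      exact (congr_arg (fun φ ↦ evalSection V.unop φ (H.val.map l x)) h).trans
        (evalSection_restrictHom l.unop _ x))

/-- The morphism `K ⟶ Hom(H, I)` defined by natural bilinear maps. -/
noncomputable def homOfBilinear
    (β : ∀ U : Cᵒᵖ, K.obj.obj U →+ (H.val.obj U →ₗ[R.obj.obj U] I.val.obj U))
    (hβ : ∀ {U V : Cᵒᵖ} (k : U ⟶ V) (x : H.val.obj U) (y : K.obj.obj U),
      β V (K.obj.map k y) (H.val.map k x) = I.val.map k (β U y x)) : K ⟶ homSheaf H I where
  hom :=
    { app U := AddCommGrpCat.ofHom (AddMonoidHom.mk'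
        (fun y ↦ show H.over U.unop ⟶ I.over U.unop from ⟨PresheafOfModules.homMk
          { app T := AddCommGrpCat.ofHom
              (β (op T.unop.left) (K.obj.map T.unop.hom.op y)).toAddMonoidHom
            naturality T T' k := AddCommGrpCat.hom_ext (AddMonoidHom.ext
              fun (x : H.val.obj (op T.unop.left)) ↦ by
                have h := hβ k.unop.left.op x (K.obj.map T.unop.hom.op y)
                refine Eq.trans ?_ h
                have h' : K.obj.map T'.unop.hom.op y =
                    K.obj.map k.unop.left.op (K.obj.map T.unop.hom.op y) := by
                  rw [← CategoryTheory.comp_apply, ← Functor.map_comp, ← op_comp, Over.w]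
                exact congr_arg (fun z ↦ β (op T'.unop.left) z (H.val.map k.unop.left.op x)) h') }
          (fun T r x ↦ (β (op T.unop.left) (K.obj.map T.unop.hom.op y)).map_smul r x)⟩)
        (fun y y' ↦ sectionMap_ext fun T ↦ AddCommGrpCat.hom_ext (AddMonoidHom.ext
          fun (x : H.val.obj (op T.unop.left)) ↦ by
            have h : β (op T.unop.left) (K.obj.map T.unop.hom.op (y + y')) =
                β (op T.unop.left) (K.obj.map T.unop.hom.op y) +
                  β (op T.unop.left) (K.obj.map T.unop.hom.op y') := by
              rw [map_add, map_add]
            exact LinearMap.congr_fun h x)))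
      naturality U V l := AddCommGrpCat.hom_ext (AddMonoidHom.ext fun y ↦
        sectionMap_ext fun T ↦ AddCommGrpCat.hom_ext (AddMonoidHom.ext
          fun (x : H.val.obj (op T.unop.left)) ↦ by
            have h : K.obj.map T.unop.hom.op (K.obj.map l y) =
                K.obj.map (T.unop.hom ≫ l.unop).op y := by
              rw [op_comp, Functor.map_comp, CategoryTheory.comp_apply]
              rfl
            exact congr_arg (fun z ↦ β (op T.unop.left) z x) h)) }

/-- The bilinear maps attached to `H ⊗_ℤ K ⟶ I`. -/
noncomputable def bilinearOfTensorAb (g : H.val.tensorAb K.obj ⟶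
    (PresheafOfModules.restrictScalars (𝟙 R.obj)).obj ((forget R).obj I)) (U : Cᵒᵖ) :
    K.obj.obj U →+ (H.val.obj U →ₗ[R.obj.obj U] I.val.obj U) where
  toFun y :=
    { toFun x := g.app U (x ⊗ₜ[ℤ] y : H.val.obj U ⊗[ℤ] K.obj.obj U)
      map_add' x x' := (congr_arg (g.app U) (TensorProduct.add_tmul x x' y)).trans
        (map_add (g.app U).hom _ _)
      map_smul' r x := (g.app U).hom.map_smul r (x ⊗ₜ[ℤ] y : H.val.obj U ⊗[ℤ] K.obj.obj U) }
  map_zero' := by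
    ext x
    exact (congr_arg (g.app U) (TensorProduct.tmul_zero _ x)).trans (map_zero (g.app U).hom)
  map_add' y y' := by
    ext x
    exact (congr_arg (g.app U) (TensorProduct.tmul_add x y y')).trans (map_add (g.app U).hom _ _)

lemma bilinearOfTensorAb_naturality (g : H.val.tensorAb K.obj ⟶
    (PresheafOfModules.restrictScalars (𝟙 R.obj)).obj ((forget R).obj I)) {U V : Cᵒᵖ} (k : U ⟶ V)
    (x : H.val.obj U) (y : K.obj.obj U) :
    bilinearOfTensorAb g V (K.obj.map k y) (H.val.map k x) =
      I.val.map k (bilinearOfTensorAb g U y x) :=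
  CategoryTheory.congr_fun (((PresheafOfModules.toPresheaf _).map g).naturality k)
    (x ⊗ₜ[ℤ] y : H.val.obj U ⊗[ℤ] K.obj.obj U)

/-- If `I` is injective, morphisms to `Hom(H, I)` extend along the monomorphisms of abelian sheaves
whose cokernel is torsion-free. -/
lemma exists_extension_of_isTorsionFree [Injective I] {S : ShortComplex (Sheaf J AddCommGrpCat.{u})}
    (hS : S.ShortExact) (hS₃ : S.X₃.IsTorsionFree) (k : S.X₁ ⟶ homSheaf H I) :
    ∃ l : S.X₂ ⟶ homSheaf H I, S.f ≫ l = k := by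
  have := hS.mono_f
  have : Mono (PresheafOfModules.tensorAbMap H.val S.f.hom) := by
    refine PresheafOfModules.mono_tensorAbMap _ fun U ↦ ?_
    have hinj := Sheaf.injective_app_of_mono S.f U
    -- On sections `S.g` need not be surjective, so the third term of the exact sequence of groups
    -- is the range of `q`. As a subgroup of a torsion-free group it is torsion-free, hence flat
    -- over ℤ, and tensoring with `H(U)` keeps the injection injective.
    let q := (S.g.hom.app U).hom.toIntLinearMap
    have := (hS₃ U)
    have : Module.IsTorsionFree ℤ q.range :=
      Function.Injective.moduleIsTorsionFree q.range.subtype Subtype.val_injective fun _ _ ↦ rfl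
    have hex : ((S.map (sheafToPresheaf J _)).map ((CategoryTheory.evaluation _ _).obj U)).Exact :=
      (hS.exact.map_of_mono_of_preservesKernel (sheafToPresheaf J _) inferInstance
        inferInstance).map ((CategoryTheory.evaluation _ _).obj U)
    rw [ShortComplex.ab_exact_iff_function_exact] at hex
    refine LinearMap.lTensor_injective_of_exact_of_flat q.rangeRestrict q.surjective_rangeRestrict
      _ hinj (fun x ↦ ?_) _
    exact Subtype.ext_iff.trans (hex x)
  let adj := PresheafOfModules.sheafificationAdjunction (𝟙 R.obj)
  have hm : Mono ((PresheafOfModules.sheafification (𝟙 R.obj)).map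
    (PresheafOfModules.tensorAbMap H.val S.f.hom)) := inferInstance
  -- Injectivity of `I` applies among sheaves of modules: the morphism H ⊗ X₁ → I is sheafified,
  -- extended along the sheafified monomorphism, and transposed back to presheaves.
  let g := adj.homEquiv _ _ (Injective.factorThru ((adj.homEquiv _ _).symm (tensorAbHom k))
    ((PresheafOfModules.sheafification (𝟙 R.obj)).map
    (PresheafOfModules.tensorAbMap H.val S.f.hom)))
  have hg : PresheafOfModules.tensorAbMap H.val S.f.hom ≫ g = tensorAbHom k := by
    dsimp only [g]
    rw [← adj.homEquiv_naturality_left, Injective.comp_factorThru, Equiv.apply_symm_apply]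
  refine ⟨homOfBilinear (bilinearOfTensorAb g) (bilinearOfTensorAb_naturality g),
    sheaf_hom_ext_apply fun U y ↦ sectionMap_ext fun T ↦ AddCommGrpCat.hom_ext (AddMonoidHom.ext
      fun (x : H.val.obj (op T.unop.left)) ↦ ?_)⟩
  refine Eq.trans ?_ (evalSection_restrictHom_hom
    (show H.over U ⟶ I.over U from k.hom.app (op U) y) T.unop x)
  have h₁ : S.X₂.obj.map T.unop.hom.op (S.f.hom.app (op U) y) =
      S.f.hom.app _ (S.X₁.obj.map T.unop.hom.op y) :=
    (CategoryTheory.congr_fun (S.f.hom.naturality T.unop.hom.op) y).symm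
  have h₂ : k.hom.app _ (S.X₁.obj.map T.unop.hom.op y) = (restrictHom T.unop.hom
      (show H.over U ⟶ I.over U from k.hom.app (op U) y)) :=
    CategoryTheory.congr_fun (k.hom.naturality T.unop.hom.op) y
  refine (congr_arg (fun z ↦ bilinearOfTensorAb g (op T.unop.left) z x) h₁).trans ?_
  refine Eq.trans ?_ (congr_arg (fun φ ↦ evalSection T.unop.left φ x) h₂)
  exact CategoryTheory.congr_fun (congr_arg (fun f ↦
    ((PresheafOfModules.toPresheaf _).map f).app (op T.unop.left)) hg)
      (x ⊗ₜ[ℤ] S.X₁.obj.map T.unop.hom.op y :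
        H.val.obj (op T.unop.left) ⊗[ℤ] S.X₁.obj.obj (op T.unop.left))

end SheafOfModules

end

/-! ### Effaceability of Ext, acyclicity of Hom(H, I), and comparison of Ext with cohomology -/

namespace CategoryTheory.Abelian.Ext

variable {𝒜 : Type*} [Category* 𝒜] [Abelian 𝒜] [EnoughInjectives 𝒜] [HasExt.{w} 𝒜]

/-- If every object is a quotient of an object satisfying `P`, then every class of positive degree
is killed by an epimorphism whose source satisfies `P`. -/
lemma exists_epi_comp_eq_zero {P : 𝒜 → Prop} (hP : ∀ X, ∃ (Y : 𝒜) (p : Y ⟶ X), P Y ∧ Epi p)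
    (n : ℕ) {A B : 𝒜} (y : Ext.{w} A B (n + 1)) :
    ∃ (Y : 𝒜) (p : Y ⟶ A), P Y ∧ Epi p ∧ (mk₀ p).comp y (zero_add _) = 0 := by
  induction n generalizing B with
  | zero =>
    let I : InjectivePresentation B := Classical.arbitrary _
    let S := ShortComplex.mk _ _ (cokernel.condition I.f)
    have hS : S.ShortExact := { exact := ShortComplex.exact_cokernel I.f }
    have : Injective S.X₂ := I.injective
    obtain ⟨y', rfl⟩ := covariant_sequence_exact₁ A hS y (eq_zero_of_injective _) rfl
    obtain ⟨φ, rfl⟩ := (mk₀_bijective _ _).2 y'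
    -- The class is now the composition of `φ` with an extension class. On the pullback `φ` factors
    -- through `S.g`, which the extension class kills; it only remains to cover this pullback by an
    -- object satisfying `P`.
    obtain ⟨Y, p, hY, _⟩ := hP (pullback φ S.g)
    have : Epi S.g := hS.epi_g
    refine ⟨Y, p ≫ pullback.fst φ S.g, hY, epi_comp _ _, ?_⟩
    rw [mk₀_comp_mk₀_assoc, Category.assoc, pullback.condition, ← Category.assoc,
      ← mk₀_comp_mk₀_assoc, hS.comp_extClass, comp_zero]
  | succ n ih =>
    let I : InjectivePresentation B := Classical.arbitrary _
    let S := ShortComplex.mk _ _ (cokernel.condition I.f)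
    have hS : S.ShortExact := { exact := ShortComplex.exact_cokernel I.f }
    have : Injective S.X₂ := I.injective
    obtain ⟨y', rfl⟩ := covariant_sequence_exact₁ A hS y (eq_zero_of_injective _) rfl
    obtain ⟨Y, p, hY, hp, h⟩ := ih y'
    refine ⟨Y, p, hY, hp, ?_⟩
    rw [← comp_assoc (a₁₂ := n + 1) _ _ _ (by lia) (by lia) (by lia), h, zero_comp]

end CategoryTheory.Abelian.Ext

namespace SheafOfModules

open Abelian

variable {C : Type u} [SmallCategory C] {J : GrothendieckTopology C} {R : Sheaf J RingCat.{u}}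

/-- `Hom(H, I)` is acyclic if `I` is injective. -/
lemma ext_homSheaf_eq_zero {H I : SheafOfModules.{u} R} [Injective I] (n : ℕ)
    {A : Sheaf J AddCommGrpCat.{u}} (hA : A.IsTorsionFree) (y : Ext A (homSheaf H I) (n + 1)) :
    y = 0 := by
  induction n generalizing A with
  | zero =>
    obtain ⟨P, p, hP, _, hp⟩ := Ext.exists_epi_comp_eq_zero Sheaf.exists_epi_of_isTorsionFree 0 y
    have hS : (ShortComplex.mk _ _ (kernel.condition p)).ShortExact :=
      { exact := ShortComplex.exact_kernel p }
    -- A class that dies on `P` comes from the kernel of `P ⟶ A`, one degree lower.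
    obtain ⟨w, rfl⟩ := Ext.contravariant_sequence_exact₃ hS _ y hp (add_comm 1 0)
    obtain ⟨φ, rfl⟩ := (Ext.mk₀_bijective _ _).2 w
    -- The cokernel of the inclusion of the kernel into `P` is `A`, which is torsion-free, so `φ`
    -- extends to `P`; what extends to `P` has zero boundary.
    obtain ⟨l, rfl⟩ := exists_extension_of_isTorsionFree hS hA φ
    rw [← Ext.mk₀_comp_mk₀, hS.extClass_comp_assoc]
  | succ n ih =>
    obtain ⟨P, p, hP, _, hp⟩ :=
      Ext.exists_epi_comp_eq_zero Sheaf.exists_epi_of_isTorsionFree (n + 1) y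
    have hS : (ShortComplex.mk _ _ (kernel.condition p)).ShortExact :=
      { exact := ShortComplex.exact_kernel p }
    obtain ⟨w, rfl⟩ := Ext.contravariant_sequence_exact₃ hS _ y hp (add_comm 1 (n + 1))
    -- The induction hypothesis applies to the kernel because it is a subsheaf of the torsion-free
    -- sheaf `P`.
    rw [ih (hP.of_mono (kernel.ι p)) w, Ext.comp_zero]

section

variable {X : C} (hX : IsTerminal X) (H : SheafOfModules.{u} R)

/-- The morphism from the constant sheaf `ℤ` to `Hom(H, H)` given by the identity. -/
noncomputable def idClass : Sheaf.H (homSheaf H H) 0 :=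
  (Sheaf.H.equiv₀ (homSheaf H H) hX).symm (𝟙 (H.over X))

include hX in
-- Since `X` is terminal, the slice over `X` is the site itself and restriction to it loses nothing.
-- This is the degree zero case of the comparison of Ext with cohomology.
lemma bijective_overFunctor_map (F : SheafOfModules.{u} R) : Function.Bijective
    (fun φ : H ⟶ F ↦ (overFunctor R X).map φ) := by
  refine ⟨fun φ ψ h ↦ sectionMap_ext fun U ↦ ?_, fun φ ↦ ?_⟩
  · exact congr_arg (fun f ↦ sectionMap f (op (Over.mk (hX.from U.unop)))) h
  · let a {T T' : Over X} (l : T'.left ⟶ T.left) : T' ⟶ T := Over.homMk l (hX.hom_ext _ _)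
    refine ⟨⟨PresheafOfModules.homMk
      { app U := sectionMap φ (op (Over.mk (hX.from U.unop)))
        naturality U V k := AddCommGrpCat.hom_ext (AddMonoidHom.ext fun x ↦
          sectionMap_naturality φ (a k.unop :
            Over.mk (hX.from V.unop) ⟶ Over.mk (hX.from U.unop)) x) }
      fun U r x ↦ (φ.val.app (op (Over.mk (hX.from U.unop)))).hom.map_smul r x⟩,
      sectionMap_ext fun T ↦ AddCommGrpCat.hom_ext (AddMonoidHom.ext fun x ↦ ?_)⟩
    have h := sectionMap_naturality φ
      (a (𝟙 _) : T.unop ⟶ Over.mk (hX.from T.unop.left)) x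
    have h₁ : (H.over X).val.presheaf.map
      (a (𝟙 _) : T.unop ⟶ Over.mk (hX.from T.unop.left)).op x = x := presheaf_map_id H x
    rw [h₁] at h
    exact (h.trans (presheaf_map_id F _)).symm

variable {H} (hH : IsLocallyFreeOfFiniteRank H)

/-- The map `Extⁿ(H, F) ⟶ Hⁿ(X, Hom(H, F))` induced by the exact functor `Hom(H, -)`. -/
noncomputable def extToH (n : ℕ) (F : SheafOfModules.{u} R) :
    Ext H F n →+ Sheaf.H (homSheaf H F) n :=
  letI := preservesFiniteLimits_homSheafFunctor hH
  letI := preservesFiniteColimits_homSheafFunctor hH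
  ((idClass hX H).precomp _ (zero_add n)).comp ((homSheafFunctor H).mapExtAddHom H F n)

lemma extToH_apply (n : ℕ) {F : SheafOfModules.{u} R} (x : Ext H F n) :
    haveI := preservesFiniteLimits_homSheafFunctor hH
    haveI := preservesFiniteColimits_homSheafFunctor hH
    extToH hX hH n F x = (idClass hX H).comp (x.mapExactFunctor (homSheafFunctor H)) (zero_add n) :=
  rfl

lemma extToH_naturality (n : ℕ) {F G : SheafOfModules.{u} R} (a : F ⟶ G) (x : Ext H F n) :
    extToH hX hH n G (x.comp (Ext.mk₀ a) (add_zero n)) =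
      Sheaf.H.map (homSheafMap H a) n (extToH hX hH n F x) := by
  have := preservesFiniteLimits_homSheafFunctor hH
  have := preservesFiniteColimits_homSheafFunctor hH
  rw [extToH_apply, extToH_apply, Ext.mapExactFunctor_comp, Ext.mapExactFunctor_mk₀]
  exact (Ext.comp_assoc_of_third_deg_zero (idClass hX H) (x.mapExactFunctor (homSheafFunctor H))
    (Ext.mk₀ (homSheafMap H a)) (zero_add n)).symm

/-- An exact functor sends the class of a short exact sequence to the class of its image, and
composition of Ext classes is associative. -/
lemma extToH_connecting {S : ShortComplex (SheafOfModules.{u} R)} (hS : S.ShortExact) (n : ℕ)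
    (x : Ext H S.X₃ n) :
    extToH hX hH (n + 1) S.X₁ (x.comp hS.extClass rfl) =
      Ext.comp (extToH hX hH n S.X₃ x) (shortExact_map_homSheafFunctor hH hS).extClass rfl := by
  have := preservesFiniteLimits_homSheafFunctor hH
  have := preservesFiniteColimits_homSheafFunctor hH
  rw [extToH_apply, extToH_apply, Ext.mapExactFunctor_comp, Ext.mapExactFunctor_extClass]
  exact (Ext.comp_assoc _ _ _ _ _ (by lia)).symm

lemma equiv₀_extToH_zero {F : SheafOfModules.{u} R} (φ : H ⟶ F) :
    Sheaf.H.equiv₀ (homSheaf H F) hX (extToH hX hH 0 F (Ext.mk₀ φ)) = (overFunctor R X).map φ := by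
  have := preservesFiniteLimits_homSheafFunctor hH
  have := preservesFiniteColimits_homSheafFunctor hH
  rw [extToH_apply, Ext.mapExactFunctor_mk₀]
  refine (Sheaf.H.equiv₀_naturality (F := homSheaf H H) hX (homSheafMap H φ) _).symm.trans ?_
  refine (congr_arg ((homSheafMap H φ).hom.app (op X))
    ((Sheaf.H.equiv₀ (homSheaf H H) hX).apply_symm_apply _)).trans ?_
  exact Category.id_comp ((overFunctor R X).map φ)

/-- Dimension shifting along an embedding of `F` in an injective module: in both long exact
sequences the group of degree n + 1 at `F` is the cokernel of the map of degree n groups from the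
injective to the quotient, because the injective contributes nothing in positive degree on either
side. -/
lemma extToH_bijective (n : ℕ) (F : SheafOfModules.{u} R) :
    Function.Bijective (extToH hX hH n F) := by
  induction n generalizing F with
  | zero =>
    have h : Function.Bijective (Sheaf.H.equiv₀ (homSheaf H F) hX ∘ extToH hX hH 0 F ∘ Ext.mk₀) := by
      have h : (Sheaf.H.equiv₀ (homSheaf H F) hX ∘ extToH hX hH 0 F ∘ Ext.mk₀) =
        fun φ : H ⟶ F ↦ (overFunctor R X).map φ := funext fun φ ↦ equiv₀_extToH_zero hX hH φ
      rw [h]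
      exact bijective_overFunctor_map hX H F
    exact (Function.Bijective.of_comp_iff _ (Ext.mk₀_bijective H F)).1
      ((Function.Bijective.of_comp_iff' (Sheaf.H.equiv₀ (homSheaf H F) hX).bijective _).1 h)
  | succ n hn =>
    let I : InjectivePresentation F := Classical.arbitrary _
    let S := ShortComplex.mk _ _ (cokernel.condition I.f)
    have hS : S.ShortExact := { exact := ShortComplex.exact_cokernel I.f }
    have : Injective S.X₂ := I.injective
    have hS' := shortExact_map_homSheafFunctor hH hS
    refine AddMonoidHom.bijective_of_surjective_of_bijective_of_right_exact
      ((Ext.mk₀ S.g).postcomp H (add_zero n)) (hS.extClass.postcomp H rfl)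
      (Sheaf.H.map (homSheafMap H S.g) n) (hS'.extClass.postcomp _ rfl)
      (extToH hX hH n S.X₂) (extToH hX hH n S.X₃) (extToH hX hH (n + 1) S.X₁)
      (AddMonoidHom.ext fun x ↦ (extToH_naturality hX hH n S.g x).symm)
      (AddMonoidHom.ext fun x ↦ (extToH_connecting hX hH hS n x).symm)
      ((ShortComplex.ab_exact_iff_function_exact _).1
        (Ext.covariant_sequence_exact₃' H hS n (n + 1) rfl))
      ((ShortComplex.ab_exact_iff_function_exact _).1
        (Ext.covariant_sequence_exact₃' _ hS' n (n + 1) rfl))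
      (hn _).surjective (hn _)
      (fun x ↦ Ext.covariant_sequence_exact₁ _ hS x (Ext.eq_zero_of_injective _) rfl)
      -- Cohomology is Ext out of the constant sheaf ℤ, which is torsion-free, so the acyclicity of
      -- Hom(H, I) applies.
      (fun y ↦ Ext.covariant_sequence_exact₁ _ hS' y
        (ext_homSheaf_eq_zero n Sheaf.isTorsionFree_constantSheaf _) rfl)

/-- The isomorphisms `Extⁿ(H, F) ≃ Hⁿ(X, Hom(H, F))` for `H` locally free of finite rank. -/
noncomputable def extIdentification : ExtIdentification hX H where
  e n F := AddEquiv.ofBijective (extToH hX hH n F) (extToH_bijective hX hH n F)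
  naturality n _ _ a x := extToH_naturality hX hH n a x
  shortExact hS := shortExact_map_homSheafFunctor hH hS
  connecting hS n x := extToH_connecting hX hH hS n x
  zero φ := equiv₀_extToH_zero hX hH φ

end

end SheafOfModules

/-! ### Gluing sheaves of modules along a sieve -/

namespace SheafOfModules

variable {C : Type u} [SmallCategory C] {J : GrothendieckTopology C} {R : Sheaf J RingCat.{u}}

section Sec

variable {X Y Y' Y'' : C} (E : SheafOfModules.{u} (R.over X))

/-- The module of sections of `E` over `a : Y ⟶ X`. -/
def sec (a : Y ⟶ X) : ModuleCat.{u} (R.obj.obj (op Y)) := E.val.obj (op (Over.mk a))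

/-- The restriction of sections along `g : Y' ⟶ Y`. -/
noncomputable def res (g : Y' ⟶ Y) (a : Y ⟶ X) (a' : Y' ⟶ X) (h : g ≫ a = a') :
    E.sec a →+ E.sec a' :=
  (E.val.presheaf.map (Over.homMk g h : Over.mk a' ⟶ Over.mk a).op).hom

lemma res_smul (g : Y' ⟶ Y) (a : Y ⟶ X) (a' : Y' ⟶ X) (h : g ≫ a = a') (r : R.obj.obj (op Y))
    (x : E.sec a) : E.res g a a' h (r • x) = R.obj.map g.op r • E.res g a a' h x :=
  PresheafOfModules.map_smul E.val _ _ _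

lemma res_res (g : Y' ⟶ Y) (g' : Y'' ⟶ Y') (a : Y ⟶ X) (a' : Y' ⟶ X) (a'' : Y'' ⟶ X)
    (h : g ≫ a = a') (h' : g' ≫ a' = a'') (x : E.sec a) :
    E.res g' a' a'' h' (E.res g a a' h x) = E.res (g' ≫ g) a a'' (by simp [h, h']) x :=
  presheaf_map_map E _ _ _

lemma res_id (a : Y ⟶ X) (x : E.sec a) : E.res (𝟙 Y) a a (Category.id_comp a) x = x := by
  refine Eq.trans ?_ (presheaf_map_id E (X := Over.mk a) x)
  exact congr_arg (fun k ↦ E.val.presheaf.map (Quiver.Hom.op k) x) (by ext; rfl)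

variable {E} {E' E'' : SheafOfModules.{u} (R.over X)}

/-- A morphism of modules over `X`, on sections over `a : Y ⟶ X`. -/
noncomputable def secMap (φ : E ⟶ E') (a : Y ⟶ X) : E.sec a →ₗ[R.obj.obj (op Y)] E'.sec a :=
  (φ.val.app (op (Over.mk a))).hom

lemma secMap_res (φ : E ⟶ E') (g : Y' ⟶ Y) (a : Y ⟶ X) (a' : Y' ⟶ X) (h : g ≫ a = a')
    (x : E.sec a) : secMap φ a' (E.res g a a' h x) = E'.res g a a' h (secMap φ a x) :=
  sectionMap_naturality φ _ x

lemma secMap_comp (φ : E ⟶ E') (ψ : E' ⟶ E'') (a : Y ⟶ X) (x : E.sec a) :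
    secMap (φ ≫ ψ) a x = secMap ψ a (secMap φ a x) := rfl

lemma secMap_id (a : Y ⟶ X) (x : E.sec a) : secMap (𝟙 E) a x = x := rfl

lemma hom_ext_secMap {φ ψ : E ⟶ E'}
    (h : ∀ (Y : C) (a : Y ⟶ X) (x : E.sec a), secMap φ a x = secMap ψ a x) : φ = ψ :=
  sectionMap_ext fun T ↦ AddCommGrpCat.hom_ext (AddMonoidHom.ext fun x ↦ h _ T.unop.hom x)

/-- The morphism of modules defined by natural linear maps. -/
noncomputable def homMk (φ : ∀ {Y : C} (a : Y ⟶ X), E.sec a →ₗ[R.obj.obj (op Y)] E'.sec a)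
    (hφ : ∀ {Y Y' : C} (g : Y' ⟶ Y) (a : Y ⟶ X) (a' : Y' ⟶ X) (h : g ≫ a = a') (x : E.sec a),
      φ a' (E.res g a a' h x) = E'.res g a a' h (φ a x)) : E ⟶ E' :=
  ⟨PresheafOfModules.homMk
    { app T := AddCommGrpCat.ofHom (φ T.unop.hom).toAddMonoidHom
      naturality T T' k := AddCommGrpCat.hom_ext (AddMonoidHom.ext
        fun x ↦ hφ k.unop.left T.unop.hom T'.unop.hom (Over.w k.unop) x) }
    fun T r x ↦ (φ T.unop.hom).map_smul r x⟩

lemma isIso_of_bijective_secMap (φ : E ⟶ E')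
    (h : ∀ (Y : C) (a : Y ⟶ X), Function.Bijective (secMap φ a)) : IsIso φ := by
  have : IsIso ((forget _ ⋙ PresheafOfModules.toPresheaf _).map φ) := by
    have (T : (Over X)ᵒᵖ) : IsIso (((forget _ ⋙ PresheafOfModules.toPresheaf _).map φ).app T) := by
      rw [ConcreteCategory.isIso_iff_bijective]
      exact h _ T.unop.hom
    exact NatIso.isIso_of_isIso_app _
  have : IsIso ((toSheaf _).map φ) := by
    have : IsIso ((sheafToPresheaf _ _).map ((toSheaf _).map φ)) := this
    exact isIso_of_reflects_iso _ (sheafToPresheaf _ _)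
  exact isIso_of_reflects_iso _ (toSheaf _)

variable (E)

lemma isSheafFor_over (a : Y ⟶ X) {T : Sieve Y} (hT : T ∈ J Y) :
    Presieve.IsSheafFor (E.val.presheaf ⋙ CategoryTheory.forget AddCommGrpCat.{u})
      ((Sieve.overEquiv (Over.mk a)).symm T).arrows :=
  (isSheaf_iff_isSheaf_of_type _ _).1 ((Presheaf.isSheaf_iff_isSheaf_forget _ _
    (CategoryTheory.forget AddCommGrpCat.{u})).1 E.isSheaf) _
      (J.overEquiv_symm_mem_over (Over.mk a) T hT)

variable {E} in
lemma sec_ext {a : Y ⟶ X} {T : Sieve Y} (hT : T ∈ J Y) {x y : E.sec a}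
    (h : ∀ ⦃V : C⦄ (l : V ⟶ Y), T l → E.res l a _ rfl x = E.res l a _ rfl y) : x = y := by
  refine (E.isSheafFor_over a hT).isSeparatedFor.ext fun W k hk ↦ ?_
  have hk' : T k.left := (Sieve.overEquiv_symm_iff _ _).1 hk
  have h' : ∀ (V : C) (l : V ⟶ Y) (a' : V ⟶ X) (e : l ≫ a = a'), T l →
      E.res l a a' e x = E.res l a a' e y := by
    rintro V l _ rfl hl
    exact h l hl
  exact h' _ k.left W.hom (Over.w k) hk'

/-- The structure map `a'` of each piece is a variable tied to `l ≫ a` by an equation. This avoids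
transporting sections along equalities of morphisms when the lemma is applied. -/
lemma exists_glue {a : Y ⟶ X} {T : Sieve Y} (hT : T ∈ J Y)
    (y : ∀ ⦃V : C⦄ (l : V ⟶ Y), T l → ∀ a' : V ⟶ X, l ≫ a = a' → E.sec a')
    (hy : ∀ ⦃V V' : C⦄ (l : V ⟶ Y) (hl : T l) (g : V' ⟶ V) (a' : V ⟶ X) (h : l ≫ a = a')
      (a'' : V' ⟶ X) (h' : g ≫ a' = a''),
      E.res g _ _ h' (y l hl a' h) =
        y (g ≫ l) (T.downward_closed hl g) a'' (by rw [Category.assoc, h, h'])) :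
    ∃ x : E.sec a, ∀ ⦃V : C⦄ (l : V ⟶ Y) (hl : T l), E.res l a _ rfl x = y l hl _ rfl := by
  let fam : Presieve.FamilyOfElements (E.val.presheaf ⋙ CategoryTheory.forget AddCommGrpCat.{u})
      ((Sieve.overEquiv (Over.mk a)).symm T).arrows := fun W k hk ↦ y k.left hk W.hom (Over.w k)
  have hfam : fam.SieveCompatible := by
    intro W W' k g hk
    exact (hy k.left hk g.left W.hom (Over.w k) W'.hom (Over.w g)).symm
  obtain ⟨x, hx, -⟩ := E.isSheafFor_over a hT fam
    ((Presieve.compatible_iff_sieveCompatible _).2 hfam)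
  exact ⟨x, fun V l hl ↦ hx (Over.homMk l : Over.mk (l ≫ a) ⟶ Over.mk a) hl⟩

end Sec

section Glue

variable {X : C} {S : Sieve X}

/-- Modules over the members of a sieve, with gluing isomorphisms, expressed on sections. -/
structure GluingData (R : Sheaf J RingCat.{u}) (S : Sieve X) where
  E (i : S.arrows.category) : SheafOfModules.{u} (R.over i.obj.left)
  θ {Y : C} (i j : S.arrows.category) (a : Y ⟶ i.obj.left) (b : Y ⟶ j.obj.left)
    (h : a ≫ i.obj.hom = b ≫ j.obj.hom) : (E i).sec a →ₗ[R.obj.obj (op Y)] (E j).sec b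
  θ_self {Y : C} (i : S.arrows.category) (a : Y ⟶ i.obj.left) (x : (E i).sec a) :
    θ i i a a rfl x = x
  θ_θ {Y : C} (i j k : S.arrows.category) (a : Y ⟶ i.obj.left) (b : Y ⟶ j.obj.left)
    (c : Y ⟶ k.obj.left) (h : a ≫ i.obj.hom = b ≫ j.obj.hom) (h' : b ≫ j.obj.hom = c ≫ k.obj.hom)
    (x : (E i).sec a) : θ j k b c h' (θ i j a b h x) = θ i k a c (h.trans h') x
  θ_res {Y Y' : C} (g : Y' ⟶ Y) (i j : S.arrows.category) (a : Y ⟶ i.obj.left)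
    (b : Y ⟶ j.obj.left) (h : a ≫ i.obj.hom = b ≫ j.obj.hom) (a' : Y' ⟶ i.obj.left)
    (ha : g ≫ a = a') (b' : Y' ⟶ j.obj.left) (hb : g ≫ b = b') (x : (E i).sec a) :
    (E j).res g b b' hb (θ i j a b h x) = θ i j a' b' (by rw [← ha, ← hb]; simp [h])
      ((E i).res g a a' ha x)

namespace GluingData

variable (D : GluingData R S)

/-- The compatible families of sections over an object `T` over `X`. -/
def family (T : Over X) : AddSubgroup
    (∀ V : S.arrows.category, (V.obj ⟶ T) → (D.E V).sec (𝟙 V.obj.left)) where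
  carrier := {x | ∀ (V V' : S.arrows.category) (g : V'.obj ⟶ V.obj) (k : V.obj ⟶ T),
    D.θ V V' g.left (𝟙 _) (by simp) ((D.E V).res g.left (𝟙 _) g.left (by simp) (x V k)) =
      x V' (g ≫ k)}
  zero_mem' V V' g k := by simp
  add_mem' {x y} hx hy V V' g k := by
    have := hx V V' g k
    have := hy V V' g k
    simp_all
  neg_mem' {x} hx V V' g k := by
    have := hx V V' g k
    simp_all

lemma family_ext {T : Over X} {x y : D.family T} (h : ∀ V k, x.1 V k = y.1 V k) : x = y :=
  Subtype.ext (funext fun V ↦ funext fun k ↦ h V k)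

noncomputable instance (T : Over X) : Module (R.obj.obj (op T.left)) (D.family T) where
  smul r x := ⟨fun V k ↦ R.obj.map k.left.op r • x.1 V k, fun V V' g k ↦ by
    rw [res_smul, map_smul, x.2, ← CategoryTheory.comp_apply, ← Functor.map_comp]
    rfl⟩
  one_smul x := D.family_ext fun V k ↦ by
    change R.obj.map k.left.op 1 • x.1 V k = _
    rw [map_one, one_smul]
  mul_smul r s x := D.family_ext fun V k ↦ by
    change R.obj.map k.left.op (r * s) • x.1 V k =
      R.obj.map k.left.op r • R.obj.map k.left.op s • x.1 V k
    rw [map_mul, mul_smul]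
  smul_zero r := D.family_ext fun V k ↦ smul_zero (R.obj.map k.left.op r)
  smul_add r x y := D.family_ext fun V k ↦ smul_add (R.obj.map k.left.op r) _ _
  add_smul r s x := D.family_ext fun V k ↦ by
    change R.obj.map k.left.op (r + s) • x.1 V k =
      R.obj.map k.left.op r • x.1 V k + R.obj.map k.left.op s • x.1 V k
    rw [map_add, add_smul]
  zero_smul x := D.family_ext fun V k ↦ by
    change R.obj.map k.left.op 0 • x.1 V k = 0
    rw [map_zero, zero_smul]

/-- The presheaf of compatible families. -/
def presheaf : (Over X)ᵒᵖ ⥤ AddCommGrpCat.{u} where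
  obj T := AddCommGrpCat.of (D.family T.unop)
  map {T T'} l := AddCommGrpCat.ofHom
    { toFun x := ⟨fun V k ↦ x.1 V (k ≫ l.unop), fun V V' g k ↦ by
        rw [x.2]
        simp only [Category.assoc]⟩
      map_zero' := rfl
      map_add' _ _ := rfl }
  map_id T := AddCommGrpCat.hom_ext (AddMonoidHom.ext fun x ↦ D.family_ext fun V k ↦
    congr_arg (x.1 V) (Category.comp_id k))
  map_comp l l' := AddCommGrpCat.hom_ext (AddMonoidHom.ext fun x ↦ D.family_ext fun V k ↦
    congr_arg (x.1 V) (Category.assoc k _ _).symm)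

noncomputable instance (T : (Over X)ᵒᵖ) : Module ((R.over X).obj.obj T) (D.presheaf.obj T) :=
  inferInstanceAs (Module (R.obj.obj (op T.unop.left)) (D.family T.unop))

lemma presheaf_map_smul ⦃T T' : (Over X)ᵒᵖ⦄ (l : T ⟶ T') (r : (R.over X).obj.obj T)
    (x : D.presheaf.obj T) :
    D.presheaf.map l (r • x) = (R.over X).obj.map l r • D.presheaf.map l x :=
  D.family_ext fun V k ↦ by
    change R.obj.map (k ≫ l.unop).left.op r • x.1 V _ =
      R.obj.map k.left.op (R.obj.map l.unop.left.op r) • x.1 V _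
    exact congr_arg (· • x.1 V (k ≫ l.unop))
      (CategoryTheory.congr_fun (R.obj.map_comp l.unop.left.op k.left.op) r)

variable {D} in
-- The compatibility of a family, read in the opposite direction by means of the inverse gluing map.
lemma res_family {T : Over X} (x : D.family T) {V W : S.arrows.category} (g : W.obj ⟶ V.obj)
    (k : V.obj ⟶ T) : (D.E V).res g.left (𝟙 _) g.left (by simp) (x.1 V k) =
      D.θ W V (𝟙 _) g.left (by simp) (x.1 W (g ≫ k)) := by
  rw [← x.2, D.θ_θ, D.θ_self]

/-- The component of a family at `k : V ⟶ T` is a section of the sheaf `D.E V`. The covering sieve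
of `T` pulls back to a covering sieve of `V`, so the components can be glued, compared and
determined inside each `D.E V` separately. -/
lemma isSheaf_presheaf : Presheaf.IsSheaf (J.over X) D.presheaf := by
  rw [Presheaf.isSheaf_iff_isSheaf_forget _ _ (CategoryTheory.forget AddCommGrpCat.{u}),
    isSheaf_iff_isSheaf_of_type]
  intro T 𝒯 h𝒯 y hy
  rw [Presieve.compatible_iff_sieveCompatible] at hy
  let y' {T' : Over X} (f : T' ⟶ T) (hf : 𝒯 f) : D.family T' := y f hf
  have hy' {T' T'' : Over X} (f : T' ⟶ T) (hf : 𝒯 f) (g : T'' ⟶ T') (f' : T'' ⟶ T) (hf' : 𝒯 f')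
      (e : g ≫ f = f') (V : S.arrows.category) (k : V.obj ⟶ T'') :
      (y' f' hf').1 V k = (y' f hf).1 V (k ≫ g) := by
    subst e
    exact congr_arg (fun z : D.family T'' ↦ z.1 V k) (hy f g hf)
  have hcov (V : S.arrows.category) (k : V.obj ⟶ T) :
      Sieve.overEquiv V.obj (𝒯.pullback k) ∈ J V.obj.left :=
    (J.mem_over_iff _).1 ((J.over X).pullback_stable k h𝒯)
  let obj (V : S.arrows.category) {W : C} (l : W ⟶ V.obj.left) : S.arrows.category :=
    ⟨Over.mk (l ≫ V.obj.hom), S.downward_closed V.property l⟩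
  let π (V : S.arrows.category) {W : C} (l : W ⟶ V.obj.left) : (obj V l).obj ⟶ V.obj :=
    Over.homMk l
  have hmem {V : S.arrows.category} {k : V.obj ⟶ T} {W : C} {l : W ⟶ V.obj.left}
      (hl : Sieve.overEquiv V.obj (𝒯.pullback k) l) : 𝒯 (π V l ≫ k) :=
    (Sieve.overEquiv_iff _ _).1 hl
  -- The piece over `l : W ⟶ V` is the component at `W` of the given family along `π V l ≫ k`,
  -- carried from `D.E W` to `D.E V` by the gluing map. Agreement on overlaps is the compatibility
  -- of that family together with the cocycle relation of the gluing maps.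
  have hex (V : S.arrows.category) (k : V.obj ⟶ T) : ∃ x : (D.E V).sec (𝟙 V.obj.left),
      ∀ (W : C) (l : W ⟶ V.obj.left) (hl : Sieve.overEquiv V.obj (𝒯.pullback k) l),
        (D.E V).res l (𝟙 _) (l ≫ 𝟙 _) rfl x = D.θ (obj V l) V (𝟙 W) (l ≫ 𝟙 _) (by simp [obj])
          ((y' (π V l ≫ k) (hmem hl)).1 (obj V l) (𝟙 _)) := by
    refine exists_glue (D.E V) (hcov V k)
      (fun W l hl a' h ↦ D.θ (obj V l) V (𝟙 W) a' (by simp [← h, obj])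
        ((y' (π V l ≫ k) (hmem hl)).1 (obj V l) (𝟙 _))) ?_
    rintro W W' l hl g a' rfl a'' rfl
    let γ : (obj V (g ≫ l)).obj ⟶ (obj V l).obj := Over.homMk g (by simp [obj])
    rw [D.θ_res g _ _ _ _ _ g (by simp [obj]) _ rfl]
    have h₁ := hy' (π V l ≫ k) (hmem hl) γ (π V (g ≫ l) ≫ k) (hmem (Sieve.downward_closed _ hl g))
      (by ext; simp [π, γ]) (obj V (g ≫ l)) (𝟙 _)
    have h₂ : 𝟙 _ ≫ γ = γ ≫ 𝟙 _ := by simp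
    rw [h₁, h₂]
    exact (congr_arg _ (res_family (y' (π V l ≫ k) (hmem hl)) γ (𝟙 _))).trans (D.θ_θ _ _ _ _ _ _ _ _ _)
  choose x hx using hex
  -- The characterization of `x` extends from the objects `obj V l` to all `W` over `V`: the
  -- structure map of `W` over `X` is determined by that over `V`.
  have hx' (V W : S.arrows.category) (g : W.obj ⟶ V.obj) (k : V.obj ⟶ T) (hg : 𝒯 (g ≫ k)) :
      (D.E V).res g.left (𝟙 _) g.left (by simp) (x V k) =
        D.θ W V (𝟙 _) g.left (by simp) ((y' (g ≫ k) hg).1 W (𝟙 _)) := by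
    have (Y : C) (w : Y ⟶ X) (hw : S w) (l : Y ⟶ V.obj.left) (e : l ≫ V.obj.hom = w)
        (l' : Y ⟶ V.obj.left) (hl' : l ≫ 𝟙 _ = l')
        (hg : 𝒯 ((Over.homMk l e : Over.mk w ⟶ V.obj) ≫ k)) :
        (D.E V).res l (𝟙 _) l' hl' (x V k) =
          D.θ ⟨Over.mk w, hw⟩ V (𝟙 _) l' (by simp [← hl', e])
            ((y' _ hg).1 ⟨Over.mk w, hw⟩ (𝟙 _)) := by
      subst e hl'
      exact hx V k Y l ((Sieve.overEquiv_iff _ _).2 hg)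
    exact this _ W.obj.hom W.property g.left (Over.w g) g.left (by simp) hg
  have hext (V : S.arrows.category) (k : V.obj ⟶ T) {a b : (D.E V).sec (𝟙 V.obj.left)}
      (h : ∀ (W : S.arrows.category) (g : W.obj ⟶ V.obj), 𝒯 (g ≫ k) →
        (D.E V).res g.left (𝟙 _) g.left (by simp) a =
          (D.E V).res g.left (𝟙 _) g.left (by simp) b) : a = b := by
    refine sec_ext (hcov V k) fun W l hl ↦ ?_
    have (l' : W ⟶ V.obj.left) (h' : l ≫ 𝟙 _ = l') :
        (D.E V).res l (𝟙 _) l' h' a = (D.E V).res l (𝟙 _) l' h' b := by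
      obtain rfl : l = l' := by rw [← h', Category.comp_id]
      exact h (obj V l) (π V l) (hmem hl)
    exact this _ rfl
  -- Compatibility of the glued components is checked after restriction to the covering sieve, where
  -- both sides become the same component of the given families.
  let z : D.family T := ⟨x, fun V V' g k ↦ by
    refine hext V' (g ≫ k) fun W l hl ↦ ?_
    rw [hx' V' W l (g ≫ k) hl, D.θ_res _ _ _ _ _ _ (l.left ≫ g.left) rfl l.left (by simp),
      res_res, ← D.θ_θ W V V' (𝟙 _) (l.left ≫ g.left) l.left (by simp) (by simp)]
    refine congr_arg _ ((hx' V W (l ≫ g) k (by simpa using hl)).trans (congr_arg _ ?_))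
    have {f f' : W.obj ⟶ T} (hf : 𝒯 f) (hf' : 𝒯 f') (e : f = f') :
        (y' f hf).1 W (𝟙 _) = (y' f' hf').1 W (𝟙 _) := by
      subst e
      rfl
    exact this _ _ (Category.assoc _ _ _)⟩
  refine ⟨z, fun T' f hf ↦ D.family_ext fun V k ↦ ?_, fun z' hz' ↦ D.family_ext fun V k ↦ ?_⟩
  · refine hext V (k ≫ f) fun W l hl ↦ ?_
    refine (hx' V W l (k ≫ f) hl).trans ?_
    refine Eq.trans (congr_arg _ ?_) (res_family (y' f hf) l k).symm
    refine (hy' f hf (l ≫ k) _ hl (by simp) _ _).trans ?_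
    rw [Category.id_comp]
  · refine hext V k fun W l hl ↦ ?_
    refine (res_family (show D.family T from z') l k).trans (Eq.trans (congr_arg _ ?_)
      (hx' V W l k hl).symm)
    refine Eq.trans ?_ (congr_arg (fun w : D.family _ ↦ w.1 W (𝟙 _)) (hz' (l ≫ k) hl))
    exact congr_arg ((show D.family T from z').1 W) (Category.id_comp _).symm

/-- The module glued from the data. -/
noncomputable def glue : SheafOfModules.{u} (R.over X) where
  val := PresheafOfModules.ofPresheaf D.presheaf D.presheaf_map_smul
  isSheaf := D.isSheaf_presheaf

end GluingData

end Glue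

end SheafOfModules

namespace SheafOfModules

variable {C : Type u} [SmallCategory C] {J : GrothendieckTopology C} {R : Sheaf J RingCat.{u}}

namespace GluingData

variable {X : C} {S : Sieve X} (D : GluingData R S)

/-- The index of the restriction of the member `i` of the sieve along `a`. -/
abbrev restrictIndex (i : S.arrows.category) {Y : C} (a : Y ⟶ i.obj.left) : S.arrows.category :=
  ⟨Over.mk (a ≫ i.obj.hom), S.downward_closed i.property a⟩

/-- The restriction of the glued module to a member of the sieve. -/
noncomputable def glueHom (i : S.arrows.category) : (overMap R i.obj.hom).obj D.glue ⟶ D.E i :=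
  homMk (fun {Y} a ↦
    { toFun := fun (x : D.family (Over.mk (a ≫ i.obj.hom))) ↦
        D.θ (restrictIndex i a) i (𝟙 Y) a (by simp) (x.1 (restrictIndex i a) (𝟙 _))
      map_add' := fun (x y : D.family (Over.mk (a ≫ i.obj.hom))) ↦ map_add (D.θ _ _ _ _ _) _ _
      map_smul' := fun r (x : D.family (Over.mk (a ≫ i.obj.hom))) ↦ by
        refine (congr_arg _ ?_).trans (map_smul (D.θ _ _ _ _ _) r _)
        exact congr_arg (· • x.1 (restrictIndex i a) (𝟙 _))
          (CategoryTheory.congr_fun (R.obj.map_id (op Y)) r) })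
    (by
      rintro Y Y' g a a' rfl (x : D.family (Over.mk (a ≫ i.obj.hom)))
      refine Eq.trans ?_ (D.θ_res g _ _ _ _ _ g (by simp) _ rfl _).symm
      let γ : (restrictIndex i (g ≫ a)).obj ⟶ (restrictIndex i a).obj := Over.homMk g
      refine Eq.trans ?_ (congr_arg _ (res_family x γ (𝟙 _))).symm
      refine Eq.trans ?_ (D.θ_θ _ _ _ _ _ _ _ _ _).symm
      refine congr_arg (D.θ _ _ _ _ _) (congr_arg (x.1 _) ?_)
      exact (Category.id_comp _).trans (Category.comp_id γ).symm)

lemma secMap_glueHom (i : S.arrows.category) {Y : C} (a : Y ⟶ i.obj.left)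
    (x : D.family (Over.mk (a ≫ i.obj.hom))) : secMap (D.glueHom i) a x =
      D.θ (restrictIndex i a) i (𝟙 Y) a (by simp) (x.1 (restrictIndex i a) (𝟙 _)) := rfl

/-- Over an object of the sieve a compatible family is determined by its component at the identity;
conversely a section `y` of `D.E i` spreads to a family by restricting it and applying the gluing
maps. -/
lemma secMap_glueHom_bijective (i : S.arrows.category) {Y : C} (a : Y ⟶ i.obj.left) :
    Function.Bijective (secMap (D.glueHom i) a) := by
  constructor
  · intro (x : D.family (Over.mk (a ≫ i.obj.hom))) (y : D.family (Over.mk (a ≫ i.obj.hom))) h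
    have h' : x.1 (restrictIndex i a) (𝟙 _) = y.1 (restrictIndex i a) (𝟙 _) := by
      have := congr_arg (D.θ i (restrictIndex i a) a (𝟙 Y) (by simp)) h
      rw [secMap_glueHom, secMap_glueHom] at this
      simpa only [D.θ_θ, D.θ_self] using this
    refine D.family_ext fun V k ↦ ?_
    have h₁ := x.2 (restrictIndex i a) V k (𝟙 _)
    have h₂ := y.2 (restrictIndex i a) V k (𝟙 _)
    rw [Category.comp_id] at h₁ h₂
    rw [← h₁, ← h₂, h']
  · intro y
    refine ⟨(⟨fun V k ↦ D.θ i V (k.left ≫ a) (𝟙 _) (by simpa using Over.w k)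
      ((D.E i).res k.left a _ rfl y), fun V V' g k ↦ ?_⟩ : D.family (Over.mk (a ≫ i.obj.hom))), ?_⟩
    · rw [D.θ_res g.left _ _ _ _ _ ((g ≫ k).left ≫ a) (by simp) g.left (by simp), D.θ_θ, res_res]
      rfl
    · refine (D.θ_θ _ _ _ _ _ _ _ _ _).trans ?_
      have h : D.θ i i (𝟙 Y ≫ a) a (by simp) ((D.E i).res (𝟙 Y) a (𝟙 Y ≫ a) rfl y) = y := by
        rw [← D.θ_res (𝟙 Y) i i a a rfl _ rfl a (by simp), res_id, D.θ_self]
      exact h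

/-- This is what makes the identifications of the glued module with the members `D.E i` a morphism
of descent data. -/
lemma θ_glueHom {Y : C} (i j : S.arrows.category) (a : Y ⟶ i.obj.left) (b : Y ⟶ j.obj.left)
    (h : a ≫ i.obj.hom = b ≫ j.obj.hom) (x : D.glue.sec (a ≫ i.obj.hom)) :
    D.θ i j a b h (secMap (D.glueHom i) a x) =
      secMap (D.glueHom j) b (D.glue.res (𝟙 Y) _ _ ((Category.id_comp _).trans h) x) := by
  change D.family (Over.mk (a ≫ i.obj.hom)) at x
  refine (D.θ_θ _ _ _ _ _ _ _ _ _).trans ?_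
  let γ : (restrictIndex j b).obj ⟶ (restrictIndex i a).obj := Over.homMk (𝟙 Y) (by simp [h])
  have h₁ := x.2 (restrictIndex i a) (restrictIndex j b) γ (𝟙 _)
  refine Eq.trans ?_ (congr_arg (D.θ (restrictIndex j b) j (𝟙 Y) b (by simp)) (h₁.trans
    (congr_arg (x.1 _) ((Category.comp_id γ).trans (Category.id_comp γ).symm))))
  refine Eq.trans ?_ (D.θ_θ _ _ _ _ _ _ _ _ _).symm
  exact congr_arg (D.θ _ _ _ _ _) ((D.E _).res_id _ _).symm

end GluingData

lemma bijective_secMap_of_isIso {X : C} {E E' : SheafOfModules.{u} (R.over X)} (φ : E ⟶ E')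
    [IsIso φ] {Y : C} (a : Y ⟶ X) : Function.Bijective (secMap φ a) :=
  Function.bijective_iff_has_inverse.2 ⟨secMap (inv φ) a,
    fun x ↦ by rw [← secMap_comp, IsIso.hom_inv_id, secMap_id],
    fun x ↦ by rw [← secMap_comp, IsIso.inv_hom_id, secMap_id]⟩

/-! ### Properties of modules and morphisms that can be checked on a covering sieve -/

section Local

variable {X : C} {S : Sieve X} (hS : S ∈ J X) {E E' : SheafOfModules.{u} (R.over X)}

include hS

lemma hom_ext_of_mem {φ ψ : E ⟶ E'} (h : ∀ (Y : C) (a : Y ⟶ X) (_ : S a) (x : E.sec a),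
    secMap φ a x = secMap ψ a x) : φ = ψ :=
  hom_ext_secMap fun Y a x ↦ sec_ext (J.pullback_stable a hS) fun V l hl ↦ by
    rw [← secMap_res, ← secMap_res, h _ _ hl]

/-- For an arbitrary `a : Y ⟶ X` the pullback of `S` covers `Y`, and the values of `φ` on the
restrictions of a section glue to its image. Linearity and naturality follow from the uniqueness of
gluing. -/
lemma exists_hom_of_mem (φ : ∀ {Y : C} (a : Y ⟶ X), S a → (E.sec a →ₗ[R.obj.obj (op Y)] E'.sec a))
    (hφ : ∀ {Y Y' : C} (g : Y' ⟶ Y) (a : Y ⟶ X) (ha : S a) (a' : Y' ⟶ X) (h : g ≫ a = a')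
      (x : E.sec a), φ a' (h ▸ S.downward_closed ha g) (E.res g a a' h x) =
        E'.res g a a' h (φ a ha x)) :
    ∃ ψ : E ⟶ E', ∀ (Y : C) (a : Y ⟶ X) (ha : S a) (x : E.sec a), secMap ψ a x = φ a ha x := by
  have (Y : C) (a : Y ⟶ X) (x : E.sec a) : ∃ y : E'.sec a, ∀ (V : C) (l : V ⟶ Y) (hl : S (l ≫ a)),
      E'.res l a _ rfl y = φ (l ≫ a) hl (E.res l a _ rfl x) := by
    refine exists_glue E' (J.pullback_stable a hS)
      (fun V l (hl : S (l ≫ a)) a' h ↦ φ a' (h ▸ hl) (E.res l a a' h x)) ?_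
    rintro V V' l hl g a' rfl a'' rfl
    rw [← hφ g (l ≫ a) hl _ rfl, res_res]
  choose ψ hψ using this
  replace hψ {Y V : C} (a : Y ⟶ X) (x : E.sec a) (l : V ⟶ Y) (a' : V ⟶ X) (h : l ≫ a = a')
      (ha' : S a') : E'.res l a a' h (ψ Y a x) = φ a' ha' (E.res l a a' h x) := by
    subst h
    exact hψ Y a x V l ha'
  have hext (Y : C) (a : Y ⟶ X) {y y' : E'.sec a} (h : ∀ (V : C) (l : V ⟶ Y) (hl : S (l ≫ a)),
      E'.res l a _ rfl y = E'.res l a _ rfl y') : y = y' :=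
    sec_ext (J.pullback_stable a hS) h
  refine ⟨homMk (fun {Y} a ↦
    { toFun := ψ Y a
      map_add' x y := hext Y a fun V l hl ↦ by
        simp only [map_add, hψ _ _ _ _ _ hl]
      map_smul' r x := hext Y a fun V l hl ↦ by
        rw [hψ _ _ _ _ _ hl, RingHom.id_apply, res_smul, res_smul, hψ _ _ _ _ _ hl]
        exact map_smul (φ (l ≫ a) hl) _ _ }) ?_, fun Y a ha x ↦ ?_⟩
  · rintro Y Y' g a a' rfl x
    refine hext _ _ fun V l hl ↦ ?_
    refine (hψ (g ≫ a) _ l _ rfl hl).trans (Eq.trans ?_ (res_res E' g l a _ _ rfl rfl _).symm)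
    exact (congr_arg (φ _ hl) (res_res E g l a _ _ rfl rfl x)).trans
      (hψ a x (l ≫ g) _ (by simp) hl).symm
  · refine hext _ _ fun V l hl ↦ ?_
    exact (hψ a _ l _ rfl hl).trans (hφ l a ha _ rfl x)

/-- The inverses over the members of the sieve commute with restriction, so they glue to a global
inverse. -/
lemma isIso_of_bijective_of_mem (φ : E ⟶ E')
    (h : ∀ (Y : C) (a : Y ⟶ X), S a → Function.Bijective (secMap φ a)) : IsIso φ := by
  let e {Y : C} (a : Y ⟶ X) (ha : S a) : E.sec a ≃ₗ[R.obj.obj (op Y)] E'.sec a :=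
    LinearEquiv.ofBijective (secMap φ a) (h Y a ha)
  obtain ⟨ψ, hψ⟩ := exists_hom_of_mem hS (E := E') (E' := E)
    (fun a ha ↦ (e a ha).symm.toLinearMap) (fun g a ha a' h x ↦ by
      obtain ⟨y, rfl⟩ := (e a ha).surjective x
      have h₁ : e a ha y = secMap φ a y := rfl
      have h₂ : E'.res g a a' h (secMap φ a y) =
          e a' (h ▸ S.downward_closed ha g) (E.res g a a' h y) := (secMap_res φ g a a' h y).symm
      rw [h₁, h₂, ← h₁]
      simp)
  refine ⟨ψ, hom_ext_of_mem hS fun Y a ha x ↦ ?_, hom_ext_of_mem hS fun Y a ha x ↦ ?_⟩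
  · rw [secMap_comp, hψ Y a ha]
    exact (e a ha).symm_apply_apply x
  · rw [secMap_comp, hψ Y a ha]
    exact (e a ha).apply_symm_apply x

lemma isIso_of_isIso_overMap (φ : E ⟶ E') (h : ∀ (Y : C) (a : Y ⟶ X), S a →
    IsIso ((overMap R a).map φ)) : IsIso φ :=
  isIso_of_bijective_of_mem hS φ fun Y a ha ↦ by
    have := h Y a ha
    have h₁ := bijective_secMap_of_isIso ((overMap R a).map φ) (𝟙 Y)
    have h₂ (a' : Y ⟶ X) (h : 𝟙 Y ≫ a = a') (h' : Function.Bijective (secMap φ (𝟙 Y ≫ a))) :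
        Function.Bijective (secMap φ a') := h ▸ h'
    exact h₂ a (Category.id_comp a) h₁

lemma hom_ext_of_overMap {φ ψ : E ⟶ E'} (h : ∀ (Y : C) (a : Y ⟶ X), S a →
    (overMap R a).map φ = (overMap R a).map ψ) : φ = ψ :=
  hom_ext_of_mem hS fun Y a ha x ↦ by
    have h₁ (x : E.sec (𝟙 Y ≫ a)) : secMap φ (𝟙 Y ≫ a) x = secMap ψ (𝟙 Y ≫ a) x :=
      congr_arg (fun f ↦ secMap f (𝟙 Y) x) (h Y a ha)
    have h₂ (a' : Y ⟶ X) (h : 𝟙 Y ≫ a = a') (x : E.sec a') : secMap φ a' x = secMap ψ a' x := by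
      subst h
      exact h₁ x
    exact h₂ a (Category.id_comp a) x

/-- Restriction preserves pullbacks, so the comparison morphism to the actual pullback restricts to
isomorphisms on a cover, and is therefore an isomorphism. -/
lemma isPullback_of_overMap {P A B G : SheafOfModules.{u} (R.over X)} {fst : P ⟶ A} {snd : P ⟶ B}
    {f : A ⟶ G} {g : B ⟶ G} (h : ∀ (Y : C) (a : Y ⟶ X), S a →
      IsPullback ((overMap R a).map fst) ((overMap R a).map snd)
        ((overMap R a).map f) ((overMap R a).map g)) : IsPullback fst snd f g := by
  have w : fst ≫ f = snd ≫ g := hom_ext_of_overMap hS fun Y a ha ↦ by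
    rw [Functor.map_comp, Functor.map_comp, (h Y a ha).w]
  have : IsIso (pullback.lift fst snd w) := isIso_of_isIso_overMap hS _ fun Y a ha ↦ by
    have h₁ := (IsPullback.of_hasPullback f g).map (overMap R a)
    have h₂ : (overMap R a).map (pullback.lift fst snd w) =
        ((h Y a ha).isoIsPullback _ _ h₁).hom := h₁.hom_ext
      (by rw [← Functor.map_comp, pullback.lift_fst, IsPullback.isoIsPullback_hom_fst])
      (by rw [← Functor.map_comp, pullback.lift_snd, IsPullback.isoIsPullback_hom_snd])
    rw [h₂]
    infer_instance
  exact IsPullback.of_iso_pullback ⟨w⟩ (asIso (pullback.lift fst snd w)) (pullback.lift_fst _ _ _)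
    (pullback.lift_snd _ _ _)

/-- Dual to the case of pullbacks; it uses that restriction is also right exact. -/
lemma isPushout_of_overMap {P A B G : SheafOfModules.{u} (R.over X)} {f : G ⟶ A} {g : G ⟶ B}
    {inl : A ⟶ P} {inr : B ⟶ P} (h : ∀ (Y : C) (a : Y ⟶ X), S a →
      IsPushout ((overMap R a).map f) ((overMap R a).map g)
        ((overMap R a).map inl) ((overMap R a).map inr)) : IsPushout f g inl inr := by
  have w : f ≫ inl = g ≫ inr := hom_ext_of_overMap hS fun Y a ha ↦ by
    rw [Functor.map_comp, Functor.map_comp, (h Y a ha).w]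
  have : IsIso (pushout.desc inl inr w) := isIso_of_isIso_overMap hS _ fun Y a ha ↦ by
    have h₁ := (IsPushout.of_hasPushout f g).map (overMap R a)
    have h₂ : (overMap R a).map (pushout.desc inl inr w) =
        (h₁.isoIsPushout _ _ (h Y a ha)).hom := h₁.hom_ext
      (by rw [← Functor.map_comp, pushout.inl_desc, IsPushout.inl_isoIsPushout_hom])
      (by rw [← Functor.map_comp, pushout.inr_desc, IsPushout.inr_isoIsPushout_hom])
    rw [h₂]
    infer_instance
  exact IsPushout.of_iso_pushout ⟨w⟩ (asIso (pushout.desc inl inr w)).symm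
    ((IsIso.comp_inv_eq _).2 (pushout.inl_desc _ _ _).symm)
    ((IsIso.comp_inv_eq _).2 (pushout.inr_desc _ _ _).symm)

lemma bicartesianSq_of_overMap {P A B G : SheafOfModules.{u} (R.over X)} {fst : P ⟶ A}
    {snd : P ⟶ B} {f : A ⟶ G} {g : B ⟶ G} (h : ∀ (Y : C) (a : Y ⟶ X), S a →
      BicartesianSq ((overMap R a).map fst) ((overMap R a).map snd)
        ((overMap R a).map f) ((overMap R a).map g)) : BicartesianSq fst snd f g :=
  .of_isPullback_isPushout
    (isPullback_of_overMap hS fun Y a ha ↦ (h Y a ha).toIsPullback)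
    (isPushout_of_overMap hS fun Y a ha ↦ (h Y a ha).toIsPushout)

end Local

end SheafOfModules

/-! ### Descent for diagram completions -/

namespace SheafOfModules

open CategoryTheory.Pseudofunctor CategoryTheory.Pseudofunctor.LocallyDiscreteOpToCat

variable {C : Type u} [SmallCategory C] {J : GrothendieckTopology C} {R : Sheaf J RingCat.{u}}
  {M N : SheafOfModules.{u} R} {f : M ⟶ N}

lemma res_id_smul {X Y : C} (E : SheafOfModules.{u} (R.over X)) (a a' : Y ⟶ X) (h : 𝟙 Y ≫ a = a')
    (r : R.obj.obj (op Y)) (x : E.sec a) : E.res (𝟙 Y) a a' h (r • x) = r • E.res (𝟙 Y) a a' h x :=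
  (res_smul E _ _ _ _ _ _).trans
    (congr_arg (· • E.res (𝟙 Y) a a' h x) (CategoryTheory.congr_fun (R.obj.map_id (op Y)) r))

lemma res_eq_self {X Y : C} (E : SheafOfModules.{u} (R.over X)) (k : Y ⟶ Y) (hk : k = 𝟙 Y)
    (a : Y ⟶ X) (h : k ≫ a = a) (x : E.sec a) : E.res k a a h x = x := by
  subst hk
  exact E.res_id a x

/-- The coherence isomorphisms of the pseudofunctor act on sections as restrictions along
identities. They relate structure maps which are equal but written differently, and they cancel. -/
lemma res_secMap_res {X₁ X₂ Y T : C} {E : SheafOfModules.{u} (R.over X₁)}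
    {F : SheafOfModules.{u} (R.over X₂)} {a : Y ⟶ X₁} {b : Y ⟶ X₂}
    (φ : (overMap R a).obj E ⟶ (overMap R b).obj F) {c c' : T ⟶ Y} (hc : c' = c) {a' : T ⟶ X₁}
    (ha : 𝟙 T ≫ c ≫ a = a') (ha' : 𝟙 T ≫ a' = c' ≫ a) {b' : T ⟶ X₂} (hb : 𝟙 T ≫ c' ≫ b = b')
    (hb' : 𝟙 T ≫ b' = c ≫ b) (x : E.sec (c ≫ a)) :
    F.res (𝟙 T) b' (c ≫ b) hb' (F.res (𝟙 T) (c' ≫ b) b' hb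
      (secMap φ c' (E.res (𝟙 T) a' (c' ≫ a) ha' (E.res (𝟙 T) (c ≫ a) a' ha x)))) =
        secMap φ c x := by
  rw [Category.id_comp] at ha hb
  subst hc ha hb
  rw [res_id, res_id]
  exact (res_id F _ _).trans (congr_arg (secMap φ c') (res_id E _ _))

lemma res_congr {X Y Y' : C} (E : SheafOfModules.{u} (R.over X)) {g g' : Y' ⟶ Y} (h : g = g')
    {a : Y ⟶ X} {a' : Y' ⟶ X} (hg : g ≫ a = a') (x : E.sec a) :
    E.res g a a' hg x = E.res g' a a' (h ▸ hg) x := by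
  subst h
  rfl

lemma res_res_secMap {X₁ X₂ Y T : C} {E : SheafOfModules.{u} (R.over X₁)}
    {F : SheafOfModules.{u} (R.over X₂)} {a : Y ⟶ X₁} {b : Y ⟶ X₂}
    (φ : (overMap R a).obj E ⟶ (overMap R b).obj F) (g : T ⟶ Y) (x : E.sec a) :
    F.res g b (g ≫ b) rfl (F.res (𝟙 Y) (𝟙 Y ≫ b) b (by simp)
      (secMap φ (𝟙 Y) (E.res (𝟙 Y) a (𝟙 Y ≫ a) rfl x))) =
        secMap φ g (E.res g a (g ≫ a) rfl x) := by
  have h := secMap_res φ g (𝟙 Y) g (by simp) (E.res (𝟙 Y) a (𝟙 Y ≫ a) rfl x)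
  refine (F.res_res _ _ _ _ _ _ _ _).trans ((F.res_congr (by simp) _ _).trans
    (h.symm.trans (congr_arg (secMap φ g) ?_)))
  exact (E.res_res (𝟙 Y) g a (𝟙 Y ≫ a) (g ≫ a) rfl (by simp) x).trans
    (E.res_congr (Category.comp_id g) (by simp) x)

namespace DiagramCompletion

/-- The underlying morphism of modules. -/
abbrev homφ {U : C} {X Y : (completions f).obj ⟨op U⟩} (a : X ⟶ Y) :
    DiagramCompletion.E (show DiagramCompletion f U from X) ⟶
      DiagramCompletion.E (show DiagramCompletion f U from Y) :=
  DiagramCompletion.Hom.φ (X := (show DiagramCompletion f U from X))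
    (Y := (show DiagramCompletion f U from Y)) a

lemma homφ_pullHom {X₁ X₂ : C} {M₁ : DiagramCompletion f X₁} {M₂ : DiagramCompletion f X₂}
    {Y Y' : C} {f₁ : Y ⟶ X₁} {f₂ : Y ⟶ X₂}
    (φ : ((completions f).map f₁.op.toLoc).toFunctor.obj M₁ ⟶
      ((completions f).map f₂.op.toLoc).toFunctor.obj M₂) (g : Y' ⟶ Y) :
    homφ (U := Y') (pullHom φ g (g ≫ f₁) (g ≫ f₂) rfl rfl) = (overMapComp R g f₁).hom.app M₁.E ≫
      (overMap R g).map (homφ (U := Y) φ) ≫ (overMapComp R g f₂).inv.app M₂.E := by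
  have h₁ := (completions f).mapComp'_eq_mapComp f₁.op.toLoc g.op.toLoc
  have h₂ := (completions f).mapComp'_eq_mapComp f₂.op.toLoc g.op.toLoc
  have h : pullHom φ g (g ≫ f₁) (g ≫ f₂) rfl rfl =
      ((completions f).mapComp f₁.op.toLoc g.op.toLoc).hom.toNatTrans.app M₁ ≫
        ((completions f).map g.op.toLoc).toFunctor.map φ ≫
          ((completions f).mapComp f₂.op.toLoc g.op.toLoc).inv.toNatTrans.app M₂ := by
    rw [← h₁, ← h₂]
    rfl
  rw [h]
  rfl

lemma secMap_pullHom {X₁ X₂ : C} {M₁ : DiagramCompletion f X₁} {M₂ : DiagramCompletion f X₂}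
    {Y Y' : C} {f₁ : Y ⟶ X₁} {f₂ : Y ⟶ X₂}
    (φ : ((completions f).map f₁.op.toLoc).toFunctor.obj M₁ ⟶
      ((completions f).map f₂.op.toLoc).toFunctor.obj M₂)
    (ψ : (overMap R f₁).obj M₁.E ⟶ (overMap R f₂).obj M₂.E) (hψ : ψ = homφ (U := Y) φ)
    (g : Y' ⟶ Y) (gf₁ : Y' ⟶ X₁) (gf₂ : Y' ⟶ X₂) (h₁ : g ≫ f₁ = gf₁) (h₂ : g ≫ f₂ = gf₂)
    (ψ' : (overMap R gf₁).obj M₁.E ⟶ (overMap R gf₂).obj M₂.E)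
    (hψ' : ψ' = homφ (U := Y') (pullHom φ g gf₁ gf₂ h₁ h₂))
    {T : C} (a : T ⟶ Y') (x : M₁.E.sec (a ≫ gf₁)) :
    secMap ψ' a x = M₂.E.res (𝟙 T) ((a ≫ g) ≫ f₂) (a ≫ gf₂) (by simp [← h₂]) (secMap ψ (a ≫ g)
        (M₁.E.res (𝟙 T) (a ≫ gf₁) ((a ≫ g) ≫ f₁) (by simp [← h₁]) x)) := by
  subst h₁ h₂
  have h : ψ' = (overMapComp R g f₁).hom.app M₁.E ≫ (overMap R g).map ψ ≫
      (overMapComp R g f₂).inv.app M₂.E := by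
    rw [hψ', hψ]
    exact homφ_pullHom φ g
  rw [h]
  rfl

section Descent

variable {X : C} {S : Sieve X}
  (D : (completions f).DescentData (fun i : S.arrows.category ↦ i.obj.hom))

/-- A member of a descent datum. -/
abbrev descentObj (i : S.arrows.category) : DiagramCompletion f i.obj.left := D.obj i

/-- The gluing morphisms of a descent datum. -/
def descentHom {Y : C} {i j : S.arrows.category} {q : Y ⟶ X} {a : Y ⟶ i.obj.left}
    {b : Y ⟶ j.obj.left} (ha : a ≫ i.obj.hom = q) (hb : b ≫ j.obj.hom = q) :
    (restrict a).obj (descentObj D i) ⟶ (restrict b).obj (descentObj D j) :=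
  D.hom q a b ha hb

lemma secMap_descentHom_res {T Y : C} {i j : S.arrows.category} {q : Y ⟶ X} {a : Y ⟶ i.obj.left}
    {b : Y ⟶ j.obj.left} (ha : a ≫ i.obj.hom = q) (hb : b ≫ j.obj.hom = q) (g : T ⟶ Y)
    {q' : T ⟶ X} {a' : T ⟶ i.obj.left} {b' : T ⟶ j.obj.left} (ha' : a' ≫ i.obj.hom = q')
    (hb' : b' ≫ j.obj.hom = q') (hq : g ≫ q = q') (hga : g ≫ a = a') (hgb : g ≫ b = b')
    {W : C} (c : W ⟶ T) (x : (descentObj D i).E.sec (c ≫ a')) :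
    secMap (descentHom D ha' hb').φ c x = (descentObj D j).E.res (𝟙 W) ((c ≫ g) ≫ b) (c ≫ b')
      (by simp [← hgb]) (secMap (descentHom D ha hb).φ (c ≫ g)
        ((descentObj D i).E.res (𝟙 W) (c ≫ a') ((c ≫ g) ≫ a) (by simp [← hga]) x)) := by
  refine secMap_pullHom (D.hom q a b ha hb) (descentHom D ha hb).φ rfl g a' b' hga hgb
    (descentHom D ha' hb').φ ?_ c x
  rw [D.pullHom_hom g q q' hq a b ha hb a' b' hga hgb]
  rfl

/-- The gluing morphisms of a descent datum, on sections. -/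
noncomputable def descentθ {Y : C} (i j : S.arrows.category) (a : Y ⟶ i.obj.left)
    (b : Y ⟶ j.obj.left) (h : a ≫ i.obj.hom = b ≫ j.obj.hom) :
    (descentObj D i).E.sec a →ₗ[R.obj.obj (op Y)] (descentObj D j).E.sec b where
  toFun x := (descentObj D j).E.res (𝟙 Y) (𝟙 Y ≫ b) b (by simp)
    (secMap (descentHom D rfl h.symm).φ (𝟙 Y) ((descentObj D i).E.res (𝟙 Y) a (𝟙 Y ≫ a) rfl x))
  map_add' x y := by
    rw [map_add]
    exact (congr_arg _ (map_add (secMap (descentHom D rfl h.symm).φ (𝟙 Y)) _ _)).trans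
      (map_add _ _ _)
  map_smul' r x := by
    rw [res_id_smul]
    exact (congr_arg _ (map_smul (secMap (descentHom D rfl h.symm).φ (𝟙 Y)) r _)).trans
      (res_id_smul _ _ _ _ _ _)

/-- Thus a gluing morphism acts on sections over `c` in a way depending only on the composites `c ≫
a` and `c ≫ b`, and the descent datum is encoded by the maps `descentθ`. -/
lemma secMap_descentHom {T Y : C} {i j : S.arrows.category} {q : Y ⟶ X} {a : Y ⟶ i.obj.left}
    {b : Y ⟶ j.obj.left} (ha : a ≫ i.obj.hom = q) (hb : b ≫ j.obj.hom = q) (c : T ⟶ Y)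
    (x : (descentObj D i).E.sec (c ≫ a)) : secMap (descentHom D ha hb).φ c x =
      descentθ D i j (c ≫ a) (c ≫ b) (by simp [ha, hb]) x := by
  have h := secMap_descentHom_res D ha hb c (q' := (c ≫ a) ≫ i.obj.hom) rfl (by simp [ha, hb])
    (by simp [ha]) rfl rfl (𝟙 T) ((descentObj D i).E.res (𝟙 T) (c ≫ a) (𝟙 T ≫ c ≫ a) rfl x)
  exact Eq.symm ((congr_arg _ h).trans
    (res_secMap_res (descentHom D ha hb).φ (Category.id_comp c) _ _ _ _ x))

lemma descentHom_self {Y : C} {i : S.arrows.category} {q : Y ⟶ X} {a : Y ⟶ i.obj.left}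
    (ha : a ≫ i.obj.hom = q) : descentHom D ha ha = 𝟙 _ := D.hom_self q a ha

lemma descentHom_comp {Y : C} {i j k : S.arrows.category} {q : Y ⟶ X} {a : Y ⟶ i.obj.left}
    {b : Y ⟶ j.obj.left} {c : Y ⟶ k.obj.left} (ha : a ≫ i.obj.hom = q) (hb : b ≫ j.obj.hom = q)
    (hc : c ≫ k.obj.hom = q) : descentHom D ha hb ≫ descentHom D hb hc = descentHom D ha hc :=
  D.hom_comp q a b c ha hb hc

lemma descentθ_apply {Y : C} {i j : S.arrows.category} {q : Y ⟶ X} {a : Y ⟶ i.obj.left}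
    {b : Y ⟶ j.obj.left} (ha : a ≫ i.obj.hom = q) (hb : b ≫ j.obj.hom = q)
    (x : (descentObj D i).E.sec a) : descentθ D i j a b (ha.trans hb.symm) x =
      (descentObj D j).E.res (𝟙 Y) (𝟙 Y ≫ b) b (by simp)
        (secMap (descentHom D ha hb).φ (𝟙 Y) ((descentObj D i).E.res (𝟙 Y) a (𝟙 Y ≫ a) rfl x)) := by
  subst ha
  rfl

/-- A descent datum of completions, on sections. -/
noncomputable def gluingData : GluingData R S where
  E i := (descentObj D i).E
  θ i j a b h := descentθ D i j a b h
  θ_self {Y} i a x := by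
    rw [descentθ_apply D rfl rfl, descentHom_self]
    exact (res_res _ _ _ _ _ _ _ _ _).trans (res_eq_self _ _ (by simp) _ _ _)
  θ_θ {Y} i j k a b c h h' x := by
    rw [descentθ_apply D h rfl, descentθ_apply D rfl h'.symm, descentθ_apply D h (h'.symm),
      ← descentHom_comp D h rfl h'.symm]
    refine congr_arg _ (congr_arg (secMap (descentHom D rfl h'.symm).φ (𝟙 Y)) ?_)
    exact (res_res _ _ _ _ _ _ _ _ _).trans (res_eq_self _ _ (by simp) _ _ _)
  θ_res g i j a b h a' ha b' hb x := by
    subst ha hb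
    rw [← secMap_descentHom D rfl h.symm g]
    exact res_res_secMap (descentHom D rfl h.symm).φ g x

/-- The gluing morphisms are morphisms of completions, so they respect the maps from `M`; this lets
the local maps `h` assemble into a map to the glued module. -/
lemma descentθ_h {Y : C} {i j : S.arrows.category} (a : Y ⟶ i.obj.left) (b : Y ⟶ j.obj.left)
    (h : a ≫ i.obj.hom = b ≫ j.obj.hom) (x : M.val.obj (op Y)) :
    descentθ D i j a b h (secMap (descentObj D i).h a x) = secMap (descentObj D j).h b x := by
  have h₁ : secMap (descentHom D rfl h.symm).φ (𝟙 Y) (secMap (descentObj D i).h (𝟙 Y ≫ a) x) =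
      secMap (descentObj D j).h (𝟙 Y ≫ b) x :=
    congr_arg (fun φ : M.over Y ⟶ ((restrict b).obj (descentObj D j)).E ↦ secMap φ (𝟙 Y) x)
      (descentHom D rfl h.symm).h_comp
  have h₂ {X : C} {E : SheafOfModules.{u} (R.over X)} (φ : M.over X ⟶ E) (a a' : Y ⟶ X)
      (e : 𝟙 Y ≫ a = a') : E.res (𝟙 Y) a a' e (secMap φ a x) = secMap φ a' x := by
    rw [Category.id_comp] at e
    subst e
    exact E.res_id _ _
  exact (congr_arg (fun y ↦ (descentObj D j).E.res (𝟙 Y) (𝟙 Y ≫ b) b (by simp)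
    (secMap (descentHom D rfl h.symm).φ (𝟙 Y) y)) (h₂ (descentObj D i).h a (𝟙 Y ≫ a) rfl)).trans
      ((congr_arg _ h₁).trans (h₂ (descentObj D j).h (𝟙 Y ≫ b) b (by simp)))

lemma descentθ_g {Y : C} {i j : S.arrows.category} (a : Y ⟶ i.obj.left) (b : Y ⟶ j.obj.left)
    (h : a ≫ i.obj.hom = b ≫ j.obj.hom) (x : (descentObj D i).E.sec a) :
    (show N.val.obj (op Y) from secMap (descentObj D j).g b (descentθ D i j a b h x)) =
      secMap (descentObj D i).g a x := by
  have h₁ (y : (descentObj D i).E.sec (𝟙 Y ≫ a)) :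
      (show N.val.obj (op Y) from secMap (descentObj D j).g (𝟙 Y ≫ b)
        (secMap (descentHom D rfl h.symm).φ (𝟙 Y) y)) = secMap (descentObj D i).g (𝟙 Y ≫ a) y :=
    congr_arg (fun φ : ((restrict a).obj (descentObj D i)).E ⟶ N.over Y ↦ secMap φ (𝟙 Y) y)
      (descentHom D rfl h.symm).comp_g
  have h₂ {X : C} {E : SheafOfModules.{u} (R.over X)} (φ : E ⟶ N.over X) (a a' : Y ⟶ X)
      (e : 𝟙 Y ≫ a = a') (x : E.sec a) : (show N.val.obj (op Y) from
        secMap φ a' (E.res (𝟙 Y) a a' e x)) = secMap φ a x := by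
    rw [Category.id_comp] at e
    subst e
    exact congr_arg (secMap φ a) (E.res_id _ _)
  exact (h₂ _ _ _ _ _).trans ((h₁ _).trans (h₂ _ _ _ _ _))

end Descent

end DiagramCompletion

end SheafOfModules

universe v' u'

namespace SheafOfModules

open CategoryTheory.Pseudofunctor CategoryTheory.Pseudofunctor.LocallyDiscreteOpToCat

section

variable {C : Type*} [Category* C] {F : LocallyDiscrete Cᵒᵖ ⥤ᵖ Cat.{v', u'}} {S Y : C} {ι : Type*}
  {Z : ι → C} {l : ∀ i, Z i ⟶ S} {𝒟 : Type*} [Category* 𝒟] (G : F.obj ⟨op Y⟩ ⥤ 𝒟)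

lemma map_ofObj_hom (E : F.obj ⟨op S⟩) {q : Y ⟶ S} {i j : ι} {a : Y ⟶ Z i} {b : Y ⟶ Z j}
    (ha : a ≫ l i = q) (hb : b ≫ l j = q) (ha' : (l i).op.toLoc ≫ a.op.toLoc = q.op.toLoc)
    (hb' : (l j).op.toLoc ≫ b.op.toLoc = q.op.toLoc) :
    G.map ((DescentData.ofObj (F := F) (f := l) E).hom q a b ha hb) =
      G.map ((F.mapComp' (l i).op.toLoc a.op.toLoc q.op.toLoc ha').inv.toNatTrans.app E) ≫
        G.map ((F.mapComp' (l j).op.toLoc b.op.toLoc q.op.toLoc hb').hom.toNatTrans.app E) :=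
  G.map_comp _ _

lemma map_descentData_comm {D D' : F.DescentData l} (φ : D ⟶ D') {q : Y ⟶ S} {i j : ι}
    {a : Y ⟶ Z i} {b : Y ⟶ Z j} (ha : a ≫ l i = q) (hb : b ≫ l j = q) :
    G.map ((F.map a.op.toLoc).toFunctor.map (φ.hom i)) ≫ G.map (D'.hom q a b ha hb) =
      G.map (D.hom q a b ha hb) ≫ G.map ((F.map b.op.toLoc).toFunctor.map (φ.hom j)) := by
  rw [← Functor.map_comp, ← Functor.map_comp, φ.comm _ _ _ ha hb]

/-- Used for the faithful functor from completions to modules, so that commutative squares of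
completions can be checked on modules. -/
lemma comm_of_map_eq {𝒜 : Type*} [Category* 𝒜] (G : 𝒜 ⥤ 𝒟) [G.Faithful] {A B B' D : 𝒜}
    {x : A ⟶ B} {y : B ⟶ D} {x' : A ⟶ B'} {y' : B' ⟶ D} (h : G.map x ≫ G.map y = G.map x' ≫ G.map y') : x ≫ y = x' ≫ y' :=
  G.map_injective (by rw [Functor.map_comp, h, Functor.map_comp])

end

variable {C : Type u} [SmallCategory C] {J : GrothendieckTopology C} {R : Sheaf J RingCat.{u}}
  {M N : SheafOfModules.{u} R} {f : M ⟶ N}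

/-- A section, as a section of a restriction. -/
def onSec {X Y T : C} {E : SheafOfModules.{u} (R.over X)} (k : Y ⟶ X) (c : T ⟶ Y)
    (x : E.sec (c ≫ k)) : ((overMap R k).obj E).sec c := x

lemma secMap_overMap_map {X Y T : C} {E E' : SheafOfModules.{u} (R.over X)} (φ : E ⟶ E')
    (k : Y ⟶ X) (c : T ⟶ Y) (x : E.sec (c ≫ k)) :
    secMap ((overMap R k).map φ) c (onSec k c x) = onSec k c (secMap φ (c ≫ k) x) := (rfl)

namespace DiagramCompletion

/-- The functor sending a completion to the underlying module. -/
def toModules (f : M ⟶ N) (U : C) : (completions f).obj ⟨op U⟩ ⥤ SheafOfModules.{u} (R.over U) where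
  obj := fun (E : DiagramCompletion f U) ↦ E.E
  map := fun {E E'} (a : DiagramCompletion.Hom E E') ↦ a.φ
  map_id _ := rfl
  map_comp _ _ := rfl

instance (f : M ⟶ N) (U : C) : (toModules f U).Faithful where
  map_injective h := DiagramCompletion.hom_ext (f := f) (U := U) h

section Descent

variable {X : C} {S : Sieve X}
  (D : (completions f).DescentData (fun i : S.arrows.category ↦ i.obj.hom))

/-- The morphism from `M` to the glued module. -/
noncomputable def glueH : M.over X ⟶ (gluingData D).glue :=
  homMk (fun {Y} a ↦
    { toFun := fun (m : M.val.obj (op Y)) ↦ (⟨fun V (k : V.obj ⟶ Over.mk a) ↦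
        secMap (descentObj D V).h (𝟙 V.obj.left) (M.val.map k.left.op m), fun V V' g k ↦ by
          refine Eq.trans ?_ (descentθ_h D g.left (𝟙 _) (by simp) _)
          refine congr_arg (descentθ D V V' _ _ _) ?_
          refine (secMap_res (descentObj D V).h g.left (𝟙 _) g.left (by simp) _).symm.trans ?_
          exact congr_arg (secMap (descentObj D V).h g.left)
            (CategoryTheory.congr_fun (M.val.presheaf.map_comp k.left.op g.left.op) m).symm⟩ :
        (gluingData D).family (Over.mk a))
      map_add' := fun (m m' : M.val.obj (op Y)) ↦ (gluingData D).family_ext fun V k ↦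
        (congr_arg (secMap (descentObj D V).h (𝟙 V.obj.left)) (map_add _ m m')).trans
          (map_add (secMap (descentObj D V).h (𝟙 V.obj.left)) _ _)
      map_smul' := fun r (m : M.val.obj (op Y)) ↦ (gluingData D).family_ext fun V k ↦
        (congr_arg (secMap (descentObj D V).h (𝟙 V.obj.left))
          (PresheafOfModules.map_smul M.val _ r m)).trans
            (map_smul (secMap (descentObj D V).h (𝟙 V.obj.left)) _ _) })
    (fun {Y Y'} g a a' h m ↦ (gluingData D).family_ext fun V k ↦
      congr_arg (secMap (descentObj D V).h (𝟙 V.obj.left))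
        (CategoryTheory.congr_fun (M.val.presheaf.map_comp g.op k.left.op) m).symm)

/-- Over a member of the sieve, a compatible family is sent to the image under the local `g` of its
component at the identity. These local maps agree by `descentθ_g`, hence extend to all of `X`. -/
lemma exists_glueG (hS : S ∈ J X) : ∃ G : (gluingData D).glue ⟶ N.over X,
    ∀ (Y : C) (a : Y ⟶ X) (ha : S a) (x : (gluingData D).family (Over.mk a)),
      (show N.val.obj (op Y) from secMap G a x) =
        secMap (descentObj D ⟨Over.mk a, ha⟩).g (𝟙 Y) (x.1 ⟨Over.mk a, ha⟩ (𝟙 _)) := by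
  refine exists_hom_of_mem hS (E := (gluingData D).glue) (E' := N.over X) (fun {Y} a ha ↦
    { toFun := fun (x : (gluingData D).family (Over.mk a)) ↦
        secMap (descentObj D ⟨Over.mk a, ha⟩).g (𝟙 Y) (x.1 ⟨Over.mk a, ha⟩ (𝟙 _))
      map_add' := fun (x y : (gluingData D).family (Over.mk a)) ↦
        map_add (secMap (descentObj D ⟨Over.mk a, ha⟩).g (𝟙 Y)) _ _
      map_smul' := fun r (x : (gluingData D).family (Over.mk a)) ↦
        (congr_arg (secMap (descentObj D ⟨Over.mk a, ha⟩).g (𝟙 Y))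
          (congr_arg (· • x.1 ⟨Over.mk a, ha⟩ (𝟙 _))
            (CategoryTheory.congr_fun (R.obj.map_id (op Y)) r))).trans
          (map_smul (secMap (descentObj D ⟨Over.mk a, ha⟩).g (𝟙 Y)) r _) }) ?_
  intro Y Y' g a ha a' h (x : (gluingData D).family (Over.mk a))
  let V : S.arrows.category := ⟨Over.mk a, ha⟩
  let W : S.arrows.category := ⟨Over.mk a', h ▸ S.downward_closed ha g⟩
  let γ : W.obj ⟶ V.obj := Over.homMk g h
  have h₁ := GluingData.res_family x (V := V) (W := W) γ (𝟙 _)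
  have h₂ := secMap_res (descentObj D V).g g (𝟙 Y) g (by simp) (x.1 V (𝟙 _))
  refine Eq.trans ?_ h₂
  refine Eq.trans ?_ (congr_arg (secMap (descentObj D V).g g) h₁).symm
  refine Eq.trans ?_ (descentθ_g D (i := W) (j := V) (𝟙 W.obj.left) g (by simp [V, W, h]) _).symm
  exact congr_arg (fun k ↦ secMap (descentObj D W).g (𝟙 Y') (x.1 W k))
    ((Category.id_comp γ).trans (Category.comp_id γ).symm)

/-- The glued module restricts to the members of the descent datum. -/
noncomputable def descentGlueHom (i : S.arrows.category) :
    (overMap R i.obj.hom).obj (gluingData D).glue ⟶ (descentObj D i).E := (gluingData D).glueHom i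

variable {D} in
lemma glueHom_comp_g {G : (gluingData D).glue ⟶ N.over X}
    (hG : ∀ (Y : C) (a : Y ⟶ X) (ha : S a) (x : (gluingData D).family (Over.mk a)),
      (show N.val.obj (op Y) from secMap G a x) =
        secMap (descentObj D ⟨Over.mk a, ha⟩).g (𝟙 Y) (x.1 ⟨Over.mk a, ha⟩ (𝟙 _)))
    (i : S.arrows.category) : descentGlueHom D i ≫ (descentObj D i).g =
      (overMap R i.obj.hom).map G ≫ (overFunctorMap R i.obj.hom).hom.app N := by
  refine hom_ext_secMap fun Y a x ↦ ?_
  refine Eq.trans ?_ (hG Y (a ≫ i.obj.hom) (S.downward_closed i.property a) x).symm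
  exact descentθ_g D (i := GluingData.restrictIndex i a) (j := i) (𝟙 Y) a (by simp) _

lemma h_comp_glueHom (i : S.arrows.category) :
    ((overFunctorMap R i.obj.hom).inv.app M ≫ (overMap R i.obj.hom).map (glueH D)) ≫
      descentGlueHom D i = (descentObj D i).h := by
  refine hom_ext_secMap fun Y a x ↦ ?_
  refine Eq.trans ?_ (descentθ_h D (i := GluingData.restrictIndex i a) (j := i) (𝟙 Y) a
    (by simp) x)
  refine congr_arg (descentθ D (GluingData.restrictIndex i a) i (𝟙 Y) a (by simp)) ?_
  exact congr_arg (secMap (descentObj D (GluingData.restrictIndex i a)).h (𝟙 Y))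
    (CategoryTheory.congr_fun (M.val.presheaf.map_id (op Y)) x)

/-- The morphism `descentGlueHom`, as an isomorphism. -/
noncomputable def descentGlueIso (i : S.arrows.category) :
    (overMap R i.obj.hom).obj (gluingData D).glue ≅ (descentObj D i).E :=
  @asIso _ _ _ _ (descentGlueHom D i)
    (isIso_of_bijective_secMap _ fun _ a ↦ (gluingData D).secMap_glueHom_bijective i a)

variable {D} in
-- Being cartesian and cocartesian is local, and over each member of the sieve the square is
-- isomorphic to that of the descent datum.
lemma glue_bicartesian (hS : S ∈ J X) {G : (gluingData D).glue ⟶ N.over X}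
    (hG : ∀ i : S.arrows.category, descentGlueHom D i ≫ (descentObj D i).g =
      (overMap R i.obj.hom).map G ≫ (overFunctorMap R i.obj.hom).hom.app N) :
    BicartesianSq ((overFunctor R X).map (Abelian.factorThruImage f)) (glueH D)
      ((overFunctor R X).map (Abelian.image.ι f)) G := by
  refine bicartesianSq_of_overMap hS fun Y a ha ↦ ?_
  let i : S.arrows.category := ⟨Over.mk a, ha⟩
  have hh : (overMap R a).map (glueH D) ≫ descentGlueHom D i =
      (overFunctorMap R a).hom.app M ≫ (descentObj D i).h := by
    rw [← h_comp_glueHom D i]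
    exact ((Category.assoc _ _ _).symm.trans (congr_arg (· ≫ descentGlueHom D i)
      (Iso.hom_inv_id_app_assoc (overFunctorMap R a) M _))).symm
  have hh' : (descentObj D i).h ≫ (descentGlueIso D i).inv =
      (overFunctorMap R a).inv.app M ≫ (overMap R a).map (glueH D) := by
    rw [Iso.comp_inv_eq, Category.assoc]
    exact ((congr_arg (_ ≫ ·) hh).trans (Iso.inv_hom_id_app_assoc _ _ _)).symm
  have hg : (descentObj D i).g ≫ (overFunctorMap R a).inv.app N =
      (descentGlueIso D i).inv ≫ (overMap R a).map G := by
    rw [Iso.eq_inv_comp]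
    refine (Category.assoc _ _ _).symm.trans ((congr_arg (· ≫ _) (hG i)).trans ?_)
    exact (Category.assoc _ _ _).trans ((congr_arg ((overMap R a).map G ≫ ·)
      (Iso.hom_inv_id_app (overFunctorMap R a) N)).trans (Category.comp_id _))
  have n₁ := (overFunctorMap R a).inv.naturality (Abelian.factorThruImage f)
  have n₂ := (overFunctorMap R a).inv.naturality (Abelian.image.ι f)
  exact BicartesianSq.of_isPullback_isPushout
    ((descentObj D i).bicartesian.toIsPullback.of_iso ((overFunctorMap R a).app M).symm
      ((overFunctorMap R a).app _).symm (descentGlueIso D i).symm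
      ((overFunctorMap R a).app N).symm n₁ hh' n₂ hg)
    ((descentObj D i).bicartesian.toIsPushout.of_iso ((overFunctorMap R a).app M).symm
      ((overFunctorMap R a).app _).symm (descentGlueIso D i).symm
      ((overFunctorMap R a).app N).symm n₁ hh' n₂ hg)

lemma descentGlueHom_comp_descentHom {Y : C} {q : Y ⟶ X} {i j : S.arrows.category}
    {a : Y ⟶ i.obj.left} {b : Y ⟶ j.obj.left} (ha : a ≫ i.obj.hom = q) (hb : b ≫ j.obj.hom = q)
    {T : C} (c : T ⟶ Y) (x : (gluingData D).glue.sec ((c ≫ a) ≫ i.obj.hom)) :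
    secMap (descentHom D ha hb).φ c (secMap (descentGlueHom D i) (c ≫ a) x) =
      secMap (descentGlueHom D j) (c ≫ b) ((gluingData D).glue.res (𝟙 T) _ _
        (by simp [ha, hb]) x) :=
  (secMap_descentHom D ha hb c _).trans
    ((gluingData D).θ_glueHom i j (c ≫ a) (c ≫ b) (by simp [ha, hb]) x)

lemma secMap_mapComp'_hom {U V W : C} {l : V ⟶ U} {k : W ⟶ V} {kl : W ⟶ U} (h : k ≫ l = kl)
    (h' : l.op.toLoc ≫ k.op.toLoc = kl.op.toLoc) (E : DiagramCompletion f U)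
    (ψ : (overMap R kl).obj E.E ⟶ (overMap R k).obj ((overMap R l).obj E.E))
    (hψ : ψ = (toModules f W).map (((completions f).mapComp' l.op.toLoc k.op.toLoc kl.op.toLoc
      h').hom.toNatTrans.app E)) {Y : C} (a : Y ⟶ W) (x : E.E.sec (a ≫ kl)) :
    secMap ψ a (onSec kl a x) =
      onSec k a (onSec l (a ≫ k) (E.E.res (𝟙 Y) (a ≫ kl) ((a ≫ k) ≫ l) (by simp [← h]) x)) := by
  subst h
  have h : ψ = (overMapComp R k l).hom.app E.E :=
    hψ.trans (congr_arg (fun e ↦ (toModules f W).map ((Cat.Hom₂.toNatTrans (Iso.hom e)).app E))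
      ((completions f).mapComp'_eq_mapComp l.op.toLoc k.op.toLoc))
  rw [h]
  rfl

lemma secMap_mapComp'_inv {U V W : C} {l : V ⟶ U} {k : W ⟶ V} {kl : W ⟶ U} (h : k ≫ l = kl)
    (h' : l.op.toLoc ≫ k.op.toLoc = kl.op.toLoc) (E : DiagramCompletion f U)
    (ψ : (overMap R k).obj ((overMap R l).obj E.E) ⟶ (overMap R kl).obj E.E)
    (hψ : ψ = (toModules f W).map (((completions f).mapComp' l.op.toLoc k.op.toLoc kl.op.toLoc
      h').inv.toNatTrans.app E)) {Y : C} (a : Y ⟶ W) (x : E.E.sec ((a ≫ k) ≫ l)) :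
    secMap ψ a (onSec k a (onSec l (a ≫ k) x)) =
      onSec kl a (E.E.res (𝟙 Y) ((a ≫ k) ≫ l) (a ≫ kl) (by simp [← h]) x) := by
  subst h
  have h : ψ = (overMapComp R k l).inv.app E.E :=
    hψ.trans (congr_arg (fun e ↦ (toModules f W).map ((Cat.Hom₂.toNatTrans (Iso.inv e)).app E))
      ((completions f).mapComp'_eq_mapComp l.op.toLoc k.op.toLoc))
  rw [h]
  rfl

/-- Evaluating the commutative square at the identity of `Y` turns a compatibility with descent
isomorphisms into an agreement of two local morphisms on sections. -/
lemma secMap_of_comp_eq {X Z₁ Z₂ Y : C} {E E' : SheafOfModules.{u} (R.over X)} {l₁ : Z₁ ⟶ X}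
    {l₂ : Z₂ ⟶ X} {a : Y ⟶ Z₁} {b : Y ⟶ Z₂} (h : a ≫ l₁ = b ≫ l₂)
    (ψ₁ : (overMap R l₁).obj E ⟶ (overMap R l₁).obj E')
    (ψ₂ : (overMap R l₂).obj E ⟶ (overMap R l₂).obj E')
    (δ : (overMap R a).obj ((overMap R l₁).obj E) ⟶ (overMap R b).obj ((overMap R l₂).obj E))
    (δ' : (overMap R a).obj ((overMap R l₁).obj E') ⟶ (overMap R b).obj ((overMap R l₂).obj E'))
    (hδ : ∀ x : E.sec ((𝟙 Y ≫ a) ≫ l₁), secMap δ (𝟙 Y) (onSec a (𝟙 Y) (onSec l₁ (𝟙 Y ≫ a) x)) =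
      onSec b (𝟙 Y) (onSec l₂ (𝟙 Y ≫ b)
        (E.res (𝟙 Y) ((𝟙 Y ≫ a) ≫ l₁) ((𝟙 Y ≫ b) ≫ l₂) (by simp [h]) x)))
    (hδ' : ∀ x : E'.sec ((𝟙 Y ≫ a) ≫ l₁), secMap δ' (𝟙 Y) (onSec a (𝟙 Y) (onSec l₁ (𝟙 Y ≫ a) x)) =
      onSec b (𝟙 Y) (onSec l₂ (𝟙 Y ≫ b)
        (E'.res (𝟙 Y) ((𝟙 Y ≫ a) ≫ l₁) ((𝟙 Y ≫ b) ≫ l₂) (by simp [h]) x)))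
    (w : (overMap R a).map ψ₁ ≫ δ' = δ ≫ (overMap R b).map ψ₂) (x : E.sec (a ≫ l₁)) :
    onSec l₂ b (E'.res (𝟙 Y) (a ≫ l₁) (b ≫ l₂) (by simp [h]) (secMap ψ₁ a (onSec l₁ a x))) =
      secMap ψ₂ b (onSec l₂ b (E.res (𝟙 Y) (a ≫ l₁) (b ≫ l₂) (by simp [h]) x)) := by
  have key (a' : Y ⟶ Z₁) (b' : Y ⟶ Z₂) (ha : 𝟙 Y ≫ a = a') (hb : 𝟙 Y ≫ b = b')
      (h : a' ≫ l₁ = b' ≫ l₂) (x : E.sec (a' ≫ l₁)) :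
      onSec l₂ b' (E'.res (𝟙 Y) (a' ≫ l₁) (b' ≫ l₂) (by simp [h])
        (secMap ψ₁ a' (onSec l₁ a' x))) =
        secMap ψ₂ b' (onSec l₂ b' (E.res (𝟙 Y) (a' ≫ l₁) (b' ≫ l₂) (by simp [h]) x)) := by
    subst ha hb
    have e₁ := congr_arg (fun γ ↦ secMap γ (𝟙 Y) (onSec a (𝟙 Y) (onSec l₁ (𝟙 Y ≫ a) x))) w
    rw [secMap_comp, secMap_comp, secMap_overMap_map, hδ, secMap_overMap_map] at e₁
    exact (hδ' (secMap ψ₁ (𝟙 Y ≫ a) (onSec l₁ (𝟙 Y ≫ a) x))).symm.trans e₁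
  exact key a b (by simp) (by simp) h x

/-- The gluing morphisms of the restrictions of a completion. -/
noncomputable def ofObjHom {ι : Type*} {Z : ι → C} (l : ∀ i, Z i ⟶ X) (E : DiagramCompletion f X)
    {Y : C} {q : Y ⟶ X} {i j : ι} {a : Y ⟶ Z i} {b : Y ⟶ Z j} (ha : a ≫ l i = q)
    (hb : b ≫ l j = q) : (overMap R a).obj ((overMap R (l i)).obj E.E) ⟶
      (overMap R b).obj ((overMap R (l j)).obj E.E) :=
  (toModules f Y).map ((DescentData.ofObj (F := completions f) (f := l) E).hom q a b ha hb)

lemma secMap_ofObjHom {ι : Type*} {Z : ι → C} (l : ∀ i, Z i ⟶ X) (E : DiagramCompletion f X)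
    {Y : C} {q : Y ⟶ X} {i j : ι} {a : Y ⟶ Z i} {b : Y ⟶ Z j} (ha : a ≫ l i = q)
    (hb : b ≫ l j = q) {T : C} (c : T ⟶ Y) (x : E.E.sec ((c ≫ a) ≫ l i)) :
    secMap (ofObjHom l E ha hb) c (onSec a c (onSec (l i) (c ≫ a) x)) = onSec b c (onSec (l j)
      (c ≫ b) (E.E.res (𝟙 T) ((c ≫ a) ≫ l i) ((c ≫ b) ≫ l j) (by simp [ha, hb]) x)) := by
  have ha' : (l i).op.toLoc ≫ a.op.toLoc = q.op.toLoc := by rw [← ha]; rfl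
  have hb' : (l j).op.toLoc ≫ b.op.toLoc = q.op.toLoc := by rw [← hb]; rfl
  let α : (overMap R a).obj ((overMap R (l i)).obj E.E) ⟶ (overMap R q).obj E.E :=
    (toModules f Y).map (((completions f).mapComp' (l i).op.toLoc a.op.toLoc q.op.toLoc
      ha').inv.toNatTrans.app E)
  let β : (overMap R q).obj E.E ⟶ (overMap R b).obj ((overMap R (l j)).obj E.E) :=
    (toModules f Y).map (((completions f).mapComp' (l j).op.toLoc b.op.toLoc q.op.toLoc
      hb').hom.toNatTrans.app E)
  have h : ofObjHom l E ha hb = α ≫ β := map_ofObj_hom (toModules f Y) E ha hb ha' hb'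
  rw [h, secMap_comp, secMap_mapComp'_inv ha ha' E α rfl c, secMap_mapComp'_hom hb hb' E β rfl c,
    res_res]
  exact congr_arg (fun y ↦ onSec b c (onSec (l j) (c ≫ b) y)) (E.E.res_congr (by simp) _ x)

/-- The glued module with the glued `h` and `g` is a completion, and its restrictions are identified
with the members of the datum compatibly with the gluing morphisms. -/
lemma essSurj_toDescentData (hS : S ∈ J X) :
    ((completions f).toDescentData (fun i : S.arrows.category ↦ i.obj.hom)).EssSurj where
  mem_essImage D := by
    obtain ⟨G, hG⟩ := exists_glueG D hS
    let E : DiagramCompletion f X := ⟨(gluingData D).glue, glueH D, G,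
      glue_bicartesian hS (fun i ↦ glueHom_comp_g hG i)⟩
    refine ⟨E, ⟨DescentData.isoMk (fun i ↦ isoMk (descentGlueIso D i) (h_comp_glueHom D i)
      (glueHom_comp_g hG i)) ?_⟩⟩
    intro Y q i j a b ha hb
    have key : (overMap R a).map (descentGlueHom D i) ≫ (descentHom D ha hb).φ =
        ofObjHom (fun i : S.arrows.category ↦ i.obj.hom) E ha hb ≫
          (overMap R b).map (descentGlueHom D j) := by
      refine hom_ext_secMap fun T c x ↦ ?_
      refine (descentGlueHom_comp_descentHom D ha hb c x).trans ?_
      exact congr_arg (secMap (descentGlueHom D j) (c ≫ b))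
        (secMap_ofObjHom (fun i : S.arrows.category ↦ i.obj.hom) E ha hb c x).symm
    exact comm_of_map_eq (toModules f Y) key

lemma faithful_toDescentData (hS : S ∈ J X) :
    ((completions f).toDescentData (fun i : S.arrows.category ↦ i.obj.hom)).Faithful where
  map_injective {E E'} φ ψ h := by
    refine DiagramCompletion.hom_ext (f := f) (U := X) (hom_ext_of_overMap hS fun Y a ha ↦ ?_)
    exact congr_arg (fun α ↦ homφ (U := Y) (DescentData.Hom.hom α ⟨Over.mk a, ha⟩)) h

lemma exists_glue_hom (hS : S ∈ J X) {E E' : SheafOfModules.{u} (R.over X)}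
    (ψ : ∀ i : S.arrows.category, (overMap R i.obj.hom).obj E ⟶ (overMap R i.obj.hom).obj E')
    (hψ : ∀ {i j : S.arrows.category} {Y : C} (a : Y ⟶ i.obj.left) (b : Y ⟶ j.obj.left)
      (h : a ≫ i.obj.hom = b ≫ j.obj.hom) (x : E.sec (a ≫ i.obj.hom)), onSec j.obj.hom b
      (E'.res (𝟙 Y) (a ≫ i.obj.hom) (b ≫ j.obj.hom) (by simp [h])
        (secMap (ψ i) a (onSec i.obj.hom a x))) = secMap (ψ j) b (onSec j.obj.hom b
          (E.res (𝟙 Y) (a ≫ i.obj.hom) (b ≫ j.obj.hom) (by simp [h]) x))) :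
    ∃ Ψ : E ⟶ E', ∀ i : S.arrows.category, (overMap R i.obj.hom).map Ψ = ψ i := by
  let idx {Y : C} (a : Y ⟶ X) (ha : S a) : S.arrows.category := ⟨Over.mk a, ha⟩
  -- Each member of the sieve is also an index, so every `ψ i` can be computed from the morphism
  -- indexed by the composite itself, evaluated at the identity. This gives a single formula for the
  -- glued morphism.
  have hψ' {i : S.arrows.category} {Y : C} (c : Y ⟶ i.obj.left) (a : Y ⟶ X) (ha : S a)
      (h : c ≫ i.obj.hom = a) (x : E.sec (c ≫ i.obj.hom)) :
      E'.res (𝟙 Y) (𝟙 Y ≫ a) (c ≫ i.obj.hom) (by simp [h]) (secMap (ψ (idx a ha)) (𝟙 Y)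
        (E.res (𝟙 Y) (c ≫ i.obj.hom) (𝟙 Y ≫ a) (by simp [h]) x)) = secMap (ψ i) c x := by
    refine (congr_arg _ (hψ (j := idx a ha) c (𝟙 Y) (by simp [h, idx]) x).symm).trans ?_
    exact (E'.res_res _ _ _ _ _ _ _ _).trans (E'.res_eq_self _ (by simp) _ _ _)
  obtain ⟨Ψ, hΨ⟩ := exists_hom_of_mem hS (E := E) (E' := E') (fun {Y} a ha ↦
    { toFun := fun x ↦ E'.res (𝟙 Y) (𝟙 Y ≫ a) a (by simp)
        (secMap (ψ (idx a ha)) (𝟙 Y) (E.res (𝟙 Y) a (𝟙 Y ≫ a) rfl x))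
      map_add' := fun x y ↦ by
        rw [map_add]
        exact (congr_arg _ (map_add (secMap (ψ (idx a ha)) (𝟙 Y)) _ _)).trans (map_add _ _ _)
      map_smul' := fun r x ↦ by
        rw [res_id_smul]
        exact (congr_arg _ (map_smul (secMap (ψ (idx a ha)) (𝟙 Y)) r _)).trans
          (res_id_smul _ _ _ _ _ _) }) (by
      rintro Y Y' g a ha a' rfl x
      refine Eq.trans ?_ (res_res_secMap (ψ (idx a ha)) g x).symm
      exact hψ' (i := idx a ha) g (g ≫ a) _ rfl _)
  exact ⟨Ψ, fun i ↦ hom_ext_secMap fun Y c x ↦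
    (hΨ Y (c ≫ i.obj.hom) (S.downward_closed i.property c) x).trans (hψ' c _ _ rfl x)⟩

/-- The members of a morphism of descent data. -/
def descentMap {E E' : DiagramCompletion f X}
    (φ : ((completions f).toDescentData (fun i : S.arrows.category ↦ i.obj.hom)).obj E ⟶
      ((completions f).toDescentData (fun i : S.arrows.category ↦ i.obj.hom)).obj E')
    (i : S.arrows.category) : (restrict i.obj.hom).obj E ⟶ (restrict i.obj.hom).obj E' :=
  φ.hom i

lemma descentMap_comm {E E' : DiagramCompletion f X}
    (φ : ((completions f).toDescentData (fun i : S.arrows.category ↦ i.obj.hom)).obj E ⟶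
      ((completions f).toDescentData (fun i : S.arrows.category ↦ i.obj.hom)).obj E')
    {i j : S.arrows.category} {Y : C} (a : Y ⟶ i.obj.left) (b : Y ⟶ j.obj.left)
    (h : a ≫ i.obj.hom = b ≫ j.obj.hom) :
    (overMap R a).map (descentMap φ i).φ ≫
        ofObjHom (fun i : S.arrows.category ↦ i.obj.hom) E' rfl h.symm =
      ofObjHom (fun i : S.arrows.category ↦ i.obj.hom) E rfl h.symm ≫
        (overMap R b).map (descentMap φ j).φ :=
  map_descentData_comm (toModules f Y) φ rfl h.symm

lemma secMap_descentMap {E E' : DiagramCompletion f X}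
    (φ : ((completions f).toDescentData (fun i : S.arrows.category ↦ i.obj.hom)).obj E ⟶
      ((completions f).toDescentData (fun i : S.arrows.category ↦ i.obj.hom)).obj E')
    {i j : S.arrows.category} {Y : C} (a : Y ⟶ i.obj.left) (b : Y ⟶ j.obj.left)
    (h : a ≫ i.obj.hom = b ≫ j.obj.hom) (x : E.E.sec (a ≫ i.obj.hom)) :
    onSec j.obj.hom b (E'.E.res (𝟙 Y) (a ≫ i.obj.hom) (b ≫ j.obj.hom) (by simp [h])
      (secMap (descentMap φ i).φ a (onSec i.obj.hom a x))) = secMap (descentMap φ j).φ b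
        (onSec j.obj.hom b (E.E.res (𝟙 Y) (a ≫ i.obj.hom) (b ≫ j.obj.hom) (by simp [h]) x)) :=
  secMap_of_comp_eq (E := E.E) (E' := E'.E) h (descentMap φ i).φ (descentMap φ j).φ
    (ofObjHom (fun i : S.arrows.category ↦ i.obj.hom) E rfl h.symm)
    (ofObjHom (fun i : S.arrows.category ↦ i.obj.hom) E' rfl h.symm)
    (secMap_ofObjHom (fun i : S.arrows.category ↦ i.obj.hom) E rfl h.symm (𝟙 Y))
    (secMap_ofObjHom (fun i : S.arrows.category ↦ i.obj.hom) E' rfl h.symm (𝟙 Y))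
    (descentMap_comm φ a b h) x

lemma exists_descentMap_eq (hS : S ∈ J X) {E E' : DiagramCompletion f X}
    (φ : ((completions f).toDescentData (fun i : S.arrows.category ↦ i.obj.hom)).obj E ⟶
      ((completions f).toDescentData (fun i : S.arrows.category ↦ i.obj.hom)).obj E') :
    ∃ ψ : E ⟶ E', ∀ i, (overMap R i.obj.hom).map ψ.φ = (descentMap φ i).φ := by
  obtain ⟨Ψ, hΨ⟩ := exists_glue_hom hS (E := E.E) (E' := E'.E) (fun i ↦ (descentMap φ i).φ)
    (secMap_descentMap φ)
  let idx {Y : C} (a : Y ⟶ X) (ha : S a) : S.arrows.category := ⟨Over.mk a, ha⟩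
  refine ⟨{ φ := Ψ, h_comp := ?_, comp_g := ?_ }, hΨ⟩
  · refine hom_ext_of_overMap hS fun Y a ha ↦ ?_
    have h : ((overFunctorMap R a).inv.app M ≫ (overMap R a).map E.h) ≫
        (descentMap φ (idx a ha)).φ = (overFunctorMap R a).inv.app M ≫ (overMap R a).map E'.h :=
      (descentMap φ (idx a ha)).h_comp
    rw [← cancel_epi ((overFunctorMap R a).inv.app M), ← h, Functor.map_comp]
    exact (congr_arg (fun γ ↦ _ ≫ _ ≫ γ) (hΨ (idx a ha))).trans (Category.assoc _ _ _).symm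
  · refine hom_ext_of_overMap hS fun Y a ha ↦ ?_
    have h : (descentMap φ (idx a ha)).φ ≫ (overMap R a).map E'.g ≫
        (overFunctorMap R a).hom.app N = (overMap R a).map E.g ≫ (overFunctorMap R a).hom.app N :=
      (descentMap φ (idx a ha)).comp_g
    rw [← cancel_mono ((overFunctorMap R a).hom.app N), ← h, Functor.map_comp]
    exact (Category.assoc _ _ _).trans (congr_arg (· ≫ _) (hΨ (idx a ha)))

lemma full_toDescentData (hS : S ∈ J X) :
    ((completions f).toDescentData (fun i : S.arrows.category ↦ i.obj.hom)).Full where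
  map_surjective φ := by
    obtain ⟨ψ, hψ⟩ := exists_descentMap_eq hS φ
    exact ⟨ψ, DescentData.hom_ext fun i ↦
      DiagramCompletion.hom_ext (f := f) (U := i.obj.left) (hψ i)⟩

lemma isStack_completions : (completions f).IsStack J :=
  .of_isStackFor fun _ _ hS ↦ by
    rw [isStackFor_iff]
    have := faithful_toDescentData (f := f) hS
    have := full_toDescentData (f := f) hS
    have := essSurj_toDescentData (f := f) hS
    exact { }

end Descent

end DiagramCompletion

end SheafOfModules

/-! ### Completions as extensions, and the completion attached to a splitting -/

namespace CategoryTheory.ShortComplex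


variable {𝓐 : Type u'} [Category.{v'} 𝓐] [Abelian 𝓐] {M B N H : 𝓐} {p : M ⟶ B} {i : B ⟶ N}
  {π : N ⟶ H} {w : i ≫ π = 0}

/-- A section `s` of `π` completes the diagram `M ⟶ B ⟶ N` by the direct sum of `M` and `H`. -/
lemma ShortExact.bicartesianSq_of_section (hS : (ShortComplex.mk i π w).ShortExact)
    (b : BinaryBicone M H) (hb : b.fst ≫ b.inl + b.snd ≫ b.inr = 𝟙 b.pt)
    (s : H ⟶ N) (hs : s ≫ π = 𝟙 H) :
    BicartesianSq p b.inl i (b.fst ≫ p ≫ i + b.snd ≫ s) := by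
  have := hS.mono_f
  have hmono : Mono i := this
  have sq : CommSq p b.inl i (b.fst ≫ p ≫ i + b.snd ≫ s) := ⟨by simp⟩
  -- For the pullback: a pair agreeing in N has zero component in H, since composing with π kills
  -- the part from B, so only its component in M remains. For the pushout: the section splits N as B
  -- ⊕ H, the projection to B being the factorization of 1 − πs through `i`.
  refine BicartesianSq.of_isPullback_isPushout ⟨sq, ⟨PullbackCone.IsLimit.mk _
    (fun t ↦ t.snd ≫ b.fst) (fun t ↦ ?_) (fun t ↦ ?_) (fun t m h₁ h₂ ↦ ?_)⟩⟩ ⟨sq,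
    ⟨PushoutCocone.IsColimit.mk _ (fun t ↦ hS.exact.lift (𝟙 N - π ≫ s) (by simp [hs]) ≫ t.inl +
      π ≫ b.inr ≫ t.inr) (fun t ↦ ?_) (fun t ↦ ?_) (fun t m h₁ h₂ ↦ ?_)⟩⟩
  · have h₀ : t.snd ≫ b.snd = 0 := by
      have := t.condition =≫ π
      simpa [w, hs] using this.symm
    rw [← cancel_mono i]
    have := t.condition
    simp [reassoc_of% h₀] at this
    simp [this]
  · have h₀ : t.snd ≫ b.snd = 0 := by
      have := t.condition =≫ π
      simpa [w, hs] using this.symm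
    have := t.snd ≫= hb
    simpa [reassoc_of% h₀] using this
  · rw [← h₂]
    simp
  · have h₁ : i ≫ hS.exact.lift (𝟙 N - π ≫ s) (by simp [hs]) = 𝟙 B := by
      rw [← cancel_mono i, Category.assoc]
      have := hS.exact.lift_f (𝟙 N - π ≫ s) (by simp [hs])
      dsimp at this
      rw [this]
      simp [reassoc_of% w]
    simp [reassoc_of% h₁, reassoc_of% w]
  · have h₁ : p ≫ i ≫ hS.exact.lift (𝟙 N - π ≫ s) (by simp [hs]) = p := by
      rw [← cancel_mono i, Category.assoc, Category.assoc]
      have := hS.exact.lift_f (𝟙 N - π ≫ s) (by simp [hs])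
      dsimp at this
      rw [this]
      simp [reassoc_of% w]
    have h₂ : s ≫ hS.exact.lift (𝟙 N - π ≫ s) (by simp [hs]) = 0 := by
      rw [← cancel_mono i, Category.assoc]
      have := hS.exact.lift_f (𝟙 N - π ≫ s) (by simp [hs])
      dsimp at this
      rw [this]
      simp [reassoc_of% hs]
    have h₃ := hb =≫ t.inr
    have h₄ := t.condition
    simp only [Preadditive.comp_add, Preadditive.add_comp, Category.assoc, Category.id_comp,
      reassoc_of% hs, reassoc_of% w, reassoc_of% h₁, reassoc_of% h₂, zero_comp, comp_zero,
      add_zero, zero_add] at h₃ ⊢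
    rw [h₄, h₃]
  · have := hS.exact.lift_f (𝟙 N - π ≫ s) (by simp [hs])
    dsimp at this
    rw [← h₁, ← h₂, reassoc_of% this]
    simp

/-- A diagram completion `E` of `M ⟶ B ⟶ N` is an extension of `H` by `M`. -/
lemma ShortExact.shortExact_of_bicartesianSq (hS : (ShortComplex.mk i π w).ShortExact) {E : 𝓐}
    {h : M ⟶ E} {g : E ⟶ N} (sq : BicartesianSq p h i g) (w' : h ≫ g ≫ π = 0) :
    (ShortComplex.mk h (g ≫ π) w').ShortExact where
  exact := by
    have hi : Mono i := hS.mono_f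
    have hh : Mono h := sq.toIsPullback.mono_snd_of_mono
    refine ShortComplex.exact_of_f_is_kernel _ (KernelFork.IsLimit.ofι' _ _ fun {T} x hx ↦
      ⟨sq.toIsPullback.lift (hS.exact.lift (x ≫ g) (by simpa using hx)) x
        (hS.exact.lift_f _ _), sq.toIsPullback.lift_snd _ _ _⟩)
  mono_f := by
    have hi : Mono i := hS.mono_f
    exact sq.toIsPullback.mono_snd_of_mono
  epi_g := by
    have hπ : Epi π := hS.epi_g
    refine Preadditive.epi_of_cancel_zero _ fun {T} a ha ↦ ?_
    rw [← cancel_epi π, comp_zero]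
    -- Morphisms out of N are tested on B, where `i ≫ π` vanishes, and on E, where the hypothesis
    -- applies.
    refine sq.toIsPushout.hom_ext ?_ ?_
    · rw [reassoc_of% w, zero_comp, comp_zero]
    · simpa using ha

end CategoryTheory.ShortComplex

namespace SheafOfModules

variable {C : Type u} [SmallCategory C] {J : GrothendieckTopology C} {R : Sheaf J RingCat.{u}}
  {M N : SheafOfModules.{u} R} (f : M ⟶ N)

lemma image_cokernel_shortExact_over (U : C) :
    ((ShortComplex.mk (Abelian.image.ι f) (cokernel.π f) (kernel.condition _)).map
      (overFunctor R U)).ShortExact :=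
  (image_cokernel_shortExact f).map_of_exact (overFunctor R U)

variable {f}

namespace DiagramCompletion

variable {U V W : C}

lemma h_g (E : DiagramCompletion f U) : E.h ≫ E.g = (overFunctor R U).map f := by
  rw [← E.bicartesian.w, ← Functor.map_comp, Abelian.image.fac]

lemma h_g_π (E : DiagramCompletion f U) :
    E.h ≫ E.g ≫ (overFunctor R U).map (cokernel.π f) = 0 := by
  rw [← Category.assoc, h_g, ← Functor.map_comp, cokernel.condition, Functor.map_zero]

lemma shortExact (E : DiagramCompletion f U) :
    (ShortComplex.mk E.h (E.g ≫ (overFunctor R U).map (cokernel.π f)) E.h_g_π).ShortExact :=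
  (image_cokernel_shortExact_over f U).shortExact_of_bicartesianSq E.bicartesian E.h_g_π

/-- A morphism of completions is a morphism of extensions of coker f by M which is the identity on
both ends; the five lemma applies. -/
lemma isIso_hom {E E' : DiagramCompletion f U} (φ : E ⟶ E') : IsIso φ := by
  let ψ : ShortComplex.mk E.h (E.g ≫ (overFunctor R U).map (cokernel.π f)) E.h_g_π ⟶
      ShortComplex.mk E'.h (E'.g ≫ (overFunctor R U).map (cokernel.π f)) E'.h_g_π :=
    { τ₁ := 𝟙 _, τ₂ := φ.φ, τ₃ := 𝟙 _
      comm₁₂ := (Category.id_comp _).trans φ.h_comp.symm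
      comm₂₃ := by
        refine Eq.trans ?_ (Category.comp_id _).symm
        exact (Category.assoc _ _ _).symm.trans (congr_arg (· ≫ _) φ.comp_g) }
  have : IsIso ψ.τ₁ := inferInstanceAs (IsIso (𝟙 _))
  have : IsIso ψ.τ₃ := inferInstanceAs (IsIso (𝟙 _))
  have : IsIso φ.φ :=
    ShortComplex.isIso₂_of_shortExact_of_isIso₁₃ ψ E.shortExact E'.shortExact
  exact (isoMk (asIso φ.φ) φ.h_comp φ.comp_g).isIso_hom

lemma over_biprod_total (A B : SheafOfModules.{u} R) (U : C) :
    (overFunctor R U).map (biprod.fst : A ⊞ B ⟶ _) ≫ (overFunctor R U).map biprod.inl +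
      (overFunctor R U).map biprod.snd ≫ (overFunctor R U).map biprod.inr =
        𝟙 ((A ⊞ B).over U) := by
  simp only [← Functor.map_comp, ← Functor.map_add, biprod.total]
  exact CategoryTheory.Functor.map_id _ _

lemma over_inl_fst (A B : SheafOfModules.{u} R) (U : C) :
    (overFunctor R U).map (biprod.inl : A ⟶ A ⊞ B) ≫ (overFunctor R U).map biprod.fst =
      𝟙 (A.over U) := by
  rw [← Functor.map_comp, biprod.inl_fst]
  exact CategoryTheory.Functor.map_id _ _

lemma over_inl_snd (A B : SheafOfModules.{u} R) (U : C) :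
    (overFunctor R U).map (biprod.inl : A ⟶ A ⊞ B) ≫ (overFunctor R U).map biprod.snd = 0 := by
  rw [← Functor.map_comp, biprod.inl_snd, Functor.map_zero]

lemma over_inr_snd (A B : SheafOfModules.{u} R) (U : C) :
    (overFunctor R U).map (biprod.inr : B ⟶ A ⊞ B) ≫ (overFunctor R U).map biprod.snd =
      𝟙 (B.over U) := by
  rw [← Functor.map_comp, biprod.inr_snd]
  exact CategoryTheory.Functor.map_id _ _

lemma over_inr_fst (A B : SheafOfModules.{u} R) (U : C) :
    (overFunctor R U).map (biprod.inr : B ⟶ A ⊞ B) ≫ (overFunctor R U).map biprod.fst = 0 := by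
  rw [← Functor.map_comp, biprod.inr_fst, Functor.map_zero]

lemma over_biprod_hom_ext {T : SheafOfModules.{u} (R.over U)} {A B : SheafOfModules.{u} R}
    {a b : (A ⊞ B).over U ⟶ T}
    (h₁ : (overFunctor R U).map (biprod.inl : A ⟶ A ⊞ B) ≫ a =
      (overFunctor R U).map (biprod.inl : A ⟶ A ⊞ B) ≫ b)
    (h₂ : (overFunctor R U).map (biprod.inr : B ⟶ A ⊞ B) ≫ a =
      (overFunctor R U).map (biprod.inr : B ⟶ A ⊞ B) ≫ b) : a = b := by
  refine (Category.id_comp a).symm.trans (Eq.trans ?_ (Category.id_comp b))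
  rw [← over_biprod_total, Preadditive.add_comp, Preadditive.add_comp, Category.assoc,
    Category.assoc, h₁, h₂, Category.assoc, Category.assoc]

/-- The diagram completion `(M ⊞ coker f)|U` given by a splitting of `N|U ⟶ coker f|U`. -/
noncomputable def ofSplitting (s : (cokernel f).over U ⟶ N.over U)
    (hs : s ≫ (overFunctor R U).map (cokernel.π f) = 𝟙 _) : DiagramCompletion f U where
  E := (M ⊞ cokernel f).over U
  h := (overFunctor R U).map biprod.inl
  g := (overFunctor R U).map biprod.fst ≫ (overFunctor R U).map f +
    (overFunctor R U).map biprod.snd ≫ s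
  bicartesian := by
    have := (image_cokernel_shortExact_over f U).bicartesianSq_of_section
      (p := (overFunctor R U).map (Abelian.factorThruImage f))
      ((overFunctor R U).mapBinaryBicone (BinaryBiproduct.bicone M (cokernel f)))
      (over_biprod_total _ _ _) s hs
    have h : (overFunctor R U).map f = (overFunctor R U).map (Abelian.factorThruImage f) ≫
        (overFunctor R U).map (Abelian.image.ι f) := by
      rw [← Functor.map_comp, Abelian.image.fac]
    rw [h]
    exact this

/-- The endomorphism of `(A ⊞ B)|U` given by a morphism `B|U ⟶ A|U`. -/
noncomputable def shear {A B : SheafOfModules.{u} R} (ξ : B.over U ⟶ A.over U) :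
    (A ⊞ B).over U ⟶ (A ⊞ B).over U :=
  𝟙 _ + (overFunctor R U).map biprod.snd ≫ ξ ≫ (overFunctor R U).map biprod.inl

lemma inl_shear {A B : SheafOfModules.{u} R} (ξ : B.over U ⟶ A.over U) :
    (overFunctor R U).map biprod.inl ≫ shear ξ = (overFunctor R U).map biprod.inl := by
  have h := over_inl_snd A B U
  simp only [shear, Preadditive.comp_add, Category.comp_id, reassoc_of% h, zero_comp, add_zero]

lemma shear_zero {A B : SheafOfModules.{u} R} : shear (0 : B.over U ⟶ A.over U) = 𝟙 _ := by
  simp [shear]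

lemma shear_add {A B : SheafOfModules.{u} R} (ξ ξ' : B.over U ⟶ A.over U) :
    shear (ξ + ξ') = shear ξ ≫ shear ξ' := by
  have h := over_inl_snd A B U
  simp only [shear, Preadditive.add_comp, Preadditive.comp_add, Category.assoc, Category.id_comp,
    Category.comp_id, reassoc_of% h, zero_comp, comp_zero, add_zero]
  abel

lemma shear_injective {A B : SheafOfModules.{u} R} {ξ ξ' : B.over U ⟶ A.over U}
    (hξ : shear ξ = shear ξ') : ξ = ξ' := by
  have h₁ : (overFunctor R U).map biprod.snd ≫ ξ ≫ (overFunctor R U).map biprod.inl =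
      (overFunctor R U).map (biprod.snd : A ⊞ B ⟶ _) ≫ ξ' ≫ (overFunctor R U).map biprod.inl :=
    add_left_cancel hξ
  have h₂ := over_inr_snd A B U
  have h₃ := (overFunctor R U).map (biprod.inr : B ⟶ A ⊞ B) ≫= h₁ =≫
    (overFunctor R U).map biprod.fst
  simp only [Category.assoc, over_inl_fst, reassoc_of% h₂] at h₃
  simpa using h₃

/-- An endomorphism fixing `A` and inducing the identity on the quotient `B` is a unipotent matrix,
determined by its off-diagonal entry. -/
lemma eq_shear {A B : SheafOfModules.{u} R} (ψ : (A ⊞ B).over U ⟶ (A ⊞ B).over U)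
    (h₁ : (overFunctor R U).map biprod.inl ≫ ψ = (overFunctor R U).map biprod.inl)
    (h₂ : ψ ≫ (overFunctor R U).map biprod.snd = (overFunctor R U).map biprod.snd) :
    ψ = shear ((overFunctor R U).map biprod.inr ≫ ψ ≫ (overFunctor R U).map biprod.fst) := by
  have h₃ := over_inr_snd A B U
  refine over_biprod_hom_ext ?_ ?_
  · rw [h₁, inl_shear]
  · have h₄ : (overFunctor R U).map (biprod.inr : B ⟶ A ⊞ B) ≫ ψ =
        (overFunctor R U).map (biprod.inr : B ⟶ A ⊞ B) ≫ ψ ≫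
          ((overFunctor R U).map (biprod.fst : A ⊞ B ⟶ _) ≫ (overFunctor R U).map biprod.inl +
      (overFunctor R U).map biprod.snd ≫ (overFunctor R U).map biprod.inr) := by
      rw [over_biprod_total, Category.comp_id]
    refine h₄.trans ?_
    simp only [shear, Preadditive.comp_add, reassoc_of% h₂, reassoc_of% h₃, Category.comp_id,
      Category.assoc]
    exact add_comm _ _

/-- The convention `s = s' + f ∘ ξ` for morphisms of splittings is exactly the one that makes the
unipotent matrix of `ξ` a morphism of completions in the same direction. -/
lemma shear_comp_g {s s' : (cokernel f).over U ⟶ N.over U} {ξ : (cokernel f).over U ⟶ M.over U}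
    (h : s = s' + ξ ≫ (overFunctor R U).map f) :
    shear ξ ≫ ((overFunctor R U).map biprod.fst ≫ (overFunctor R U).map f +
      (overFunctor R U).map biprod.snd ≫ s') =
    (overFunctor R U).map biprod.fst ≫ (overFunctor R U).map f +
      (overFunctor R U).map biprod.snd ≫ s := by
  have h₁ := over_inl_snd M (cokernel f) U
  have h₂ := over_inl_fst M (cokernel f) U
  subst h
  simp only [shear, Preadditive.add_comp, Preadditive.comp_add, Category.assoc, Category.id_comp,
    reassoc_of% h₁, reassoc_of% h₂, zero_comp, comp_zero]
  abel

/-- Projecting the relation to the cokernel shows that `ψ` induces the identity on the quotient;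
restricting it to the second summand then gives the relation between the splittings. This yields
fullness of `ofSplittings`. -/
lemma eq_of_comp_g {s s' : (cokernel f).over U ⟶ N.over U}
    (hs : s ≫ (overFunctor R U).map (cokernel.π f) = 𝟙 _)
    (hs' : s' ≫ (overFunctor R U).map (cokernel.π f) = 𝟙 _)
    {ψ : (M ⊞ cokernel f).over U ⟶ (M ⊞ cokernel f).over U}
    (h : ψ ≫ ((overFunctor R U).map biprod.fst ≫ (overFunctor R U).map f +
      (overFunctor R U).map biprod.snd ≫ s') =
    (overFunctor R U).map biprod.fst ≫ (overFunctor R U).map f +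
      (overFunctor R U).map biprod.snd ≫ s) :
    ψ ≫ (overFunctor R U).map biprod.snd = (overFunctor R U).map biprod.snd ∧
    s = s' + ((overFunctor R U).map biprod.inr ≫ ψ ≫ (overFunctor R U).map biprod.fst) ≫
      (overFunctor R U).map f := by
  have hf : (overFunctor R U).map f ≫ (overFunctor R U).map (cokernel.π f) = 0 := by
    rw [← Functor.map_comp, cokernel.condition, Functor.map_zero]
  have h₁ : ψ ≫ (overFunctor R U).map biprod.snd = (overFunctor R U).map biprod.snd := by
    have h₁ := h =≫ (overFunctor R U).map (cokernel.π f)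
    simp only [Preadditive.add_comp, Preadditive.comp_add, Category.assoc, hf, hs, hs', comp_zero,
      zero_add] at h₁
    exact ((congr_arg _ (Category.comp_id _)).symm.trans h₁).trans (Category.comp_id _)
  have h₂ := (overFunctor R U).map (biprod.inr : _ ⟶ M ⊞ cokernel f) ≫= h
  have h₃ := over_inr_snd M (cokernel f) U
  have h₄ := over_inr_fst M (cokernel f) U
  simp only [Preadditive.comp_add, reassoc_of% h₁, reassoc_of% h₃, reassoc_of% h₄, zero_comp,
    zero_add] at h₂
  refine ⟨h₁, ?_⟩
  rw [← h₂, add_comm]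
  simp only [Category.assoc]

abbrev SplittingObj (f : M ⟶ N) (U : C) :=
  TranslationObj (homSheafMap (cokernel f) f).hom (splittingSubfunctor f) U

/-- A morphism of splittings, as a morphism of modules. -/
def splittingHom {s s' : SplittingObj f U} (ξ : s ⟶ s') : (cokernel f).over U ⟶ M.over U := ξ.ξ

variable (f) in
/-- The functor which sends a splitting to the corresponding diagram completion. -/
noncomputable def ofSplittings (U : C) : SplittingObj f U ⥤ DiagramCompletion f U where
  obj s := ofSplitting s.val s.mem
  map ξ :=
    { φ := shear (splittingHom ξ)
      h_comp := inl_shear (splittingHom ξ)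
      comp_g := shear_comp_g ξ.eq }
  map_id _ := Hom.ext shear_zero
  map_comp _ _ := Hom.ext (shear_add _ _)

instance (U : C) : (ofSplittings f U).Faithful where
  map_injective hab := TranslationObj.hom_ext (shear_injective (congr_arg Hom.φ hab))

instance (U : C) : (ofSplittings f U).Full where
  map_surjective {s s'} φ :=
    have h := eq_of_comp_g s.mem s'.mem φ.comp_g
    ⟨TranslationObj.Hom.mk _ h.2, Hom.ext (eq_shear φ.φ φ.h_comp h.1).symm⟩

lemma overFunctorMap_comp_shear {A B : SheafOfModules.{u} R} (k : V ⟶ U)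
    (ξ : B.over U ⟶ A.over U) :
    shear (restrictHom k ξ) ≫ (overFunctorMap R k).inv.app (A ⊞ B) =
      (overFunctorMap R k).inv.app (A ⊞ B) ≫ (overMap R k).map (shear ξ) := by
  have h₁ := (overFunctorMap R k).inv.naturality (biprod.snd : A ⊞ B ⟶ _)
  have h₂ := (overFunctorMap R k).inv.naturality (biprod.inl : A ⟶ A ⊞ B)
  dsimp [restrictHom, shear] at h₁ h₂ ⊢
  simp only [Functor.map_add, Preadditive.add_comp, Preadditive.comp_add, Category.assoc,
    Functor.map_comp, h₂, ← reassoc_of% h₁, Category.id_comp, Iso.hom_inv_id_app_assoc]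
  congr 1

lemma overFunctorMap_comp_g (k : V ⟶ U) (s : (cokernel f).over U ⟶ N.over U) :
    (overFunctorMap R k).inv.app (M ⊞ cokernel f) ≫
      (overMap R k).map ((overFunctor R U).map biprod.fst ≫ (overFunctor R U).map f +
      (overFunctor R U).map biprod.snd ≫ s) ≫ (overFunctorMap R k).hom.app N =
    (overFunctor R V).map biprod.fst ≫ (overFunctor R V).map f +
      (overFunctor R V).map biprod.snd ≫ restrictHom k s := by
  have h₁ := (overFunctorMap R k).inv.naturality (biprod.snd : M ⊞ cokernel f ⟶ _)
  have h₂ := (overFunctorMap R k).inv.naturality (biprod.fst : M ⊞ cokernel f ⟶ _)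
  have h₃ := (overFunctorMap R k).inv.naturality f
  dsimp [restrictHom] at h₁ h₂ h₃ ⊢
  simp only [Functor.map_add, Preadditive.add_comp, Preadditive.comp_add, Category.assoc,
    Functor.map_comp, ← reassoc_of% h₁, ← reassoc_of% h₂, ← reassoc_of% h₃, Iso.inv_hom_id_app]
  congr 2

/-- The compatibility of `ofSplittings` with restriction. -/
noncomputable def ofSplittingsRestrict (k : V ⟶ U) :
    TranslationObj.restrict k ⋙ ofSplittings f V ≅ ofSplittings f U ⋙ restrict k :=
  NatIso.ofComponents (fun s ↦ isoMk ((overFunctorMap R k).symm.app (M ⊞ cokernel f))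
    ((overFunctorMap R k).inv.naturality biprod.inl)
    (overFunctorMap_comp_g k s.val))
    (fun a ↦ Hom.ext (overFunctorMap_comp_shear k (splittingHom a)))

end DiagramCompletion
end SheafOfModules

/-! ### The completions as the stack associated with the splittings -/

namespace SheafOfModules

variable {C : Type u} [SmallCategory C] {J : GrothendieckTopology C} {R : Sheaf J RingCat.{u}}
  {M N : SheafOfModules.{u} R} (f : M ⟶ N)

namespace DiagramCompletion

variable {U V W : C}

/-- The morphism from the splittings to the diagram completions. -/
noncomputable def splittingsToCompletions :
    Pseudofunctor.StrongTrans (splittings f) (completions f) where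
  app U := (ofSplittings f U.as.unop).toCatHom
  naturality k := Cat.Hom.isoMk (ofSplittingsRestrict k.as.unop)
  naturality_naturality {a b k l} η := by
    obtain rfl : k = l := LocallyDiscrete.eq_of_hom η 
    obtain rfl : η = 𝟙 k := Subsingleton.elim _ _
    rw [PrelaxFunctor.map₂_id, PrelaxFunctor.map₂_id]
    exact (congr_arg (· ≫ _) (id_whiskerRight _ _)).trans ((Category.id_comp _).trans
      ((Category.comp_id _).symm.trans (congr_arg (_ ≫ ·) (whiskerLeft_id _ _).symm)))
  naturality_id a := by
    ext s
    apply hom_ext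
    change (overFunctorMap R (𝟙 a.as.unop)).inv.app (M ⊞ cokernel f) ≫
      (overMapId R a.as.unop).hom.app ((M ⊞ cokernel f).over a.as.unop) =
        shear (0 : (cokernel f).over a.as.unop ⟶ M.over a.as.unop) ≫ 𝟙 _ ≫ 𝟙 _
    rw [shear_zero, overFunctorMap_id]
    simp
  naturality_comp {a b c} k l := by
    ext s
    apply hom_ext
    change (overFunctorMap R (l.as.unop ≫ k.as.unop)).inv.app (M ⊞ cokernel f) ≫
      (overMapComp R l.as.unop k.as.unop).hom.app ((M ⊞ cokernel f).over a.as.unop) =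
        shear (0 : (cokernel f).over c.as.unop ⟶ M.over c.as.unop) ≫ 𝟙 _ ≫
          (overFunctorMap R l.as.unop).inv.app (M ⊞ cokernel f) ≫ 𝟙 _ ≫
            (overMap R l.as.unop).map ((overFunctorMap R k.as.unop).inv.app (M ⊞ cokernel f)) ≫ 𝟙 _
    rw [shear_zero, overFunctorMap_comp]
    simp only [Category.id_comp]
    exact (congr_arg (_ ≫ ·) (Category.comp_id _)).symm

variable {f}

/-- The map from E to coker f is an epimorphism, and the identity of the locally free module coker f
lifts locally along it. -/
lemma exists_section (hf : IsLocallyFreeOfFiniteRank (cokernel f)) (E : DiagramCompletion f U) :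
    ∃ T ∈ J U, ∀ ⦃V : C⦄ (k : V ⟶ U), T k →
      ∃ σ : (cokernel f).over V ⟶ ((restrict k).obj E).E,
        σ ≫ ((restrict k).obj E).g ≫ (overFunctor R V).map (cokernel.π f) = 𝟙 _ := by
  have := E.shortExact.epi_g
  obtain ⟨T, hT, h⟩ := exists_local_lift hf (E.g ≫ (overFunctor R U).map (cokernel.π f))
    (𝟙 ((cokernel f).over U))
  refine ⟨T, hT, fun V k hk ↦ ?_⟩
  obtain ⟨σ, hσ⟩ := h k hk
  refine ⟨σ, ?_⟩
  have hn := (overFunctorMap R k).hom.naturality (cokernel.π f)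
  have h₁ := hσ =≫ (overFunctorMap R k).hom.app (cokernel f)
  rw [overRestrict_over, Functor.map_comp, Category.assoc, Category.assoc] at h₁
  have h₂ : restrictHom k (𝟙 ((cokernel f).over U)) = 𝟙 _ := by
    refine (congr_arg (restrictHom k) ((overFunctor R U).map_id (cokernel f)).symm).trans ?_
    exact (restrictHom_over _ _ k (𝟙 (cokernel f))).trans ((overFunctor R V).map_id _)
  refine Eq.trans ?_ (h₁.trans h₂)
  refine congr_arg (σ ≫ ·) ((Category.assoc _ _ _).trans ?_)
  exact congr_arg (_ ≫ ·) hn.symm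

/-- A section of `E ⟶ coker f` identifies `E` with the completion defined by a splitting. -/
noncomputable def ofSplittingHom (E : DiagramCompletion f U) (σ : (cokernel f).over U ⟶ E.E)
    (hσ : σ ≫ E.g ≫ (overFunctor R U).map (cokernel.π f) = 𝟙 _) :
    ofSplitting (σ ≫ E.g) ((Category.assoc _ _ _).trans hσ) ⟶ E where
  φ := (overFunctor R U).map biprod.fst ≫ E.h + (overFunctor R U).map biprod.snd ≫ σ
  h_comp := by
    have h₁ := over_inl_snd M (cokernel f) U
    have h₂ := over_inl_fst M (cokernel f) U
    dsimp only [ofSplitting]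
    simp only [Preadditive.comp_add, reassoc_of% h₁, reassoc_of% h₂, zero_comp, add_zero]
  comp_g := by
    dsimp only [ofSplitting]
    simp only [Preadditive.add_comp, Category.assoc, h_g]

/-- The diagram completions are the stack associated with the splittings. -/
theorem isAssociatedStack (hf : IsLocallyFreeOfFiniteRank (cokernel f)) :
    IsAssociatedStack J (splittingsToCompletions f) where
  isStack := isStack_completions
  full U := inferInstanceAs (ofSplittings f U).Full
  faithful U := inferInstanceAs (ofSplittings f U).Faithful
  locally_essSurj {U} (E : DiagramCompletion f U) := by
    obtain ⟨T, hT, h⟩ := exists_section hf E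
    refine ⟨T, hT, fun V k hk ↦ ?_⟩
    obtain ⟨σ, hσ⟩ := h k hk
    let s : SplittingObj f V := ⟨σ ≫ ((restrict k).obj E).g, (Category.assoc _ _ _).trans hσ⟩
    let φ : (ofSplittings f V).obj s ⟶ (restrict k).obj E :=
      ofSplittingHom ((restrict k).obj E) σ hσ
    let e : (ofSplittings f V).obj s ≅ (restrict k).obj E := @asIso _ _ _ _ φ (isIso_hom φ)
    exact ⟨s, ⟨e⟩⟩

end DiagramCompletion
end SheafOfModules

/-! ### Cocycles on locally nonempty presheaves of sets, and connecting homomorphisms -/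

namespace CategoryTheory

section Local


variable {C : Type u} [SmallCategory C] {J : GrothendieckTopology C}

/-- Definition by local description: a condition stable under restriction, satisfied by at most one
section, and locally satisfiable determines a section. The chosen local solutions are compatible by
uniqueness. -/
lemma Presieve.IsSheaf.exists_section {F : Cᵒᵖ ⥤ Type w} (hF : Presieve.IsSheaf J F) {U : C}
    (r : ∀ ⦃V : C⦄, (V ⟶ U) → F.obj (op V) → Prop)
    (hr : ∀ ⦃V W : C⦄ (k : V ⟶ U) (l : W ⟶ V) (x : F.obj (op V)), r k x →
      r (l ≫ k) (F.map l.op x))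
    (hu : ∀ ⦃V : C⦄ (k : V ⟶ U) (x y : F.obj (op V)), r k x → r k y → x = y)
    {T : Sieve U} (hT : T ∈ J U) (h : ∀ ⦃V : C⦄ (k : V ⟶ U), T k → ∃ x, r k x) :
    ∃ s : F.obj (op U), ∀ ⦃V : C⦄ (k : V ⟶ U) (x : F.obj (op V)), r k x → F.map k.op s = x := by
  choose a ha using h
  have hc : Presieve.FamilyOfElements.Compatible (P := F) (R := T.arrows)
      (fun V k hk ↦ a k hk) := by
    refine (Presieve.compatible_iff_sieveCompatible _).2 ?_
    intro V W k l hk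
    exact hu _ _ _ (ha _ _) (hr _ _ _ (ha _ _))
  refine ⟨(hF T hT).amalgamate _ hc, fun V k x hx ↦ ?_⟩
  refine (hF.isSeparated _ (J.pullback_stable k hT)).ext fun W l hl ↦ ?_
  have h₁ := (hF T hT).valid_glue hc (l ≫ k) hl
  refine (Eq.trans ?_ h₁).trans (hu _ _ _ (ha _ _) (hr _ _ _ hx))
  rw [op_comp, F.map_comp]
  rfl

end Local

namespace Sheaf

variable {C : Type u} [SmallCategory C] {J : GrothendieckTopology C}

lemma isSheaf_forget (F : Sheaf J AddCommGrpCat.{u}) :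
    Presieve.IsSheaf J (F.obj ⋙ forget AddCommGrpCat.{u}) :=
  (isSheaf_iff_isSheaf_of_type _ _).1
    ((Presheaf.isSheaf_iff_isSheaf_forget _ _ (CategoryTheory.forget AddCommGrpCat.{u})).1
      F.property)

lemma map_map_apply (F : Sheaf J AddCommGrpCat.{u}) {U V W : C} (k : V ⟶ U) (l : W ⟶ V)
    (x : F.obj.obj (op U)) : F.obj.map l.op (F.obj.map k.op x) = F.obj.map (l ≫ k).op x :=
  (CategoryTheory.congr_fun (F.obj.map_comp k.op l.op) x).symm

lemma map_terminal_apply (F : Sheaf J AddCommGrpCat.{u}) {X U V : C} (hX : IsTerminal X) (k : V ⟶ U)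
    (x : F.obj.obj (op X)) :
    F.obj.map k.op (F.obj.map (hX.from U).op x) = F.obj.map (hX.from V).op x := by
  rw [map_map_apply, hX.hom_ext (k ≫ hX.from U) (hX.from V)]

lemma naturality_apply {F G : Sheaf J AddCommGrpCat.{u}} (φ : F ⟶ G) {U V : C} (k : V ⟶ U)
    (x : F.obj.obj (op U)) :
    φ.hom.app (op V) (F.obj.map k.op x) = G.obj.map k.op (φ.hom.app (op U) x) :=
  CategoryTheory.congr_fun (φ.hom.naturality k.op) x

lemma comp_apply {F G H : Sheaf J AddCommGrpCat.{u}} (φ : F ⟶ G) (ψ : G ⟶ H) {U : C}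
    (x : F.obj.obj (op U)) :
    (φ ≫ ψ).hom.app (op U) x = ψ.hom.app (op U) (φ.hom.app (op U) x) := rfl

lemma section_ext (F : Sheaf J AddCommGrpCat.{u}) {U : C} {x y : F.obj.obj (op U)} {T : Sieve U}
    (hT : T ∈ J U) (h : ∀ ⦃V : C⦄ (k : V ⟶ U), T k → F.obj.map k.op x = F.obj.map k.op y) :
    x = y :=
  (F.isSheaf_forget.isSeparated T hT).ext h

variable {S : ShortComplex (Sheaf J AddCommGrpCat.{u})}

lemma comp_zero_apply (S : ShortComplex (Sheaf J AddCommGrpCat.{u})) {U : C}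
    (x : S.X₁.obj.obj (op U)) : S.g.hom.app (op U) (S.f.hom.app (op U) x) = 0 :=
  congr_arg (fun φ : S.X₁ ⟶ S.X₃ ↦ φ.hom.app (op U) x) S.zero

lemma _root_.CategoryTheory.ShortComplex.ShortExact.sections_exact (hS : S.ShortExact) (U : C) :
    (S.map (sheafToPresheaf J AddCommGrpCat.{u} ⋙ (CategoryTheory.evaluation _ _).obj (op U))).Exact ∧
      Mono (S.map (sheafToPresheaf J AddCommGrpCat.{u} ⋙
        (CategoryTheory.evaluation _ _).obj (op U))).f := by
  have := hS.mono_f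
  exact ⟨hS.exact.map_of_mono_of_preservesKernel _ inferInstance inferInstance,
    inferInstanceAs (Mono ((sheafToPresheaf J AddCommGrpCat.{u} ⋙
        (CategoryTheory.evaluation _ _).obj (op U)).map S.f))⟩

lemma injective_of_shortExact (hS : S.ShortExact) (U : C) :
    Function.Injective (S.f.hom.app (op U)) :=
  (AddCommGrpCat.mono_iff_injective _).1 (hS.sections_exact U).2

lemma exists_of_shortExact (hS : S.ShortExact) {U : C} (x : S.X₂.obj.obj (op U))
    (hx : S.g.hom.app (op U) x = 0) : ∃ y : S.X₁.obj.obj (op U), S.f.hom.app (op U) y = x :=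
  (ShortComplex.ab_exact_iff _).1 (hS.sections_exact U).1 x hx

lemma exists_local_lift {F G : Sheaf J AddCommGrpCat.{u}} (g : F ⟶ G) [Epi g] {U : C}
    (x : G.obj.obj (op U)) : ∃ T ∈ J U, ∀ ⦃V : C⦄ (k : V ⟶ U), T k →
      ∃ y : F.obj.obj (op V), g.hom.app (op V) y = G.obj.map k.op x := by
  have := (Sheaf.isLocallySurjective_iff_epi' (J := J) _ g).2 inferInstance
  exact ⟨_, Presheaf.imageSieve_mem J g.hom x, fun V k hk ↦ hk⟩

end Sheaf

/-- The presheaf of sets `P` locally has sections. -/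
def LocallyNonempty {C : Type u} [SmallCategory C] (J : GrothendieckTopology C)
    (P : Cᵒᵖ ⥤ Type u) : Prop :=
  ∀ U : C, ∃ T ∈ J U, ∀ ⦃V : C⦄ (k : V ⟶ U), T k → Nonempty (P.obj (op V))

/-- A cocycle on the presheaf of sets `P` with values in `G`. -/
structure PresheafCocycle {C : Type u} [SmallCategory C] (P : Cᵒᵖ ⥤ Type u)
    (G : Cᵒᵖ ⥤ AddCommGrpCat.{u}) where
  d {U : C} (x y : P.obj (op U)) : G.obj (op U)
  d_add {U : C} (x y z : P.obj (op U)) : d x y + d y z = d x z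
  map_d {U V : C} (k : V ⟶ U) (x y : P.obj (op U)) :
    G.map k.op (d x y) = d (P.map k.op x) (P.map k.op y)

section Cocycle

variable {C : Type u} [SmallCategory C] {J : GrothendieckTopology C} {X : C} (hX : IsTerminal X)
  {P : Cᵒᵖ ⥤ Type u}

/-- The image of a global section under the connecting homomorphism `H⁰ ⟶ H¹`. -/
noncomputable def Sheaf.δ₀ {S : ShortComplex (Sheaf J AddCommGrpCat.{u})}
    (hS : S.ShortExact) (z : S.X₃.obj.obj (op X)) : Sheaf.H S.X₁ 1 :=
  ((Sheaf.H.equiv₀ S.X₃ hX).symm z).comp hS.extClass (zero_add 1)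

lemma Sheaf.δ₀_naturality {S S' : ShortComplex (Sheaf J AddCommGrpCat.{u})}
    (hS : S.ShortExact) (hS' : S'.ShortExact) (φ : S ⟶ S') (z : S.X₃.obj.obj (op X)) :
    (Sheaf.δ₀ hX hS z).comp (Abelian.Ext.mk₀ φ.τ₁) (add_zero 1) =
      Sheaf.δ₀ hX hS' (φ.τ₃.hom.app (op X) z) := by
  have h := Sheaf.H.equiv₀_symm_naturality hX φ.τ₃ z
  rw [Sheaf.H.map_apply] at h
  dsimp only [δ₀]
  rw [← h, Abelian.Ext.comp_assoc_of_third_deg_zero, ShortComplex.ShortExact.extClass_naturality hS hS' φ,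
    Abelian.Ext.comp_assoc_of_second_deg_zero]

lemma Sheaf.δ₀_map {S : ShortComplex (Sheaf J AddCommGrpCat.{u})}
    (hS : S.ShortExact) (w : S.X₂.obj.obj (op X)) : Sheaf.δ₀ hX hS (S.g.hom.app (op X) w) = 0 := by
  have h := Sheaf.H.equiv₀_symm_naturality hX S.g w
  rw [Sheaf.H.map_apply] at h
  dsimp only [δ₀]
  rw [← h, Abelian.Ext.comp_assoc_of_second_deg_zero, ShortComplex.ShortExact.comp_extClass, Abelian.Ext.comp_zero]

lemma Sheaf.δ₀_add {S : ShortComplex (Sheaf J AddCommGrpCat.{u})}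
    (hS : S.ShortExact) (z z' : S.X₃.obj.obj (op X)) :
    Sheaf.δ₀ hX hS (z + z') = Sheaf.δ₀ hX hS z + Sheaf.δ₀ hX hS z' := by
  dsimp only [δ₀]
  rw [map_add, Abelian.Ext.add_comp]

/-- A natural family of sections, constant on `P`, comes from a global section. -/
lemma Sheaf.exists_global_section (F : Sheaf J AddCommGrpCat.{u}) (hP : LocallyNonempty J P)
    (w : P ⟶ F.obj ⋙ forget AddCommGrpCat.{u})
    (hw : ∀ (U : C) (x y : P.obj (op U)), w.app (op U) x = w.app (op U) y) :
    ∃ s : F.obj.obj (op X), ∀ (U : C) (x : P.obj (op U)),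
      w.app (op U) x = F.obj.map (hX.from U).op s := by
  obtain ⟨T, hT, hT'⟩ := hP X
  obtain ⟨s, hs⟩ := F.isSheaf_forget.exists_section
    (r := fun V _ y ↦ ∃ x : P.obj (op V), w.app (op V) x = y)
    (fun V W k l y ⟨x, hx⟩ ↦ ⟨P.map l.op x, by rw [← hx]; exact CategoryTheory.congr_fun (w.naturality l.op) x⟩)
    (fun V k y y' ⟨x, hx⟩ ⟨x', hx'⟩ ↦ by rw [← hx, ← hx', hw]) hT
    (fun V k hk ↦ ⟨_, (hT' k hk).some, rfl⟩)
  exact ⟨s, fun U x ↦ (hs (hX.from U) _ ⟨x, rfl⟩).symm⟩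

/-- The cocycle `c` is the coboundary of `e`, a family of local liftings of the global
section `z`. -/
structure PresheafCocycle.IsCoboundary {S : ShortComplex (Sheaf J AddCommGrpCat.{u})}
    (c : PresheafCocycle P S.X₁.obj) (z : S.X₃.obj.obj (op X))
    (e : P ⟶ S.X₂.obj ⋙ forget AddCommGrpCat.{u}) : Prop where
  sub {U : C} (x y : P.obj (op U)) : S.f.hom.app (op U) (c.d x y) =
    (show S.X₂.obj.obj (op U) from e.app (op U) x) - e.app (op U) y
  lift {U : C} (x : P.obj (op U)) :
    S.g.hom.app (op U) (e.app (op U) x) = S.X₃.obj.map (hX.from U).op z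

variable {S S' : ShortComplex (Sheaf J AddCommGrpCat.{u})}

/-- The cocycle defines a morphism from ℤ[P × P] to `S.X₂`. By the cocycle relation it vanishes on
the kernel of (x, y) ↦ x − y, so injectivity extends it from the image of this map to ℤ[P]; its
values on generators are `e`. The image of `e` in `S.X₃` is constant on `P`, hence comes from a
global section. -/
lemma PresheafCocycle.exists_isCoboundary (hP : LocallyNonempty J P) (hS : S.ShortExact)
    [Injective S.X₂] (c : PresheafCocycle P S.X₁.obj) :
    ∃ (z : S.X₃.obj.obj (op X)) (e : P ⟶ S.X₂.obj ⋙ forget AddCommGrpCat.{u}),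
      c.IsCoboundary hX z e := by
  let PP : Cᵒᵖ ⥤ Type u :=
    { obj U := P.obj U × P.obj U
      map k := ↾fun p ↦ (P.map k p.1, P.map k p.2) }
  let A : Cᵒᵖ ⥤ AddCommGrpCat.{u} := PP ⋙ AddCommGrpCat.free
  let B : Cᵒᵖ ⥤ AddCommGrpCat.{u} := P ⋙ AddCommGrpCat.free
  let a : A ⟶ B :=
    { app U := AddCommGrpCat.ofHom (FreeAbelianGroup.lift fun p : P.obj U × P.obj U ↦
        FreeAbelianGroup.of p.1 - FreeAbelianGroup.of p.2)
      naturality U V k := AddCommGrpCat.hom_ext (FreeAbelianGroup.lift_ext _ _ fun p ↦ by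
        change FreeAbelianGroup.lift _ (FreeAbelianGroup.map _ (FreeAbelianGroup.of p)) =
          FreeAbelianGroup.map _ (FreeAbelianGroup.lift _ (FreeAbelianGroup.of p))
        rw [FreeAbelianGroup.map_of_apply, FreeAbelianGroup.lift_apply_of,
          FreeAbelianGroup.lift_apply_of, map_sub, FreeAbelianGroup.map_of_apply,
          FreeAbelianGroup.map_of_apply]
        rfl) }
  let m : A ⟶ S.X₂.obj :=
    { app U := AddCommGrpCat.ofHom (FreeAbelianGroup.lift fun p : P.obj U × P.obj U ↦
        (S.f.hom.app U (c.d p.1 p.2) : S.X₂.obj.obj U))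
      naturality U V k := AddCommGrpCat.hom_ext (FreeAbelianGroup.lift_ext _ _ fun p ↦ by
        change FreeAbelianGroup.lift _ (FreeAbelianGroup.map _ (FreeAbelianGroup.of p)) =
          S.X₂.obj.map k (FreeAbelianGroup.lift _ (FreeAbelianGroup.of p))
        rw [FreeAbelianGroup.map_of_apply, FreeAbelianGroup.lift_apply_of,
          FreeAbelianGroup.lift_apply_of]
        exact (congr_arg (S.f.hom.app V) (c.map_d k.unop p.1 p.2).symm).trans
          (Sheaf.naturality_apply S.f k.unop _)) }
  have hm : kernel.ι a ≫ m = 0 := by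
    ext U t
    rcases isEmpty_or_nonempty (P.obj U) with hU | ⟨⟨x₀⟩⟩
    · have h : (m.app U).hom = 0 := FreeAbelianGroup.lift_ext _ _ fun p ↦ isEmptyElim p.1
      exact congr_arg (fun φ : A.obj U →+ S.X₂.obj.obj U ↦ φ ((kernel.ι a).app U t)) h
    -- Over an object where `P` has a section `x₀`, the map x ↦ d(x, x₀) is a factorization of `m`
    -- through `a`. It depends on `x₀` and is not natural in the object, but it suffices to see that
    -- `m` kills the kernel of `a`.
    · let ψ : FreeAbelianGroup (P.obj U) →+ S.X₂.obj.obj U :=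
        FreeAbelianGroup.lift fun x ↦ (S.f.hom.app U (c.d x x₀) : S.X₂.obj.obj U)
      have h : (m.app U).hom = ψ.comp (a.app U).hom := FreeAbelianGroup.lift_ext _ _ fun p ↦ by
        refine (FreeAbelianGroup.lift_apply_of _ _).trans
          (Eq.trans ?_ (congr_arg ψ (FreeAbelianGroup.lift_apply_of _ _)).symm)
        rw [map_sub, FreeAbelianGroup.lift_apply_of, FreeAbelianGroup.lift_apply_of, eq_sub_iff_add_eq]
        exact (map_add (S.f.hom.app U).hom _ _).symm.trans
          (congr_arg (S.f.hom.app U) (c.d_add p.1 p.2 x₀))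
      refine (congr_arg (fun φ : A.obj U →+ S.X₂.obj.obj U ↦ φ ((kernel.ι a).app U t)) h).trans ?_
      refine (congr_arg ψ ?_).trans (map_zero ψ)
      exact congr_arg (fun φ : kernel a ⟶ B ↦ φ.app U t) (kernel.condition a)
  -- The extension problem is posed among presheaves; an injective sheaf is injective as a presheaf
  -- because sheafification is exact.
  have : Injective S.X₂.obj :=
    Injective.injective_of_adjoint (sheafificationAdjunction J AddCommGrpCat.{u}) S.X₂
  let E : B ⟶ S.X₂.obj := (ShortComplex.exact_kernel a).descToInjective m hm
  have hE : a ≫ E = m := (ShortComplex.exact_kernel a).comp_descToInjective m hm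
  let e : P ⟶ S.X₂.obj ⋙ forget AddCommGrpCat.{u} :=
    { app U := ↾fun x ↦ E.app U (FreeAbelianGroup.of x)
      naturality U V k := by
        ext x
        refine Eq.trans ?_ (CategoryTheory.congr_fun (E.naturality k) (FreeAbelianGroup.of x))
        exact congr_arg (E.app V) (FreeAbelianGroup.map_of_apply x).symm }
  have he {U : C} (x y : P.obj (op U)) : S.f.hom.app (op U) (c.d x y) =
      (show S.X₂.obj.obj (op U) from e.app (op U) x) - e.app (op U) y := by
    have h := congr_arg (fun φ : A ⟶ S.X₂.obj ↦
      φ.app (op U) (FreeAbelianGroup.of ((x, y) : P.obj (op U) × P.obj (op U)))) hE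
    refine (h.trans (FreeAbelianGroup.lift_apply_of _ _)).symm.trans ?_
    exact (congr_arg (E.app (op U)) (FreeAbelianGroup.lift_apply_of _ _)).trans
      (map_sub (E.app (op U)).hom _ _)
  obtain ⟨z, hz⟩ := S.X₃.exists_global_section hX hP
    (e ≫ Functor.whiskerRight S.g.hom (forget AddCommGrpCat.{u})) fun U x y ↦ by
      refine sub_eq_zero.1 ((map_sub (S.g.hom.app (op U)).hom _ _).symm.trans ?_)
      exact (congr_arg (S.g.hom.app (op U)) (he x y).symm).trans (Sheaf.comp_zero_apply S _)
  exact ⟨z, e, he, fun x ↦ hz _ x⟩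

/-- The families `e'` and `φ e` have the same differences, so `e' - φ e` is constant on `P` and
comes from a global section `s` of `S'.X₂`. Hence z' = φ z + g s, and the connecting homomorphism
kills g s. -/
lemma PresheafCocycle.IsCoboundary.δ₀_eq_of_hom (hP : LocallyNonempty J P) (hS : S.ShortExact)
    (hS' : S'.ShortExact) (φ : S ⟶ S') {c : PresheafCocycle P S.X₁.obj}
    {c' : PresheafCocycle P S'.X₁.obj}
    (hc : ∀ (U : C) (x y : P.obj (op U)), φ.τ₁.hom.app (op U) (c.d x y) = c'.d x y)
    {z : S.X₃.obj.obj (op X)} {e : P ⟶ S.X₂.obj ⋙ forget AddCommGrpCat.{u}}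
    (h : c.IsCoboundary hX z e) {z' : S'.X₃.obj.obj (op X)}
    {e' : P ⟶ S'.X₂.obj ⋙ forget AddCommGrpCat.{u}} (h' : c'.IsCoboundary hX z' e') :
    (Sheaf.δ₀ hX hS z).comp (Abelian.Ext.mk₀ φ.τ₁) (add_zero 1) = Sheaf.δ₀ hX hS' z' := by
  let w : P ⟶ S'.X₂.obj ⋙ forget AddCommGrpCat.{u} :=
    { app U := ↾fun x ↦ (show S'.X₂.obj.obj U from e'.app U x) - φ.τ₂.hom.app U (e.app U x)
      naturality U V k := by
        ext x
        have h₁ := CategoryTheory.congr_fun (e'.naturality k) x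
        have h₂ := CategoryTheory.congr_fun (e.naturality k) x
        have h₃ := CategoryTheory.congr_fun (φ.τ₂.hom.naturality k) (e.app U x)
        change (show S'.X₂.obj.obj V from e'.app V (P.map k x)) -
          φ.τ₂.hom.app V (e.app V (P.map k x)) = S'.X₂.obj.map k
            ((show S'.X₂.obj.obj U from e'.app U x) - φ.τ₂.hom.app U (e.app U x))
        rw [map_sub]
        exact congr_arg₂ (fun a b : S'.X₂.obj.obj V ↦ a - b) h₁
          ((congr_arg (φ.τ₂.hom.app V) h₂).trans h₃) }
  obtain ⟨s, hs⟩ := S'.X₂.exists_global_section hX hP w fun U x y ↦ by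
    have h₁ := h'.sub x y
    have h₂ := congr_arg (φ.τ₂.hom.app (op U)) (h.sub x y)
    have h₃ : φ.τ₂.hom.app (op U) (S.f.hom.app (op U) (c.d x y)) =
        S'.f.hom.app (op U) (φ.τ₁.hom.app (op U) (c.d x y)) :=
      congr_arg (fun a : S.X₁ ⟶ S'.X₂ ↦ a.hom.app (op U) (c.d x y)) φ.comm₁₂.symm
    rw [map_sub, h₃, hc, h₁] at h₂
    exact sub_eq_sub_iff_sub_eq_sub.1 h₂
  have hz : z' = φ.τ₃.hom.app (op X) z + S'.g.hom.app (op X) s := by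
    obtain ⟨T, hT, hT'⟩ := hP X
    refine S'.X₃.section_ext hT fun V k hk ↦ ?_
    have x := (hT' k hk).some
    obtain rfl : k = hX.from V := hX.hom_ext _ _
    have h₁ := congr_arg (S'.g.hom.app (op V)) (hs V x)
    change S'.g.hom.app (op V) ((show S'.X₂.obj.obj (op V) from e'.app (op V) x) -
      φ.τ₂.hom.app (op V) (e.app (op V) x)) = _ at h₁
    have h₂ : S'.g.hom.app (op V) (φ.τ₂.hom.app (op V) (e.app (op V) x)) =
        φ.τ₃.hom.app (op V) (S.g.hom.app (op V) (e.app (op V) x)) :=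
      congr_arg (fun a : S.X₂ ⟶ S'.X₃ ↦ a.hom.app (op V) (e.app (op V) x)) φ.comm₂₃
    rw [map_sub, h₂, h'.lift, h.lift, Sheaf.naturality_apply, Sheaf.naturality_apply,
      sub_eq_iff_eq_add] at h₁
    rw [map_add, h₁, add_comm]
  rw [hz, Sheaf.δ₀_add, Sheaf.δ₀_map, add_zero, Sheaf.δ₀_naturality]

/-- The class of a cocycle does not depend on the way in which it is written as a coboundary, and
it is natural. -/
lemma PresheafCocycle.IsCoboundary.δ₀_eq (hP : LocallyNonempty J P) (hS : S.ShortExact)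
    (hS' : S'.ShortExact) (φ : S.X₁ ⟶ S'.X₁) {c : PresheafCocycle P S.X₁.obj}
    {c' : PresheafCocycle P S'.X₁.obj}
    (hc : ∀ (U : C) (x y : P.obj (op U)), φ.hom.app (op U) (c.d x y) = c'.d x y)
    {z : S.X₃.obj.obj (op X)} {e : P ⟶ S.X₂.obj ⋙ forget AddCommGrpCat.{u}}
    (h : c.IsCoboundary hX z e) {z' : S'.X₃.obj.obj (op X)}
    {e' : P ⟶ S'.X₂.obj ⋙ forget AddCommGrpCat.{u}} (h' : c'.IsCoboundary hX z' e') :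
    (Sheaf.δ₀ hX hS z).comp (Abelian.Ext.mk₀ φ) (add_zero 1) = Sheaf.δ₀ hX hS' z' := by
  have := hS.mono_f
  have := hS'.mono_f
  -- A third sequence S'' with injective middle term receives both others: S' through the embedding
  -- of its middle term, S by extending `φ ≫ i` along `S.f`. The cocycle `c'` is a coboundary there,
  -- and both classes are compared with the resulting one.
  let i : S'.X₁ ⟶ Injective.under S'.X₂ := S'.f ≫ Injective.ι S'.X₂
  let S'' := ShortComplex.mk i (cokernel.π i) (cokernel.condition i)
  have hS'' : S''.ShortExact :=
    { exact := ShortComplex.exact_cokernel i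
      mono_f := inferInstanceAs (Mono i)
      epi_g := inferInstanceAs (Epi (cokernel.π i)) }
  obtain ⟨z'', e'', h''⟩ := c'.exists_isCoboundary hX hP hS''
  have := hS.epi_g
  have := hS'.epi_g
  have hex := hS.exact
  let u : S.X₂ ⟶ S''.X₂ := Injective.factorThru (φ ≫ i) S.f
  have hu : S.f ≫ u = φ ≫ S''.f := Injective.comp_factorThru _ _
  let α : S ⟶ S'' :=
    { τ₁ := φ, τ₂ := u
      τ₃ := hS.exact.desc (u ≫ S''.g) (by rw [reassoc_of% hu, S''.zero, comp_zero])
      comm₁₂ := hu.symm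
      comm₂₃ := (hS.exact.g_desc _ _).symm }
  let β : S' ⟶ S'' :=
    { τ₁ := 𝟙 _, τ₂ := Injective.ι _
      τ₃ := hS'.exact.desc (Injective.ι _ ≫ S''.g) (by
        rw [← Category.assoc]
        exact S''.zero)
      comm₁₂ := Category.id_comp _
      comm₂₃ := (hS'.exact.g_desc _ _).symm }
  refine (PresheafCocycle.IsCoboundary.δ₀_eq_of_hom hX hP hS hS'' α hc h h'').trans ?_
  rw [← PresheafCocycle.IsCoboundary.δ₀_eq_of_hom hX hP hS' hS'' β (c := c') (c' := c')
    (fun _ _ _ ↦ rfl) h' h'']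
  exact Abelian.Ext.comp_mk₀_id _

end Cocycle

end CategoryTheory

/-! ### Families of objects in a fibered category and the presheaves of morphisms between them -/

namespace CategoryTheory

variable {C : Type u} [SmallCategory C]

lemma mapId'_app {B : Type*} [Bicategory B] (F : B ⥤ᵖ Cat.{u, u + 1}) {b : B} (x : F.obj b) :
    (F.mapId' (𝟙 b) rfl).hom.toNatTrans.app x = (F.mapId b).hom.toNatTrans.app x := by
  rw [F.mapId'_eq_mapId]

lemma mapComp'_app {B : Type*} [Bicategory B] (F : B ⥤ᵖ Cat.{u, u + 1}) {a b c : B} (f : a ⟶ b)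
    (g : b ⟶ c) (x : F.obj a) : (F.mapComp' f g (f ≫ g) rfl).hom.toNatTrans.app x =
      (F.mapComp f g).hom.toNatTrans.app x := by
  rw [F.mapComp'_eq_mapComp]

/-- A family of objects of the fibered category `F`, indexed by the sections of the presheaf of
sets `T` and compatible with restriction. -/
structure ObjectFamily (T : Cᵒᵖ ⥤ Type u) (F : LocallyDiscrete Cᵒᵖ ⥤ᵖ Cat.{u, u + 1}) where
  obj {U : C} (t : T.obj (op U)) : F.obj ⟨op U⟩
  iso {U V : C} (k : V ⟶ U) (t : T.obj (op U)) :
    obj (T.map k.op t) ≅ (F.map k.op.toLoc).toFunctor.obj (obj t)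
  iso_id {U : C} {k : U ⟶ U} (hk : k.op.toLoc = 𝟙 _) {t : T.obj (op U)} (ht : T.map k.op t = t) :
    (iso k t).hom ≫ (F.mapId' k.op.toLoc hk).hom.toNatTrans.app (obj t) =
      eqToHom (congr_arg obj ht)
  iso_comp {U V W : C} {k : V ⟶ U} {l : W ⟶ V} {m : W ⟶ U}
    (hm : k.op.toLoc ≫ l.op.toLoc = m.op.toLoc) {t : T.obj (op U)}
    (ht : T.map m.op t = T.map l.op (T.map k.op t)) :
    (iso m t).hom ≫
      (F.mapComp' k.op.toLoc l.op.toLoc m.op.toLoc hm).hom.toNatTrans.app (obj t) =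
      eqToHom (congr_arg obj ht) ≫
        (iso l (T.map k.op t)).hom ≫ (F.map l.op.toLoc).toFunctor.map (iso k t).hom

namespace ObjectFamily

variable {T T' : Cᵒᵖ ⥤ Type u} {F : LocallyDiscrete Cᵒᵖ ⥤ᵖ Cat.{u, u + 1}}
  (σ : ObjectFamily T F) (σ' : ObjectFamily T' F)

/-- Two equal indices define the same object. -/
def eqHom {U : C} {t t' : T.obj (op U)} (h : t = t') : σ.obj t ⟶ σ.obj t' :=
  eqToHom (congr_arg σ.obj h)

@[simp] lemma eqHom_refl {U : C} (t : T.obj (op U)) : σ.eqHom (rfl : t = t) = 𝟙 _ := rfl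

/-- A section of the presheaf of morphisms from `σ` to `σ'`. -/
structure Transporter (U : C) where
  src : T.obj (op U)
  tgt : T'.obj (op U)
  hom : σ.obj src ⟶ σ'.obj tgt

variable {σ σ'} in
lemma Transporter.ext {U : C} {x y : Transporter σ σ' U} (h : x.src = y.src) (h' : x.tgt = y.tgt)
    (hh : x.hom ≫ σ'.eqHom h' = σ.eqHom h ≫ y.hom) : x = y := by
  obtain ⟨s, t, φ⟩ := x
  obtain ⟨s', t', φ'⟩ := y
  obtain rfl : s = s' := h
  obtain rfl : t = t' := h'
  obtain rfl : φ = φ' := by simpa using hh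
  rfl

/-- Restriction of a morphism between two objects of the families. -/
def Transporter.restrict {U V : C} (k : V ⟶ U) (x : Transporter σ σ' U) : Transporter σ σ' V where
  src := T.map k.op x.src
  tgt := T'.map k.op x.tgt
  hom := (σ.iso k x.src).hom ≫ (F.map k.op.toLoc).toFunctor.map x.hom ≫ (σ'.iso k x.tgt).inv

lemma iso_comp_hom {U V W : C} {k : V ⟶ U} {l : W ⟶ V} {m : W ⟶ U}
    (hm : k.op.toLoc ≫ l.op.toLoc = m.op.toLoc) {t : T.obj (op U)}
    (ht : T.map m.op t = T.map l.op (T.map k.op t)) :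
    (σ.iso m t).hom = σ.eqHom ht ≫
        (σ.iso l (T.map k.op t)).hom ≫ (F.map l.op.toLoc).toFunctor.map (σ.iso k t).hom ≫
      (F.mapComp' k.op.toLoc l.op.toLoc m.op.toLoc hm).inv.toNatTrans.app (σ.obj t) := by
  have h := σ.iso_comp hm ht =≫
    (F.mapComp' k.op.toLoc l.op.toLoc m.op.toLoc hm).inv.toNatTrans.app (σ.obj t)
  simpa [eqHom] using h

lemma iso_comp_inv {U V W : C} {k : V ⟶ U} {l : W ⟶ V} {m : W ⟶ U}
    (hm : k.op.toLoc ≫ l.op.toLoc = m.op.toLoc) {t : T.obj (op U)}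
    (ht : T.map m.op t = T.map l.op (T.map k.op t)) :
    (σ.iso m t).inv ≫ σ.eqHom ht =
      (F.mapComp' k.op.toLoc l.op.toLoc m.op.toLoc hm).hom.toNatTrans.app (σ.obj t) ≫
        (F.map l.op.toLoc).toFunctor.map (σ.iso k t).inv ≫ (σ.iso l (T.map k.op t)).inv := by
  rw [Iso.inv_comp_eq, reassoc_of% (σ.iso_comp hm ht), ← Functor.map_comp_assoc]
  simp [eqHom]

lemma Transporter.restrict_id {U : C} {k : U ⟶ U} (hk : k.op.toLoc = 𝟙 _)
    (x : Transporter σ σ' U) (h : T.map k.op x.src = x.src) (h' : T'.map k.op x.tgt = x.tgt) :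
    x.restrict σ σ' k = x := by
  refine Transporter.ext h h' ?_
  have h₁ := σ.iso_id hk h
  have h₂ := σ'.iso_id hk h'
  have h₃ : (σ'.iso k x.tgt).inv ≫ σ'.eqHom h' =
      (F.mapId' k.op.toLoc hk).hom.toNatTrans.app (σ'.obj x.tgt) := by
    rw [Iso.inv_comp_eq]
    exact h₂.symm
  dsimp only [restrict]
  rw [Category.assoc, Category.assoc, h₃, F.mapId'_hom_naturality, reassoc_of% h₁]
  rfl

lemma Transporter.restrict_comp {U V W : C} {k : V ⟶ U} {l : W ⟶ V} {m : W ⟶ U}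
    (hm : k.op.toLoc ≫ l.op.toLoc = m.op.toLoc) (x : Transporter σ σ' U)
    (h : T.map m.op x.src = T.map l.op (T.map k.op x.src))
    (h' : T'.map m.op x.tgt = T'.map l.op (T'.map k.op x.tgt)) :
    x.restrict σ σ' m = (x.restrict σ σ' k).restrict σ σ' l := by
  refine Transporter.ext h h' ?_
  have h₁ := σ.iso_comp_hom hm h
  have h₂ := σ'.iso_comp_inv hm h'
  dsimp only [restrict]
  rw [Category.assoc, Category.assoc, h₂, h₁]
  have h₃ := F.mapComp'_naturality_1 k.op.toLoc l.op.toLoc m.op.toLoc hm x.hom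
  simp only [Category.assoc, Functor.map_comp]
  rw [reassoc_of% h₃]

/-- The presheaf of morphisms from `σ` to `σ'`. -/
def transporter : Cᵒᵖ ⥤ Type u where
  obj U := Transporter σ σ' U.unop
  map k := ↾fun x ↦ x.restrict σ σ' k.unop
  map_id U := by
    ext x
    exact x.restrict_id σ σ' rfl (CategoryTheory.congr_fun (T.map_id U) x.src)
      (CategoryTheory.congr_fun (T'.map_id U) x.tgt)
  map_comp k l := by
    ext x
    exact x.restrict_comp σ σ' rfl (CategoryTheory.congr_fun (T.map_comp k l) x.src)
      (CategoryTheory.congr_fun (T'.map_comp k l) x.tgt)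

/-- The family of the restrictions of a global object. -/
def ofObj {X : C} (hX : IsTerminal X) (y : F.obj ⟨op X⟩) :
    ObjectFamily ((Functor.const _).obj PUnit) F where
  obj {U} _ := (F.map (hX.from U).op.toLoc).toFunctor.obj y
  iso {U V} k _ := (Cat.Hom.toNatIso (F.mapComp' (hX.from U).op.toLoc k.op.toLoc
    (hX.from V).op.toLoc (by rw [← hX.hom_ext (k ≫ hX.from U) (hX.from V)]; rfl))).app y
  iso_id {U k} hk t ht := by
    obtain rfl : k = 𝟙 U := Quiver.Hom.op_inj (congr_arg (fun m ↦ m.as) hk)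
    have h := F.mapComp'_comp_id_hom_app (hX.from U).op.toLoc y
    refine (congr_arg₂ (fun a b ↦ a ≫ b) h (mapId'_app F _)).trans ?_
    simp
  iso_comp {U V W k l m} hm t ht := by
    have h := F.mapComp'₀₁₃_hom_comp_whiskerLeft_mapComp'_hom_app (hX.from U).op.toLoc k.op.toLoc
      l.op.toLoc (hX.from V).op.toLoc m.op.toLoc (hX.from W).op.toLoc
      (by rw [← hX.hom_ext (k ≫ hX.from U) (hX.from V)]; rfl) hm
      (by rw [← hX.hom_ext (m ≫ hX.from U) (hX.from W)]; rfl) y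
    refine h.trans ?_
    simp

section Translation

variable {A B : Cᵒᵖ ⥤ AddCommGrpCat.{u}} {d : A ⟶ B}
  {P : Subfunctor (B ⋙ forget AddCommGrpCat.{u})}
  (θ : Pseudofunctor.StrongTrans (translations d P) F)

/-- The object of the fibered category of translations defined by a section of `P`. -/
def translationObj {U : C} (t : P.toFunctor.obj (op U)) : TranslationObj d P U := ⟨t.1, t.2⟩

lemma map_isoOfEq {U : C} {t t' : P.toFunctor.obj (op U)} (h : t = t') :
    (θ.app ⟨op U⟩).toFunctor.map (TranslationObj.isoOfEq (t := translationObj t)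
      (t' := translationObj t') (congr_arg Subtype.val h)).hom =
    eqToHom (congr_arg (fun t ↦ (θ.app ⟨op U⟩).toFunctor.obj (translationObj t)) h) := by
  subst h
  exact (θ.app ⟨op U⟩).toFunctor.map_id _

/-- The family of the images of the objects of the fibered category of translations. -/
def ofStrongTrans : ObjectFamily P.toFunctor F where
  obj {U} t := (θ.app ⟨op U⟩).toFunctor.obj (translationObj t)
  iso {U V} k t := (Cat.Hom.toNatIso (θ.naturality k.op.toLoc)).app (translationObj t)
  iso_id {U k} hk t ht := by
    obtain rfl : k = 𝟙 U := Quiver.Hom.op_inj (congr_arg (fun m ↦ m.as) hk)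
    have h := congr_arg (fun φ ↦ (Cat.Hom₂.toNatTrans φ).app (translationObj t))
      (θ.naturality_id ⟨op U⟩)
    refine (congr_arg (_ ≫ ·) (mapId'_app F _)).trans (h.trans ?_)
    refine Eq.trans ?_ (map_isoOfEq θ ht)
    exact (congr_arg (_ ≫ ·) (Category.comp_id _)).trans (Category.comp_id _)
  iso_comp {U V W k l m} hm t ht := by
    obtain rfl : m = l ≫ k := Quiver.Hom.op_inj (congr_arg (fun m ↦ m.as) hm).symm
    have h := congr_arg (fun φ ↦ (Cat.Hom₂.toNatTrans φ).app (translationObj t))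
      (θ.naturality_comp k.op.toLoc l.op.toLoc)
    refine (congr_arg (_ ≫ ·) (mapComp'_app F k.op.toLoc l.op.toLoc _)).trans (h.trans ?_)
    rw [← map_isoOfEq θ ht]
    refine congr_arg (_ ≫ ·) ?_
    refine (Category.id_comp _).trans ?_
    refine congr_arg (_ ≫ ·) ?_
    exact (Category.id_comp _).trans (Category.comp_id _)

end Translation

end ObjectFamily

end CategoryTheory

/-! ### Comparison of two morphisms from liftings to the same banded fibered category -/

namespace CategoryTheory

variable {C : Type u} [SmallCategory C] {F : LocallyDiscrete Cᵒᵖ ⥤ᵖ Cat.{u, u + 1}}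

namespace ObjectFamily

section Translation

variable {A B : Cᵒᵖ ⥤ AddCommGrpCat.{u}} {d : A ⟶ B}
  {P : Subfunctor (B ⋙ forget AddCommGrpCat.{u})}
  (θ : Pseudofunctor.StrongTrans (translations d P) F)

/-- The image under `θ` of a morphism of the fibered category of translations. -/
def hom {U : C} {t s : P.toFunctor.obj (op U)} (ξ : A.obj (op U))
    (h : (t.1 : B.obj (op U)) = s.1 + d.app (op U) ξ) :
    (ofStrongTrans θ).obj t ⟶ (ofStrongTrans θ).obj s :=
  (θ.app ⟨op U⟩).toFunctor.map
    (show translationObj (d := d) t ⟶ translationObj s from TranslationObj.Hom.mk ξ h)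

lemma hom_comp_hom {U : C} {t s r : P.toFunctor.obj (op U)} {ξ η : A.obj (op U)}
    (h : (t.1 : B.obj (op U)) = s.1 + d.app (op U) ξ)
    (h' : (s.1 : B.obj (op U)) = r.1 + d.app (op U) η) :
    hom θ ξ h ≫ hom θ η h' = hom θ (ξ + η) (by rw [h, h', map_add]; abel) :=
  ((θ.app ⟨op U⟩).toFunctor.map_comp _ _).symm

lemma hom_zero {U : C} {t s : P.toFunctor.obj (op U)} (h : t = s)
    (h' : (t.1 : B.obj (op U)) = s.1 + d.app (op U) 0) :
    hom θ 0 h' = (ofStrongTrans θ).eqHom h := by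
  subst h
  exact (θ.app ⟨op U⟩).toFunctor.map_id _

lemma hom_restrict {U V : C} {t s : P.toFunctor.obj (op U)} {ξ : A.obj (op U)}
    (h : (t.1 : B.obj (op U)) = s.1 + d.app (op U) ξ) (k : V ⟶ U)
    (h' : ((P.toFunctor.map k.op t).1 : B.obj (op V)) =
      (P.toFunctor.map k.op s).1 + d.app (op V) (A.map k.op ξ)) :
    hom θ (A.map k.op ξ) h' ≫ ((ofStrongTrans θ).iso k s).hom =
      ((ofStrongTrans θ).iso k t).hom ≫ (F.map k.op.toLoc).toFunctor.map (hom θ ξ h) :=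
  (θ.naturality k.op.toLoc).hom.toNatTrans.naturality
    (show translationObj (d := d) t ⟶ translationObj s from TranslationObj.Hom.mk ξ h)

lemma restrict_eq {U V : C} {t s : P.toFunctor.obj (op U)} {ξ : A.obj (op U)}
    (h : (t.1 : B.obj (op U)) = s.1 + d.app (op U) ξ) (k : V ⟶ U) :
    ((P.toFunctor.map k.op t).1 : B.obj (op V)) =
      (P.toFunctor.map k.op s).1 + d.app (op V) (A.map k.op ξ) :=
  ((TranslationObj.restrict k).map
    (show translationObj (d := d) t ⟶ translationObj s from TranslationObj.Hom.mk ξ h)).eq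

end Translation

end ObjectFamily

variable {J : GrothendieckTopology C} {A : Sheaf J AddCommGrpCat.{u}} {X : C}

/-- The morphism `θ` is compatible with the actions of `A` on automorphisms. -/
def Banding.IsCompatible (b : Banding F A.obj) {K : TwoStepResolution A} {hX : IsTerminal X}
    {z : K.Z.obj.obj (op X)} (θ : Pseudofunctor.StrongTrans (K.liftings hX z) F) : Prop :=
  ∀ (U : C) (t : TranslationObj (K.p ≫ K.j).hom (fiberSubfunctor hX K.q.hom z) U)
    (a : A.obj.obj (op U)),
    (θ.app ⟨op U⟩).toFunctor.map (t.autOfKer (K.ι.hom.app (op U) a) (K.d_ι a)) =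
      b.act ((θ.app ⟨op U⟩).toFunctor.obj t) a

namespace TwoStepResolution

variable (K K' : TwoStepResolution A) (hX : IsTerminal X)
  {z : K.Z.obj.obj (op X)} {z' : K'.Z.obj.obj (op X)}

lemma sub_eq_zero_of_eq_add {G : Type*} [AddCommGroup G] {x y a b : G} (h : x = y + a)
    (h' : x = y + b) : a - b = 0 := by
  rw [sub_eq_zero]
  exact add_left_cancel (h.symm.trans h')

/-- Since `j` is injective on sections, `d` and `p` have the same kernel. Hence the automorphisms of
a lifting are exactly the sections of A. -/
lemma eq_ι_of_d_eq_zero {U : C} (ξ : K.I₀.obj.obj (op U))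
    (h : (K.p ≫ K.j).hom.app (op U) ξ = 0) :
    ∃ a : A.obj.obj (op U), K.ι.hom.app (op U) a = ξ := by
  refine Sheaf.exists_of_shortExact K.shortExact₀ ξ ?_
  refine Sheaf.injective_of_shortExact K.shortExact₁ U ?_
  exact h.trans (map_zero (K.j.hom.app (op U)).hom).symm

lemma exists_local_d {U : C} (x : K.I₁.obj.obj (op U)) (hx : K.q.hom.app (op U) x = 0) :
    ∃ T ∈ J U, ∀ ⦃V : C⦄ (k : V ⟶ U), T k → ∃ ξ : K.I₀.obj.obj (op V),
      (K.p ≫ K.j).hom.app (op V) ξ = K.I₁.obj.map k.op x := by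
  obtain ⟨y, rfl⟩ := Sheaf.exists_of_shortExact K.shortExact₁ x hx
  have := K.shortExact₀.epi_g
  have hp : Epi K.p := this
  obtain ⟨T, hT, h⟩ := Sheaf.exists_local_lift K.p y
  refine ⟨T, hT, fun V k hk ↦ ?_⟩
  obtain ⟨ξ, hξ⟩ := h k hk
  refine ⟨ξ, ?_⟩
  exact (congr_arg (K.j.hom.app (op V)) hξ).trans (Sheaf.naturality_apply K.j k y)

/-- The difference of two liftings of z is a section of Q, which comes from I⁰ locally. -/
lemma exists_local_hom {U : C} (t s : (fiberSubfunctor hX K.q.hom z).toFunctor.obj (op U)) :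
    ∃ T ∈ J U, ∀ ⦃V : C⦄ (k : V ⟶ U), T k → ∃ ξ : K.I₀.obj.obj (op V),
      (((fiberSubfunctor hX K.q.hom z).toFunctor.map k.op t).1 : K.I₁.obj.obj (op V)) =
        ((fiberSubfunctor hX K.q.hom z).toFunctor.map k.op s).1 +
          (K.p ≫ K.j).hom.app (op V) ξ := by
  obtain ⟨T, hT, h⟩ := K.exists_local_d ((t.1 : K.I₁.obj.obj (op U)) - s.1) (by
    refine (map_sub (K.q.hom.app (op U)).hom _ _).trans ?_
    exact sub_eq_zero.2 (t.2.trans (show _ = _ from s.2).symm))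
  refine ⟨T, hT, fun V k hk ↦ ?_⟩
  obtain ⟨ξ, hξ⟩ := h k hk
  refine ⟨ξ, ?_⟩
  rw [hξ]
  exact ((congr_arg (K.I₁.obj.map k.op s.1 + ·)
    (map_sub (K.I₁.obj.map k.op).hom (t.1 : K.I₁.obj.obj (op U)) s.1)).trans
      (add_sub_cancel (K.I₁.obj.map k.op s.1) (K.I₁.obj.map k.op t.1))).symm

variable {K K' hX} (θ : Pseudofunctor.StrongTrans (K.liftings hX z) F)
  (θ' : Pseudofunctor.StrongTrans (K'.liftings hX z') F)

open ObjectFamily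

/-- The sections `ξ` and `ξ'` define a morphism from `x` to `y`. -/
def Rel {U : C} (x y : Transporter (ofStrongTrans θ) (ofStrongTrans θ') U)
    (ξ : K.I₀.obj.obj (op U)) (ξ' : K'.I₀.obj.obj (op U)) : Prop :=
  ∃ (h : (x.src.1 : K.I₁.obj.obj (op U)) = y.src.1 + (K.p ≫ K.j).hom.app (op U) ξ)
    (h' : (x.tgt.1 : K'.I₁.obj.obj (op U)) = y.tgt.1 + (K'.p ≫ K'.j).hom.app (op U) ξ'),
    hom θ ξ h ≫ y.hom = x.hom ≫ hom θ' ξ' h'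

variable {θ θ'}

lemma Rel.restrict {U V : C} {x y : Transporter (ofStrongTrans θ) (ofStrongTrans θ') U}
    {ξ : K.I₀.obj.obj (op U)} {ξ' : K'.I₀.obj.obj (op U)} (h : Rel θ θ' x y ξ ξ') (k : V ⟶ U) :
    Rel θ θ' (x.restrict _ _ k) (y.restrict _ _ k) (K.I₀.obj.map k.op ξ)
      (K'.I₀.obj.map k.op ξ') := by
  obtain ⟨h₁, h₂, h₃⟩ := h
  refine ⟨restrict_eq h₁ k, restrict_eq h₂ k, ?_⟩
  dsimp only [Transporter.restrict]
  have h₄ := hom_restrict θ h₁ k (restrict_eq h₁ k)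
  have h₅ := hom_restrict θ' h₂ k (restrict_eq h₂ k)
  rw [reassoc_of% h₄, ← Functor.map_comp_assoc, h₃, Functor.map_comp_assoc, Category.assoc,
    Category.assoc]
  congr 2
  rw [Iso.eq_inv_comp, ← reassoc_of% h₅]
  simp

lemma Rel.add {U : C} {x y w : Transporter (ofStrongTrans θ) (ofStrongTrans θ') U}
    {ξ η : K.I₀.obj.obj (op U)} {ξ' η' : K'.I₀.obj.obj (op U)} (h : Rel θ θ' x y ξ ξ')
    (h' : Rel θ θ' y w η η') : Rel θ θ' x w (ξ + η) (ξ' + η') := by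
  obtain ⟨h₁, h₂, h₃⟩ := h
  obtain ⟨h₁', h₂', h₃'⟩ := h'
  refine ⟨_, _, (congr_arg (· ≫ w.hom) (hom_comp_hom θ h₁ h₁')).symm.trans (Eq.trans ?_
    (congr_arg (x.hom ≫ ·) (hom_comp_hom θ' h₂ h₂')))⟩
  rw [Category.assoc, h₃', reassoc_of% h₃]

section Band

variable {b : Banding F A.obj} (hθ : b.IsCompatible θ) (hθ' : b.IsCompatible θ')

lemma hom_ι_add (hθ : b.IsCompatible θ) {U : C}
    {t s : (fiberSubfunctor hX K.q.hom z).toFunctor.obj (op U)} {ξ : K.I₀.obj.obj (op U)}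
    (h : (t.1 : K.I₁.obj.obj (op U)) = s.1 + (K.p ≫ K.j).hom.app (op U) ξ)
    (a : A.obj.obj (op U))
    (h' : (t.1 : K.I₁.obj.obj (op U)) = s.1 +
      (K.p ≫ K.j).hom.app (op U) (K.ι.hom.app (op U) a + ξ)) :
    hom θ (K.ι.hom.app (op U) a + ξ) h' = b.act ((ofStrongTrans θ).obj t) a ≫ hom θ ξ h := by
  have h₁ := hθ U (translationObj t) a
  refine Eq.trans ?_ (congr_arg (· ≫ hom θ ξ h) h₁)
  exact (θ.app ⟨op U⟩).toFunctor.map_comp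
    ((translationObj t).autOfKer (K.ι.hom.app (op U) a) (K.d_ι a))
    (show translationObj (d := (K.p ≫ K.j).hom) t ⟶ translationObj s from
      TranslationObj.Hom.mk ξ h)

/-- Each component is unique up to a section of A. The band commutes with morphisms, so in the
relation one section acts from the left and the other from the right on the same isomorphism; as A
acts faithfully, the two sections coincide. The ambiguity is therefore the diagonal A. -/
lemma Rel.unique (hθ : b.IsCompatible θ) (hθ' : b.IsCompatible θ')
    (hF : ∀ {U : C} {x y : F.obj ⟨op U⟩} (φ : x ⟶ y), IsIso φ) {U : C}
    {x y : Transporter (ofStrongTrans θ) (ofStrongTrans θ') U}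
    {ξ η : K.I₀.obj.obj (op U)} {ξ' η' : K'.I₀.obj.obj (op U)} (h : Rel θ θ' x y ξ ξ')
    (h' : Rel θ θ' x y η η') :
    ∃ a : A.obj.obj (op U), ξ = K.ι.hom.app (op U) a + η ∧ ξ' = K'.ι.hom.app (op U) a + η' := by
  obtain ⟨h₁, h₂, h₃⟩ := h
  obtain ⟨h₁', h₂', h₃'⟩ := h'
  obtain ⟨a, ha⟩ := K.eq_ι_of_d_eq_zero (ξ - η)
    ((map_sub ((K.p ≫ K.j).hom.app (op U)).hom _ _).trans
      (sub_eq_zero_of_eq_add h₁ h₁'))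
  obtain ⟨a', ha'⟩ := K'.eq_ι_of_d_eq_zero (ξ' - η')
    ((map_sub ((K'.p ≫ K'.j).hom.app (op U)).hom _ _).trans
      (sub_eq_zero_of_eq_add h₂ h₂'))
  obtain rfl := eq_add_of_sub_eq ha.symm
  obtain rfl := eq_add_of_sub_eq ha'.symm
  refine ⟨a, rfl, ?_⟩
  rw [hom_ι_add hθ h₁' a, hom_ι_add hθ' h₂' a', Category.assoc, h₃'] at h₃
  have h₄ : b.act ((ofStrongTrans θ').obj x.tgt) a = b.act ((ofStrongTrans θ').obj x.tgt) a' := by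
    have := hF x.hom
    have := hF (hom θ' η' h₂')
    have h₅ := b.naturality x.hom a
    rw [← cancel_epi x.hom, ← cancel_mono (hom θ' η' h₂'), Category.assoc, Category.assoc, ← h₃]
    simp only [← Category.assoc]
    exact congr_arg (· ≫ _) h₅.symm
  have h₅ : a = a' := Multiplicative.ofAdd.injective ((b.aut _).injective (Iso.ext h₄))
  rw [h₅]

/-- Locally there are ξ and ξ' relating the sources and the targets. The resulting square commutes
up to an automorphism, which is the action of a section `a` of the band; replacing ξ by ι a + ξ
repairs it. -/
lemma Rel.exists (hθ : b.IsCompatible θ)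
    (hF : ∀ {U : C} {x y : F.obj ⟨op U⟩} (φ : x ⟶ y), IsIso φ) {U : C}
    (x y : Transporter (ofStrongTrans θ) (ofStrongTrans θ') U) :
    ∃ T ∈ J U, ∀ ⦃V : C⦄ (k : V ⟶ U), T k → ∃ (ξ : K.I₀.obj.obj (op V))
      (ξ' : K'.I₀.obj.obj (op V)),
      Rel θ θ' (x.restrict _ _ k) (y.restrict _ _ k) ξ ξ' := by
  obtain ⟨T, hT, h⟩ := K.exists_local_hom hX x.src y.src
  obtain ⟨T', hT', h'⟩ := K'.exists_local_hom hX x.tgt y.tgt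
  refine ⟨T ⊓ T', J.intersection_covering hT hT', fun V k hk ↦ ?_⟩
  obtain ⟨ξ, hξ⟩ := h k hk.1
  obtain ⟨ξ', hξ'⟩ := h' k hk.2
  generalize hx' : x.restrict _ _ k = x'
  generalize hy' : y.restrict _ _ k = y'
  have hξ : (x'.src.1 : K.I₁.obj.obj (op V)) = y'.src.1 + (K.p ≫ K.j).hom.app (op V) ξ := by
    rw [← hx', ← hy']
    exact hξ
  have hξ' : (x'.tgt.1 : K'.I₁.obj.obj (op V)) =
      y'.tgt.1 + (K'.p ≫ K'.j).hom.app (op V) ξ' := by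
    rw [← hx', ← hy']
    exact hξ'
  have := hF (hom θ ξ hξ)
  have := hF y'.hom
  have := hF x'.hom
  have := hF (hom θ' ξ' hξ')
  let e := asIso (x'.hom ≫ hom θ' ξ' hξ') ≪≫ (asIso (hom θ ξ hξ ≫ y'.hom)).symm
  obtain ⟨a, ha⟩ := (b.aut _).surjective e
  refine ⟨K.ι.hom.app (op V) a.toAdd + ξ, ξ', ?_, hξ', ?_⟩
  · rw [map_add, K.d_ι, zero_add]
    exact hξ
  · rw [hom_ι_add hθ hξ]
    have h₁ := congr_arg Iso.hom ha
    have h₂ : e.hom ≫ hom θ ξ hξ ≫ y'.hom = x'.hom ≫ hom θ' ξ' hξ' := by simp [e]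
    exact (Category.assoc _ _ _).trans ((congr_arg (· ≫ _) h₁).trans h₂)

end Band

end TwoStepResolution

end CategoryTheory

/-! ### The class of a banded gerbe is well defined -/

namespace CategoryTheory

variable {C : Type u} [SmallCategory C] {F : LocallyDiscrete Cᵒᵖ ⥤ᵖ Cat.{u, u + 1}}
  {J : GrothendieckTopology C} {A : Sheaf J AddCommGrpCat.{u}} {X : C}

/-- The image of a cocycle under a morphism of sheaves. -/
def PresheafCocycle.map {P : Cᵒᵖ ⥤ Type u} {G G' : Sheaf J AddCommGrpCat.{u}}
    (c : PresheafCocycle P G.obj) (φ : G ⟶ G') : PresheafCocycle P G'.obj where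
  d {U} x y := φ.hom.app (op U) (c.d x y)
  d_add {U} x y w := by
    refine (map_add (φ.hom.app (op U)).hom _ _).symm.trans ?_
    exact congr_arg (φ.hom.app (op U)) (c.d_add x y w)
  map_d k x y := by
    rw [← Sheaf.naturality_apply, c.map_d]

namespace TwoStepResolution

variable {K K' : TwoStepResolution A} {hX : IsTerminal X}
  {z : K.Z.obj.obj (op X)} {z' : K'.Z.obj.obj (op X)}

lemma δδ_eq_δ₀_comp (z : K.Z.obj.obj (op X)) :
    K.δδ hX z = (Sheaf.δ₀ hX K.shortExact₁ z).comp K.shortExact₀.extClass rfl := rfl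

/-- The class `δδ z` computed by means of a cocycle with values in an extension of `A`. -/
lemma δδ_eq {P : Cᵒᵖ ⥤ Type u} (hP : LocallyNonempty J P) {M G J₀ W : Sheaf J AddCommGrpCat.{u}}
    {i : A ⟶ M} {π : M ⟶ G} {hi : i ≫ π = 0} (hE : (ShortComplex.mk i π hi).ShortExact)
    {a : M ⟶ K.I₀} {v : G ⟶ K.Q} (ha : i ≫ a = K.ι) (hv : π ≫ v = a ≫ K.p)
    {m : G ⟶ J₀} {n : J₀ ⟶ W} {hm : m ≫ n = 0} (hS : (ShortComplex.mk m n hm).ShortExact)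
    {c : PresheafCocycle P G.obj} {w : W.obj.obj (op X)} {e : P ⟶ J₀.obj ⋙ forget AddCommGrpCat.{u}}
    (h : c.IsCoboundary (S := ShortComplex.mk m n hm) hX w e)
    {e' : P ⟶ K.I₁.obj ⋙ forget AddCommGrpCat.{u}}
    (h' : (c.map v).IsCoboundary (S := ShortComplex.mk K.j K.q K.j_q) hX z e') :
    K.δδ hX z = (Sheaf.δ₀ hX hS w).comp hE.extClass rfl := by
  have h₁ : (Sheaf.δ₀ hX hS w).comp (Abelian.Ext.mk₀ v) (add_zero 1) =
      Sheaf.δ₀ hX K.shortExact₁ z :=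
    PresheafCocycle.IsCoboundary.δ₀_eq hX hP hS K.shortExact₁ v (fun _ _ _ ↦ rfl) h h'
  let f : ShortComplex.mk i π hi ⟶ ShortComplex.mk K.ι K.p K.ι_p :=
    { τ₁ := 𝟙 _, τ₂ := a, τ₃ := v
      comm₁₂ := (Category.id_comp _).trans ha.symm
      comm₂₃ := hv.symm }
  -- The morphism of extensions is the identity on A, so the extension by `M` is the pullback along
  -- `v` of the first sequence of `K`.
  have h₂ : (Abelian.Ext.mk₀ v).comp K.shortExact₀.extClass (zero_add 1) = hE.extClass :=
    (ShortComplex.ShortExact.extClass_naturality hE K.shortExact₀ f).symm.trans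
      (Abelian.Ext.comp_mk₀_id hE.extClass)
  rw [δδ_eq_δ₀_comp, ← h₁, ← h₂]
  exact Abelian.Ext.comp_assoc_of_second_deg_zero _ _ _ _

variable (K) in
lemma exists_local_lifting (z : K.Z.obj.obj (op X)) (U : C) : ∃ T ∈ J U, ∀ ⦃V : C⦄ (k : V ⟶ U), T k →
    Nonempty ((fiberSubfunctor hX K.q.hom z).toFunctor.obj (op V)) := by
  have := K.shortExact₁.epi_g
  have hq : Epi K.q := this
  obtain ⟨T, hT, h⟩ := Sheaf.exists_local_lift K.q (K.Z.obj.map (hX.from U).op z)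
  refine ⟨T, hT, fun V k hk ↦ ?_⟩
  obtain ⟨y, hy⟩ := h k hk
  exact ⟨⟨y, hy.trans (K.Z.map_terminal_apply hX k z)⟩⟩

open ObjectFamily

/-- Liftings of both sections exist locally, and any two objects of a gerbe are locally isomorphic.
-/
lemma locallyNonempty_transporter (hF : IsGerbe J F) (θ : Pseudofunctor.StrongTrans (K.liftings hX z) F)
    (θ' : Pseudofunctor.StrongTrans (K'.liftings hX z') F) :
    LocallyNonempty J (transporter (ofStrongTrans θ) (ofStrongTrans θ')) := by
  intro U
  obtain ⟨T, hT, h⟩ := K.exists_local_lifting (hX := hX) z U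
  obtain ⟨T', hT', h'⟩ := K'.exists_local_lifting (hX := hX) z' U
  have (V : C) (k : V ⟶ U) (hk : (T ⊓ T') k) : ∃ R ∈ J V, ∀ ⦃W : C⦄ (l : W ⟶ V), R l →
      Nonempty ((transporter (ofStrongTrans θ) (ofStrongTrans θ')).obj (op W)) := by
    obtain ⟨t⟩ := h k hk.1
    obtain ⟨t'⟩ := h' k hk.2
    obtain ⟨R, hR, h''⟩ := hF.locally_iso ((ofStrongTrans θ).obj t) ((ofStrongTrans θ').obj t')
    refine ⟨R, hR, fun W l hl ↦ ?_⟩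
    obtain ⟨e⟩ := h'' l hl
    exact ⟨⟨_, _, ((ofStrongTrans θ).iso l t).hom ≫ e.hom ≫ ((ofStrongTrans θ').iso l t').inv⟩⟩
  choose R hR hR' using this
  refine ⟨Sieve.bind (T ⊓ T') R, J.bind_covering (J.intersection_covering hT hT') hR, ?_⟩
  rintro W _ ⟨V, l, k, hk, hl, rfl⟩
  exact hR' V k hk l hl

section Difference

variable (K K')

/-- The inclusion of the band in the sum of the two resolutions. -/
noncomputable def diagonal : A ⟶ K.I₀ ⊞ K'.I₀ := biprod.lift K.ι K'.ι

lemma shortExact_diagonal : (ShortComplex.mk (diagonal K K') (cokernel.π (diagonal K K'))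
    (cokernel.condition _)).ShortExact where
  exact := ShortComplex.exact_cokernel _
  mono_f := by
    have := K.shortExact₀.mono_f
    have : Mono K.ι := this
    have : Mono (diagonal K K' ≫ biprod.fst) := by
      rw [diagonal, biprod.lift_fst]
      infer_instance
    exact mono_of_mono (diagonal K K') biprod.fst
  epi_g := inferInstanceAs (Epi (cokernel.π (diagonal K K')))

/-- The class of a pair of sections. -/
noncomputable def pairClass {U : C} (ξ : K.I₀.obj.obj (op U)) (ξ' : K'.I₀.obj.obj (op U)) :
    (cokernel (diagonal K K')).obj.obj (op U) :=
  (biprod.inl ≫ cokernel.π (diagonal K K')).hom.app (op U) ξ +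
    (biprod.inr ≫ cokernel.π (diagonal K K')).hom.app (op U) ξ'

lemma map_pairClass {U V : C} (k : V ⟶ U) (ξ : K.I₀.obj.obj (op U)) (ξ' : K'.I₀.obj.obj (op U)) :
    (cokernel (diagonal K K')).obj.map k.op (pairClass K K' ξ ξ') =
      pairClass K K' (K.I₀.obj.map k.op ξ) (K'.I₀.obj.map k.op ξ') := by
  rw [pairClass, pairClass, map_add, Sheaf.naturality_apply, Sheaf.naturality_apply]

lemma pairClass_add {U : C} (ξ η : K.I₀.obj.obj (op U)) (ξ' η' : K'.I₀.obj.obj (op U)) :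
    pairClass K K' (ξ + η) (ξ' + η') = pairClass K K' ξ ξ' + pairClass K K' η η' := by
  rw [pairClass, map_add, map_add]
  exact add_add_add_comm _ _ _ _

lemma pairClass_ι {U : C} (a : A.obj.obj (op U)) :
    pairClass K K' (K.ι.hom.app (op U) a) (K'.ι.hom.app (op U) a) = 0 := by
  have h : (K.ι ≫ biprod.inl + K'.ι ≫ biprod.inr) ≫ cokernel.π (diagonal K K') = 0 := by
    rw [← biprod.lift_eq]
    exact cokernel.condition _
  rw [Preadditive.add_comp, Category.assoc, Category.assoc] at h
  exact congr_arg (fun φ : A ⟶ cokernel (diagonal K K') ↦ φ.hom.app (op U) a) h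

lemma fst_pairClass {G : Sheaf J AddCommGrpCat.{u}} (v : K.I₀ ⊞ K'.I₀ ⟶ G)
    (h : diagonal K K' ≫ v = 0) {U : C} (ξ : K.I₀.obj.obj (op U)) (ξ' : K'.I₀.obj.obj (op U)) :
    (cokernel.desc (diagonal K K') v h).hom.app (op U) (pairClass K K' ξ ξ') =
      (biprod.inl ≫ v).hom.app (op U) ξ + (biprod.inr ≫ v).hom.app (op U) ξ' := by
  rw [pairClass, map_add, ← Sheaf.comp_apply, ← Sheaf.comp_apply, Category.assoc, Category.assoc,
    cokernel.π_desc]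

end Difference

section Cocycle

variable {b : Banding F A.obj} {θ : Pseudofunctor.StrongTrans (K.liftings hX z) F}
  {θ' : Pseudofunctor.StrongTrans (K'.liftings hX z') F}

lemma restrict_restrict {U V W : C} (x : Transporter (ofStrongTrans θ) (ofStrongTrans θ') U)
    (k : V ⟶ U) (l : W ⟶ V) :
    x.restrict _ _ (l ≫ k) = (x.restrict _ _ k).restrict _ _ l :=
  CategoryTheory.congr_fun
    ((transporter (ofStrongTrans θ) (ofStrongTrans θ')).map_comp k.op l.op) x

/-- Related pairs (ξ, ξ') exist only locally and are unique up to the diagonal A; in the cokernel of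
the diagonal they become unique, so their classes glue. -/
lemma exists_pairClass (hθ : b.IsCompatible θ) (hθ' : b.IsCompatible θ') (hF : IsGerbe J F) {U : C}
    (x y : Transporter (ofStrongTrans θ) (ofStrongTrans θ') U) :
    ∃ g : (cokernel (diagonal K K')).obj.obj (op U), ∀ ⦃V : C⦄ (k : V ⟶ U)
      (ξ : K.I₀.obj.obj (op V)) (ξ' : K'.I₀.obj.obj (op V)),
      Rel θ θ' (x.restrict _ _ k) (y.restrict _ _ k) ξ ξ' →
        (cokernel (diagonal K K')).obj.map k.op g = pairClass K K' ξ ξ' := by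
  obtain ⟨T, hT, h⟩ := Rel.exists hθ hF.isIso x y
  obtain ⟨g, hg⟩ := (cokernel (diagonal K K')).isSheaf_forget.exists_section
    (r := fun V k g ↦ ∃ (ξ : K.I₀.obj.obj (op V)) (ξ' : K'.I₀.obj.obj (op V)),
      Rel θ θ' (x.restrict _ _ k) (y.restrict _ _ k) ξ ξ' ∧ g = pairClass K K' ξ ξ')
    (by
      rintro V W k l _ ⟨ξ, ξ', h₁, rfl⟩
      refine ⟨_, _, ?_, map_pairClass K K' l ξ ξ'⟩
      have h₂ := h₁.restrict l
      have hx := restrict_restrict (θ := θ) (θ' := θ') x k l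
      have hy := restrict_restrict (θ := θ) (θ' := θ') y k l
      rw [hx, hy]
      exact h₂)
    (by
      rintro V k _ _ ⟨ξ, ξ', h₁, rfl⟩ ⟨η, η', h₂, rfl⟩
      obtain ⟨a, rfl, rfl⟩ := h₁.unique hθ hθ' hF.isIso h₂
      rw [pairClass_add, pairClass_ι, zero_add])
    hT (fun V k hk ↦ by
      obtain ⟨ξ, ξ', h₁⟩ := h k hk
      exact ⟨_, ξ, ξ', h₁, rfl⟩)
  exact ⟨g, fun V k ξ ξ' h₁ ↦ hg k _ ⟨ξ, ξ', h₁, rfl⟩⟩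

end Cocycle

end TwoStepResolution

end CategoryTheory

namespace CategoryTheory

variable {C : Type u} [SmallCategory C] {F : LocallyDiscrete Cᵒᵖ ⥤ᵖ Cat.{u, u + 1}}
  {J : GrothendieckTopology C} {A : Sheaf J AddCommGrpCat.{u}} {X : C}

namespace TwoStepResolution

variable {K K' : TwoStepResolution A} {hX : IsTerminal X}
  {z : K.Z.obj.obj (op X)} {z' : K'.Z.obj.obj (op X)}

open ObjectFamily

variable {b : Banding F A.obj} {θ : Pseudofunctor.StrongTrans (K.liftings hX z) F}
  {θ' : Pseudofunctor.StrongTrans (K'.liftings hX z') F}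

/-- The cocycle which compares the differences of the sources and of the targets. -/
noncomputable def pairCocycle (hθ : b.IsCompatible θ) (hθ' : b.IsCompatible θ')
    (hF : IsGerbe J F) : PresheafCocycle (transporter (ofStrongTrans θ) (ofStrongTrans θ'))
      (cokernel (diagonal K K')).obj where
  d x y := (exists_pairClass hθ hθ' hF x y).choose
  d_add {U} x y w := by
    obtain ⟨T, hT, h⟩ := Rel.exists hθ hF.isIso x y
    obtain ⟨T', hT', h'⟩ := Rel.exists hθ hF.isIso y w
    refine Sheaf.section_ext _ (J.intersection_covering hT hT') fun V k hk ↦ ?_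
    obtain ⟨ξ, ξ', h₁⟩ := h k hk.1
    obtain ⟨η, η', h₂⟩ := h' k hk.2
    have e₁ := (exists_pairClass hθ hθ' hF x y).choose_spec k ξ ξ' h₁
    have e₂ := (exists_pairClass hθ hθ' hF y w).choose_spec k η η' h₂
    have e₃ := (exists_pairClass hθ hθ' hF x w).choose_spec k _ _ (h₁.add h₂)
    rw [e₃, map_add, e₁, e₂, pairClass_add]
  map_d {U V} k x y := by
    obtain ⟨T, hT, h⟩ := Rel.exists hθ hF.isIso (x.restrict _ _ k) (y.restrict _ _ k)
    refine Sheaf.section_ext _ hT fun W l hl ↦ ?_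
    obtain ⟨ξ, ξ', h₁⟩ := h l hl
    have e₁ := (exists_pairClass hθ hθ' hF (x.restrict _ _ k)
      (y.restrict _ _ k)).choose_spec l ξ ξ' h₁
    have hx := restrict_restrict (θ := θ) (θ' := θ') x k l
    have hy := restrict_restrict (θ := θ) (θ' := θ') y k l
    have e₂ := (exists_pairClass hθ hθ' hF x y).choose_spec (l ≫ k) ξ ξ' (by
      rw [hx, hy]
      exact h₁)
    rw [Sheaf.map_map_apply]
    exact e₂.trans e₁.symm

/-- Since the cocycle is defined by gluing, its images are computed on local related pairs. -/
lemma map_pairCocycle (hθ : b.IsCompatible θ) (hθ' : b.IsCompatible θ') (hF : IsGerbe J F)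
    {G : Sheaf J AddCommGrpCat.{u}} (v : cokernel (diagonal K K') ⟶ G) {U : C}
    (x y : Transporter (ofStrongTrans θ) (ofStrongTrans θ') U) (g : G.obj.obj (op U))
    (h : ∀ {V : C} (k : V ⟶ U) (ξ : K.I₀.obj.obj (op V)) (ξ' : K'.I₀.obj.obj (op V)),
      Rel θ θ' (x.restrict _ _ k) (y.restrict _ _ k) ξ ξ' →
        v.hom.app (op V) (pairClass K K' ξ ξ') = G.obj.map k.op g) :
    v.hom.app (op U) ((pairCocycle hθ hθ' hF).d (U := U) x y) = g := by
  obtain ⟨T, hT, hT'⟩ := Rel.exists hθ hF.isIso x y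
  refine Sheaf.section_ext _ hT fun V k hk ↦ ?_
  obtain ⟨ξ, ξ', h₁⟩ := hT' k hk
  rw [← h k ξ ξ' h₁, ← Sheaf.naturality_apply]
  exact congr_arg _ ((exists_pairClass hθ hθ' hF x y).choose_spec k ξ ξ' h₁)

/-- The projection to the first resolution. -/
noncomputable def diagonalFst : cokernel (diagonal K K') ⟶ K.Q :=
  cokernel.desc _ (biprod.fst ≫ K.p) (by rw [diagonal, biprod.lift_fst_assoc, K.ι_p])

/-- The projection to the second resolution. -/
noncomputable def diagonalSnd : cokernel (diagonal K K') ⟶ K'.Q :=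
  cokernel.desc _ (biprod.snd ≫ K'.p) (by rw [diagonal, biprod.lift_snd_assoc, K'.ι_p])

lemma diagonalFst_pairClass {U : C} (ξ : K.I₀.obj.obj (op U)) (ξ' : K'.I₀.obj.obj (op U)) :
    (diagonalFst (K := K) (K' := K')).hom.app (op U) (pairClass K K' ξ ξ') =
      K.p.hom.app (op U) ξ := by
  refine (fst_pairClass K K' _ _ ξ ξ').trans ?_
  rw [biprod.inl_fst_assoc, biprod.inr_fst_assoc, zero_comp]
  exact add_zero _

lemma diagonalSnd_pairClass {U : C} (ξ : K.I₀.obj.obj (op U)) (ξ' : K'.I₀.obj.obj (op U)) :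
    (diagonalSnd (K := K) (K' := K')).hom.app (op U) (pairClass K K' ξ ξ') =
      K'.p.hom.app (op U) ξ' := by
  refine (fst_pairClass K K' _ _ ξ ξ').trans ?_
  rw [biprod.inl_snd_assoc, biprod.inr_snd_assoc, zero_comp]
  exact zero_add _

/-- The tautological family of sources consists of liftings of z, and the first component of a
related pair satisfies d ξ = difference of the sources. -/
lemma isCoboundary_fst (hθ : b.IsCompatible θ) (hθ' : b.IsCompatible θ') (hF : IsGerbe J F) :
    ((pairCocycle hθ hθ' hF).map diagonalFst).IsCoboundary
      (S := ShortComplex.mk K.j K.q K.j_q) hX z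
      { app U := ↾fun x : Transporter (ofStrongTrans θ) (ofStrongTrans θ') U.unop ↦ x.src.1 } where
  sub {U} x y := by
    refine map_pairCocycle hθ hθ' hF (diagonalFst ≫ K.j) x y _ fun {V} k ξ ξ' h ↦ ?_
    rw [Sheaf.comp_apply, diagonalFst_pairClass]
    obtain ⟨h₁, -, -⟩ := h
    refine Eq.trans ?_ (map_sub (K.I₁.obj.map k.op).hom _ _).symm
    exact eq_sub_of_add_eq' h₁.symm
  lift {U} x := x.src.2

lemma isCoboundary_snd (hθ : b.IsCompatible θ) (hθ' : b.IsCompatible θ') (hF : IsGerbe J F) :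
    ((pairCocycle hθ hθ' hF).map diagonalSnd).IsCoboundary
      (S := ShortComplex.mk K'.j K'.q K'.j_q) hX z'
      { app U := ↾fun x : Transporter (ofStrongTrans θ) (ofStrongTrans θ') U.unop ↦ x.tgt.1 } where
  sub {U} x y := by
    refine map_pairCocycle hθ hθ' hF (diagonalSnd ≫ K'.j) x y _ fun {V} k ξ ξ' h ↦ ?_
    rw [Sheaf.comp_apply, diagonalSnd_pairClass]
    obtain ⟨-, h₁, -⟩ := h
    refine Eq.trans ?_ (map_sub (K'.I₁.obj.map k.op).hom _ _).symm
    exact eq_sub_of_add_eq' h₁.symm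
  lift {U} x := x.tgt.2

/-- The class of a banded gerbe is well-defined. -/
theorem δδ_eq_δδ (hF : IsGerbe J F) (hθ : b.IsCompatible θ) (hθ' : b.IsCompatible θ') :
    K.δδ hX z = K'.δδ hX z' := by
  have hP := locallyNonempty_transporter hF θ θ'
  -- One cocycle, with values in the cokernel of the diagonal, is written as a coboundary in an
  -- injective sheaf. Its two projections give the cocycles of z and z', and the extension of this
  -- cokernel by A maps to both resolutions, so both classes equal the same composition.
  let m := Injective.ι (cokernel (diagonal K K'))
  have hS : (ShortComplex.mk m (cokernel.π m) (cokernel.condition m)).ShortExact :=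
    { exact := ShortComplex.exact_cokernel m
      mono_f := inferInstanceAs (Mono m)
      epi_g := inferInstanceAs (Epi (cokernel.π m)) }
  have : Injective (ShortComplex.mk m (cokernel.π m) (cokernel.condition m)).X₂ :=
    inferInstanceAs (Injective (Injective.under _))
  obtain ⟨w, e, h⟩ := (pairCocycle hθ hθ' hF).exists_isCoboundary (hX := hX) hP hS
  rw [δδ_eq hP (shortExact_diagonal K K') (a := biprod.fst) (v := diagonalFst)
      (biprod.lift_fst _ _) (cokernel.π_desc _ _ _) hS h (isCoboundary_fst hθ hθ' hF),
    δδ_eq hP (shortExact_diagonal K K') (a := biprod.snd) (v := diagonalSnd)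
      (biprod.lift_snd _ _) (cokernel.π_desc _ _ _) hS h (isCoboundary_snd hθ hθ' hF)]

end TwoStepResolution

end CategoryTheory

/-! ### Gluing morphisms in a prestack -/

namespace CategoryTheory

variable {C : Type u} [SmallCategory C] {J : GrothendieckTopology C}
  {F : LocallyDiscrete Cᵒᵖ ⥤ᵖ Cat.{u, u + 1}}

namespace Pseudofunctor

open LocallyDiscreteOpToCat

section PullHom

variable {U V W : C} {x y w : F.obj ⟨op U⟩} {k : V ⟶ U} {l : W ⟶ V} {m : W ⟶ U}

lemma pullHom_comp (hm : l ≫ k = m)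
    (φ : (F.map k.op.toLoc).toFunctor.obj x ⟶ (F.map k.op.toLoc).toFunctor.obj y)
    (ψ : (F.map k.op.toLoc).toFunctor.obj y ⟶ (F.map k.op.toLoc).toFunctor.obj w) :
    pullHom (φ ≫ ψ) l m m hm hm = pullHom φ l m m hm hm ≫ pullHom ψ l m m hm hm := by
  simp [pullHom]

lemma pullHom_map (hm : l ≫ k = m) (φ : x ⟶ y) :
    pullHom ((F.map k.op.toLoc).toFunctor.map φ) l m m hm hm =
      (F.map m.op.toLoc).toFunctor.map φ := by
  have h := F.mapComp'_naturality_1 k.op.toLoc l.op.toLoc m.op.toLoc (by subst hm; rfl) φ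
  dsimp only [pullHom]
  rw [← h]
  simp

lemma pullHom_identity (hm : l ≫ k = m) :
    pullHom (𝟙 ((F.map k.op.toLoc).toFunctor.obj x)) l m m hm hm = 𝟙 _ := by
  simpa using pullHom_map (F := F) hm (𝟙 x)

lemma pullHom_presheafHomObjHomEquiv (φ : x ⟶ y) (k : V ⟶ U) :
    pullHom (F.presheafHomObjHomEquiv φ) k k k (Category.comp_id k) (Category.comp_id k) =
      (F.map k.op.toLoc).toFunctor.map φ := by
  have h : F.presheafHomObjHomEquiv φ = (F.map (𝟙 U).op.toLoc).toFunctor.map φ := by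
    have h := (F.mapId ⟨op U⟩).hom.toNatTrans.naturality φ
    have h' := (Cat.Hom.toNatIso (F.mapId ⟨op U⟩)).hom_inv_id_app y
    refine (Category.assoc _ _ _).symm.trans ((congr_arg (· ≫ _) h.symm).trans ?_)
    exact (Category.assoc _ _ _).trans ((congr_arg (_ ≫ ·) h').trans (Category.comp_id _))
  exact (congr_arg (fun ψ ↦ pullHom ψ k k k (Category.comp_id k) (Category.comp_id k)) h).trans
    (pullHom_map _ φ)

end PullHom

section Gluing

variable [F.IsPrestack J] {U : C} {x y : F.obj ⟨op U⟩}

lemma isSheaf_presheafHom (x y : F.obj ⟨op U⟩) :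
    Presieve.IsSheaf (J.over U) (F.presheafHom x y) :=
  (isSheaf_iff_isSheaf_of_type _ _).1 (IsPrestack.isSheaf J x y)

/-- Morphisms in a prestack can be glued. -/
lemma exists_hom (r : ∀ ⦃V : C⦄ (k : V ⟶ U),
      ((F.map k.op.toLoc).toFunctor.obj x ⟶ (F.map k.op.toLoc).toFunctor.obj y) → Prop)
    (hr : ∀ ⦃V W : C⦄ (k : V ⟶ U) (l : W ⟶ V) (m : W ⟶ U) (hm : l ≫ k = m)
      (φ : (F.map k.op.toLoc).toFunctor.obj x ⟶ (F.map k.op.toLoc).toFunctor.obj y),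
      r k φ → r m (pullHom φ l m m hm hm))
    (hu : ∀ ⦃V : C⦄ (k : V ⟶ U)
      (φ ψ : (F.map k.op.toLoc).toFunctor.obj x ⟶ (F.map k.op.toLoc).toFunctor.obj y),
      r k φ → r k ψ → φ = ψ)
    {T : Sieve U} (hT : T ∈ J U) (h : ∀ ⦃V : C⦄ (k : V ⟶ U), T k → ∃ φ, r k φ) :
    ∃ φ : x ⟶ y, ∀ ⦃V : C⦄ (k : V ⟶ U)
      (ψ : (F.map k.op.toLoc).toFunctor.obj x ⟶ (F.map k.op.toLoc).toFunctor.obj y), r k ψ →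
        (F.map k.op.toLoc).toFunctor.map φ = ψ := by
  have hT' : (Sieve.overEquiv (Over.mk (𝟙 U))).symm T ∈ J.over U (Over.mk (𝟙 U)) := by
    rw [J.mem_over_iff]
    simpa using hT
  obtain ⟨s, hs⟩ := (isSheaf_presheafHom (J := J) x y).exists_section
    (U := Over.mk (𝟙 U)) (r := fun V _ φ ↦ r V.hom φ)
    (fun V W k l φ hφ ↦ hr V.hom l.left W.hom (Over.w l) φ hφ)
    (fun V k φ ψ h h' ↦ hu V.hom φ ψ h h') hT'
    (fun V k hk ↦ h V.hom (by
      have := (Sieve.overEquiv_symm_iff (Y := Over.mk (𝟙 U)) T k).1 hk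
      have h' : k.left = V.hom := by simpa using Over.w k
      rwa [h'] at this))
  obtain ⟨φ, rfl⟩ := F.presheafHomObjHomEquiv.surjective s
  refine ⟨φ, fun V k ψ hψ ↦ ?_⟩
  have h₁ := hs (V := Over.mk k) (Over.homMk k) ψ hψ
  exact (pullHom_presheafHomObjHomEquiv φ k).symm.trans h₁

variable (J) in
lemma hom_ext_of_cover {V : C} {k : V ⟶ U}
    {φ ψ : (F.map k.op.toLoc).toFunctor.obj x ⟶ (F.map k.op.toLoc).toFunctor.obj y}
    {T : Sieve V} (hT : T ∈ J V)
    (h : ∀ ⦃W : C⦄ (l : W ⟶ V) (m : W ⟶ U) (hm : l ≫ k = m), T l →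
      pullHom φ l m m hm hm = pullHom ψ l m m hm hm) : φ = ψ := by
  have hT' : (Sieve.overEquiv (Over.mk k)).symm T ∈ J.over U (Over.mk k) := by
    rw [J.mem_over_iff]
    simpa using hT
  refine ((isSheaf_presheafHom (J := J) x y).isSeparated _ hT').ext fun W l hl ↦ ?_
  exact h l.left W.hom (Over.w l) ((Sieve.overEquiv_symm_iff (Y := Over.mk k) T l).1 hl)

variable (J) in
lemma hom_ext_of_cover' {φ ψ : x ⟶ y} {T : Sieve U} (hT : T ∈ J U)
    (h : ∀ ⦃V : C⦄ (k : V ⟶ U), T k →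
      (F.map k.op.toLoc).toFunctor.map φ = (F.map k.op.toLoc).toFunctor.map ψ) : φ = ψ := by
  refine F.presheafHomObjHomEquiv.injective (hom_ext_of_cover J hT fun V k m hm hk ↦ ?_)
  obtain rfl : k = m := by simpa using hm
  exact (pullHom_presheafHomObjHomEquiv φ k).trans ((h k hk).trans
    (pullHom_presheafHomObjHomEquiv ψ k).symm)

variable (J) in
/-- In a prestack, a morphism which is locally an isomorphism is an isomorphism. -/
lemma isIso_of_cover (φ : x ⟶ y) {T : Sieve U} (hT : T ∈ J U)
    (h : ∀ ⦃V : C⦄ (k : V ⟶ U), T k → IsIso ((F.map k.op.toLoc).toFunctor.map φ)) : IsIso φ := by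
  obtain ⟨ψ, hψ⟩ := exists_hom (J := J) (x := y) (y := x)
    (r := fun V k ψ ↦ (F.map k.op.toLoc).toFunctor.map φ ≫ ψ = 𝟙 _ ∧
      ψ ≫ (F.map k.op.toLoc).toFunctor.map φ = 𝟙 _)
    (fun V W k l m hm ψ ⟨h, h'⟩ ↦ by
      rw [← pullHom_map hm φ, ← pullHom_comp, ← pullHom_comp, h, h']
      exact ⟨pullHom_identity hm, pullHom_identity hm⟩)
    (fun V k ψ ψ' h h' ↦ by
      rw [← Category.comp_id ψ, ← h'.1, ← Category.assoc, h.2, Category.id_comp]) hT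
    (fun V k hk ↦ by
      have := h k hk
      exact ⟨inv ((F.map k.op.toLoc).toFunctor.map φ), by simp, by simp⟩)
  have hinv : ∀ ⦃V : C⦄ (k : V ⟶ U), T k → ∃ ψ', (F.map k.op.toLoc).toFunctor.map φ ≫ ψ' = 𝟙 _ ∧
      ψ' ≫ (F.map k.op.toLoc).toFunctor.map φ = 𝟙 _ ∧
        (F.map k.op.toLoc).toFunctor.map ψ = ψ' := fun V k hk ↦ by
    have := h k hk
    exact ⟨inv ((F.map k.op.toLoc).toFunctor.map φ), by simp, by simp, hψ _ _ (by simp)⟩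
  refine ⟨ψ, hom_ext_of_cover' J hT fun V k hk ↦ ?_, hom_ext_of_cover' J hT fun V k hk ↦ ?_⟩
  all_goals
    obtain ⟨ψ', h₁, h₂, h₃⟩ := hinv k hk
    rw [Functor.map_comp, Functor.map_id, h₃]
    assumption

end Gluing

end Pseudofunctor

end CategoryTheory

/-! ### The action of A on the objects of the stack associated with liftings -/

namespace CategoryTheory

variable {C : Type u} [SmallCategory C] {J : GrothendieckTopology C}
  {F : LocallyDiscrete Cᵒᵖ ⥤ᵖ Cat.{u, u + 1}} {A : Sheaf J AddCommGrpCat.{u}} {X : C}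

namespace TwoStepResolution

open ObjectFamily Pseudofunctor Pseudofunctor.LocallyDiscreteOpToCat

variable {K : TwoStepResolution A} {hX : IsTerminal X}
  {z : K.Z.obj.obj (op X)} (η : Pseudofunctor.StrongTrans (K.liftings hX z) F)

lemma eq_add_d_ι {U : C} (x : K.I₁.obj.obj (op U)) (a : A.obj.obj (op U)) :
    x = x + (K.p ≫ K.j).hom.app (op U) (K.ι.hom.app (op U) a) := by
  rw [K.d_ι, add_zero]

lemma eq_add_d_neg {U : C} {x y : K.I₁.obj.obj (op U)} {ξ : K.I₀.obj.obj (op U)}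
    (h : x = y + (K.p ≫ K.j).hom.app (op U) ξ) : y = x + (K.p ≫ K.j).hom.app (op U) (-ξ) := by
  rw [h, map_neg, add_neg_cancel_right]

/-- The action of a section of `A` on the image of a lifting of `z`. -/
def translate {U : C} (t : (fiberSubfunctor hX K.q.hom z).toFunctor.obj (op U))
    (a : A.obj.obj (op U)) : (ofStrongTrans η).obj t ⟶ (ofStrongTrans η).obj t :=
  hom η (K.ι.hom.app (op U) a) (eq_add_d_ι _ a)

lemma hom_congr {U : C} {t s : (fiberSubfunctor hX K.q.hom z).toFunctor.obj (op U)}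
    {ξ ξ' : K.I₀.obj.obj (op U)}
    (h : (t.1 : K.I₁.obj.obj (op U)) = s.1 + (K.p ≫ K.j).hom.app (op U) ξ) (e : ξ = ξ') :
    hom η ξ h = hom η ξ' (e ▸ h) := by
  subst e
  rfl

section Translate

variable {U V : C} {t s : (fiberSubfunctor hX K.q.hom z).toFunctor.obj (op U)}

lemma translate_add (a a' : A.obj.obj (op U)) :
    translate η t (a + a') = translate η t a ≫ translate η t a' :=
  (hom_congr η _ (map_add (K.ι.hom.app (op U)).hom a a')).trans (hom_comp_hom η _ _).symm

lemma translate_restrict (a : A.obj.obj (op U)) (k : V ⟶ U) :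
    translate η ((fiberSubfunctor hX K.q.hom z).toFunctor.map k.op t) (A.obj.map k.op a) ≫
        ((ofStrongTrans η).iso k t).hom =
      ((ofStrongTrans η).iso k t).hom ≫ (F.map k.op.toLoc).toFunctor.map (translate η t a) := by
  have h : (t.1 : K.I₁.obj.obj (op U)) =
      t.1 + (K.p ≫ K.j).hom.app (op U) (K.ι.hom.app (op U) a) := eq_add_d_ι _ a
  refine Eq.trans ?_ (hom_restrict η h k (restrict_eq h k))
  exact congr_arg (· ≫ _) (hom_congr η _ (Sheaf.naturality_apply K.ι k a))

variable {η} (hη : IsAssociatedStack J η)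
include hη

lemma exists_hom_eq (φ : (ofStrongTrans η).obj t ⟶ (ofStrongTrans η).obj s) :
    ∃ (ξ : K.I₀.obj.obj (op U))
      (h : (t.1 : K.I₁.obj.obj (op U)) = s.1 + (K.p ≫ K.j).hom.app (op U) ξ),
      hom η ξ h = φ := by
  obtain ⟨ψ, hψ⟩ := (hη.full U).map_surjective (X := translationObj t)
    (Y := translationObj s) φ
  exact ⟨TranslationObj.Hom.ξ ψ, TranslationObj.Hom.eq ψ, hψ⟩

lemma eq_of_hom_eq {ξ ξ' : K.I₀.obj.obj (op U)}
    {h : (t.1 : K.I₁.obj.obj (op U)) = s.1 + (K.p ≫ K.j).hom.app (op U) ξ}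
    {h' : (t.1 : K.I₁.obj.obj (op U)) = s.1 + (K.p ≫ K.j).hom.app (op U) ξ'}
    (e : hom η ξ h = hom η ξ' h') : ξ = ξ' := by
  exact congr_arg TranslationObj.Hom.ξ ((hη.faithful U).map_injective e)

/-- Every morphism between images of liftings comes from a section of I⁰, and composition is
addition, which is commutative. -/
lemma translate_comp (a : A.obj.obj (op U))
    (φ : (ofStrongTrans η).obj t ⟶ (ofStrongTrans η).obj s) :
    translate η t a ≫ φ = φ ≫ translate η s a := by
  obtain ⟨ξ, h, rfl⟩ := exists_hom_eq hη φ
  exact (hom_comp_hom η _ _).trans ((hom_congr η _ (add_comm _ _)).trans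
    (hom_comp_hom η _ _).symm)

lemma isIso_of_obj (φ : (ofStrongTrans η).obj t ⟶ (ofStrongTrans η).obj s) : IsIso φ := by
  obtain ⟨ξ, h, rfl⟩ := exists_hom_eq hη φ
  have h' : (s.1 : K.I₁.obj.obj (op U)) = t.1 + (K.p ≫ K.j).hom.app (op U) (-ξ) :=
    eq_add_d_neg h
  exact ⟨hom η (-ξ) h', ((hom_comp_hom η h h').trans (hom_congr η _ (add_neg_cancel ξ))).trans
    (hom_zero η rfl _), ((hom_comp_hom η h' h).trans (hom_congr η _ (neg_add_cancel ξ))).trans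
    (hom_zero η rfl _)⟩

lemma eq_of_translate_eq {a a' : A.obj.obj (op U)} (e : translate η t a = translate η t a') :
    a = a' :=
  Sheaf.injective_of_shortExact K.shortExact₀ U (eq_of_hom_eq hη e)

lemma exists_translate_eq (φ : (ofStrongTrans η).obj t ⟶ (ofStrongTrans η).obj t) :
    ∃ a : A.obj.obj (op U), translate η t a = φ := by
  obtain ⟨ξ, h, rfl⟩ := exists_hom_eq hη φ
  obtain ⟨a, rfl⟩ := K.eq_ι_of_d_eq_zero ξ (left_eq_add.1 h)
  exact ⟨a, rfl⟩

lemma exists_local_obj (y : F.obj ⟨op U⟩) : ∃ T ∈ J U, ∀ ⦃V : C⦄ (k : V ⟶ U), T k →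
    ∃ t : (fiberSubfunctor hX K.q.hom z).toFunctor.obj (op V),
      Nonempty ((ofStrongTrans η).obj t ≅ (F.map k.op.toLoc).toFunctor.obj y) := by
  obtain ⟨T, hT, h⟩ := hη.locally_essSurj y
  refine ⟨T, hT, fun V k hk ↦ ?_⟩
  obtain ⟨t, e⟩ := h k hk
  exact ⟨⟨t.val, t.mem⟩, e⟩

end Translate

section IsAct

variable {U V W : C}

/-- The endomorphism `α` of the restriction of `y` along `k` is the action of `a`. -/
def IsLocalAct (y : F.obj ⟨op U⟩) (k : V ⟶ U) (a : A.obj.obj (op V))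
    (α : (F.map k.op.toLoc).toFunctor.obj y ⟶ (F.map k.op.toLoc).toFunctor.obj y) : Prop :=
  ∀ ⦃W : C⦄ (l : W ⟶ V) (m : W ⟶ U) (hm : l ≫ k = m)
    (t : (fiberSubfunctor hX K.q.hom z).toFunctor.obj (op W))
    (φ : (ofStrongTrans η).obj t ⟶ (F.map m.op.toLoc).toFunctor.obj y),
    translate η t (A.obj.map l.op a) ≫ φ = φ ≫ pullHom α l m m hm hm

/-- The endomorphism `α` of `y` is the action of `a`. -/
def IsAct (y : F.obj ⟨op U⟩) (a : A.obj.obj (op U)) (α : y ⟶ y) : Prop :=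
  ∀ ⦃V : C⦄ (k : V ⟶ U) (t : (fiberSubfunctor hX K.q.hom z).toFunctor.obj (op V))
    (φ : (ofStrongTrans η).obj t ⟶ (F.map k.op.toLoc).toFunctor.obj y),
    translate η t (A.obj.map k.op a) ≫ φ = φ ≫ (F.map k.op.toLoc).toFunctor.map α

variable {η} {y : F.obj ⟨op U⟩}

lemma IsLocalAct.pullHom {k : V ⟶ U} {a : A.obj.obj (op V)}
    {α : (F.map k.op.toLoc).toFunctor.obj y ⟶ (F.map k.op.toLoc).toFunctor.obj y}
    (h : IsLocalAct η y k a α) (l : W ⟶ V) (m : W ⟶ U) (hm : l ≫ k = m) :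
    IsLocalAct η y m (A.obj.map l.op a) (pullHom α l m m hm hm) := by
  intro W' l' m' hm' t φ
  have h₁ := h (l' ≫ l) m' (by rw [Category.assoc, hm, hm']) t φ
  rw [pullHom_pullHom]
  refine Eq.trans ?_ h₁
  rw [Sheaf.map_map_apply]

lemma IsAct.isLocalAct {a : A.obj.obj (op U)} {α : y ⟶ y} (h : IsAct η y a α) (k : V ⟶ U) :
    IsLocalAct η y k (A.obj.map k.op a) ((F.map k.op.toLoc).toFunctor.map α) := by
  intro W l m hm t φ
  rw [pullHom_map]
  refine Eq.trans ?_ (h m t φ)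
  rw [Sheaf.map_map_apply, hm]

variable (hη : IsAssociatedStack J η)
include hη

/-- It is enough to test on one isomorphism `e` with the image of a lifting: any other test morphism
differs from the restriction of `e` by a morphism between images of liftings, and these commute with
translations. -/
lemma isLocalAct_of_iso {k : V ⟶ U} {a : A.obj.obj (op V)}
    {α : (F.map k.op.toLoc).toFunctor.obj y ⟶ (F.map k.op.toLoc).toFunctor.obj y}
    {t : (fiberSubfunctor hX K.q.hom z).toFunctor.obj (op V)}
    (e : (ofStrongTrans η).obj t ≅ (F.map k.op.toLoc).toFunctor.obj y)
    (h : translate η t a ≫ e.hom = e.hom ≫ α) : IsLocalAct η y k a α := by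
  intro W l m hm s φ
  let e' : (ofStrongTrans η).obj ((fiberSubfunctor hX K.q.hom z).toFunctor.map l.op t) ≅
      (F.map m.op.toLoc).toFunctor.obj y :=
    (ofStrongTrans η).iso l t ≪≫ (F.map l.op.toLoc).toFunctor.mapIso e ≪≫
      (Cat.Hom.toNatIso (F.mapComp' k.op.toLoc l.op.toLoc m.op.toLoc
        (by subst hm; rfl))).symm.app y
  have h₁ : translate η _ (A.obj.map l.op a) ≫ e'.hom = e'.hom ≫ pullHom α l m m hm hm := by
    have h₂ := translate_restrict η (t := t) a l
    have h₃ := congr_arg (F.map l.op.toLoc).toFunctor.map h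
    rw [Functor.map_comp, Functor.map_comp] at h₃
    dsimp [e', LocallyDiscreteOpToCat.pullHom]
    rw [reassoc_of% h₂, reassoc_of% h₃]
    simp
  have h₂ := translate_comp hη (A.obj.map l.op a) (φ ≫ e'.inv)
  rw [← cancel_mono e'.inv, Category.assoc, h₂, Category.assoc, Category.assoc]
  congr 1
  rw [Iso.inv_comp_eq, ← reassoc_of% h₁, Iso.hom_inv_id, Category.comp_id]

/-- Two endomorphisms by which the same section acts are equal, and two sections with the same
action are equal. -/
lemma IsLocalAct.eq_iff {k : V ⟶ U} {a a' : A.obj.obj (op V)}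
    {α α' : (F.map k.op.toLoc).toFunctor.obj y ⟶ (F.map k.op.toLoc).toFunctor.obj y}
    (h : IsLocalAct η y k a α) (h' : IsLocalAct η y k a' α') : α = α' ↔ a = a' := by
  have := hη.isStack
  obtain ⟨T, hT, hT'⟩ := exists_local_obj hη y
  have hT'' := J.pullback_stable k hT
  constructor
  · rintro rfl
    refine Sheaf.section_ext A hT'' fun W l hl ↦ ?_
    obtain ⟨t, ⟨e⟩⟩ := hT' _ hl
    have h₁ := (h l _ rfl t e.hom).trans (h' l _ rfl t e.hom).symm
    exact eq_of_translate_eq hη ((cancel_mono e.hom).1 h₁)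
  · rintro rfl
    refine hom_ext_of_cover J hT'' fun W l m hm hl ↦ ?_
    obtain ⟨t, ⟨e⟩⟩ := hT' m (by subst hm; exact hl)
    exact (cancel_epi e.hom).1 ((h l m hm t e.hom).symm.trans (h' l m hm t e.hom))

lemma IsAct.eq_iff {a a' : A.obj.obj (op U)} {α α' : y ⟶ y} (h : IsAct η y a α)
    (h' : IsAct η y a' α') : α = α' ↔ a = a' := by
  have := hη.isStack
  constructor
  · rintro rfl
    refine Sheaf.section_ext A (J.top_mem U) fun V k _ ↦ ?_
    exact ((h.isLocalAct k).eq_iff hη (h'.isLocalAct k)).1 rfl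
  · rintro rfl
    refine hom_ext_of_cover' J (J.top_mem U) fun V k _ ↦ ?_
    exact ((h.isLocalAct k).eq_iff hη (h'.isLocalAct k)).2 rfl

omit hη in
-- The condition is an equality of morphisms for every test morphism, and equality of morphisms in a
-- stack is local.
lemma isAct_of_cover (hF : F.IsStack J) {a : A.obj.obj (op U)} {α : y ⟶ y} {T : Sieve U}
    (hT : T ∈ J U)
    (h : ∀ ⦃V : C⦄ (k : V ⟶ U), T k →
      IsLocalAct η y k (A.obj.map k.op a) ((F.map k.op.toLoc).toFunctor.map α)) :
    IsAct η y a α := by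
  intro V k t φ
  refine hom_ext_of_cover' J (J.pullback_stable k hT) fun W l hl ↦ ?_
  have h₁ := h (l ≫ k) hl (𝟙 W) (l ≫ k) (Category.id_comp _)
    ((fiberSubfunctor hX K.q.hom z).toFunctor.map l.op t) (((ofStrongTrans η).iso l t).hom ≫
      (F.map l.op.toLoc).toFunctor.map φ ≫
      (F.mapComp' k.op.toLoc l.op.toLoc (l ≫ k).op.toLoc rfl).inv.toNatTrans.app y)
  rw [pullHom_id, Sheaf.map_map_apply, Category.id_comp] at h₁
  have h₂ := translate_restrict η (t := t) (A.obj.map k.op a) l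
  rw [Sheaf.map_map_apply] at h₂
  rw [reassoc_of% h₂, Category.assoc, Category.assoc, cancel_epi] at h₁
  have h₃ := F.mapComp'_inv_naturality k.op.toLoc l.op.toLoc (l ≫ k).op.toLoc rfl α
  have h₄ := h₁ =≫ (F.mapComp' k.op.toLoc l.op.toLoc (l ≫ k).op.toLoc rfl).hom.toNatTrans.app y
  simp only [Category.assoc] at h₄
  rw [← reassoc_of% h₃] at h₄
  simpa using h₄

variable (y) in
-- Locally `y` is isomorphic to the image of a lifting, and the translation by `a` is conjugated to
-- `y`. The result does not depend on the isomorphism, so the local automorphisms glue.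
lemma exists_isAct (a : A.obj.obj (op U)) : ∃ α : y ⟶ y, IsAct η y a α := by
  have := hη.isStack
  obtain ⟨T, hT, hT'⟩ := exists_local_obj hη y
  have hloc : ∀ ⦃V : C⦄ (k : V ⟶ U), T k → ∃ α, IsLocalAct η y k (A.obj.map k.op a) α := by
    intro V k hk
    obtain ⟨t, ⟨e⟩⟩ := hT' k hk
    exact ⟨e.inv ≫ translate η t (A.obj.map k.op a) ≫ e.hom, isLocalAct_of_iso hη e (by simp)⟩
  have hr : ∀ ⦃V W : C⦄ (k : V ⟶ U) (l : W ⟶ V) (m : W ⟶ U) (hm : l ≫ k = m) α,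
      IsLocalAct η y k (A.obj.map k.op a) α →
      IsLocalAct η y m (A.obj.map m.op a) (LocallyDiscreteOpToCat.pullHom α l m m hm hm) := by
    intro V W k l m hm α h
    have h₁ := h.pullHom l m hm
    rwa [Sheaf.map_map_apply, hm] at h₁
  obtain ⟨α, hα⟩ := Pseudofunctor.exists_hom (J := J) (x := y) (y := y)
    (r := fun V k α ↦ IsLocalAct η y k (A.obj.map k.op a) α) hr
    (fun V k α α' h h' ↦ (h.eq_iff hη h').2 rfl) hT hloc
  refine ⟨α, isAct_of_cover hη.isStack hT fun V k hk ↦ ?_⟩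
  obtain ⟨α', hα'⟩ := hloc k hk
  rwa [hα k α' hα']

/-- Conversely, `α` is locally conjugate to an endomorphism of the image of a lifting, hence to a
translation; the translating sections are unique and glue in the sheaf A. -/
lemma exists_isAct_eq (α : y ⟶ y) : ∃ a : A.obj.obj (op U), IsAct η y a α := by
  obtain ⟨T, hT, hT'⟩ := exists_local_obj hη y
  have hloc : ∀ ⦃V : C⦄ (k : V ⟶ U), T k → ∃ a : A.obj.obj (op V),
      IsLocalAct η y k a ((F.map k.op.toLoc).toFunctor.map α) := by
    intro V k hk
    obtain ⟨t, ⟨e⟩⟩ := hT' k hk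
    obtain ⟨a, ha⟩ := exists_translate_eq hη
      (e.hom ≫ (F.map k.op.toLoc).toFunctor.map α ≫ e.inv)
    exact ⟨a, isLocalAct_of_iso hη e (by rw [ha]; simp)⟩
  obtain ⟨a, ha⟩ := A.isSheaf_forget.exists_section
    (r := fun V k (a : A.obj.obj (op V)) ↦
      IsLocalAct η y k a ((F.map k.op.toLoc).toFunctor.map α))
    (fun V W k l a h ↦ by
      have h₁ := IsLocalAct.pullHom h l _ rfl
      rwa [pullHom_map] at h₁)
    (fun V k a a' h h' ↦ (IsLocalAct.eq_iff hη h h').1 rfl) hT hloc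
  refine ⟨a, isAct_of_cover hη.isStack hT fun V k hk ↦ ?_⟩
  obtain ⟨a', ha'⟩ := hloc k hk
  have h : A.obj.map k.op a = a' := ha k a' ha'
  rwa [h]

omit hη in
lemma IsAct.comp {a a' : A.obj.obj (op U)} {α α' : y ⟶ y} (h : IsAct η y a α)
    (h' : IsAct η y a' α') : IsAct η y (a + a') (α ≫ α') := by
  intro V k t φ
  have h₁ := h k t φ
  have h₂ := h' k t φ
  have h₃ : A.obj.map k.op (a + a') = A.obj.map k.op a + A.obj.map k.op a' :=
    map_add (A.obj.map k.op).hom a a'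
  rw [h₃, translate_add, Category.assoc, h₂, reassoc_of% h₁, Functor.map_comp]

lemma IsAct.naturality {x : F.obj ⟨op U⟩} {a : A.obj.obj (op U)} {α : x ⟶ x} {β : y ⟶ y}
    (h : IsAct η x a α) (h' : IsAct η y a β) (φ : x ⟶ y) : α ≫ φ = φ ≫ β := by
  have := hη.isStack
  obtain ⟨T, hT, hT'⟩ := exists_local_obj hη x
  refine hom_ext_of_cover' J hT fun V k hk ↦ ?_
  obtain ⟨t, ⟨e⟩⟩ := hT' k hk
  rw [Functor.map_comp, Functor.map_comp, ← cancel_epi e.hom, ← reassoc_of% (h k t e.hom),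
    ← h' k t (e.hom ≫ (F.map k.op.toLoc).toFunctor.map φ) |>.trans (Category.assoc _ _ _)]

omit hη in
lemma IsAct.restrict {a : A.obj.obj (op U)} {α : y ⟶ y} (h : IsAct η y a α) (k : V ⟶ U) :
    IsAct η ((F.map k.op.toLoc).toFunctor.obj y) (A.obj.map k.op a)
      ((F.map k.op.toLoc).toFunctor.map α) := by
  intro W l t φ
  have h₁ := h (l ≫ k) t (φ ≫
    (F.mapComp' k.op.toLoc l.op.toLoc (l ≫ k).op.toLoc rfl).inv.toNatTrans.app y)
  have h₃ := F.mapComp'_inv_naturality k.op.toLoc l.op.toLoc (l ≫ k).op.toLoc rfl α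
  have h₄ := h₁ =≫ (F.mapComp' k.op.toLoc l.op.toLoc (l ≫ k).op.toLoc rfl).hom.toNatTrans.app y
  simp only [Category.assoc] at h₄
  rw [← reassoc_of% h₃] at h₄
  rw [Sheaf.map_map_apply]
  simpa using h₄

lemma isAct_translate (t : (fiberSubfunctor hX K.q.hom z).toFunctor.obj (op U))
    (a : A.obj.obj (op U)) : IsAct η ((ofStrongTrans η).obj t) a (translate η t a) := by
  intro V k s φ
  have h₁ := translate_comp hη (A.obj.map k.op a) (φ ≫ ((ofStrongTrans η).iso k t).inv)
  have h₂ := translate_restrict η (t := t) a k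
  rw [← Iso.inv_comp_eq] at h₂
  rw [← cancel_mono ((ofStrongTrans η).iso k t).inv, Category.assoc, h₁, ← h₂]
  simp

end IsAct

end TwoStepResolution

end CategoryTheory

/-! ### The stack associated with liftings as a banded gerbe, and its class -/

namespace CategoryTheory

variable {C : Type u} [SmallCategory C] {J : GrothendieckTopology C}
  {F : LocallyDiscrete Cᵒᵖ ⥤ᵖ Cat.{u, u + 1}} {A : Sheaf J AddCommGrpCat.{u}} {X : C}

namespace TwoStepResolution

open ObjectFamily Pseudofunctor

variable {K : TwoStepResolution A} {hX : IsTerminal X} {z : K.Z.obj.obj (op X)}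
  {η : Pseudofunctor.StrongTrans (K.liftings hX z) F} (hη : IsAssociatedStack J η)
include hη

/-- The stack associated with the liftings of a global section is a gerbe. -/
theorem isGerbe : IsGerbe J F where
  isStack := hη.isStack
  isIso {U x y} φ := by
    have := hη.isStack
    obtain ⟨T, hT, h⟩ := exists_local_obj hη x
    obtain ⟨T', hT', h'⟩ := exists_local_obj hη y
    refine isIso_of_cover J φ (J.intersection_covering hT hT') fun V k hk ↦ ?_
    obtain ⟨t, ⟨e⟩⟩ := h k hk.1
    obtain ⟨s, ⟨e'⟩⟩ := h' k hk.2
    have h₁ := isIso_of_obj hη (e.hom ≫ (F.map k.op.toLoc).toFunctor.map φ ≫ e'.inv)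
    have h₂ : (F.map k.op.toLoc).toFunctor.map φ =
        e.inv ≫ (e.hom ≫ (F.map k.op.toLoc).toFunctor.map φ ≫ e'.inv) ≫ e'.hom := by simp
    rw [h₂]
    infer_instance
  locally_nonempty U := by
    obtain ⟨T, hT, h⟩ := K.exists_local_lifting z U
    refine ⟨T, hT, fun V k hk ↦ ?_⟩
    obtain ⟨t, ht⟩ := h k hk
    exact ⟨(ofStrongTrans η).obj ⟨t, ht⟩⟩
  locally_iso {U} x y := by
    -- The sieve of all arrows over which the restrictions become isomorphic. It covers by
    -- transitivity: first both objects come from liftings, then these liftings are related by a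
    -- section of I⁰.
    let R : Sieve U :=
      { arrows V k := Nonempty ((F.map k.op.toLoc).toFunctor.obj x ≅
          (F.map k.op.toLoc).toFunctor.obj y)
        downward_closed {V W k} := fun ⟨e⟩ l ↦
          ⟨(Cat.Hom.toNatIso (F.mapComp' k.op.toLoc l.op.toLoc (l ≫ k).op.toLoc rfl)).app x ≪≫
            (F.map l.op.toLoc).toFunctor.mapIso e ≪≫
            (Cat.Hom.toNatIso (F.mapComp' k.op.toLoc l.op.toLoc (l ≫ k).op.toLoc rfl)).symm.app y⟩ }
    obtain ⟨T, hT, h⟩ := exists_local_obj hη x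
    obtain ⟨T', hT', h'⟩ := exists_local_obj hη y
    refine ⟨R, J.transitive (J.intersection_covering hT hT') R fun V k hk ↦ ?_, fun _ _ h ↦ h⟩
    obtain ⟨t, ⟨e⟩⟩ := h k hk.1
    obtain ⟨s, ⟨e'⟩⟩ := h' k hk.2
    obtain ⟨T'', hT'', h''⟩ := K.exists_local_hom hX t s
    refine J.superset_covering (fun W l hl ↦ ?_) hT''
    obtain ⟨ξ, hξ⟩ := h'' l hl
    have := isIso_of_obj hη (hom η ξ hξ)
    exact ⟨(Cat.Hom.toNatIso (F.mapComp' k.op.toLoc l.op.toLoc (l ≫ k).op.toLoc rfl)).app x ≪≫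
      (F.map l.op.toLoc).toFunctor.mapIso e.symm ≪≫ ((ofStrongTrans η).iso l t).symm ≪≫
      asIso (hom η ξ hξ) ≪≫ (ofStrongTrans η).iso l s ≪≫ (F.map l.op.toLoc).toFunctor.mapIso e' ≪≫
      (Cat.Hom.toNatIso (F.mapComp' k.op.toLoc l.op.toLoc (l ≫ k).op.toLoc rfl)).symm.app y⟩

/-- The automorphism of `y` by which `a` acts. -/
noncomputable def act {U : C} (y : F.obj ⟨op U⟩) (a : A.obj.obj (op U)) : y ⟶ y :=
  (exists_isAct y hη a).choose

lemma isAct_act {U : C} (y : F.obj ⟨op U⟩) (a : A.obj.obj (op U)) :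
    IsAct η y a (act hη y a) :=
  (exists_isAct y hη a).choose_spec

lemma act_eq {U : C} {y : F.obj ⟨op U⟩} {a : A.obj.obj (op U)} {α : y ⟶ y}
    (h : IsAct η y a α) : act hη y a = α :=
  ((isAct_act hη y a).eq_iff hη h).2 rfl

lemma act_add {U : C} (y : F.obj ⟨op U⟩) (a a' : A.obj.obj (op U)) :
    act hη y (a + a') = act hη y a ≫ act hη y a' :=
  act_eq hη ((isAct_act hη y a).comp (isAct_act hη y a'))

lemma act_zero {U : C} (y : F.obj ⟨op U⟩) : act hη y (0 : A.obj.obj (op U)) = 𝟙 y := by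
  -- The identity is the action of some `a`; additivity of the action on `a + 0` then cancels it.
  obtain ⟨a, ha⟩ := exists_isAct_eq hη (𝟙 y)
  have h := act_eq hη (ha.comp (isAct_act hη y 0))
  rw [add_zero, act_eq hη ha, Category.id_comp] at h
  exact h.symm

lemma act_comp_act {U : C} (y : F.obj ⟨op U⟩) {a a' : A.obj.obj (op U)} (h : a + a' = 0) :
    act hη y a ≫ act hη y a' = 𝟙 y := by
  rw [← act_add, h, act_zero]

/-- The action of a section of `A` on `y`, as a homomorphism to the group of automorphisms. -/
noncomputable def actAut {U : C} (y : F.obj ⟨op U⟩) :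
    Multiplicative (A.obj.obj (op U)) →* Aut y where
  toFun a :=
    { hom := act hη y a.toAdd
      inv := act hη y (-a.toAdd)
      hom_inv_id := act_comp_act hη y (add_neg_cancel _)
      inv_hom_id := act_comp_act hη y (neg_add_cancel _) }
  map_one' := Iso.ext (act_zero hη y)
  -- Multiplication in `Aut y` is composition in the reverse order, hence the exchange of the two
  -- summands.
  map_mul' a a' := Iso.ext ((congr_arg (act hη y) (add_comm _ _)).trans (act_add hη y _ _))

lemma actAut_bijective {U : C} (y : F.obj ⟨op U⟩) : Function.Bijective (actAut hη y) := by
  constructor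
  · intro a a' h
    have h₁ : act hη y a.toAdd = act hη y a'.toAdd := congr_arg Iso.hom h
    exact ((isAct_act hη y a.toAdd).eq_iff hη (isAct_act hη y a'.toAdd)).1 h₁
  · intro α
    obtain ⟨a, ha⟩ := exists_isAct_eq hη α.hom
    exact ⟨.ofAdd a, Iso.ext (act_eq hη ha)⟩

/-- The stack associated with the liftings of a global section is banded by `A`. -/
noncomputable def banding : Banding F A.obj where
  aut y := MulEquiv.ofBijective (actAut hη y) (actAut_bijective hη y)
  naturality φ a := (isAct_act hη _ a).naturality hη (isAct_act hη _ a) φ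
  restrict k y a := (act_eq hη ((isAct_act hη y a).restrict k)).symm

lemma banding_act {U : C} {y : F.obj ⟨op U⟩} {a : A.obj.obj (op U)} {α : y ⟶ y}
    (h : IsAct η y a α) : (banding hη).act y a = α :=
  act_eq hη h

lemma banding_isCompatible : (banding hη).IsCompatible η := fun _ t a ↦
  (banding_act hη (isAct_translate hη ⟨t.val, t.mem⟩ a)).symm

/-- The class of the stack associated with the liftings of `z` is the image of `z`. -/
theorem banding_hasClass_iff (c : Sheaf.H A 2) :
    (banding hη).HasClass hX c ↔ c = K.δδ hX z := by
  constructor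
  · rintro ⟨K', z', θ, hθ, rfl⟩
    exact δδ_eq_δδ (isGerbe hη) hθ (banding_isCompatible hη)
  · rintro rfl
    exact ⟨K, z, η, banding_isCompatible hη, rfl⟩

end TwoStepResolution

end CategoryTheory

/-! ### Global objects and the vanishing of the class -/

namespace CategoryTheory

variable {C : Type u} [SmallCategory C] {J : GrothendieckTopology C}
  {F : LocallyDiscrete Cᵒᵖ ⥤ᵖ Cat.{u, u + 1}} {A : Sheaf J AddCommGrpCat.{u}} {X : C}

namespace TwoStepResolution

open ObjectFamily Pseudofunctor

variable {K : TwoStepResolution A} {hX : IsTerminal X} {z : K.Z.obj.obj (op X)}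
  {η : Pseudofunctor.StrongTrans (K.liftings hX z) F}

lemma eq_add_d_add {U : C} {x y w : K.I₁.obj.obj (op U)} {ξ ξ' : K.I₀.obj.obj (op U)}
    (h : x = y + (K.p ≫ K.j).hom.app (op U) ξ) (h' : y = w + (K.p ≫ K.j).hom.app (op U) ξ') :
    x = w + (K.p ≫ K.j).hom.app (op U) (ξ + ξ') := by
  rw [map_add, ← add_assoc, add_right_comm, ← h', ← h]

section Trivialization

variable (hη : IsAssociatedStack J η) (y : F.obj ⟨op X⟩)
include hη

/-- Two identifications of `y` with images of liftings differ by an isomorphism between these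
images, which comes from a section of I⁰ by fullness. A global object thus lifts the cocycle of z
from Q to I⁰. -/
lemma exists_difference {U : C} (x x' : Transporter (ofStrongTrans η) (ofObj hX y) U) :
    ∃ (ξ : K.I₀.obj.obj (op U))
      (h : (x.src.1 : K.I₁.obj.obj (op U)) = x'.src.1 + (K.p ≫ K.j).hom.app (op U) ξ),
      hom η ξ h ≫ x'.hom = x.hom := by
  have := (isGerbe hη).isIso x'.hom
  obtain ⟨ξ, h, h'⟩ := exists_hom_eq hη (t := x.src) (s := x'.src) (x.hom ≫ inv x'.hom)
  exact ⟨ξ, h, by rw [h']; simp⟩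

lemma eq_of_hom_comp_eq {U : C} {x x' : Transporter (ofStrongTrans η) (ofObj hX y) U}
    {ξ ξ' : K.I₀.obj.obj (op U)}
    {h : (x.src.1 : K.I₁.obj.obj (op U)) = x'.src.1 + (K.p ≫ K.j).hom.app (op U) ξ}
    {h' : (x.src.1 : K.I₁.obj.obj (op U)) = x'.src.1 + (K.p ≫ K.j).hom.app (op U) ξ'}
    (e : hom η ξ h ≫ x'.hom = x.hom) (e' : hom η ξ' h' ≫ x'.hom = x.hom) : ξ = ξ' := by
  have := (isGerbe hη).isIso x'.hom
  exact eq_of_hom_eq hη ((cancel_mono x'.hom).1 (e.trans e'.symm))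

/-- The cocycle on the presheaf of the local isomorphisms between `y` and the liftings of `z`. -/
noncomputable def differenceCocycle :
    PresheafCocycle (transporter (ofStrongTrans η) (ofObj hX y)) K.I₀.obj where
  d {U} x x' := (exists_difference hη y (U := U) x x').choose
  d_add {U} x x' x'' := by
    obtain ⟨h, e⟩ := (exists_difference hη y (U := U) x x').choose_spec
    obtain ⟨h', e'⟩ := (exists_difference hη y (U := U) x' x'').choose_spec
    obtain ⟨h'', e''⟩ := (exists_difference hη y (U := U) x x'').choose_spec
    refine eq_of_hom_comp_eq hη y (h := eq_add_d_add h h') ?_ e''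
    refine (congr_arg (· ≫ _) (hom_comp_hom η h h').symm).trans ?_
    exact (Category.assoc _ _ _).trans ((congr_arg (_ ≫ ·) e').trans e)
  map_d {U V} k x x' := by
    obtain ⟨h, e⟩ := (exists_difference hη y (U := U) x x').choose_spec
    obtain ⟨h', e'⟩ := (exists_difference hη y (U := V)
      (Transporter.restrict _ _ k x) (Transporter.restrict _ _ k x')).choose_spec
    refine eq_of_hom_comp_eq hη y (h := restrict_eq h k) ?_ e'
    have h₁ := hom_restrict η h k (restrict_eq h k)
    dsimp only [Transporter.restrict]
    rw [reassoc_of% h₁, ← Functor.map_comp_assoc, e]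
    rfl

end Trivialization

/-- If the stack associated with the liftings of `z` has a global object, its class is zero. -/
lemma δδ_eq_zero (hη : IsAssociatedStack J η) (y : F.obj ⟨op X⟩) : K.δδ hX z = 0 := by
  have hP : LocallyNonempty J (transporter (ofStrongTrans η) (ofObj hX y)) := fun U ↦ by
    obtain ⟨T, hT, h⟩ := exists_local_obj hη ((F.map (hX.from U).op.toLoc).toFunctor.obj y)
    refine ⟨T, hT, fun V k hk ↦ ?_⟩
    obtain ⟨t, ⟨e⟩⟩ := h k hk
    exact ⟨⟨t, PUnit.unit, e.hom ≫ ((ofObj hX y).iso k (U := U) PUnit.unit).inv⟩⟩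
  let m := Injective.ι K.I₀
  have hS : (ShortComplex.mk m (cokernel.π m) (cokernel.condition m)).ShortExact :=
    { exact := ShortComplex.exact_cokernel m
      mono_f := inferInstanceAs (Mono m)
      epi_g := inferInstanceAs (Epi (cokernel.π m)) }
  have : Injective (ShortComplex.mk m (cokernel.π m) (cokernel.condition m)).X₂ :=
    inferInstanceAs (Injective (Injective.under _))
  obtain ⟨w, e, h⟩ := (differenceCocycle hη y).exists_isCoboundary (hX := hX) hP hS
  have h' : ((differenceCocycle hη y).map K.p).IsCoboundary
      (S := ShortComplex.mk K.j K.q K.j_q) hX z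
      { app U := ↾fun x : Transporter (ofStrongTrans η) (ofObj hX y) U.unop ↦ x.src.1 } :=
    { sub {U} x x' := by
        obtain ⟨h, -⟩ := (exists_difference hη y (U := U) x x').choose_spec
        exact eq_sub_of_add_eq' h.symm
      lift {U} x := x.src.2 }
  -- The image of z in H¹(Q) comes from H¹(I⁰), hence dies in H²(A).
  have h₁ := PresheafCocycle.IsCoboundary.δ₀_eq hX hP hS K.shortExact₁ K.p (fun _ _ _ ↦ rfl) h h'
  have h₂ : (Abelian.Ext.mk₀ K.p).comp K.shortExact₀.extClass (zero_add 1) = 0 :=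
    K.shortExact₀.comp_extClass
  rw [δδ_eq_δ₀_comp, ← h₁, Abelian.Ext.comp_assoc_of_second_deg_zero, h₂, Abelian.Ext.comp_zero]

section Descent

variable {P : Cᵒᵖ ⥤ Type u} (c : PresheafCocycle P K.I₀.obj)
  (τ : P ⟶ (fiberSubfunctor hX K.q.hom z).toFunctor)
  (hτ : ∀ {U : C} (x x' : P.obj (op U)), ((τ.app (op U) x).1 : K.I₁.obj.obj (op U)) =
    (τ.app (op U) x').1 + (K.p ≫ K.j).hom.app (op U) (c.d x x'))

include hτ

lemma eq_add_of_cocycle {U U' V : C} (k : V ⟶ U) (k' : V ⟶ U') (x : P.obj (op U))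
    (x' : P.obj (op U')) :
    (((fiberSubfunctor hX K.q.hom z).toFunctor.map k.op (τ.app (op U) x)).1 :
        K.I₁.obj.obj (op V)) =
      ((fiberSubfunctor hX K.q.hom z).toFunctor.map k'.op (τ.app (op U') x')).1 +
        (K.p ≫ K.j).hom.app (op V) (c.d (P.map k.op x) (P.map k'.op x')) := by
  have h₁ := CategoryTheory.congr_fun (τ.naturality k.op) x
  have h₂ := CategoryTheory.congr_fun (τ.naturality k'.op) x'
  refine (congr_arg Subtype.val h₁.symm).trans ((hτ (P.map k.op x) (P.map k'.op x')).trans ?_)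
  exact congr_arg (fun t : (fiberSubfunctor hX K.q.hom z).toFunctor.obj (op V) ↦
    (t.1 : K.I₁.obj.obj (op V)) + _) h₂

omit hτ in
lemma eqHom_hom_eqHom {U : C} {t t' s s' : (fiberSubfunctor hX K.q.hom z).toFunctor.obj (op U)}
    {ξ ξ' : K.I₀.obj.obj (op U)} (e : t' = t) (e' : s' = s)
    (h : (t.1 : K.I₁.obj.obj (op U)) = s.1 + (K.p ≫ K.j).hom.app (op U) ξ)
    (h' : (t'.1 : K.I₁.obj.obj (op U)) = s'.1 + (K.p ≫ K.j).hom.app (op U) ξ') (hξ : ξ = ξ') :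
    (ofStrongTrans η).eqHom e ≫ hom η ξ h = hom η ξ' h' ≫ (ofStrongTrans η).eqHom e' := by
  subst e e' hξ
  simp

variable (η) in
/-- The descent datum defined by a cocycle. -/
def descentData {ι : Type u} {V : ι → C} (k : ∀ i, V i ⟶ X) (x : ∀ i, P.obj (op (V i))) :
    F.DescentData k where
  obj i := (ofStrongTrans η).obj (τ.app _ (x i))
  hom Y q i₁ i₂ f₁ f₂ _ _ := ((ofStrongTrans η).iso f₁ _).inv ≫
    hom η _ (eq_add_of_cocycle c τ hτ f₁ f₂ (x i₁) (x i₂)) ≫ ((ofStrongTrans η).iso f₂ _).hom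
  pullHom_hom Y' Y g q q' hq i₁ i₂ f₁ f₂ hf₁ hf₂ gf₁ gf₂ hgf₁ hgf₂ := by
    have hg₁ : f₁.op.toLoc ≫ g.op.toLoc = gf₁.op.toLoc := by rw [← hgf₁]; rfl
    have hg₂ : f₂.op.toLoc ≫ g.op.toLoc = gf₂.op.toLoc := by rw [← hgf₂]; rfl
    have e₁ : (fiberSubfunctor hX K.q.hom z).toFunctor.map gf₁.op (τ.app _ (x i₁)) =
        (fiberSubfunctor hX K.q.hom z).toFunctor.map g.op
          ((fiberSubfunctor hX K.q.hom z).toFunctor.map f₁.op (τ.app _ (x i₁))) := by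
      rw [← hgf₁]
      exact CategoryTheory.congr_fun (Functor.map_comp _ _ _) _
    have e₂ : (fiberSubfunctor hX K.q.hom z).toFunctor.map gf₂.op (τ.app _ (x i₂)) =
        (fiberSubfunctor hX K.q.hom z).toFunctor.map g.op
          ((fiberSubfunctor hX K.q.hom z).toFunctor.map f₂.op (τ.app _ (x i₂))) := by
      rw [← hgf₂]
      exact CategoryTheory.congr_fun (Functor.map_comp _ _ _) _
    have h₁ := (ofStrongTrans η).iso_comp_inv hg₁ e₁
    have h₂ := (ofStrongTrans η).iso_comp_hom hg₂ e₂
    have h := eq_add_of_cocycle c τ hτ f₁ f₂ (x i₁) (x i₂)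
    have h₃ := hom_restrict η h g (restrict_eq h g)
    have h₄ := eqHom_hom_eqHom (η := η) e₁ e₂ (restrict_eq h g)
      (eq_add_of_cocycle c τ hτ gf₁ gf₂ (x i₁) (x i₂)) (by
        rw [c.map_d]
        refine congr_arg₂ c.d ?_ ?_
        · rw [← hgf₁]
          exact (CategoryTheory.congr_fun (P.map_comp _ _) _).symm
        · rw [← hgf₂]
          exact (CategoryTheory.congr_fun (P.map_comp _ _) _).symm)
    dsimp only [LocallyDiscreteOpToCat.pullHom]
    rw [h₂, ← reassoc_of% h₄, reassoc_of% h₁, reassoc_of% h₃]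
    simp
  hom_self Y q i g _ := by
    have h : c.d (P.map g.op (x i)) (P.map g.op (x i)) = 0 := by
      simpa using c.d_add (P.map g.op (x i)) (P.map g.op (x i)) (P.map g.op (x i))
    have h' := (hom_congr η (eq_add_of_cocycle c τ hτ g g (x i) (x i)) h).trans
      (hom_zero η rfl _)
    rw [h']
    simp
  hom_comp Y q i₁ i₂ i₃ f₁ f₂ f₃ _ _ _ := by
    have h := (hom_comp_hom η (eq_add_of_cocycle c τ hτ f₁ f₂ (x i₁) (x i₂))
      (eq_add_of_cocycle c τ hτ f₂ f₃ (x i₂) (x i₃))).trans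
        (hom_congr η _ (c.d_add _ _ _))
    simp only [Category.assoc, Iso.hom_inv_id_assoc]
    rw [reassoc_of% h]

/-- The cocycle with values in I⁰ provides isomorphisms between the images of the liftings `τ x`,
and its additivity is the cocycle condition of a descent datum, which is effective in a stack. -/
lemma nonempty_of_cocycle (hF : F.IsStack J) (η : Pseudofunctor.StrongTrans (K.liftings hX z) F)
    (hP : LocallyNonempty J P) : Nonempty (F.obj ⟨op X⟩) := by
  -- The covering family is indexed by all sections of `P` over all objects, so that no choice of
  -- local sections is needed.
  let V (i : Σ V : C, P.obj (op V)) : C := i.1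
  let k (i : Σ V : C, P.obj (op V)) : V i ⟶ X := hX.from _
  have hk : Sieve.ofArrows V k ∈ J X := by
    obtain ⟨T, hT, h⟩ := hP X
    refine J.superset_covering (fun W l hl ↦ ?_) hT
    obtain ⟨x⟩ := h l hl
    rw [hX.hom_ext l (k ⟨W, x⟩)]
    exact Sieve.ofArrows_mk V k ⟨W, x⟩
  have := F.isEquivalence_toDescentData k hk
  exact ⟨(F.toDescentData k).objPreimage (descentData η c τ hτ k fun i ↦ i.2)⟩

end Descent

end TwoStepResolution

end CategoryTheory

namespace CategoryTheory

variable {C : Type u} [SmallCategory C] {J : GrothendieckTopology C}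
  {F : LocallyDiscrete Cᵒᵖ ⥤ᵖ Cat.{u, u + 1}} {A : Sheaf J AddCommGrpCat.{u}} {X : C}

lemma Sheaf.exists_of_δ₀_eq_zero (hX : IsTerminal X)
    {S : ShortComplex (Sheaf J AddCommGrpCat.{u})} (hS : S.ShortExact) {z : S.X₃.obj.obj (op X)}
    (hz : Sheaf.δ₀ hX hS z = 0) : ∃ x : S.X₂.obj.obj (op X), S.g.hom.app (op X) x = z := by
  obtain ⟨x, hx⟩ := Abelian.Ext.covariant_sequence_exact₃ _ hS _ (zero_add 1) hz
  obtain ⟨x, rfl⟩ := (Sheaf.H.equiv₀ S.X₂ hX).symm.surjective x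
  refine ⟨x, (Sheaf.H.equiv₀ S.X₃ hX).symm.injective ?_⟩
  rw [← Sheaf.H.equiv₀_symm_naturality hX S.g x, Sheaf.H.map_apply]
  exact hx

namespace TwoStepResolution

variable {K : TwoStepResolution A} {hX : IsTerminal X} {z : K.Z.obj.obj (op X)}

section Pairs

variable {J₀ W E Z' : Sheaf J AddCommGrpCat.{u}} (n : J₀ ⟶ W) (w : W.obj.obj (op X))
  (u : J₀ ⟶ E) (ν : K.I₁ ⟶ E) (e : E.obj.obj (op X))

variable (hX z) in
/-- The presheaf of the pairs formed by a lifting `t` of `z` and a lifting `b` of `w` such that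
`u b = ν t + e`. -/
def pairs : Cᵒᵖ ⥤ Type u where
  obj U := {x : K.I₁.obj.obj U × J₀.obj.obj U //
    K.q.hom.app U x.1 = K.Z.obj.map (hX.from U.unop).op z ∧
    n.hom.app U x.2 = W.obj.map (hX.from U.unop).op w ∧
    u.hom.app U x.2 = ν.hom.app U x.1 + E.obj.map (hX.from U.unop).op e}
  map {U V} k := ↾fun x ↦ ⟨(K.I₁.obj.map k x.1.1, J₀.obj.map k x.1.2), by
    obtain ⟨⟨t, b⟩, h₁, h₂, h₃⟩ := x
    dsimp only at h₁ h₂ h₃ ⊢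
    have e₁ := Sheaf.naturality_apply K.q k.unop t
    have e₂ := Sheaf.naturality_apply n k.unop b
    have e₃ := Sheaf.naturality_apply u k.unop b
    have e₄ := Sheaf.naturality_apply ν k.unop t
    have f₁ := K.Z.map_terminal_apply hX k.unop z
    have f₂ := W.map_terminal_apply hX k.unop w
    have f₃ := E.map_terminal_apply hX k.unop e
    refine ⟨e₁.trans ((congr_arg (K.Z.obj.map k) h₁).trans f₁),
      e₂.trans ((congr_arg (W.obj.map k) h₂).trans f₂), ?_⟩
    refine e₃.trans ((congr_arg (E.obj.map k) h₃).trans ((map_add (E.obj.map k).hom _ _).trans ?_))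
    exact congr_arg₂ (fun a b : E.obj.obj V ↦ a + b) e₄.symm f₃⟩
  map_id U := by
    refine ConcreteCategory.hom_ext _ _ fun x ↦ ?_
    refine Subtype.ext (Prod.ext ?_ ?_)
    · exact CategoryTheory.congr_fun (K.I₁.obj.map_id U) x.1.1
    · exact CategoryTheory.congr_fun (J₀.obj.map_id U) x.1.2
  map_comp k l := by
    refine ConcreteCategory.hom_ext _ _ fun x ↦ ?_
    refine Subtype.ext (Prod.ext ?_ ?_)
    · exact CategoryTheory.congr_fun (K.I₁.obj.map_comp k l) x.1.1
    · exact CategoryTheory.congr_fun (J₀.obj.map_comp k l) x.1.2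

variable {n w u ν e} {m : K.I₀ ⟶ J₀} {hm : m ≫ n = 0} (hS : (ShortComplex.mk m n hm).ShortExact)
  (hu : m ≫ u = (K.p ≫ K.j) ≫ ν)

include hS in
lemma exists_pair_difference {U : C} (x y : (pairs hX z n w u ν e).obj (op U)) :
    ∃ ξ : K.I₀.obj.obj (op U),
      m.hom.app (op U) ξ = (x.1.2 : J₀.obj.obj (op U)) - y.1.2 :=
  Sheaf.exists_of_shortExact hS _ ((map_sub (n.hom.app (op U)).hom _ _).trans
    (sub_eq_zero.2 (x.2.2.1.trans y.2.2.1.symm)))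

/-- The cocycle formed by the differences of pairs. -/
noncomputable def pairsCocycle : PresheafCocycle (pairs hX z n w u ν e) K.I₀.obj where
  d {U} x y := (exists_pair_difference hS (U := U) x y).choose
  d_add {U} x y y' := by
    have h₁ := (exists_pair_difference hS (U := U) x y).choose_spec
    have h₂ := (exists_pair_difference hS (U := U) y y').choose_spec
    have h₃ := (exists_pair_difference hS (U := U) x y').choose_spec
    refine Sheaf.injective_of_shortExact hS U ((map_add (m.hom.app (op U)).hom _ _).trans ?_)
    exact (congr_arg₂ (fun a b : J₀.obj.obj (op U) ↦ a + b) h₁ h₂).trans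
      ((sub_add_sub_cancel _ _ _).trans h₃.symm)
  map_d {U V} k x y := by
    have h₁ := (exists_pair_difference hS (U := U) x y).choose_spec
    have h₂ := (exists_pair_difference hS (U := V) ((pairs hX z n w u ν e).map k.op x)
      ((pairs hX z n w u ν e).map k.op y)).choose_spec
    refine Sheaf.injective_of_shortExact hS V ((Sheaf.naturality_apply m k _).trans ?_)
    exact (congr_arg (J₀.obj.map k.op) h₁).trans
      ((map_sub (J₀.obj.map k.op).hom _ _).trans h₂.symm)

include hu in
-- After applying the monomorphism ν, the relations `u b = ν t + e` for two pairs are subtracted: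
-- the fixed section e disappears, and the difference of the b's is the image of the cocycle.
lemma eq_add_d_pairsCocycle [Mono ν] {U : C} (x y : (pairs hX z n w u ν e).obj (op U)) :
    (x.1.1 : K.I₁.obj.obj (op U)) =
      y.1.1 + (K.p ≫ K.j).hom.app (op U) ((pairsCocycle hS).d x y) := by
  have h₁ : m.hom.app (op U) ((pairsCocycle hS).d x y) = (x.1.2 : J₀.obj.obj (op U)) - y.1.2 :=
    (exists_pair_difference hS (U := U) x y).choose_spec
  have h₂ : u.hom.app (op U) (m.hom.app (op U) ((pairsCocycle hS).d x y)) =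
      ν.hom.app (op U) ((K.p ≫ K.j).hom.app (op U) ((pairsCocycle hS).d x y)) :=
    congr_arg (fun φ : K.I₀ ⟶ E ↦ φ.hom.app (op U) ((pairsCocycle hS).d x y)) hu
  have hν : (ShortComplex.mk ν (cokernel.π ν) (cokernel.condition ν)).ShortExact :=
    { exact := ShortComplex.exact_cokernel ν
      mono_f := inferInstanceAs (Mono ν)
      epi_g := inferInstanceAs (Epi (cokernel.π ν)) }
  refine Sheaf.injective_of_shortExact hν U ?_
  change ν.hom.app (op U) _ = ν.hom.app (op U) _
  have h₃ := x.2.2.2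
  have h₄ := y.2.2.2
  rw [map_add, ← h₂, h₁, map_sub, h₃, h₄]
  abel

include hm in
-- For arbitrary liftings t and b, the defect u b − ν t − e is killed by π, so it is a section of Q.
-- It comes locally from a section ξ of I⁰, and replacing b by b − m ξ removes it.
lemma exists_local_pair {i : K.Q ⟶ E} {π : E ⟶ Z'} {hi : i ≫ π = 0}
    (hS' : (ShortComplex.mk i π hi).ShortExact) (hν : K.j ≫ ν = i) (hu : m ≫ u = K.p ≫ i)
    {v : W ⟶ Z'} {ν' : K.Z ⟶ Z'} (hv : n ≫ v = u ≫ π) (hν' : K.q ≫ ν' = ν ≫ π)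
    (hw : v.hom.app (op X) w = ν'.hom.app (op X) z + π.hom.app (op X) e) {U : C}
    {t : K.I₁.obj.obj (op U)} (ht : K.q.hom.app (op U) t = K.Z.obj.map (hX.from U).op z)
    {b : J₀.obj.obj (op U)} (hb : n.hom.app (op U) b = W.obj.map (hX.from U).op w) :
    ∃ T ∈ J U, ∀ ⦃V : C⦄ (k : V ⟶ U), T k → Nonempty ((pairs hX z n w u ν e).obj (op V)) := by
  have h₁ : π.hom.app (op U) (u.hom.app (op U) b) = v.hom.app (op U) (n.hom.app (op U) b) :=
    congr_arg (fun φ : J₀ ⟶ Z' ↦ φ.hom.app (op U) b) hv.symm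
  have h₂ : π.hom.app (op U) (ν.hom.app (op U) t) = ν'.hom.app (op U) (K.q.hom.app (op U) t) :=
    congr_arg (fun φ : K.I₁ ⟶ Z' ↦ φ.hom.app (op U) t) hν'.symm
  have h₃ : π.hom.app (op U)
      (u.hom.app (op U) b - (ν.hom.app (op U) t + E.obj.map (hX.from U).op e)) = 0 := by
    rw [map_sub, map_add, h₁, h₂, ht, hb, Sheaf.naturality_apply, Sheaf.naturality_apply,
      Sheaf.naturality_apply, hw, map_add, sub_self]
  obtain ⟨x, hx⟩ := Sheaf.exists_of_shortExact hS' _ h₃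
  have := K.shortExact₀.epi_g
  have hp : Epi K.p := this
  obtain ⟨T, hT, h⟩ := Sheaf.exists_local_lift K.p x
  refine ⟨T, hT, fun V k hk ↦ ?_⟩
  obtain ⟨ξ, hξ⟩ := h k hk
  have h₄ : u.hom.app (op V) (m.hom.app (op V) ξ) = i.hom.app (op V) (K.p.hom.app (op V) ξ) :=
    congr_arg (fun φ : K.I₀ ⟶ E ↦ φ.hom.app (op V) ξ) hu
  have h₅ : n.hom.app (op V) (m.hom.app (op V) ξ) = 0 :=
    congr_arg (fun φ : K.I₀ ⟶ W ↦ φ.hom.app (op V) ξ) hm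
  have h₆ : i.hom.app (op U) x =
      u.hom.app (op U) b - (ν.hom.app (op U) t + E.obj.map (hX.from U).op e) := hx
  refine ⟨⟨(K.I₁.obj.map k.op t, J₀.obj.map k.op b - m.hom.app (op V) ξ), ?_, ?_, ?_⟩⟩
  · dsimp only
    rw [Sheaf.naturality_apply, ht]
    exact K.Z.map_terminal_apply hX k z
  · dsimp only
    rw [map_sub, h₅, sub_zero, Sheaf.naturality_apply, hb]
    exact W.map_terminal_apply hX k w
  · have h₇ := E.map_terminal_apply hX k e
    dsimp only
    rw [map_sub, h₄, hξ, Sheaf.naturality_apply, Sheaf.naturality_apply, Sheaf.naturality_apply,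
      h₆, map_sub, map_add, sub_sub_cancel]
    exact congr_arg (_ + ·) h₇

lemma locallyNonempty_pairs (hS : (ShortComplex.mk m n hm).ShortExact)
    {i : K.Q ⟶ E} {π : E ⟶ Z'} {hi : i ≫ π = 0}
    (hS' : (ShortComplex.mk i π hi).ShortExact) (hν : K.j ≫ ν = i) (hu : m ≫ u = K.p ≫ i)
    {v : W ⟶ Z'} {ν' : K.Z ⟶ Z'} (hv : n ≫ v = u ≫ π) (hν' : K.q ≫ ν' = ν ≫ π)
    (hw : v.hom.app (op X) w = ν'.hom.app (op X) z + π.hom.app (op X) e) :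
    LocallyNonempty J (pairs hX z n w u ν e) := fun U ↦ by
  have := K.shortExact₁.epi_g
  have hq : Epi K.q := this
  have := hS.epi_g
  have hn : Epi n := this
  obtain ⟨T, hT, h⟩ := Sheaf.exists_local_lift K.q (K.Z.obj.map (hX.from U).op z)
  obtain ⟨T', hT', h'⟩ := Sheaf.exists_local_lift n (W.obj.map (hX.from U).op w)
  let R : Sieve U :=
    { arrows V _ := Nonempty ((pairs hX z n w u ν e).obj (op V))
      downward_closed {V V' k} := fun ⟨x⟩ l ↦ ⟨(pairs hX z n w u ν e).map l.op x⟩ }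
  refine ⟨R, J.transitive (J.intersection_covering hT hT') R fun V k hk ↦ ?_, fun _ _ h ↦ h⟩
  obtain ⟨t, ht⟩ := h k hk.1
  obtain ⟨b, hb⟩ := h' k hk.2
  obtain ⟨T'', hT'', h''⟩ := exists_local_pair (z := z) (hm := hm) hS' hν hu hv hν' hw
    (ht.trans (K.Z.map_terminal_apply hX k z)) (hb.trans (W.map_terminal_apply hX k w))
  exact J.superset_covering (fun V' l hl ↦ h'' l hl) hT''

end Pairs

/-- If the class of the stack associated with the liftings of `z` is zero, it has a global
object. -/
lemma nonempty_of_δδ_eq_zero (hF : F.IsStack J)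
    (η : Pseudofunctor.StrongTrans (K.liftings hX z) F) (hz : K.δδ hX z = 0) :
    Nonempty (F.obj ⟨op X⟩) := by
  -- The image of z in H¹(Q) lifts to a class x in H¹(I⁰). Embedding I⁰ in an injective sheaf then
  -- represents x by a global section w of the cokernel.
  obtain ⟨x, hx⟩ := Abelian.Ext.covariant_sequence_exact₃ _ K.shortExact₀ _ rfl hz
  let m := Injective.ι K.I₀
  have hS : (ShortComplex.mk m (cokernel.π m) (cokernel.condition m)).ShortExact :=
    { exact := ShortComplex.exact_cokernel m
      mono_f := inferInstanceAs (Mono m)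
      epi_g := inferInstanceAs (Epi (cokernel.π m)) }
  obtain ⟨w, hw⟩ := Abelian.Ext.covariant_sequence_exact₁ _ hS x
    (Abelian.Ext.eq_zero_of_injective _) (zero_add 1)
  obtain ⟨w, rfl⟩ := (Sheaf.H.equiv₀ _ hX).symm.surjective w
  let ν := Injective.ι K.I₁
  have := K.shortExact₁.mono_f
  have hj : Mono K.j := this
  let i := K.j ≫ ν
  have hS' : (ShortComplex.mk i (cokernel.π i) (cokernel.condition i)).ShortExact :=
    { exact := ShortComplex.exact_cokernel i
      mono_f := inferInstanceAs (Mono i)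
      epi_g := inferInstanceAs (Epi (cokernel.π i)) }
  -- Both w and z are carried to one short exact sequence starting at Q, with middle term the
  -- injective sheaf containing I¹: w through `u` and `v`, z through `ν` and `ν'`.
  let u : Injective.under K.I₀ ⟶ Injective.under K.I₁ := Injective.factorThru (K.p ≫ i) m
  have hu : m ≫ u = K.p ≫ i := Injective.comp_factorThru _ _
  let v : cokernel m ⟶ cokernel i :=
    cokernel.desc _ (u ≫ cokernel.π i) (by
      rw [reassoc_of% hu, cokernel.condition, comp_zero])
  have hv : cokernel.π m ≫ v = u ≫ cokernel.π i := cokernel.π_desc _ _ _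
  have := K.shortExact₁.epi_g
  let ν' : K.Z ⟶ cokernel i := K.shortExact₁.exact.desc (ν ≫ cokernel.π i) (by
    rw [← Category.assoc]
    exact cokernel.condition i)
  have hν' : K.q ≫ ν' = ν ≫ cokernel.π i := K.shortExact₁.exact.g_desc _ _
  let φ : ShortComplex.mk m (cokernel.π m) (cokernel.condition m) ⟶
      ShortComplex.mk i (cokernel.π i) (cokernel.condition i) :=
    { τ₁ := K.p, τ₂ := u, τ₃ := v, comm₁₂ := hu.symm, comm₂₃ := hv.symm }
  let ψ : ShortComplex.mk K.j K.q K.j_q ⟶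
      ShortComplex.mk i (cokernel.π i) (cokernel.condition i) :=
    { τ₁ := 𝟙 _, τ₂ := ν, τ₃ := ν', comm₁₂ := Category.id_comp _, comm₂₃ := hν'.symm }
  have h₁ := Sheaf.δ₀_naturality hX hS hS' φ w
  have h₂ := Sheaf.δ₀_naturality hX K.shortExact₁ hS' ψ z
  have h₃ : (Sheaf.δ₀ hX hS w).comp (Abelian.Ext.mk₀ K.p) (add_zero 1) =
      (Sheaf.δ₀ hX K.shortExact₁ z).comp (Abelian.Ext.mk₀ (𝟙 K.Q)) (add_zero 1) := by
    rw [Abelian.Ext.comp_mk₀_id]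
    exact (congr_arg (fun y ↦ Abelian.Ext.comp y (Abelian.Ext.mk₀ K.p) (add_zero 1)) hw).trans hx
  -- The sections v w and ν' z have the same image in H¹(Q), so their difference lifts to a global
  -- section e of the middle term. This is the constant in the equation `u b = ν t + e` defining the
  -- pairs.
  obtain ⟨e, he⟩ := Sheaf.exists_of_δ₀_eq_zero hX hS'
    (z := v.hom.app (op X) w - ν'.hom.app (op X) z) (by
      have h₄ := Sheaf.δ₀_add hX hS' (v.hom.app (op X) w - ν'.hom.app (op X) z)
        (ν'.hom.app (op X) z)
      rw [sub_add_cancel] at h₄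
      exact right_eq_add.1 ((h₂.symm.trans (h₃.symm.trans h₁)).trans h₄))
  have hP := locallyNonempty_pairs (hX := hX) (z := z) (w := w) (e := e) hS hS' rfl hu hv hν'
    (by rw [add_comm]; exact (sub_eq_iff_eq_add.1 he.symm))
  let τ : pairs hX z (cokernel.π m) w u ν e ⟶ (fiberSubfunctor hX K.q.hom z).toFunctor :=
    { app U := ↾fun x ↦ ⟨x.1.1, x.2.1⟩ }
  exact nonempty_of_cocycle (pairsCocycle hS) τ
    (fun {U} x y ↦ eq_add_d_pairsCocycle hS (by rw [hu, Category.assoc]) x y) hF η hP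

/-- The stack associated with the liftings of `z` has a global object if and only if its
class is zero. -/
theorem nonempty_iff_δδ_eq_zero {η : Pseudofunctor.StrongTrans (K.liftings hX z) F}
    (hη : IsAssociatedStack J η) : Nonempty (F.obj ⟨op X⟩) ↔ K.δδ hX z = 0 :=
  ⟨fun ⟨y⟩ ↦ δδ_eq_zero hη y, nonempty_of_δδ_eq_zero hη.isStack η⟩

end TwoStepResolution

end CategoryTheory

/-! ### Summary of the general statement for a stack associated with liftings -/

namespace CategoryTheory.TwoStepResolution

variable {C : Type u} [SmallCategory C] {J : GrothendieckTopology C}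
  {F : LocallyDiscrete Cᵒᵖ ⥤ᵖ Cat.{u, u + 1}} {A : Sheaf J AddCommGrpCat.{u}} {X : C}
  {K : TwoStepResolution A} {hX : IsTerminal X} {z : K.Z.obj.obj (op X)}
  {d : K.I₀.obj ⟶ K.I₁.obj} {P : Subfunctor (K.I₁.obj ⋙ forget AddCommGrpCat.{u})}

/-- The band, the class and the global objects of the stack associated with a fibered category of
translations which is that of the liftings of `z`. -/
theorem exists_banding (hd : d = (K.p ≫ K.j).hom) (hP : P = fiberSubfunctor hX K.q.hom z)
    {η : Pseudofunctor.StrongTrans (translations d P) F} (hη : IsAssociatedStack J η) :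
    IsGerbe J F ∧ (Nonempty (F.obj ⟨op X⟩) ↔ K.δδ hX z = 0) ∧
    ∃ b : Banding F A.obj,
      (∀ (U : C) (t : TranslationObj d P U) (a : A.obj.obj (op U))
        (h : d.app (op U) (K.ι.hom.app (op U) a) = 0),
        b.act ((η.app ⟨op U⟩).toFunctor.obj t) a =
          (η.app ⟨op U⟩).toFunctor.map (t.autOfKer (K.ι.hom.app (op U) a) h)) ∧
      (∀ (U : C) (y : F.obj ⟨op U⟩) (a : A.obj.obj (op U)) (α : y ⟶ y),
        (∀ (V : C) (k : V ⟶ U) (t : TranslationObj d P V)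
          (h : d.app (op V) (K.ι.hom.app (op V) (A.obj.map k.op a)) = 0)
          (φ : (η.app ⟨op V⟩).toFunctor.obj t ⟶ (F.map k.op.toLoc).toFunctor.obj y),
          (η.app ⟨op V⟩).toFunctor.map (t.autOfKer (K.ι.hom.app (op V) (A.obj.map k.op a)) h) ≫ φ =
            φ ≫ (F.map k.op.toLoc).toFunctor.map α) → b.act y a = α) ∧
      ∀ c : Sheaf.H A 2, b.HasClass hX c ↔ c = K.δδ hX z := by
  subst hd hP
  refine ⟨isGerbe hη, nonempty_iff_δδ_eq_zero hη, banding hη,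
    fun U t a h ↦ (banding_isCompatible hη U t a).symm, fun U y a α h ↦ banding_act hη ?_,
    banding_hasClass_iff hη⟩
  intro V k t φ
  exact h V k (ObjectFamily.translationObj t) (K.d_ι _) φ

end CategoryTheory.TwoStepResolution

/-! ### Application to the resolution of Hom(coker f, ker f) defined by f -/

namespace SheafOfModules

variable {C : Type u} [SmallCategory C] {J : GrothendieckTopology C} {R : Sheaf J RingCat.{u}}
  {X : C} (hX : IsTerminal X) {M N : SheafOfModules.{u} R} (f : M ⟶ N)

section Resolution

lemma kernel_ι_comp_factorThruImage : kernel.ι f ≫ Abelian.factorThruImage f = 0 := by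
  rw [← cancel_mono (Abelian.image.ι f)]
  simp

variable {f} (hf : IsLocallyFreeOfFiniteRank (cokernel f))

/-- The two-step resolution of `Hom(coker f, ker f)` defined by `f`. -/
noncomputable def homResolution :
    TwoStepResolution (homSheaf (cokernel f) (kernel f)) where
  I₀ := homSheaf (cokernel f) M
  Q := homSheaf (cokernel f) (Abelian.image f)
  I₁ := homSheaf (cokernel f) N
  Z := homSheaf (cokernel f) (cokernel f)
  ι := homSheafMap (cokernel f) (kernel.ι f)
  p := homSheafMap (cokernel f) (Abelian.factorThruImage f)
  j := homSheafMap (cokernel f) (Abelian.image.ι f)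
  q := homSheafMap (cokernel f) (cokernel.π f)
  ι_p := (ShortComplex.map (ShortComplex.mk (kernel.ι f) (Abelian.factorThruImage f)
    (kernel_ι_comp_factorThruImage f)) (homSheafFunctor (cokernel f))).zero
  j_q := (ShortComplex.map (ShortComplex.mk (Abelian.image.ι f) (cokernel.π f)
    (kernel.condition _)) (homSheafFunctor (cokernel f))).zero
  shortExact₀ := shortExact_map_homSheafFunctor hf (kernel_image_shortExact f)
  shortExact₁ := shortExact_map_homSheafFunctor hf (image_cokernel_shortExact f)

variable (f) in
/-- The identity of `coker f`, as a section over `X`. -/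
noncomputable def idSection : (homSheaf (cokernel f) (cokernel f)).obj.obj (op X) :=
  (overFunctor R X).map (𝟙 (cokernel f))

lemma homSheafMap_hom_eq :
    (homSheafMap (cokernel f) f).hom = ((homResolution hf).p ≫ (homResolution hf).j).hom := by
  have h := (homSheafFunctor (cokernel f)).map_comp (Abelian.factorThruImage f)
    (Abelian.image.ι f)
  rw [Abelian.image.fac] at h
  exact congr_arg (fun φ ↦ φ.hom) h

/-- The restriction of the identity section is the identity, so the equation defining a splitting is
the equation defining a lifting of the identity section. -/
lemma splittingSubfunctor_eq : splittingSubfunctor f =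
    fiberSubfunctor hX (homResolution hf).q.hom (idSection f) := by
  ext U s
  have h : restrictHom (hX.from U.unop) ((overFunctor R X).map (𝟙 (cokernel f))) =
      𝟙 ((cokernel f).over U.unop) :=
    (restrictHom_over _ _ _ _).trans ((overFunctor R U.unop).map_id _)
  exact (congr_arg ((show (cokernel f).over U.unop ⟶ N.over U.unop from s) ≫
    (overFunctor R U.unop).map (cokernel.π f) = ·) h.symm).to_iff

/-- The Yoneda class is obtained from the identity of coker f by composing with the two extension
classes. The identification of Ext with cohomology turns each into a connecting homomorphism and the
identity into the identity section. -/
lemma yonedaClass_eq_zero_iff :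
    yonedaClass f = 0 ↔ (homResolution hf).δδ hX (idSection f) = 0 := by
  let I := extIdentification hX hf
  have h₁ : (image_cokernel_shortExact f).extClass =
      (Abelian.Ext.mk₀ (𝟙 (cokernel f))).comp (image_cokernel_shortExact f).extClass rfl :=
    (Abelian.Ext.mk₀_id_comp _).symm
  have h₂ : I.e 0 _ (Abelian.Ext.mk₀ (𝟙 (cokernel f))) =
      (Sheaf.H.equiv₀ (homSheaf (cokernel f) (cokernel f)) hX).symm (idSection f) := by
    rw [AddEquiv.eq_symm_apply]
    exact I.zero (𝟙 _)
  have h₃ := (congr_arg (I.e 1 _) h₁).trans ((I.connecting (image_cokernel_shortExact f) 0 _).trans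
    (congr_arg (fun x ↦ Abelian.Ext.comp x (I.shortExact (image_cokernel_shortExact f)).extClass
      rfl) h₂))
  have h₄ : I.e 2 _ (yonedaClass f) = (homResolution hf).δδ hX (idSection f) :=
    (I.connecting (kernel_image_shortExact f) 1 _).trans
      (congr_arg (fun x ↦ Abelian.Ext.comp x (I.shortExact (kernel_image_shortExact f)).extClass
        rfl) h₃)
  rw [← h₄, EmbeddingLike.map_eq_zero_iff]

end Resolution

namespace DiagramCompletion

variable {f} {U V : C}

lemma ι_h_g (E : DiagramCompletion f U) :
    (overFunctor R U).map (kernel.ι f) ≫ E.h ≫ E.g = 0 := by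
  rw [h_g, ← Functor.map_comp, kernel.condition, Functor.map_zero]

/-- The endomorphism `𝟙 + ξ_E` of a diagram completion. -/
noncomputable def oneAddEndo (E : DiagramCompletion f U)
    (ξ : (cokernel f).over U ⟶ (kernel f).over U) : E ⟶ E where
  φ := 𝟙 E.E + E.endo ξ
  h_comp := by
    have h := E.h_g_π
    rw [Preadditive.comp_add, Category.comp_id, endo, reassoc_of% h, zero_comp, add_zero]
  comp_g := by
    have h := E.ι_h_g
    simp only [Preadditive.add_comp, Category.id_comp, endo, Category.assoc, h, comp_zero, add_zero]

/-- Morphisms of completions respect h and g, the only data of the completion that enter ξ_E. -/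
lemma oneAddEndo_comp {E E' : DiagramCompletion f U} (φ : E ⟶ E')
    (ξ : (cokernel f).over U ⟶ (kernel f).over U) :
    E.oneAddEndo ξ ≫ φ = φ ≫ E'.oneAddEndo ξ := by
  refine hom_ext ?_
  change (𝟙 E.E + E.endo ξ) ≫ φ.φ = φ.φ ≫ (𝟙 E'.E + E'.endo ξ)
  have h₁ := φ.h_comp
  have h₂ := φ.comp_g
  simp only [Preadditive.add_comp, Preadditive.comp_add, endo, Category.assoc, h₁,
    reassoc_of% h₂, Category.id_comp, Category.comp_id]

lemma restrict_map_oneAddEndo (k : V ⟶ U) (E : DiagramCompletion f U)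
    (ξ : (cokernel f).over U ⟶ (kernel f).over U) :
    (restrict k).map (E.oneAddEndo ξ) = ((restrict k).obj E).oneAddEndo (restrictHom k ξ) := by
  refine hom_ext ?_
  change (overMap R k).map (𝟙 E.E + E.endo ξ) = 𝟙 ((overMap R k).obj E.E) +
    ((overMap R k).map E.g ≫ (overFunctorMap R k).hom.app N) ≫
    (overFunctor R V).map (cokernel.π f) ≫ ((overFunctorMap R k).inv.app _ ≫
      (overMap R k).map ξ ≫ (overFunctorMap R k).hom.app _) ≫
    (overFunctor R V).map (kernel.ι f) ≫ (overFunctorMap R k).inv.app M ≫ (overMap R k).map E.h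
  have h₁ := (overFunctorMap R k).hom.naturality (cokernel.π f)
  have h₂ := (overFunctorMap R k).hom.naturality (kernel.ι f)
  dsimp at h₁ h₂
  simp only [Functor.map_add, endo, Functor.map_comp, Category.assoc,
    ← reassoc_of% h₁, ← reassoc_of% h₂, Iso.hom_inv_id_app_assoc]
  rfl

/-- On the completion M ⊕ coker f of a splitting, g followed by the projection to coker f is the
second projection, so 1 + ξ_E is the unipotent matrix with entry ξ followed by the inclusion of ker
f. -/
lemma oneAddEndo_ofSplittings (s : SplittingObj f U)
    (ξ : (cokernel f).over U ⟶ (kernel f).over U) :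
    ((ofSplittings f U).obj s).oneAddEndo ξ = (ofSplittings f U).map (splittingAut s ξ) := by
  refine hom_ext ?_
  refine congr_arg (𝟙 _ + ·) ?_
  have h₁ : (overFunctor R U).map f ≫ (overFunctor R U).map (cokernel.π f) = 0 := by
    rw [← Functor.map_comp, cokernel.condition, Functor.map_zero]
  have h₂ : (show (cokernel f).over U ⟶ N.over U from s.val) ≫
    (overFunctor R U).map (cokernel.π f) = 𝟙 _ := s.mem
  have h₃ : ((overFunctor R U).map (biprod.fst : M ⊞ cokernel f ⟶ _) ≫ (overFunctor R U).map f +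
      (overFunctor R U).map biprod.snd ≫ (show (cokernel f).over U ⟶ N.over U from s.val)) ≫
      (overFunctor R U).map (cokernel.π f) = (overFunctor R U).map biprod.snd := by
    rw [Preadditive.add_comp, Category.assoc, Category.assoc, h₁, h₂, comp_zero, zero_add,
      Category.comp_id]
  refine (Category.assoc _ _ _).symm.trans ((congr_arg (· ≫ _) h₃).trans ?_)
  exact congr_arg (_ ≫ ·) (Category.assoc _ _ _).symm

end DiagramCompletion

end SheafOfModules

theorem mainTheorem7 {C : Type u} [SmallCategory C] {J : GrothendieckTopology C}
    {R : Sheaf J RingCat.{u}} {X : C} (hX : IsTerminal X)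
    {M N : SheafOfModules.{u} R} (f : M ⟶ N)
    (hfree : SheafOfModules.IsLocallyFreeOfFiniteRank (cokernel f))
    (hsplit : SheafOfModules.LocallySplit (Abelian.factorThruImage f)) :
    Nonempty (SheafOfModules.ExtIdentification hX (cokernel f)) ∧
    IsGerbe J (SheafOfModules.completions f) ∧
    (Nonempty ((SheafOfModules.completions f).obj ⟨op X⟩) ↔ SheafOfModules.yonedaClass f = 0) ∧
    (∃ (S : LocallyDiscrete Cᵒᵖ ⥤ᵖ Cat.{u, u + 1})
      (η : Pseudofunctor.StrongTrans (SheafOfModules.splittings f) S), IsAssociatedStack J η) ∧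
    ∃ bC : Banding (SheafOfModules.completions f)
        (SheafOfModules.homSheaf (cokernel f) (kernel f)).obj,
      SheafOfModules.IsCompletionBanding bC ∧
      ∀ (S : LocallyDiscrete Cᵒᵖ ⥤ᵖ Cat.{u, u + 1})
        (η : Pseudofunctor.StrongTrans (SheafOfModules.splittings f) S),
        IsAssociatedStack J η →
        IsGerbe J S ∧
        (Nonempty (S.obj ⟨op X⟩) ↔ SheafOfModules.yonedaClass f = 0) ∧
        ∃ bS : Banding S (SheafOfModules.homSheaf (cokernel f) (kernel f)).obj,
          SheafOfModules.IsSplittingBanding η bS ∧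
          ∃ c : Sheaf.H (SheafOfModules.homSheaf (cokernel f) (kernel f)) 2,
            (∀ c', bC.HasClass hX c' ↔ c' = c) ∧ (∀ c', bS.HasClass hX c' ↔ c' = c) := by
  -- The general statement applies to every stack associated with the splittings, and the class it
  -- gives is the image of the identity section, independent of the stack. Equality of the two gerbe
  -- classes is therefore immediate once the completions are recognized as such a stack.
  have key {S : LocallyDiscrete Cᵒᵖ ⥤ᵖ Cat.{u, u + 1}}
      {η : Pseudofunctor.StrongTrans (SheafOfModules.splittings f) S}
      (hη : IsAssociatedStack J η) :=
    TwoStepResolution.exists_banding (K := SheafOfModules.homResolution hfree)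
      (z := SheafOfModules.idSection f) (d := (SheafOfModules.homSheafMap (cokernel f) f).hom)
      (P := SheafOfModules.splittingSubfunctor f) (η := η) (SheafOfModules.homSheafMap_hom_eq hfree)
      (SheafOfModules.splittingSubfunctor_eq hX hfree) hη
  have hη := SheafOfModules.DiagramCompletion.isAssociatedStack hfree
  have hy := SheafOfModules.yonedaClass_eq_zero_iff hX hfree
  obtain ⟨hC, hC', bC, -, hbC, hbC'⟩ := key hη
  refine ⟨⟨SheafOfModules.extIdentification hX hfree⟩, hC, hC'.trans hy.symm, ⟨_, _, hη⟩, bC, ?_, ?_⟩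
  · intro U E ξ
    have h : bC.act (F := SheafOfModules.completions f) (U := U) E ξ = E.oneAddEndo ξ := by
      -- The action on E is characterized by its compatibility with local morphisms from the images
      -- of splittings. There 1 + ξ_E is the image of the tautological automorphism, and it commutes
      -- with morphisms of completions and with restriction.
      refine hbC U E ξ (E.oneAddEndo ξ) fun V k t _ φ ↦ ?_
      have h₁ := SheafOfModules.DiagramCompletion.oneAddEndo_ofSplittings t
        (SheafOfModules.restrictHom k ξ)
      have h₂ := SheafOfModules.DiagramCompletion.restrict_map_oneAddEndo k E ξ
      have h₃ := SheafOfModules.DiagramCompletion.oneAddEndo_comp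
        (E := (SheafOfModules.DiagramCompletion.ofSplittings f V).obj t)
        (E' := (SheafOfModules.DiagramCompletion.restrict k).obj E) φ
        (SheafOfModules.restrictHom k ξ)
      exact (congr_arg (· ≫ φ) h₁.symm).trans (h₃.trans (congr_arg (φ ≫ ·) h₂.symm))
    exact congr_arg SheafOfModules.DiagramCompletion.Hom.φ h
  · intro S η hη
    obtain ⟨hS, hS', bS, hbS, -, hbS'⟩ := key hη
    exact ⟨hS, hS'.trans hy.symm, bS, fun U s ξ ↦ hbS U s ξ _, _, hbC', hbS'⟩
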